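/- **Setting.** Let $f,g\in\mathbb C\{x,y\}$ vanish at the origin, and suppose that $fg$ has only simple Newton–Puiseux roots: $f=u\,y^{E_1}\prod_{i=1}^p(x-\alpha_i(y))$, $g=u'\,y^{E_2}\prod_{j=1}^q(x-\beta_j(y))$ with $u,u'$ units and $\alpha_i,\beta_j$ pairwise distinct fractional power series (arcs) of positive order in $y$; write $\lambda_1,\dots,\lambda_N$ for all of them. A *polar root* is a Newton–Puiseux root $x=\gamma(y)$ of positive order of $J=f_yg_x-f_xg_y$, counted with multiplicity, with $f(\gamma(y),y)g(\gamma(y),y)\neq0$. Let $O(\xi,\eta)=O_y(\xi-\eta)$. **Bars.** The bars (of finite height) of the tree $T(f,g)$ are the ground bar $B_*$, with height $h(B_*)=0$ and $\lambda_{B_*}=0$, and, for any $\lambda_s\ne\lambda_t$, the bar $B$ with height $h(B)=O(\lambda_s,\lambda_t)$ and with $\lambda_B$ the sum of the terms of order $<h(B)$ of $\lambda_s$; a bar is determined by the pair $(h(B),\lambda_B)$. An arc $\xi$ *climbs over $B$ at $a\in\mathbb C$* if $\xi=\lambda_B+a\,y^{h(B)}+\cdots$; it is *bounded by* $B$ if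 $O(\xi,\lambda_B)<h(B)$. A trunk grows on $B$ at $c$ if some $\lambda_k$ climbs over $B$ at $c$; then $[p_c,q_c]$ denotes the numbers of $\alpha_i$ and of $\beta_j$ that do so. An arc *leaves the tree on $B$* if it climbs over $B$ at a point at which no trunk grows. $B'$ *lies over* the point $c$ of $B$ (and above $B$) if $h(B')>h(B)$ and $\lambda_{B'}$ climbs over $B$ at $c$. Let $\nu_F(B)=O_y\big(F(\lambda_B+zy^{h(B)},y)\big)$ for generic $z$ (so $\nu_f(B_*)=E_1$, $\nu_g(B_*)=E_2$), $\Delta_B(c)=\nu_f(B)q_c-\nu_g(B)p_c$, and $\mathscr M_B(z)=\sum_c\Delta_B(c)/(z-c)$, summed over the points at which trunks grow. Let $C(B)$ be the set of those points with $\Delta_B(c)=0$ (collinear points); $B$ is *non-collinear* if some $\Delta_B(c)\ne0$. For $B$ non-collinear let $m_B(z)$ be the multiplicity of $z$ as a zero of $\mathscr M_B$, $m(B)=\sum_z m_B(z)$; a *pure mero-zero* is a zero of $\mathscr M_B$ not in $C(B)$, and $m^*(B)$ is the number of pure mero-zeros counted with multiplicities. The *cover* of $c\in C(B)$ is the set of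 the non-collinear bars $\bar B$ over $c$ such that all bars strictly between $B$ and $\bar B$ are collinear. **Classes and factors.** Bars $B,\bar B$ are *conjugate* if $h(B)=h(\bar B)$ and some irreducible $p\in\mathbb C\{x,y\}$ has a root climbing over $B$ and a root climbing over $\bar B$. Let $\mathfrak B(f,g)$ be the set of conjugacy classes of bars. For a class $\mathbb B$ let $m^*(\mathbb B)=\sum_{B\in\mathbb B}m^*(B)$, $\nu_f(\mathbb B)=\nu_f(B)$, $\nu_g(\mathbb B)=\nu_g(B)$ ($B\in\mathbb B$); $\mathbb B$ is non-collinear if its bars are. For such $\mathbb B$ let $P_{\mathbb B}=\prod(x-\gamma(y))$ over the polar roots $\gamma$ that leave the tree on some $B\in\mathbb B$, and $Q_{\mathbb B}=\prod(x-\gamma(y))$ over the polar roots $\gamma$ that climb over some $B\in\mathbb B$ at some $c\in C(B)$ and are bounded by every bar of the cover of $c$. Let $Q_{B_*}=\prod(x-\gamma(y))$ over the polar roots that are bounded by every minimal non-collinear bar (one with no non-collinear bar below it). For $F,G\in\mathbb C\{x,y\}$ let $I(F,G)=\dim_{\mathbb C}\mathbb C\{x,y\}/(F,G)$; the curve germs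 $C_f$, $C_g$, $C=C_f\cup C_g$ are defined by $f$, $g$, $fg$. **Equivalence.** An *equivalence* from $(f,g)$ to a second such pair $(f',g')$ is a one-to-one correspondence $\sigma$ of the roots of $f$ with those of $f'$ and of the roots of $g$ with those of $g'$ that preserves all contact orders, such that $E_1=E_1'$, $E_2=E_2'$, and, for the induced correspondence of bars and of points on bars: if a non-collinear $B$ corresponds to $B'$ then $m(B)=m(B')$, and $m_B(c)=m_{B'}(c')$ whenever $c\in C(B)$ corresponds to $c'\in C(B')$. **Theorem I.** (1) Let $\mathbb B\in\mathfrak B(f,g)$ be non-collinear. Then $P_{\mathbb B}$ and $Q_{\mathbb B}$ are in $\mathbb C\{x,y\}$ and $$I(C_f,P_{\mathbb B})=\nu_f(\mathbb B)\,m^*(\mathbb B),\quad I(C_g,P_{\mathbb B})=\nu_g(\mathbb B)\,m^*(\mathbb B),\quad I(C,P_{\mathbb B})=[\nu_f(\mathbb B)+\nu_g(\mathbb B)]\,m^*(\mathbb B).$$ (2) These intersection multiplicities, and the orders in $x$ of the factors $P_{\mathbb B}$, $Q_{\mathbb B}$ of $J$, are tree-invariants. That is: if there is an equivalence from $(f,g)$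 to $(f',g')$, then there is one that induces a bijection $\mathfrak B(f,g)\to\mathfrak B(f',g')$; and if $\mathbb B$, non-collinear, corresponds to $\mathbb B'$ under any equivalence that induces such a bijection, then $\mathbb B'$ is non-collinear, $I(C_f,P_{\mathbb B})=I(C_{f'},P_{\mathbb B'})$, $I(C_g,P_{\mathbb B})=I(C_{g'},P_{\mathbb B'})$, $I(C,P_{\mathbb B})=I(C',P_{\mathbb B'})$ with $C'=C_{f'}\cup C_{g'}$, and $P_{\mathbb B},P_{\mathbb B'}$ have the same order in $x$, as have $Q_{\mathbb B},Q_{\mathbb B'}$. If moreover $B_*$ is non-collinear, then $Q_{B_*}$ and the corresponding factor for $(f',g')$ are in $\mathbb C\{x,y\}$ and have the same order in $x$. -/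

import Mathlib

noncomputable section

namespace PolarTree

/-! ### Convergent power series in two variables, arcs, and substitution of arcs -/

/-- Formal power series in two variables; the index `0` stands for `x`, the index `1` for `y`. -/
abbrev PS := MvPowerSeries (Fin 2) ℂ

/-- The exponent of the monomial `x ^ i * y ^ j`. -/
def expo (i j : ℕ) : Fin 2 →₀ ℕ := Finsupp.single 0 i + Finsupp.single 1 j

/-- Absolute convergence on some bidisc of positive radius. -/
def IsConv (F : PS) : Prop :=
  ∃ r : ℝ, 0 < r ∧ Summable fun m : Fin 2 →₀ ℕ => ‖MvPowerSeries.coeff m F‖ * r ^ (m 0 + m 1)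

theorem IsConv.shrink {F : PS} {r s : ℝ} (hs : 0 < s) (hsr : s ≤ r)
    (h : Summable fun m : Fin 2 →₀ ℕ => ‖MvPowerSeries.coeff m F‖ * r ^ (m 0 + m 1)) :
    Summable fun m : Fin 2 →₀ ℕ => ‖MvPowerSeries.coeff m F‖ * s ^ (m 0 + m 1) := by
  refine Summable.of_nonneg_of_le (fun m => by positivity) (fun m => ?_) h
  gcongr

theorem IsConv.common {F G : PS} (hF : IsConv F) (hG : IsConv G) : ∃ r : ℝ, 0 < r ∧
    (Summable fun m : Fin 2 →₀ ℕ => ‖MvPowerSeries.coeff m F‖ * r ^ (m 0 + m 1)) ∧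
    (Summable fun m : Fin 2 →₀ ℕ => ‖MvPowerSeries.coeff m G‖ * r ^ (m 0 + m 1)) := by
  obtain ⟨r, hr, h1⟩ := hF
  obtain ⟨s, hs, h2⟩ := hG
  have h0 : 0 < min r s := lt_min hr hs
  exact ⟨min r s, h0, IsConv.shrink h0 (min_le_left _ _) h1, IsConv.shrink h0 (min_le_right _ _) h2⟩

theorem IsConv.add {F G : PS} (hF : IsConv F) (hG : IsConv G) : IsConv (F + G) := by
  obtain ⟨r, hr, h1, h2⟩ := IsConv.common hF hG
  refine ⟨r, hr, Summable.of_nonneg_of_le (fun m => by positivity) (fun m => ?_) (h1.add h2)⟩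
  rw [map_add, ← add_mul]
  gcongr
  exact norm_add_le _ _

theorem IsConv.mul {F G : PS} (hF : IsConv F) (hG : IsConv G) : IsConv (F * G) := by
  classical
  obtain ⟨r, hr, h1, h2⟩ := IsConv.common hF hG
  have h3 := summable_sum_mul_antidiagonal_of_summable_mul
    (f := fun m : Fin 2 →₀ ℕ => ‖MvPowerSeries.coeff m F‖ * r ^ (m 0 + m 1))
    (g := fun m : Fin 2 →₀ ℕ => ‖MvPowerSeries.coeff m G‖ * r ^ (m 0 + m 1))
    (Summable.mul_of_nonneg h1 h2 (fun m => by positivity) (fun m => by positivity))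
  refine ⟨r, hr, Summable.of_nonneg_of_le (fun m => by positivity) (fun m => ?_) h3⟩
  have h4 : ‖MvPowerSeries.coeff m (F * G)‖ ≤ ∑ p ∈ Finset.HasAntidiagonal.antidiagonal m,
      ‖MvPowerSeries.coeff p.1 F‖ * ‖MvPowerSeries.coeff p.2 G‖ := by
    rw [MvPowerSeries.coeff_mul]
    refine (norm_sum_le _ _).trans (le_of_eq ?_)
    exact Finset.sum_congr rfl fun p _ => norm_mul _ _
  refine (mul_le_mul_of_nonneg_right h4 (by positivity)).trans (le_of_eq ?_)
  rw [Finset.sum_mul]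
  refine Finset.sum_congr rfl fun p hp => ?_
  have hm : p.1 + p.2 = m := Finset.HasAntidiagonal.mem_antidiagonal.mp hp
  have h5 : r ^ (m 0 + m 1) = r ^ (p.1 0 + p.1 1) * r ^ (p.2 0 + p.2 1) := by
    rw [← hm, ← pow_add]
    simp only [Finsupp.add_apply]
    congr 1
    omega
  rw [h5]
  ring

theorem IsConv.const (c : ℂ) : IsConv (MvPowerSeries.C c) := by
  classical
  refine ⟨1, one_pos, summable_of_ne_finset_zero (s := {0}) fun m hm => ?_⟩
  have : m ≠ 0 := by simpa using hm
  simp [MvPowerSeries.coeff_C, this]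

/-- The ring `ℂ{x, y}` of convergent power series. -/
def ConvPS : Subalgebra ℂ PS where
  carrier := {F | IsConv F}
  mul_mem' := IsConv.mul
  add_mem' := IsConv.add
  algebraMap_mem' c := IsConv.const c

/-- The field of generalized power series in `y` with rational exponents, in which the fractional
power series in `y` live. -/
abbrev Ser := HahnSeries ℚ ℂ

/-- Fractional power series: the exponents are nonnegative and have a common denominator. -/
def IsArc (ξ : Ser) : Prop :=
  ∃ D : ℕ, 0 < D ∧ ∀ e ∈ ξ.support, ∃ n : ℕ, e = (n : ℚ) / (D : ℚ)

/-- The substitution `F(ξ(y), y)`, for a series `ξ` of positive order in `y`. -/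
def evalArc (F : PS) (ξ : Ser) : Ser :=
  (HahnSeries.SummableFamily.smulFamily
    (fun n : ℕ × ℕ => MvPowerSeries.coeff (expo n.1 n.2) F)
    ((HahnSeries.SummableFamily.powers ξ).mul
      (HahnSeries.SummableFamily.powers (HahnSeries.single (1 : ℚ) (1 : ℂ))))).hsum

/-- The contact order `O(ξ, η) = O_y(ξ - η)`. -/
def contact (ξ η : Ser) : WithTop ℚ := (ξ - η).orderTop

/-- The Newton-Puiseux roots of positive order: the arcs `ξ` with `O_y(ξ) > 0` and
`F(ξ(y), y) = 0`. -/
def roots (F : PS) : Set Ser := {ξ | IsArc ξ ∧ 0 < ξ.orderTop ∧ evalArc F ξ = 0}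

/-- The partial derivatives of `F`. -/
def dx (F : PS) : PS := MvPowerSeries.pderiv ℂ 0 F
def dy (F : PS) : PS := MvPowerSeries.pderiv ℂ 1 F

/-- The multiplicity of `ξ` as a root of `F(x, y) = 0` in `x`. -/
def rootMult (F : PS) (ξ : Ser) : ℕ := sInf {n | evalArc (dx^[n] F) ξ ≠ 0}

/-- The Jacobian determinant with rows `(f_y, f_x)` and `(g_y, g_x)`. -/
def jac (f g : PS) : PS := dy f * dx g - dx f * dy g

/-- The pairs of germs that are considered: `f` and `g` vanish at the origin and the product `f g`
has only simple Newton-Puiseux roots (in particular `f g ≠ 0`). -/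
def GoodPair (f g : ConvPS) : Prop :=
  MvPowerSeries.constantCoeff (f : PS) = 0 ∧ MvPowerSeries.constantCoeff (g : PS) = 0 ∧
    ∀ ξ ∈ roots ((f : PS) * (g : PS)), evalArc (dx ((f : PS) * (g : PS))) ξ ≠ 0

/-- The roots `λ_1, …, λ_N` of `f g`. -/
def allRoots (f g : PS) : Set Ser := roots f ∪ roots g

/-- The polar roots of the pair. -/
def polarRoots (f g : PS) : Set Ser := roots (jac f g) \ allRoots f g

/-! ### The tree model -/

/-- A bar `B` of finite height is recorded by its height `h(B)` and the series `λ_B`. -/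
structure Bar where
  height : ℚ
  stem : Ser

/-- The ground bar. -/
def ground : Bar := ⟨0, 0⟩

/-- The bars of finite height of the tree of `(f, g)`: the ground bar, and, for any two
different roots of contact order `h`, the bar of height `h` on which they separate; its stem consists
of the terms of order less than `h` of either of them. -/
def IsBar (f g : PS) (B : Bar) : Prop :=
  B = ground ∨ ∃ ξ ∈ allRoots f g, ∃ η ∈ allRoots f g,
    contact ξ η = (B.height : WithTop ℚ) ∧ B.stem = HahnSeries.truncLT B.height ξ

/-- `ξ = λ_B + a y ^ h(B) + ⋯`: the arc `ξ` climbs over `B` at `a`. -/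
def ClimbsAt (ξ : Ser) (B : Bar) (a : ℂ) : Prop :=
  (∀ e < B.height, ξ.coeff e = B.stem.coeff e) ∧ ξ.coeff B.height = a

def Climbs (ξ : Ser) (B : Bar) : Prop := ∃ a, ClimbsAt ξ B a

/-- `O(ξ, λ_B) < h(B)`. -/
def BoundedBy (ξ : Ser) (B : Bar) : Prop := contact ξ B.stem < (B.height : WithTop ℚ)

/-- A trunk grows on `B` at `c`. -/
def TrunkAt (f g : PS) (B : Bar) (c : ℂ) : Prop := ∃ ξ ∈ allRoots f g, ClimbsAt ξ B c

/-- The arc `ξ` leaves the tree on `B`. -/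
def Leaves (f g : PS) (ξ : Ser) (B : Bar) : Prop := ∃ a, ClimbsAt ξ B a ∧ ¬ TrunkAt f g B a

/-- The number of roots of `F` that climb over `B` at `c`. For `F = f` and `F = g` these are the two
entries of the bimultiplicity of `c` on `B`. -/
def mult (F : PS) (B : Bar) (c : ℂ) : ℕ := {ξ ∈ roots F | ClimbsAt ξ B c}.ncard

/-- The largest power of `y` that divides `F`. -/
def yOrder (F : PS) : ℕ := sInf {j | ∃ i, MvPowerSeries.coeff (expo i j) F ≠ 0}

/-- `ν_F(B) = O_y(F(λ_B + z y ^ h(B), y))` for generic `z`. On the ground bar this is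
`O_y(F(z, y))` for a generic constant `z`, that is, the largest power of `y` dividing `F`. -/
def nu (F : PS) (B : Bar) : ℚ :=
  open Classical in
  if B.height = 0 then (yOrder F : ℚ)
  else Classical.epsilon fun v : ℚ => ∀ᶠ z : ℂ in Filter.cofinite,
    (evalArc F (B.stem + HahnSeries.single B.height z)).orderTop = (v : WithTop ℚ)

/-- The determinant with rows `(ν_f(B), p)` and `(ν_g(B), q)`, where `[p, q]` is the
bimultiplicity of `c` on `B`. It is `0` if no trunk grows at `c`. -/
def delta (f g : PS) (B : Bar) (c : ℂ) : ℚ :=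
  nu f B * (mult g B c : ℚ) - nu g B * (mult f B c : ℚ)

/-- The rational function associated to `B`. -/
def mero (f g : PS) (B : Bar) : RatFunc ℂ :=
  ∑ᶠ c : ℂ, RatFunc.C ((delta f g B c : ℚ) : ℂ) / (RatFunc.X - RatFunc.C c)

/-- The set `C(B)` of collinear points. -/
def collPts (f g : PS) (B : Bar) : Set ℂ := {c | TrunkAt f g B c ∧ delta f g B c = 0}

/-- Non-collinear bars: some trunk grows at a non-collinear point. -/
def NonColl (f g : PS) (B : Bar) : Prop := ∃ c, TrunkAt f g B c ∧ delta f g B c ≠ 0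

/-- `m_B(z)`, the multiplicity of `z` as a zero of the rational function of a non-collinear bar;
it is `0` if `z` is not a mero-zero. -/
def meroMult (f g : PS) (B : Bar) (z : ℂ) : ℕ := (mero f g B).num.rootMultiplicity z

/-- `m(B)`, the number of mero-zeros of a non-collinear bar with multiplicities. -/
def meroTotal (f g : PS) (B : Bar) : ℕ := ∑ᶠ z : ℂ, meroMult f g B z

/-- The pure mero-zeros of a non-collinear bar. -/
def pureZeros (f g : PS) (B : Bar) : Set ℂ := {z | 0 < meroMult f g B z ∧ z ∉ collPts f g B}

/-- `m*(B)`, the number of pure mero-zeros with multiplicities. -/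
def mStar (f g : PS) (B : Bar) : ℕ := ∑ᶠ z ∈ pureZeros f g B, meroMult f g B z

/-- `B'` lies above `B`, over the point `c` of `B`. -/
def LiesOver (B : Bar) (c : ℂ) (B' : Bar) : Prop := B.height < B'.height ∧ ClimbsAt B'.stem B c

def LiesAbove (B B' : Bar) : Prop := ∃ c, LiesOver B c B'

/-- The cover of `c`: the non-collinear bars over `c` that are minimal, so that all the bars of
the tree strictly between `B` and them are collinear. -/
def cover (f g : PS) (B : Bar) (c : ℂ) : Set Bar :=
  {B' | IsBar f g B' ∧ NonColl f g B' ∧ LiesOver B c B' ∧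
    ∀ B₁, IsBar f g B₁ → LiesAbove B B₁ → LiesAbove B₁ B' → ¬ NonColl f g B₁}

/-- The non-collinear bars of the tree with no non-collinear bar of the tree below them. -/
def minimalBars (f g : PS) : Set Bar :=
  {B | IsBar f g B ∧ NonColl f g B ∧ ∀ B₁, IsBar f g B₁ → LiesAbove B₁ B → ¬ NonColl f g B₁}

/-! ### Conjugate bars and the factors of the Jacobian -/

/-- Conjugate bars. -/
def Conj (B B' : Bar) : Prop :=
  B.height = B'.height ∧ ∃ p : ConvPS, Irreducible p ∧
    (∃ ξ ∈ roots (p : PS), Climbs ξ B) ∧ ∃ η ∈ roots (p : PS), Climbs η B'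

/-- The set of conjugacy classes of bars of the tree. -/
def barClasses (f g : PS) : Set (Set Bar) :=
  {K | ∃ B, IsBar f g B ∧ K = {B' | IsBar f g B' ∧ Conj B B'}}

/-- `m*` of a class of bars. -/
def mStarClass (f g : PS) (K : Set Bar) : ℕ := ∑ᶠ B ∈ K, mStar f g B

/-- The product of the `x - γ(y)` over the `γ` in a set `S` of roots of the Jacobian, each repeated
according to its multiplicity. -/
def rootProd (f g : PS) (S : Set Ser) : Polynomial Ser :=
  ∏ᶠ γ ∈ S, (Polynomial.X - Polynomial.C γ) ^ rootMult (jac f g) γ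

/-- `P_K`: the polar roots that leave the tree on some bar of the class `K`. -/
def polyP (f g : PS) (K : Set Bar) : Polynomial Ser :=
  rootProd f g {γ ∈ polarRoots f g | ∃ B ∈ K, Leaves f g γ B}

/-- `Q_K`: the polar roots that climb over some bar `B` of the class `K` at some collinear point
`c` and are bounded by every bar of the cover of `c`. -/
def polyQ (f g : PS) (K : Set Bar) : Polynomial Ser :=
  rootProd f g {γ ∈ polarRoots f g | ∃ B ∈ K, ∃ c ∈ collPts f g B,
    ClimbsAt γ B c ∧ ∀ B' ∈ cover f g B c, BoundedBy γ B'}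

/-- The factor of the ground bar: the polar roots bounded by every minimal non-collinear bar. -/
def polyGround (f g : PS) : Polynomial Ser :=
  rootProd f g {γ ∈ polarRoots f g | ∀ B ∈ minimalBars f g, BoundedBy γ B}

/-- The convergent series `F(x, y)` is the polynomial `p` in `x`. -/
def Represents (F : ConvPS) (p : Polynomial Ser) : Prop :=
  ∀ i : ℕ, HahnSeries.ofPowerSeries ℚ ℂ
    (PowerSeries.mk fun j => MvPowerSeries.coeff (expo i j) (F : PS)) = p.coeff i

/-- The intersection multiplicity at the origin of the curve germs `F = 0` and `G = 0`:
the dimension of `ℂ{x, y} / (F, G)`. -/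
def interMult (F G : ConvPS) : ℕ∞ :=
  Cardinal.toENat (Module.rank ℂ (ConvPS ⧸ Ideal.span ({F, G} : Set ConvPS)))

/-- The order in `x`, that is, the order of `F(x, 0)`. -/
def xOrder (F : ConvPS) : ℕ∞ :=
  (PowerSeries.mk fun i => MvPowerSeries.coeff (expo i 0) (F : PS)).order

/-! ### Equivalence of pairs -/

/-- The bar `B'` of the second tree corresponds to the bar `B` of the first one under the
correspondence `σ` of roots. -/
def BarCorr (f g : PS) (σ : Ser → Ser) (B B' : Bar) : Prop :=
  B.height = B'.height ∧ ∀ ξ ∈ allRoots f g, (Climbs ξ B ↔ Climbs (σ ξ) B')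

/-- The point `c'` of `B'` corresponds to the point `c` of `B`. -/
def PtCorr (f g : PS) (σ : Ser → Ser) (B : Bar) (c : ℂ) (B' : Bar) (c' : ℂ) : Prop :=
  ∀ ξ ∈ allRoots f g, (ClimbsAt ξ B c ↔ ClimbsAt (σ ξ) B' c')

/-- The correspondence `σ` of roots is an equivalence from `(f, g)` to `(f', g')`. -/
structure TreeEquiv (f g f' g' : PS) (σ : Ser → Ser) : Prop where
  bijF : Set.BijOn σ (roots f) (roots f')
  bijG : Set.BijOn σ (roots g) (roots g')
  contact_eq : ∀ ξ ∈ allRoots f g, ∀ η ∈ allRoots f g, contact (σ ξ) (σ η) = contact ξ η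
  yOrderF : yOrder f = yOrder f'
  yOrderG : yOrder g = yOrder g'
  meroTotal_eq : ∀ B B', IsBar f g B → IsBar f' g' B' → BarCorr f g σ B B' → NonColl f g B →
    meroTotal f g B = meroTotal f' g' B'
  meroMult_eq : ∀ B B', IsBar f g B → IsBar f' g' B' → BarCorr f g σ B B' → NonColl f g B →
    ∀ c ∈ collPts f g B, ∀ c' ∈ collPts f' g' B', PtCorr f g σ B c B' c' →
      meroMult f g B c = meroMult f' g' B' c'

/-- The set of bars of the second tree that correspond to the bars in `K`. -/
def corrClass (f g f' g' : PS) (σ : Ser → Ser) (K : Set Bar) : Set Bar :=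
  {B' | IsBar f' g' B' ∧ ∃ B ∈ K, BarCorr f g σ B B'}

/-- The correspondence `σ` induces a bijection between the conjugacy classes of bars. -/
def InducesClassBij (f g f' g' : PS) (σ : Ser → Ser) : Prop :=
  Set.BijOn (corrClass f g f' g' σ) (barClasses f g) (barClasses f' g')

end PolarTree

end

open PolarTree

/-! Let an arc `ξ` climb over a bar `B` of positive height at a generic point `z`. Then `f(ξ)` and
`g(ξ)` have orders `ν_f(B)` and `ν_g(B)`, and the logarithmic derivative of `f` in `x` along `ξ` has
leading term `∑ p_c/(z-c)` times `y^(-h(B))`; for `g` the numerators are `q_c`. The chain rule gives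
`y J = (y d/dy f(ξ)) g_x - f_x (y d/dy g(ξ))`, so the leading coefficient of `y J` is, up to a
constant, the product of those of `f` and `g` with the rational function `∑ Δ_B(c)/(z-c)` of the bar
(`exists_lead_jac`).

The same leading coefficient can be read off from the Newton-Puiseux factorization of `J` itself.
Comparing the two as polynomials in `z`, for `B` non-collinear, counts the roots of `J` over every
point: the number over `c`, plus one if `Δ_B(c) ≠ 0`, equals `p_c + q_c + m_B(c)` (`count_jac`).
Where no trunk grows this number is `m_B(c)`, so exactly `m*(B)` polar roots leave the tree on `B`
(`leaves_count`). Along these the order of `f` is exactly `ν_f(B)`, because no root of `f` climbs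
over the same point. The intersection multiplicity with a product of linear factors is the sum of
the orders (`interMult_represents`), whence the formulas of (1).

The factors are convergent because the sets of polar roots that define them are stable under the
generator `theta` of the Galois group, so that only integral powers of `y` remain in the
coefficients, and because every Newton-Puiseux root of a convergent series converges (`cvg_of_root`,
`exists_represents`). Conjugacy classes of bars are the orbits of `theta` (`conj_iff`).

For the invariance in (2), all counts are expressed through contact orders, bimultiplicities and the
multiplicities of mero-zeros that an equivalence preserves. The polar roots over a collinear point
that are bounded by its cover are all roots of `J` over the point except those that climb over a bar
of the cover, and both numbers come from `count_jac` (`TreeEquiv.coverCount_eq`). Every arc of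
positive order climbs over the ground bar at the single point `0`, so a non-collinear ground bar
contributes nothing and its factor is `1`.

It remains to replace an arbitrary equivalence by one that respects conjugacy. It suffices to make
it commute with `theta` (`inducesClassBij_of_equivariant`). This is done by induction over the tree
(`exists_equivariant_iso`): at the smallest contact order `h` the roots split into blocks according
to the coefficient of `y^h`, which `theta` multiplies by a root of unity. Since all nonzero points
have the same stabilizer, one can match blocks of the same isometry type and the same stabilizer,
make the matching equivariant for the stabilizer, spread it over the orbit and glue the orbits.
Colors on the roots carry along the data that an equivalence has to preserve. -/

noncomputable section

namespace PolarTree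

open HahnSeries

/-! ### Fractional power series -/

/-- The series `y`. -/
def yS : Ser := single (1 : ℚ) (1 : ℂ)

/-- The order embedding `n ↦ n / D` of exponents. -/
def fracHom (D : ℕ) : ℕ →+ ℚ where
  toFun n := (n : ℚ) / D
  map_zero' := by simp
  map_add' a b := by push_cast; ring

theorem fracHom_le (D : ℕ) [NeZero D] (a b : ℕ) : fracHom D a ≤ fracHom D b ↔ a ≤ b := by
  have : (0 : ℚ) < D := by exact_mod_cast Nat.pos_of_ne_zero (NeZero.ne D)
  simp only [fracHom, AddMonoidHom.coe_mk, ZeroHom.coe_mk]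
  rw [div_le_div_iff_of_pos_right this]
  exact Nat.cast_le

theorem fracHom_inj (D : ℕ) [NeZero D] : Function.Injective (fracHom D) := by
  intro a b h
  exact le_antisymm ((fracHom_le D a b).1 h.le) ((fracHom_le D b a).1 h.ge)

/-- The substitution `t = y ^ (1 / D)`. -/
def psi (D : ℕ) [NeZero D] : PowerSeries ℂ →+* Ser :=
  (embDomainRingHom (fracHom D) (fracHom_inj D) (fracHom_le D)).comp
    (RingEquiv.toRingHom HahnSeries.toPowerSeries.symm)

theorem psi_coeff (D : ℕ) [NeZero D] (a : PowerSeries ℂ) (n : ℕ) :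
    (psi D a).coeff ((n : ℚ) / D) = PowerSeries.coeff n a := by
  have h := embDomain_coeff
    (f := ⟨⟨fracHom D, fracHom_inj D⟩, fracHom_le D _ _⟩) (x := toPowerSeries.symm a) (a := n)
  exact h

theorem psi_coeff_of_ne (D : ℕ) [NeZero D] (a : PowerSeries ℂ) (e : ℚ)
    (he : ∀ n : ℕ, e ≠ (n : ℚ) / D) : (psi D a).coeff e = 0 := by
  have h := embDomain_of_notMem_range
    (f := ⟨⟨fracHom D, fracHom_inj D⟩, fracHom_le D _ _⟩) (x := toPowerSeries.symm a) (b := e)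
    (by rintro ⟨n, hn⟩; exact he n hn.symm)
  exact h

theorem frac_inj (D : ℕ) [NeZero D] {a b : ℕ} (h : (a : ℚ) / D = (b : ℚ) / D) : a = b :=
  fracHom_inj D h

theorem psi_injective (D : ℕ) [NeZero D] : Function.Injective (psi D) := by
  intro a b h
  ext n
  rw [← psi_coeff D, h, psi_coeff]

theorem ofPowerSeries_eq_psi (a : PowerSeries ℂ) : ofPowerSeries ℚ ℂ a = psi 1 a := by
  ext e
  by_cases he : ∃ n : ℕ, e = n
  · obtain ⟨n, rfl⟩ := he
    rw [ofPowerSeries_apply_coeff]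
    have := psi_coeff 1 a n
    simpa using this.symm
  · push Not at he
    rw [psi_coeff_of_ne 1 a e (by simpa using he), ofPowerSeries_apply,
      embDomain_of_notMem_range]
    rintro ⟨n, hn⟩
    exact he n hn.symm

theorem isArc_iff (ξ : Ser) : IsArc ξ ↔ ∃ D : ℕ, ∃ _ : NeZero D, ∃ a, ξ = psi D a := by
  constructor
  · rintro ⟨D, hD, h⟩
    have : NeZero D := ⟨hD.ne'⟩
    refine ⟨D, inferInstance, PowerSeries.mk fun n => ξ.coeff ((n : ℚ) / D), ?_⟩
    ext e
    by_cases he : ∃ n : ℕ, e = (n : ℚ) / D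
    · obtain ⟨n, rfl⟩ := he
      rw [psi_coeff, PowerSeries.coeff_mk]
    · push Not at he
      rw [psi_coeff_of_ne _ _ _ he]
      by_contra hc
      obtain ⟨n, hn⟩ := h e hc
      exact he n hn
  · rintro ⟨D, hD, a, rfl⟩
    refine ⟨D, Nat.pos_of_ne_zero (NeZero.ne D), fun e he => ?_⟩
    by_contra hc
    push Not at hc
    exact he (psi_coeff_of_ne D a e hc)

/-- The denominator of the exponents may be enlarged; this is how several arcs are brought to one
denominator. -/
theorem psi_expand (D k : ℕ) [NeZero D] [NeZero k] (a : PowerSeries ℂ) :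
    psi (D * k) (PowerSeries.expand k (NeZero.ne k) a) = psi D a := by
  have hk : (k : ℚ) ≠ 0 := by exact_mod_cast NeZero.ne k
  have hD : (D : ℚ) ≠ 0 := by exact_mod_cast NeZero.ne D
  ext e
  by_cases he : ∃ n : ℕ, e = (n : ℚ) / D
  · obtain ⟨n, rfl⟩ := he
    rw [psi_coeff]
    have : (n : ℚ) / D = ((k * n : ℕ) : ℚ) / ((D * k : ℕ) : ℚ) := by
      push_cast; field_simp
    rw [this, psi_coeff, PowerSeries.coeff_expand_mul]
  · push Not at he
    rw [psi_coeff_of_ne D a e he]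
    by_cases he' : ∃ n : ℕ, e = (n : ℚ) / ((D * k : ℕ) : ℚ)
    · obtain ⟨n, rfl⟩ := he'
      rw [psi_coeff]
      apply PowerSeries.coeff_expand_of_not_dvd
      rintro ⟨m, rfl⟩
      apply he m
      push_cast; field_simp
    · push Not at he'
      exact psi_coeff_of_ne _ _ _ he'

theorem psi_cast {D E : ℕ} [NeZero D] [NeZero E] (h : D = E) (a : PowerSeries ℂ) :
    psi D a = psi E a := by
  subst h; rfl

theorem isArc_psi (D : ℕ) [NeZero D] (a : PowerSeries ℂ) : IsArc (psi D a) :=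
  (isArc_iff _).2 ⟨D, inferInstance, a, rfl⟩

/-- Finitely many arcs have a common denominator. -/
theorem exists_common_psi (s : Finset Ser) (hs : ∀ ξ ∈ s, IsArc ξ) :
    ∃ D : ℕ, ∃ _ : NeZero D, ∀ ξ ∈ s, ∃ a, ξ = psi D a := by
  classical
  induction s using Finset.induction_on with
  | empty => exact ⟨1, inferInstance, by simp⟩
  | insert ξ s _ ih =>
    obtain ⟨D, hD, h⟩ := ih fun η hη => hs η (Finset.mem_insert_of_mem hη)
    obtain ⟨E, hE, a, ha⟩ := (isArc_iff ξ).1 (hs ξ (Finset.mem_insert_self _ _))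
    refine ⟨D * E, inferInstance, fun η hη => ?_⟩
    rcases Finset.mem_insert.1 hη with rfl | hη
    · refine ⟨PowerSeries.expand D (NeZero.ne D) a, ?_⟩
      rw [ha, ← psi_expand E D]
      exact psi_cast (mul_comm E D) _
    · obtain ⟨b, hb⟩ := h η hη
      exact ⟨_, by rw [hb, ← psi_expand D E]⟩

theorem isArc_add {ξ η : Ser} (hξ : IsArc ξ) (hη : IsArc η) : IsArc (ξ + η) := by
  classical
  obtain ⟨D, _, h⟩ := exists_common_psi {ξ, η} (by simp [hξ, hη])
  obtain ⟨a, ha⟩ := h ξ (by simp)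
  obtain ⟨b, hb⟩ := h η (by simp)
  rw [ha, hb, ← map_add]
  exact isArc_psi _ _

theorem psi_X (D : ℕ) [NeZero D] : psi D PowerSeries.X = single ((1 : ℚ) / D) (1 : ℂ) := by
  ext e
  by_cases he : ∃ n : ℕ, e = (n : ℚ) / D
  · obtain ⟨n, rfl⟩ := he
    rw [psi_coeff, PowerSeries.coeff_X, coeff_single]
    congr 1
    apply propext
    constructor
    · rintro rfl; simp
    · intro h; exact frac_inj D (by simpa using h)
  · push Not at he
    rw [psi_coeff_of_ne D _ e he, coeff_single_of_ne]
    simpa using he 1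

theorem psi_X_pow (D : ℕ) [NeZero D] : psi D (PowerSeries.X ^ D) = yS := by
  have hD : (D : ℚ) ≠ 0 := by exact_mod_cast NeZero.ne D
  rw [map_pow, psi_X, single_pow, yS]
  congr 1
  · simp [hD]
  · simp

theorem orderTop_psi_pos (D : ℕ) [NeZero D] (a : PowerSeries ℂ) :
    0 < (psi D a).orderTop ↔ PowerSeries.constantCoeff a = 0 := by
  have h0 : (psi D a).coeff 0 = PowerSeries.constantCoeff a := by
    have := psi_coeff D a 0
    simpa using this
  constructor
  · intro h
    rw [← h0]
    exact coeff_eq_zero_of_lt_orderTop (by exact_mod_cast h)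
  · intro h
    have h1 : (0 : WithTop ℚ) ≤ (psi D a).orderTop := by
      rw [le_orderTop_iff_forall]
      intro e he
      by_contra hc
      obtain ⟨n, hn⟩ : ∃ n : ℕ, e = (n : ℚ) / D := by
        by_contra hcc; push Not at hcc; exact hc (psi_coeff_of_ne D a e hcc)
      have : e < 0 := by exact_mod_cast he
      rw [hn] at this
      exact absurd this (not_lt.2 (by positivity))
    refine lt_of_le_of_ne h1 fun h2 => ?_
    exact coeff_orderTop_ne (x := psi D a) (g := 0) h2.symm (h0.trans h)

/-- The arcs of positive order. -/
def PosArc (ξ : Ser) : Prop := IsArc ξ ∧ 0 < ξ.orderTop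

theorem posArc_iff (ξ : Ser) : PosArc ξ ↔ ∃ D : ℕ, ∃ _ : NeZero D, ∃ a,
    PowerSeries.constantCoeff a = 0 ∧ ξ = psi D a := by
  constructor
  · rintro ⟨h, h0⟩
    obtain ⟨D, hD, a, rfl⟩ := (isArc_iff ξ).1 h
    exact ⟨D, hD, a, (orderTop_psi_pos D a).1 h0, rfl⟩
  · rintro ⟨D, hD, a, h, rfl⟩
    exact ⟨isArc_psi D a, (orderTop_psi_pos D a).2 h⟩

theorem yS_posArc : PosArc yS := by
  rw [posArc_iff]
  exact ⟨1, inferInstance, PowerSeries.X, by simp, by rw [psi_X, yS]; simp⟩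

theorem PosArc.add {ξ η : Ser} (h : PosArc ξ) (h' : PosArc η) : PosArc (ξ + η) :=
  ⟨isArc_add h.1 h'.1, lt_of_lt_of_le (lt_min h.2 h'.2) min_orderTop_le_orderTop_add⟩

/-! ### Multiplication of the coefficients by a character of the exponents -/

/-- Multiplication of the coefficient of `y ^ e` by `exp (2 π i e)`. -/
def chi (e : ℚ) : ℂ := Complex.exp (2 * Real.pi * Complex.I * e)

theorem chi_add (a b : ℚ) : chi (a + b) = chi a * chi b := by
  rw [chi, chi, chi, ← Complex.exp_add]; congr 1; push_cast; ring

theorem chi_ne_zero (a : ℚ) : chi a ≠ 0 := Complex.exp_ne_zero _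

theorem chi_zero : chi 0 = 1 := by simp [chi]

theorem chi_pow (k : ℕ) (a : ℚ) : chi a ^ k = chi (k * a) := by
  rw [chi, chi, ← Complex.exp_nat_mul]; congr 1; push_cast; ring

theorem chi_eq_one_iff (a : ℚ) : chi a = 1 ↔ ∃ n : ℤ, a = n := by
  rw [chi, Complex.exp_eq_one_iff]
  have hpi : (2 * Real.pi * Complex.I : ℂ) ≠ 0 := Complex.two_pi_I_ne_zero
  constructor
  · rintro ⟨n, hn⟩
    refine ⟨n, ?_⟩
    have : ((a : ℚ) : ℂ) = n := by
      apply mul_left_cancel₀ hpi; rw [hn]; ring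
    exact_mod_cast this
  · rintro ⟨n, rfl⟩
    exact ⟨n, by push_cast; ring⟩

/-- The generator `y ^ e ↦ exp (2 π i e) y ^ e` of the Galois group. -/
def theta : Ser →+* Ser where
  toFun ξ := ⟨fun e => chi e * ξ.coeff e, ξ.isPWO_support.mono fun e he => by
    intro h; exact he (by simp [h])⟩
  map_one' := by
    ext e
    by_cases he : e = 0
    · subst he; simp [chi_zero]
    · simp [coeff_one, he]
  map_zero' := by ext e; simp
  map_add' a b := by ext e; simp [mul_add]
  map_mul' a b := by
    ext e
    have ha : ∀ c : Ser, (⟨fun e => chi e * c.coeff e, c.isPWO_support.mono fun e he => by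
        intro h; exact he (by simp [h])⟩ : Ser).support ⊆ c.support := fun c e he => by
      intro h; exact he (by simp [h])
    rw [coeff_mul_left' a.isPWO_support (ha a)]
    simp only [coeff_mul]
    rw [Finset.mul_sum]
    -- The two index sets come from different supports; they agree because `chi` never vanishes. On
    -- common pairs the exponents add up to `e` and `chi` is multiplicative.
    refine Finset.sum_congr_of_eq_on_inter ?_ ?_ ?_
    · intro p hp hp'
      exfalso; apply hp'
      simp only [Finset.mem_antidiagonal, mem_support] at hp ⊢
      exact ⟨hp.1, mul_ne_zero (chi_ne_zero _) hp.2.1, hp.2.2⟩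
    · intro p hp hp'
      exfalso; apply hp'
      simp only [Finset.mem_antidiagonal, mem_support] at hp ⊢
      exact ⟨hp.1, fun h => hp.2.1 (by simp [h]), hp.2.2⟩
    · intro p hp _
      rw [← (Finset.mem_antidiagonal.1 hp).2.2, chi_add]
      ring

theorem theta_coeff (ξ : Ser) (e : ℚ) : (theta ξ).coeff e = chi e * ξ.coeff e := rfl

theorem theta_iterate_coeff (k : ℕ) (ξ : Ser) (e : ℚ) :
    (theta^[k] ξ).coeff e = chi e ^ k * ξ.coeff e := by
  induction k with
  | zero => simp
  | succ k ih => rw [Function.iterate_succ_apply', theta_coeff, ih, pow_succ]; ring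

/-- The derivation `y d/dy`. -/
def eul : Ser →+ Ser where
  toFun ξ := ⟨fun e => (e : ℂ) * ξ.coeff e, ξ.isPWO_support.mono fun e he => by
    intro h; exact he (by simp [h])⟩
  map_zero' := by ext e; simp
  map_add' a b := by ext e; simp [mul_add]

theorem eul_coeff (ξ : Ser) (e : ℚ) : (eul ξ).coeff e = (e : ℂ) * ξ.coeff e := rfl

theorem eul_support (ξ : Ser) : (eul ξ).support ⊆ ξ.support := fun e he h => he (by
  rw [eul_coeff, h, mul_zero])

theorem eul_mul (a b : Ser) : eul (a * b) = eul a * b + a * eul b := by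
  ext e
  rw [coeff_add, eul_coeff, coeff_mul_left' a.isPWO_support (eul_support a),
    coeff_mul_right' b.isPWO_support (eul_support b), coeff_mul, Finset.mul_sum,
    ← Finset.sum_add_distrib]
  refine Finset.sum_congr rfl fun p hp => ?_
  rw [← (Finset.mem_antidiagonal.1 hp).2.2, eul_coeff, eul_coeff]
  push_cast; ring

theorem eul_C (c : ℂ) : eul (HahnSeries.C c) = 0 := by
  ext e
  by_cases he : e = 0
  · simp [eul_coeff, he]
  · simp [eul_coeff, C_apply, coeff_single_of_ne he]

theorem eul_yS : eul yS = yS := by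
  ext e
  by_cases he : e = 1
  · simp [eul_coeff, he]
  · simp [eul_coeff, yS, coeff_single_of_ne he]

end PolarTree
end

noncomputable section

namespace PolarTree

open HahnSeries

/-! ### Substitution of arcs -/

theorem expo_zero (i j : ℕ) : expo i j 0 = i := by simp [expo]
theorem expo_one (i j : ℕ) : expo i j 1 = j := by simp [expo]

theorem eq_expo (d : Fin 2 →₀ ℕ) : d = expo (d 0) (d 1) := by
  ext k; fin_cases k
  · exact (expo_zero _ _).symm
  · exact (expo_one _ _).symm

/-- Exponents of monomials in `x`, `y` as pairs. -/
def expoEquiv : ℕ × ℕ ≃ (Fin 2 →₀ ℕ) where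
  toFun n := expo n.1 n.2
  invFun d := (d 0, d 1)
  left_inv n := by simp [expo_zero, expo_one]
  right_inv d := (eq_expo d).symm

theorem expo_inj {i j k l : ℕ} : expo i j = expo k l ↔ i = k ∧ j = l := by
  rw [show expo i j = expoEquiv (i, j) from rfl, show expo k l = expoEquiv (k, l) from rfl,
    expoEquiv.apply_eq_iff_eq, Prod.mk.injEq]

theorem PS.ext {F G : PS} (h : ∀ i j, MvPowerSeries.coeff (expo i j) F =
    MvPowerSeries.coeff (expo i j) G) : F = G := by
  ext d; rw [eq_expo d]; exact h _ _

/-- `SummableFamily.powers` consists of the actual powers only for a series of positive order; under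
this condition the formal definition becomes the expected sum. -/
theorem evalArc_coeff (F : PS) {ξ : Ser} (hξ : 0 < ξ.orderTop) (e : ℚ) :
    (evalArc F ξ).coeff e =
      ∑ᶠ n : ℕ × ℕ, MvPowerSeries.coeff (expo n.1 n.2) F * (ξ ^ n.1 * yS ^ n.2).coeff e := by
  rw [evalArc, SummableFamily.coeff_hsum]
  refine finsum_congr fun n => ?_
  change (MvPowerSeries.coeff (expo n.1 n.2) F •
    ((SummableFamily.powers ξ) n.1 * (SummableFamily.powers yS) n.2)).coeff e = _
  rw [SummableFamily.powers_of_orderTop_pos hξ, SummableFamily.powers_of_orderTop_pos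
    yS_posArc.2, HahnSeries.coeff_smul, smul_eq_mul]

theorem hasSubst_of_zero {τ : Type*} {a b : MvPowerSeries τ ℂ}
    (ha : MvPowerSeries.constantCoeff a = 0) (hb : MvPowerSeries.constantCoeff b = 0) :
    MvPowerSeries.HasSubst ![a, b] := by
  apply MvPowerSeries.hasSubst_of_constantCoeff_zero
  intro s; fin_cases s
  · exact ha
  · exact hb

theorem coeff_subst_pair {τ : Type*} {a b : MvPowerSeries τ ℂ}
    (h : MvPowerSeries.HasSubst ![a, b]) (F : PS) (e : τ →₀ ℕ) :
    MvPowerSeries.coeff e (MvPowerSeries.subst ![a, b] F) =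
      ∑ᶠ n : ℕ × ℕ, MvPowerSeries.coeff (expo n.1 n.2) F *
        MvPowerSeries.coeff e (a ^ n.1 * b ^ n.2) := by
  rw [MvPowerSeries.coeff_subst h, ← finsum_comp_equiv expoEquiv]
  refine finsum_congr fun n => ?_
  rw [smul_eq_mul, Finsupp.prod_fintype _ _ (by simp), Fin.prod_univ_two]
  simp [expoEquiv, expo_zero, expo_one]

/-- `F(a(t), t ^ D)`. -/
def substT (D : ℕ) (a : PowerSeries ℂ) (F : PS) : PowerSeries ℂ :=
  MvPowerSeries.subst ![a, (PowerSeries.X : PowerSeries ℂ) ^ D] F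

theorem hasSubst_T (D : ℕ) [NeZero D] {a : PowerSeries ℂ}
    (ha : PowerSeries.constantCoeff a = 0) :
    MvPowerSeries.HasSubst ![a, (PowerSeries.X : PowerSeries ℂ) ^ D] := by
  refine hasSubst_of_zero ha ?_
  change PowerSeries.constantCoeff ((PowerSeries.X : PowerSeries ℂ) ^ D) = 0
  simp [NeZero.ne D]

/-- With `y = t ^ D` the substitution of an arc becomes a substitution of ordinary power series in
`t`, so its algebraic properties are inherited from there. -/
theorem evalArc_psi (F : PS) (D : ℕ) [NeZero D] {a : PowerSeries ℂ}
    (ha : PowerSeries.constantCoeff a = 0) : evalArc F (psi D a) = psi D (substT D a F) := by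
  ext e
  rw [evalArc_coeff F ((orderTop_psi_pos D a).2 ha), ← psi_X_pow D]
  simp only [← map_pow, ← map_mul]
  by_cases he : ∃ n : ℕ, e = (n : ℚ) / D
  · obtain ⟨n, rfl⟩ := he
    simp only [psi_coeff]
    exact (coeff_subst_pair (hasSubst_T D ha) F _).symm
  · push Not at he
    simp only [psi_coeff_of_ne D _ e he, mul_zero, finsum_zero]

/-- Evaluation at an arc of positive order is a ring homomorphism. -/
def evHom (ξ : Ser) (h : PosArc ξ) : PS →+* Ser where
  toFun F := evalArc F ξ
  map_one' := by
    obtain ⟨D, _, a, ha, rfl⟩ := (posArc_iff ξ).1 h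
    rw [evalArc_psi _ D ha, substT, ← MvPowerSeries.substAlgHom_apply (hasSubst_T D ha), map_one,
      map_one]
  map_zero' := by
    obtain ⟨D, _, a, ha, rfl⟩ := (posArc_iff ξ).1 h
    rw [evalArc_psi _ D ha, substT, ← MvPowerSeries.substAlgHom_apply (hasSubst_T D ha), map_zero,
      map_zero]
  map_add' F G := by
    obtain ⟨D, _, a, ha, rfl⟩ := (posArc_iff ξ).1 h
    simp only [evalArc_psi _ D ha, substT]
    rw [MvPowerSeries.subst_add (hasSubst_T D ha), map_add]
  map_mul' F G := by
    obtain ⟨D, _, a, ha, rfl⟩ := (posArc_iff ξ).1 h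
    simp only [evalArc_psi _ D ha, substT]
    rw [MvPowerSeries.subst_mul (hasSubst_T D ha), map_mul]

theorem evalArc_mul {ξ : Ser} (h : PosArc ξ) (F G : PS) :
    evalArc (F * G) ξ = evalArc F ξ * evalArc G ξ := map_mul (evHom ξ h) F G

theorem evalArc_add {ξ : Ser} (h : PosArc ξ) (F G : PS) :
    evalArc (F + G) ξ = evalArc F ξ + evalArc G ξ := map_add (evHom ξ h) F G

theorem evalArc_sub {ξ : Ser} (h : PosArc ξ) (F G : PS) :
    evalArc (F - G) ξ = evalArc F ξ - evalArc G ξ := map_sub (evHom ξ h) F G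

theorem evalArc_zero {ξ : Ser} (h : PosArc ξ) : evalArc 0 ξ = 0 := map_zero (evHom ξ h)

theorem evalArc_pow {ξ : Ser} (h : PosArc ξ) (F : PS) (n : ℕ) :
    evalArc (F ^ n) ξ = evalArc F ξ ^ n := map_pow (evHom ξ h) F n

theorem evalArc_monomial {ξ : Ser} (h : 0 < ξ.orderTop) (i j : ℕ) (c : ℂ) :
    evalArc (MvPowerSeries.monomial (expo i j) c) ξ = HahnSeries.C c * (ξ ^ i * yS ^ j) := by
  ext e
  rw [evalArc_coeff _ h, finsum_eq_single _ (i, j)]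
  · simp
  · rintro ⟨k, l⟩ hn
    rw [MvPowerSeries.coeff_monomial_ne, zero_mul]
    simp only [ne_eq, expo_inj]
    rintro ⟨rfl, rfl⟩; exact hn rfl

theorem evalArc_C {ξ : Ser} (h : 0 < ξ.orderTop) (c : ℂ) :
    evalArc (MvPowerSeries.C c) ξ = HahnSeries.C c := by
  have := evalArc_monomial h 0 0 c
  simpa [expo, MvPowerSeries.monomial_zero_eq_C_apply] using this

theorem evalArc_X0 {ξ : Ser} (h : 0 < ξ.orderTop) : evalArc (MvPowerSeries.X 0) ξ = ξ := by
  have := evalArc_monomial h 1 0 1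
  simpa [expo, MvPowerSeries.X] using this

theorem evalArc_X1 {ξ : Ser} (h : 0 < ξ.orderTop) : evalArc (MvPowerSeries.X 1) ξ = yS := by
  have := evalArc_monomial h 0 1 1
  simpa [expo, MvPowerSeries.X] using this

theorem theta_orderTop (ξ : Ser) : (theta ξ).orderTop = ξ.orderTop := by
  apply le_antisymm
  · rw [le_orderTop_iff_forall]
    intro e he
    have := coeff_eq_zero_of_lt_orderTop he
    rw [theta_coeff] at this
    exact (mul_eq_zero.1 this).resolve_left (chi_ne_zero _)
  · rw [le_orderTop_iff_forall]
    intro e he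
    rw [theta_coeff, coeff_eq_zero_of_lt_orderTop he, mul_zero]

theorem theta_isArc {ξ : Ser} (h : IsArc ξ) : IsArc (theta ξ) := by
  obtain ⟨D, hD, h⟩ := h
  refine ⟨D, hD, fun e he => h e fun h0 => he ?_⟩
  rw [theta_coeff, h0, mul_zero]

theorem theta_yS : theta yS = yS := by
  ext e
  by_cases he : e = 1
  · subst he
    have : chi 1 = 1 := (chi_eq_one_iff 1).2 ⟨1, by simp⟩
    simp [theta_coeff, this]
  · simp [theta_coeff, yS, coeff_single_of_ne he]

/-- `F` has constant coefficients and integral powers of `y`, and `theta` fixes both. Hence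
conjugates of roots are roots. -/
theorem evalArc_theta (F : PS) {ξ : Ser} (h : 0 < ξ.orderTop) :
    evalArc F (theta ξ) = theta (evalArc F ξ) := by
  ext e
  rw [evalArc_coeff _ (by rwa [theta_orderTop]), theta_coeff, evalArc_coeff _ h,
    ← smul_eq_mul, smul_finsum]
  refine finsum_congr fun n => ?_
  have : theta ξ ^ n.1 * yS ^ n.2 = theta (ξ ^ n.1 * yS ^ n.2) := by
    rw [map_mul, map_pow, map_pow, theta_yS]
  rw [this, theta_coeff, smul_eq_mul]; ring

/-! ### Continuity and the chain rule -/

/-- All terms of `F` have degree at least `N`. -/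
def HighDeg (N : ℕ) (F : PS) : Prop := ∀ i j, i + j < N → MvPowerSeries.coeff (expo i j) F = 0

theorem le_orderTop_pow {ξ : Ser} {s : ℚ} (h : (s : WithTop ℚ) ≤ ξ.orderTop) (n : ℕ) :
    ((n * s : ℚ) : WithTop ℚ) ≤ (ξ ^ n).orderTop := by
  induction n with
  | zero => simp
  | succ n ih =>
    rw [pow_succ]
    refine le_trans ?_ orderTop_add_le_mul
    refine le_trans (le_of_eq ?_) (add_le_add ih h)
    rw [← WithTop.coe_add]; congr 1; push_cast; ring

/-- Both `ξ` and `y` have order at least `s`, so a monomial of degree `n` has order at least `n s`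
along the arc. This is the continuity that extends identities from polynomials to power series. -/
theorem le_orderTop_evalArc {ξ : Ser} (hξ : 0 < ξ.orderTop) {s : ℚ} (hs1 : s ≤ 1)
    (hs0 : 0 ≤ s) (h : (s : WithTop ℚ) ≤ ξ.orderTop) {N : ℕ} {F : PS} (hF : HighDeg N F) :
    ((N * s : ℚ) : WithTop ℚ) ≤ (evalArc F ξ).orderTop := by
  rw [le_orderTop_iff_forall]
  intro e he
  rw [evalArc_coeff F hξ, ← finsum_zero (α := ℕ × ℕ)]
  refine finsum_congr fun n => ?_
  by_cases hn : n.1 + n.2 < N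
  · rw [hF _ _ hn, zero_mul]
  · have h1 : ((n.1 * s : ℚ) : WithTop ℚ) ≤ (ξ ^ n.1).orderTop := le_orderTop_pow h _
    have h2 : ((n.2 * s : ℚ) : WithTop ℚ) ≤ (yS ^ n.2).orderTop := by
      apply le_orderTop_pow
      rw [yS, orderTop_single one_ne_zero]; exact_mod_cast hs1
    have h3 : ((N * s : ℚ) : WithTop ℚ) ≤ (ξ ^ n.1 * yS ^ n.2).orderTop := by
      refine le_trans ?_ (le_trans (add_le_add h1 h2) orderTop_add_le_mul)
      rw [← WithTop.coe_add, WithTop.coe_le_coe, ← add_mul]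
      apply mul_le_mul_of_nonneg_right _ hs0
      exact_mod_cast not_lt.1 hn
    rw [coeff_eq_zero_of_lt_orderTop (lt_of_lt_of_le he h3), mul_zero]

theorem exists_small {ξ : Ser} (hξ : 0 < ξ.orderTop) :
    ∃ s : ℚ, 0 < s ∧ s ≤ 1 ∧ (s : WithTop ℚ) ≤ ξ.orderTop := by
  rcases eq_or_ne ξ.orderTop ⊤ with h | h
  · exact ⟨1, one_pos, le_rfl, by simp [h]⟩
  · obtain ⟨q, hq⟩ := WithTop.ne_top_iff_exists.1 h
    rw [← hq] at hξ ⊢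
    have hq0 : 0 < q := by exact_mod_cast hξ
    exact ⟨min q 1, lt_min hq0 one_pos, min_le_right _ _, by exact_mod_cast min_le_left _ _⟩

theorem highDeg_sub_trunc (N : ℕ) (F : PS) :
    HighDeg N (F - (MvPowerSeries.truncTotal N F : MvPolynomial (Fin 2) ℂ)) := by
  intro i j hij
  have : (expo i j).degree < N := by
    rw [Finsupp.degree_eq_sum]; simpa [expo_zero, expo_one] using hij
  rw [map_sub, MvPolynomial.coeff_coe, MvPowerSeries.coeff_truncTotal F this, sub_self]

theorem coeff_dx (F : PS) (i j : ℕ) : MvPowerSeries.coeff (expo i j) (dx F) =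
    MvPowerSeries.coeff (expo (i + 1) j) F * (i + 1) := by
  rw [dx, MvPowerSeries.coeff_pderiv, expo_zero]
  have : expo i j + Finsupp.single 0 1 = expo (i + 1) j := by
    ext k; fin_cases k <;> simp [expo]
  rw [this]

theorem coeff_dy (F : PS) (i j : ℕ) : MvPowerSeries.coeff (expo i j) (dy F) =
    MvPowerSeries.coeff (expo i (j + 1)) F * (j + 1) := by
  rw [dy, MvPowerSeries.coeff_pderiv, expo_one]
  have : expo i j + Finsupp.single 1 1 = expo i (j + 1) := by
    ext k; fin_cases k <;> simp [expo]
  rw [this]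

theorem HighDeg.dx {N : ℕ} {F : PS} (h : HighDeg N F) : HighDeg (N - 1) (dx F) := by
  intro i j hij
  rw [coeff_dx, h _ _ (by omega), zero_mul]

theorem HighDeg.dy {N : ℕ} {F : PS} (h : HighDeg N F) : HighDeg (N - 1) (dy F) := by
  intro i j hij
  rw [coeff_dy, h _ _ (by omega), zero_mul]

theorem dx_mul (F G : PS) : dx (F * G) = dx F * G + F * dx G := by
  rw [dx, Derivation.leibniz]; simp only [smul_eq_mul, dx]; ring

theorem dy_mul (F G : PS) : dy (F * G) = dy F * G + F * dy G := by
  rw [dy, Derivation.leibniz]; simp only [smul_eq_mul, dy]; ring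

theorem dx_add (F G : PS) : dx (F + G) = dx F + dx G := by simp [dx]
theorem dy_add (F G : PS) : dy (F + G) = dy F + dy G := by simp [dy]

theorem orderTop_eul_ge (ξ : Ser) : ξ.orderTop ≤ (eul ξ).orderTop := by
  rw [le_orderTop_iff_forall]
  intro e he
  rw [eul_coeff, coeff_eq_zero_of_lt_orderTop he, mul_zero]

/-- Both sides are additive and obey the Leibniz rule, so it is enough to check constants and
variables; a remainder of high degree affects only high orders. -/
theorem chain_rule (F : PS) {ξ : Ser} (h : PosArc ξ) :
    eul (evalArc F ξ) = evalArc (dx F) ξ * eul ξ + yS * evalArc (dy F) ξ := by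
  have hpoly : ∀ p : MvPolynomial (Fin 2) ℂ, eul (evalArc (p : PS) ξ) =
      evalArc (dx (p : PS)) ξ * eul ξ + yS * evalArc (dy (p : PS)) ξ := by
    intro p
    induction p using MvPolynomial.induction_on with
    | C a =>
      rw [MvPolynomial.coe_C, evalArc_C h.2, eul_C, dx, dy, MvPowerSeries.pderiv_C,
        MvPowerSeries.pderiv_C, evalArc_zero h]; simp
    | add p q hp hq =>
      rw [MvPolynomial.coe_add, evalArc_add h, map_add, hp, hq, dx_add, dy_add, evalArc_add h,
        evalArc_add h]; ring
    | mul_X p k hp =>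
      rw [MvPolynomial.coe_mul, evalArc_mul h, eul_mul, hp, dx_mul, dy_mul, evalArc_add h,
        evalArc_add h, evalArc_mul h, evalArc_mul h, evalArc_mul h, evalArc_mul h,
        MvPolynomial.coe_X]
      have h1 : evalArc (1 : PS) ξ = 1 := map_one (evHom ξ h)
      fin_cases k
      · simp only [Fin.zero_eta]
        have h2 : dx (MvPowerSeries.X 0) = 1 := MvPowerSeries.pderiv_X_self
        have h3 : dy (MvPowerSeries.X 0) = 0 := MvPowerSeries.pderiv_X_of_ne (by decide)
        rw [evalArc_X0 h.2, h2, h3, evalArc_zero h, h1]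
        ring
      · simp only [Fin.mk_one]
        have h2 : dy (MvPowerSeries.X 1) = 1 := MvPowerSeries.pderiv_X_self
        have h3 : dx (MvPowerSeries.X 1) = 0 := MvPowerSeries.pderiv_X_of_ne (by decide)
        rw [evalArc_X1 h.2, h2, h3, evalArc_zero h, h1, eul_yS]
        ring
  obtain ⟨s, hs0, hs1, hs⟩ := exists_small h.2
  have h0 : (0 : WithTop ℚ) ≤ (eul ξ).orderTop := h.2.le.trans (orderTop_eul_ge ξ)
  rw [← sub_eq_zero]
  by_contra hne
  obtain ⟨q, hq⟩ := WithTop.ne_top_iff_exists.1 (orderTop_ne_top.2 hne)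
  obtain ⟨N, hN⟩ := exists_nat_gt (q / s)
  rw [div_lt_iff₀ hs0] at hN
  -- The difference of the two sides is assumed to have finite order `q < N s`. The truncation keeps
  -- one degree more than `N` because the partial derivatives of the remainder lose one.
  set p := MvPowerSeries.truncTotal (N + 1) F with hp
  set G : PS := F - (p : PS) with hG
  have hGd : HighDeg (N + 1) G := highDeg_sub_trunc _ _
  have hF : F = (p : PS) + G := by rw [hG]; ring
  have key : eul (evalArc F ξ) - (evalArc (dx F) ξ * eul ξ + yS * evalArc (dy F) ξ) =
      eul (evalArc G ξ) - (evalArc (dx G) ξ * eul ξ + yS * evalArc (dy G) ξ) := by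
    rw [hF, evalArc_add h, map_add, hpoly, dx_add, dy_add, evalArc_add h, evalArc_add h]; ring
  have e1 : ((N * s : ℚ) : WithTop ℚ) ≤ (eul (evalArc G ξ)).orderTop := by
    refine le_trans ?_ (orderTop_eul_ge _)
    refine le_trans ?_ (le_orderTop_evalArc h.2 hs1 hs0.le hs hGd)
    rw [WithTop.coe_le_coe]; push_cast; nlinarith
  have e2 : ((N * s : ℚ) : WithTop ℚ) ≤ (evalArc (dx G) ξ * eul ξ).orderTop := by
    refine le_trans ?_ orderTop_add_le_mul
    simpa using add_le_add (le_orderTop_evalArc h.2 hs1 hs0.le hs hGd.dx) h0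
  have e3 : ((N * s : ℚ) : WithTop ℚ) ≤ (yS * evalArc (dy G) ξ).orderTop := by
    refine le_trans ?_ orderTop_add_le_mul
    simpa using add_le_add yS_posArc.2.le (le_orderTop_evalArc h.2 hs1 hs0.le hs hGd.dy)
  have e4 : ((N * s : ℚ) : WithTop ℚ) ≤ (q : WithTop ℚ) := by
    rw [hq, key]
    exact le_trans (le_min e1 (le_trans (le_min e2 e3) min_orderTop_le_orderTop_add))
      min_orderTop_le_orderTop_sub
  rw [WithTop.coe_le_coe] at e4
  linarith

/-- `y J = (y d/dy f) g_x - f_x (y d/dy g)` along an arc. -/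
theorem evalArc_jac (f g : PS) {ξ : Ser} (h : PosArc ξ) :
    yS * evalArc (jac f g) ξ =
      eul (evalArc f ξ) * evalArc (dx g) ξ - evalArc (dx f) ξ * eul (evalArc g ξ) := by
  rw [chain_rule f h, chain_rule g h, jac, evalArc_sub h, evalArc_mul h, evalArc_mul h]
  ring

end PolarTree
end

noncomputable section

namespace PolarTree

open Polynomial

/-! ### The Newton-Puiseux theorem for distinguished polynomials -/

/-- The substitution `t ↦ t ^ k`. -/
def ex (k : ℕ) [NeZero k] : PowerSeries ℂ →+* PowerSeries ℂ :=
  (PowerSeries.expand k (NeZero.ne k)).toRingHom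

theorem ex_apply (k : ℕ) [NeZero k] (a : PowerSeries ℂ) :
    ex k a = PowerSeries.expand k (NeZero.ne k) a := rfl

theorem ex_ex (b k : ℕ) [NeZero b] [NeZero k] (a : PowerSeries ℂ) :
    ex k (ex b a) = ex (b * k) a := by
  ext n
  simp only [ex_apply, PowerSeries.coeff_expand]
  by_cases h : b * k ∣ n
  · obtain ⟨m, rfl⟩ := h
    have h1 : b * k * m = k * (b * m) := by ring
    rw [if_pos (Dvd.intro _ rfl), if_pos (Dvd.intro _ h1.symm), h1,
      Nat.mul_div_cancel_left _ (Nat.pos_of_ne_zero (NeZero.ne k)), if_pos (Dvd.intro _ rfl),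
      ← h1, Nat.mul_div_cancel_left _ (Nat.pos_of_ne_zero (NeZero.ne _)),
      Nat.mul_div_cancel_left _ (Nat.pos_of_ne_zero (NeZero.ne _))]
  · rw [if_neg h]
    split_ifs with h1 h2
    · exfalso; apply h
      obtain ⟨m, rfl⟩ := h1
      rw [Nat.mul_div_cancel_left _ (Nat.pos_of_ne_zero (NeZero.ne k))] at h2
      rw [mul_comm]; exact Nat.mul_dvd_mul_left _ h2
    · rfl
    · rfl

theorem ex_cc (k : ℕ) [NeZero k] (a : PowerSeries ℂ) :
    PowerSeries.constantCoeff (ex k a) = PowerSeries.constantCoeff a :=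
  PowerSeries.constantCoeff_expand k (NeZero.ne k) a

theorem ex_X (k : ℕ) [NeZero k] : ex k PowerSeries.X = PowerSeries.X ^ k :=
  PowerSeries.expand_X k (NeZero.ne k)

theorem ex_one (a : PowerSeries ℂ) : ex 1 a = a := by
  ext n; simp [ex_apply]

theorem exists_eq_X_pow_mul {a : PowerSeries ℂ} (ha : a ≠ 0) :
    ∃ n b, a = PowerSeries.X ^ n * b ∧ PowerSeries.constantCoeff b ≠ 0 := by
  refine ⟨a.order.toNat, _, PowerSeries.X_pow_order_mul_divXPowOrder.symm, ?_⟩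
  rwa [Ne, PowerSeries.constantCoeff_divXPowOrder_eq_zero_iff]

theorem isUnit_of_cc {a : PowerSeries ℂ} (h : PowerSeries.constantCoeff a ≠ 0) : IsUnit a :=
  PowerSeries.isUnit_iff_constantCoeff.2 h.isUnit

theorem cc_eq_zero_iff_mem (a : PowerSeries ℂ) :
    a ∈ IsLocalRing.maximalIdeal (PowerSeries ℂ) ↔ PowerSeries.constantCoeff a = 0 := by
  rw [IsLocalRing.mem_maximalIdeal, mem_nonunits_iff, PowerSeries.isUnit_iff_constantCoeff,
    isUnit_iff_ne_zero, not_not]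

instance adicCompletePowerSeries :
    IsAdicComplete (IsLocalRing.maximalIdeal (PowerSeries ℂ)) (PowerSeries ℂ) := by
  have : IsLocalRing.maximalIdeal (PowerSeries ℂ) = Ideal.span {PowerSeries.X} := by
    ext a
    rw [cc_eq_zero_iff_mem, Ideal.mem_span_singleton, PowerSeries.X_dvd_iff]
  rw [this]; infer_instance

/-- Used twice in the Newton algorithm: a suitable shift removes the subleading coefficient, and a
later shift by a nonzero number makes it nonzero again. -/
theorem coeff_taylor_pred {R : Type*} [CommRing R] {P : R[X]} {d : ℕ} (hP : P.Monic)
    (hd : P.natDegree = d + 1) (r : R) :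
    (taylor r P).coeff d = P.coeff d + (d + 1) * r := by
  rw [taylor_coeff, eval_eq_sum_range' (n := 2), Finset.sum_range_succ, Finset.sum_range_one,
    hasseDeriv_coeff, hasseDeriv_coeff]
  · have h1 : P.coeff (1 + d) = 1 := by rw [add_comm, ← hd]; exact hP
    rw [h1, add_comm 1 d, Nat.choose_succ_self_right]
    simp
  · have := natDegree_hasseDeriv_le P d
    omega

/-- A power series multiple of `X - ζ` that is a polynomial has `ζ` as a root. -/
theorem eval_eq_zero_of_dvd {ζ : PowerSeries ℂ} (hζ : PowerSeries.constantCoeff ζ = 0)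
    {p : (PowerSeries ℂ)[X]}
    (h : ((X - C ζ : (PowerSeries ℂ)[X]) : PowerSeries (PowerSeries ℂ)) ∣ (p : PowerSeries _)) :
    p.eval ζ = 0 := by
  have h1 : X - C ζ ∣ p - C (p.eval ζ) := by
    rw [dvd_iff_isRoot]; simp
  obtain ⟨q, hq⟩ := h1
  obtain ⟨h0, hh⟩ := h
  set r := p.eval ζ with hr
  have h2 : ((X - C ζ : (PowerSeries ℂ)[X]) : PowerSeries (PowerSeries ℂ)) * (h0 - q) =
      PowerSeries.C r := by
    rw [mul_sub, ← hh, ← Polynomial.coe_mul, ← hq, ← Polynomial.coe_C, ← Polynomial.coe_sub]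
    congr 1; ring
  set g := h0 - (q : PowerSeries (PowerSeries ℂ))
  rw [Polynomial.coe_sub, Polynomial.coe_X, Polynomial.coe_C, sub_mul] at h2
  -- The remainder `r` equals `(X - ζ) g`. Then the constant term of `g` is `ζ ^ n` times its `n`-th
  -- coefficient for all `n`, hence divisible by every power of `t`, hence zero, and so is `r`.
  have h3 : ∀ n, PowerSeries.coeff n g = ζ * PowerSeries.coeff (n + 1) g := by
    intro n
    have := congrArg (PowerSeries.coeff (n + 1)) h2
    rw [map_sub, PowerSeries.coeff_succ_X_mul, PowerSeries.coeff_C_mul, PowerSeries.coeff_C,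
      if_neg (by omega)] at this
    exact sub_eq_zero.1 this
  have h4 : ∀ n, PowerSeries.coeff 0 g = ζ ^ n * PowerSeries.coeff n g := by
    intro n
    induction n with
    | zero => simp
    | succ n ih => rw [ih, h3 n, pow_succ, mul_assoc]
  have h5 : PowerSeries.coeff 0 g = 0 := by
    ext n
    have hd : (PowerSeries.X : PowerSeries ℂ) ^ (n + 1) ∣ PowerSeries.coeff 0 g := by
      rw [h4 (n + 1)]
      exact Dvd.dvd.mul_right (pow_dvd_pow_of_dvd (PowerSeries.X_dvd_iff.2 hζ) _) _
    rw [PowerSeries.X_pow_dvd_iff.1 hd n (by omega)]; simp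
  have h6 := congrArg (PowerSeries.coeff 0) h2
  rw [map_sub, PowerSeries.coeff_zero_X_mul, PowerSeries.coeff_C_mul, h5, PowerSeries.coeff_C,
    if_pos rfl] at h6
  simpa using h6.symm

/-- The reduction modulo `t`. -/
abbrev redC : PowerSeries ℂ →+* ℂ := PowerSeries.constantCoeff

/-- Weierstrass preparation: `e` is the multiplicity of `0` as a root of the reduction, and `P`
collects the roots of `S` that reduce to `0`. -/
theorem exists_distinguished_factor {S : (PowerSeries ℂ)[X]} (hS : S.map redC ≠ 0) :
    ∃ (e : ℕ) (P : (PowerSeries ℂ)[X]), P.Monic ∧ P.map redC = X ^ e ∧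
      (P : PowerSeries (PowerSeries ℂ)) ∣ (S : PowerSeries (PowerSeries ℂ)) ∧
      (∀ i < e, (S.map redC).coeff i = 0) ∧ (S.map redC).coeff e ≠ 0 := by
  have h0 : (S : PowerSeries (PowerSeries ℂ)).map (IsLocalRing.residue (PowerSeries ℂ)) ≠ 0 := by
    intro h; apply hS; ext i
    have := congrArg (PowerSeries.coeff i) h
    rw [PowerSeries.coeff_map, Polynomial.coeff_coe, map_zero, IsLocalRing.residue_eq_zero_iff,
      cc_eq_zero_iff_mem] at this
    simpa using this
  obtain ⟨P, U, hPU⟩ := PowerSeries.exists_isWeierstrassFactorization h0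
  have hP := hPU.isDistinguishedAt
  have hU : PowerSeries.constantCoeff (PowerSeries.coeff 0 U) ≠ 0 := by
    have := hPU.isUnit
    rw [PowerSeries.isUnit_iff_constantCoeff, PowerSeries.isUnit_iff_constantCoeff] at this
    simpa using this.ne_zero
  have hPX : P.map redC = X ^ P.natDegree := by
    ext i
    rw [coeff_map, coeff_X_pow]
    split_ifs with h
    · rw [h, coeff_natDegree, hP.monic.leadingCoeff, map_one]
    · rcases lt_or_gt_of_ne h with h | h
      · exact (cc_eq_zero_iff_mem _).1 (hP.mem h)
      · rw [coeff_eq_zero_of_natDegree_lt h, map_zero]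
  have hmap : ((S.map redC : ℂ[X]) : PowerSeries ℂ) =
      PowerSeries.X ^ P.natDegree * U.map redC := by
    have := congrArg (PowerSeries.map redC) hPU.eq_mul
    rw [map_mul, ← Polynomial.polynomial_map_coe, ← Polynomial.polynomial_map_coe, hPX] at this
    simpa using this
  refine ⟨P.natDegree, P, hP.monic, hPX, ⟨U, hPU.eq_mul⟩, fun i hi => ?_, ?_⟩
  · rw [← Polynomial.coeff_coe, hmap, PowerSeries.coeff_X_pow_mul', if_neg (by omega)]
  · rw [← Polynomial.coeff_coe, hmap, PowerSeries.coeff_X_pow_mul', if_pos le_rfl]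
    simpa using hU

theorem map_taylor' {R S : Type*} [CommRing R] [CommRing S] (f : R →+* S) (r : R) (P : R[X]) :
    (taylor r P).map f = taylor (f r) (P.map f) := by
  simp [taylor_apply, Polynomial.map_comp]

theorem taylor_monic {R : Type*} [CommRing R] {P : R[X]} (h : P.Monic) (r : R) :
    (taylor r P).Monic := by
  rw [taylor_apply]; exact h.comp_X_add_C r

theorem natDegree_of_map {P : (PowerSeries ℂ)[X]} (h : P.Monic) {d : ℕ}
    (hd : P.map redC = X ^ d) : P.natDegree = d := by
  rw [← h.natDegree_map redC, hd, natDegree_X_pow]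

/-- The scaling step of the Newton algorithm. -/
theorem exists_scaled {Q : (PowerSeries ℂ)[X]} {d : ℕ} (hQ : Q.Monic)
    (hQd : Q.map redC = X ^ (d + 1)) (hd : Q.coeff d = 0) (hne : ∃ i ≤ d, Q.coeff i ≠ 0) :
    ∃ (b a : ℕ) (_ : NeZero b) (R : (PowerSeries ℂ)[X]), 0 < a ∧ R.Monic ∧
      R.natDegree = d + 1 ∧ R.coeff d = 0 ∧ Q.map (ex b) = R.scaleRoots (PowerSeries.X ^ a) ∧
      ∃ i ≤ d, (R.map redC).coeff i ≠ 0 := by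
  have hdeg := natDegree_of_map hQ hQd
  classical
  set I := (Finset.range (d + 1)).filter fun i => Q.coeff i ≠ 0 with hI
  have hIne : I.Nonempty := by
    obtain ⟨i, hi, h⟩ := hne
    exact ⟨i, by simp [hI, h]; omega⟩
  have hch : ∀ i, ∃ n c, Q.coeff i ≠ 0 → Q.coeff i = PowerSeries.X ^ n * c ∧
      PowerSeries.constantCoeff c ≠ 0 := by
    intro i
    by_cases h : Q.coeff i = 0
    · exact ⟨0, 0, fun h' => absurd h h'⟩
    · obtain ⟨n, c, h1⟩ := exists_eq_X_pow_mul h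
      exact ⟨n, c, fun _ => h1⟩
  choose o c hoc using hch
  -- The minimal value of `o i / (d + 1 - i)` is a slope of the Newton polygon. After `t ↦ t ^ b`
  -- with `b = d + 1 - i0` this slope is the integer `o i0`, and minimality makes the division by
  -- the powers of `t ^ (o i0)` possible.
  obtain ⟨i0, hi0, hmin⟩ := Finset.exists_min_image I
    (fun i => (o i : ℚ) / ((d + 1 - i : ℕ) : ℚ)) hIne
  simp only [hI, Finset.mem_filter, Finset.mem_range] at hi0 hmin
  have hb : NeZero (d + 1 - i0) := ⟨by omega⟩
  set b := d + 1 - i0 with hbdef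
  have hred : ∀ i, i < d + 1 → PowerSeries.constantCoeff (Q.coeff i) = 0 := by
    intro i hi
    have := congrArg (fun p => p.coeff i) hQd
    simpa [coeff_X_pow, hi.ne] using this
  have ha : 0 < o i0 := by
    by_contra h
    have h0 : o i0 = 0 := by omega
    have h1 := hoc i0 hi0.2
    rw [h0, pow_zero, one_mul] at h1
    exact h1.2 (h1.1 ▸ hred i0 hi0.1)
  have hle : ∀ i, i < d + 1 → Q.coeff i ≠ 0 → o i0 * (d + 1 - i) ≤ b * o i := by
    intro i hi h
    have h1 := hmin i ⟨hi, h⟩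
    have hp : (0 : ℚ) < ((d + 1 - i : ℕ) : ℚ) := by
      have : 0 < d + 1 - i := by omega
      exact_mod_cast this
    have hp' : (0 : ℚ) < (b : ℚ) := by
      have := Nat.pos_of_ne_zero hb.out
      exact_mod_cast this
    rw [div_le_div_iff₀ hp' hp] at h1
    have h2 : o i0 * (d + 1 - i) ≤ o i * b := by exact_mod_cast h1
    linarith
  have hR : ∀ i, ∃ r : PowerSeries ℂ, (i = d + 1 → r = 1) ∧ (i < d + 1 →
      ex b (Q.coeff i) = r * (PowerSeries.X ^ (o i0)) ^ (d + 1 - i)) := by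
    intro i
    by_cases hi : i < d + 1
    · by_cases h : Q.coeff i = 0
      · exact ⟨0, fun h' => by omega, fun _ => by simp [h]⟩
      · refine ⟨PowerSeries.X ^ (b * o i - o i0 * (d + 1 - i)) * ex b (c i), fun h' => by omega,
          fun _ => ?_⟩
        nth_rewrite 1 [(hoc i h).1]
        rw [map_mul, map_pow, ex_X, ← pow_mul, ← pow_mul,
          show b * o i = (b * o i - o i0 * (d + 1 - i)) + o i0 * (d + 1 - i) by
            have := hle i hi h; omega, pow_add]
        simp only [Nat.add_sub_cancel]
        ring
    · exact ⟨1, fun _ => rfl, fun h => absurd h hi⟩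
  choose r hr1 hr2 using hR
  set R : (PowerSeries ℂ)[X] := X ^ (d + 1) + ∑ i ∈ Finset.range (d + 1), C (r i) * X ^ i with hRdef
  have hlow : (∑ i ∈ Finset.range (d + 1), C (r i) * X ^ i).degree < ((d + 1 : ℕ) : WithBot ℕ) := by
    refine (degree_sum_le _ _).trans_lt ?_
    rw [Finset.sup_lt_iff (WithBot.bot_lt_coe _)]
    intro i hi
    exact (degree_C_mul_X_pow_le _ _).trans_lt (by exact_mod_cast Finset.mem_range.1 hi)
  have hRm : R.Monic := monic_X_pow_add hlow
  have hRd : R.natDegree = d + 1 := natDegree_eq_of_degree_eq_some (by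
    rw [hRdef, degree_add_eq_left_of_degree_lt (by rwa [degree_X_pow]), degree_X_pow])
  have hRc : ∀ i, i < d + 1 → R.coeff i = r i := by
    intro i hi
    rw [hRdef, coeff_add, coeff_X_pow, if_neg hi.ne, zero_add, finsetSum_coeff]
    simp only [coeff_C_mul_X_pow]
    rw [Finset.sum_ite_eq, if_pos (by simpa using hi)]
  have hXne : (PowerSeries.X : PowerSeries ℂ) ≠ 0 := PowerSeries.X_ne_zero
  refine ⟨b, o i0, hb, R, ha, hRm, hRd, ?_, ?_, i0, by omega, ?_⟩
  · rw [hRc d (by omega)]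
    have := hr2 d (by omega)
    rw [hd, map_zero] at this
    exact (mul_eq_zero.1 this.symm).resolve_right (pow_ne_zero _ (pow_ne_zero _ hXne))
  · ext1 i
    rw [coeff_map, coeff_scaleRoots, hRd]
    rcases lt_trichotomy i (d + 1) with h | h | h
    · rw [hr2 i h, hRc i h]
    · subst h
      have h1 : Q.coeff (d + 1) = 1 := by rw [← hdeg]; exact hQ
      have h2 : R.coeff (d + 1) = 1 := by rw [← hRd]; exact hRm
      simp [h1, h2]
    · rw [coeff_eq_zero_of_natDegree_lt (by omega), coeff_eq_zero_of_natDegree_lt (by omega)]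
      simp
  -- At `i0` the minimum is attained, so no power of `t` is left over and the reduced coefficient is
  -- nonzero.
  · rw [coeff_map, hRc i0 hi0.1]
    have h1 := hr2 i0 hi0.1
    rw [(hoc i0 hi0.2).1, map_mul, map_pow, ex_X, ← pow_mul, ← pow_mul, ← hbdef, mul_comm (o i0) b,
      mul_comm] at h1
    have h2 := mul_right_cancel₀ (pow_ne_zero _ hXne) h1
    rw [← h2, redC, ex_cc]
    exact (hoc i0 hi0.2).2

theorem exists_ne_zero_root {p : ℂ[X]} (hp : p.Monic) (h : ∃ i < p.natDegree, p.coeff i ≠ 0) :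
    ∃ z, z ≠ 0 ∧ p.eval z = 0 := by
  by_contra hc
  push Not at hc
  have h0 : ∀ z ∈ p.roots, z = 0 := by
    intro z hz
    by_contra hz0
    exact hc z hz0 (isRoot_of_mem_roots hz)
  have hs := IsAlgClosed.splits p
  have h1 : p = (p.roots.map fun a => X - C a).prod := by
    have := hs.eq_prod_roots
    rwa [hp.leadingCoeff, C_1, one_mul] at this
  have h2 : p.roots = Multiset.replicate p.roots.card 0 := Multiset.eq_replicate_card.2 h0
  rw [h2] at h1
  simp only [Multiset.map_replicate, map_zero, sub_zero, Multiset.prod_replicate] at h1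
  obtain ⟨i, hi, hne⟩ := h
  rw [h1, natDegree_X_pow] at hi
  rw [h1, coeff_X_pow, if_neg hi.ne] at hne
  exact hne rfl

/-- Newton's algorithm. After removing the subleading coefficient and scaling, the reduced
polynomial is not a power of `X`, and a nonzero root `z` of it is not of full multiplicity, because
the subleading coefficient vanishes. Weierstrass preparation at `z` therefore leads to a
distinguished polynomial of smaller degree. -/
theorem exists_root_distinguished (d : ℕ) : ∀ P : (PowerSeries ℂ)[X], P.Monic →
    P.map redC = X ^ d → 0 < d → ∃ (k : ℕ) (_ : NeZero k) (ζ : PowerSeries ℂ),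
      PowerSeries.constantCoeff ζ = 0 ∧ (P.map (ex k)).eval ζ = 0 := by
  induction d using Nat.strong_induction_on with
  | _ d ih =>
  intro P hP hPd hd
  obtain ⟨d, rfl⟩ : ∃ d', d = d' + 1 := ⟨d - 1, by omega⟩
  have hdeg := natDegree_of_map hP hPd
  have hd0 : (d + 1 : ℂ) ≠ 0 := by exact_mod_cast Nat.succ_ne_zero d
  set φ : PowerSeries ℂ := PowerSeries.C (-(1 / (d + 1 : ℂ))) * P.coeff d with hφ
  have hφ0 : PowerSeries.constantCoeff φ = 0 := by
    have := congrArg (fun p => p.coeff d) hPd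
    rw [coeff_map, coeff_X_pow, if_neg (by omega)] at this
    rw [hφ, map_mul, this, mul_zero]
  set Q := taylor φ P with hQ
  have hQm : Q.Monic := taylor_monic hP φ
  have hQd : Q.map redC = X ^ (d + 1) := by
    rw [hQ, map_taylor', hPd, show redC φ = 0 from hφ0]; simp
  have hQc : Q.coeff d = 0 := by
    rw [hQ, coeff_taylor_pred hP hdeg, hφ]
    have : ((d : PowerSeries ℂ) + 1) * PowerSeries.C (-(1 / (d + 1 : ℂ))) = -1 := by
      rw [show ((d : PowerSeries ℂ) + 1) = PowerSeries.C (d + 1 : ℂ) by simp, ← map_mul,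
        show (d + 1 : ℂ) * -(1 / (d + 1)) = -1 by field_simp]
      simp
    rw [← mul_assoc, this]; ring
  have hPQ : ∀ (k : ℕ) [NeZero k] (η : PowerSeries ℂ), (Q.map (ex k)).eval η =
      (P.map (ex k)).eval (η + ex k φ) := by
    intro k _ η
    rw [hQ, map_taylor', taylor_eval]
  by_cases hne : ∃ i ≤ d, Q.coeff i ≠ 0
  · obtain ⟨b, a, _, R, ha, hRm, hRd, hRc, hRs, i, hi, hRi⟩ := exists_scaled hQm hQd hQc hne
    have hRm' : (R.map redC).Monic := hRm.map _
    have hRd' : (R.map redC).natDegree = d + 1 := by rw [hRm.natDegree_map, hRd]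
    obtain ⟨z, hz, hz0⟩ := exists_ne_zero_root hRm' ⟨i, by omega, hRi⟩
    set S := taylor (PowerSeries.C z) R with hS
    have hSred : S.map redC = taylor z (R.map redC) := by rw [hS, map_taylor']; simp
    -- This coefficient is `(d + 1) z`; it forces `e ≤ d`, so that the induction hypothesis applies.
    have hSd : (S.map redC).coeff d ≠ 0 := by
      rw [hSred, coeff_taylor_pred hRm' hRd', coeff_map, hRc]
      simpa using ⟨hd0, hz⟩
    obtain ⟨e, P₂, hP₂, hP₂e, hdvd, hlow, hhigh⟩ :=
      exists_distinguished_factor (S := S) (fun h => hSd (by rw [h]; simp))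
    have he0 : 0 < e := by
      rw [Nat.pos_iff_ne_zero]; rintro rfl
      rw [hSred, taylor_coeff_zero] at hhigh; exact hhigh hz0
    have hed : e ≤ d := by
      by_contra h
      exact hSd (hlow d (by omega))
    obtain ⟨k, _, ζ, hζ, hroot⟩ := ih e (by omega) P₂ hP₂ hP₂e he0
    have hSz : (S.map (ex k)).eval ζ = 0 := by
      apply eval_eq_zero_of_dvd hζ
      have h1 : X - C ζ ∣ P₂.map (ex k) := dvd_iff_isRoot.2 hroot
      have h2 : ((P₂.map (ex k) : (PowerSeries ℂ)[X]) : PowerSeries (PowerSeries ℂ)) ∣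
          ((S.map (ex k) : (PowerSeries ℂ)[X]) : PowerSeries (PowerSeries ℂ)) := by
        rw [Polynomial.polynomial_map_coe, Polynomial.polynomial_map_coe]
        exact map_dvd _ hdvd
      refine dvd_trans ?_ h2
      obtain ⟨q, hq⟩ := h1
      exact ⟨q, by rw [hq, Polynomial.coe_mul]⟩
    rw [hS, map_taylor', taylor_eval] at hSz
    have hR2 := scaleRoots_eval₂_eq_zero (p := R) (s := PowerSeries.X ^ a) (f := ex k)
      (r := ζ + ex k (PowerSeries.C z)) (by rwa [← eval_map])
    rw [← hRs, ← eval_map, Polynomial.map_map] at hR2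
    have hcomp : (ex k).comp (ex b) = ex (b * k) := by
      ext1 x; exact ex_ex b k x
    rw [hcomp, hPQ] at hR2
    refine ⟨b * k, inferInstance, _, ?_, hR2⟩
    rw [map_add, ex_cc, hφ0, map_mul, ex_cc, map_pow]
    simp [ha.ne']
  -- Here the shifted polynomial is `X ^ (d + 1)`, so the shift `φ` itself is a root.
  · push Not at hne
    refine ⟨1, inferInstance, φ, hφ0, ?_⟩
    have h1 := hPQ 1 0
    rw [zero_add] at h1
    have h2 : (ex 1) φ = φ := ex_one φ
    rw [h2] at h1
    rw [← h1, ← coeff_zero_eq_eval_zero, coeff_map, hne 0 (by omega), map_zero]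

/-- **Newton-Puiseux**: a distinguished polynomial splits after a substitution `t ↦ t ^ k`. -/
theorem exists_split_distinguished (d : ℕ) : ∀ P : (PowerSeries ℂ)[X], P.Monic →
    P.map redC = X ^ d → ∃ (k : ℕ) (_ : NeZero k) (s : Multiset (PowerSeries ℂ)),
      (∀ ζ ∈ s, PowerSeries.constantCoeff ζ = 0) ∧
        P.map (ex k) = (s.map fun ζ => X - C ζ).prod := by
  induction d with
  | zero =>
    intro P hP hPd
    have := natDegree_of_map hP hPd
    refine ⟨1, inferInstance, 0, by simp, ?_⟩
    rw [hP.natDegree_eq_zero.1 this]; simp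
  | succ d ih =>
    intro P hP hPd
    obtain ⟨k, _, ζ, hζ, hroot⟩ := exists_root_distinguished (d + 1) P hP hPd (by omega)
    obtain ⟨P', hP'⟩ := dvd_iff_isRoot.2 hroot
    have hm : P'.Monic := (monic_X_sub_C ζ).of_mul_monic_left (hP' ▸ hP.map _)
    have hred : P'.map redC = X ^ d := by
      have h1 := congrArg (Polynomial.map redC) hP'
      have hcomp : redC.comp (ex k) = redC := by ext1 x; exact ex_cc k x
      rw [Polynomial.map_map, hcomp, hPd, Polynomial.map_mul, Polynomial.map_sub, map_X, map_C,
        show redC ζ = 0 from hζ, C_0, sub_zero, pow_succ'] at h1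
      exact (mul_left_cancel₀ X_ne_zero h1).symm
    obtain ⟨l, _, s, hs, hsp⟩ := ih P' hm hred
    refine ⟨k * l, inferInstance, ex l ζ ::ₘ s, ?_, ?_⟩
    · intro η hη
      rcases Multiset.mem_cons.1 hη with rfl | h
      · rw [ex_cc, hζ]
      · exact hs η h
    · have hcomp : ex (k * l) = (ex l).comp (ex k) := by ext1 x; exact (ex_ex k l x).symm
      rw [hcomp, ← Polynomial.map_map, hP', Polynomial.map_mul, hsp, Multiset.map_cons,
        Multiset.prod_cons]
      simp

end PolarTree
end

noncomputable section

namespace PolarTree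

open Polynomial

/-! ### Power series in `x` over power series in `y` -/

theorem sum_antidiagonal_expo {M : Type*} [AddCommMonoid M] (i j : ℕ)
    (φ : (Fin 2 →₀ ℕ) → (Fin 2 →₀ ℕ) → M) :
    ∑ p ∈ Finset.HasAntidiagonal.antidiagonal (expo i j), φ p.1 p.2 =
      ∑ a ∈ Finset.HasAntidiagonal.antidiagonal i, ∑ b ∈ Finset.HasAntidiagonal.antidiagonal j,
        φ (expo a.1 b.1) (expo a.2 b.2) := by
  rw [← Finset.sum_product']
  refine Finset.sum_bij' (fun p _ => ((p.1 0, p.2 0), (p.1 1, p.2 1)))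
    (fun q _ => (expo q.1.1 q.2.1, expo q.1.2 q.2.2)) ?_ ?_ ?_ ?_ ?_
  · intro p hp
    rw [Finset.HasAntidiagonal.mem_antidiagonal] at hp
    have h0 := DFunLike.congr_fun hp 0
    have h1 := DFunLike.congr_fun hp 1
    simp only [Finsupp.add_apply, expo_zero, expo_one] at h0 h1
    simp [h0, h1]
  · intro q hq
    simp only [Finset.mem_product, Finset.HasAntidiagonal.mem_antidiagonal] at hq ⊢
    ext k; fin_cases k
    · simp [expo_zero, hq.1]
    · simp [expo_one, hq.2]
  · intro p _
    simp only [← eq_expo]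
  · intro q _
    simp [expo_zero, expo_one]
  · intro p _
    simp only [← eq_expo]

/-- A power series in `x` over the power series in `y`, as a power series in `x`, `y`. -/
def unrows (G : PowerSeries (PowerSeries ℂ)) : PS :=
  fun d => PowerSeries.coeff (d 1) (PowerSeries.coeff (d 0) G)

theorem coeff_unrows (G : PowerSeries (PowerSeries ℂ)) (d : Fin 2 →₀ ℕ) :
    MvPowerSeries.coeff d (unrows G) = PowerSeries.coeff (d 1) (PowerSeries.coeff (d 0) G) := rfl

/-- A power series in `x`, `y` as a power series in `x`. -/
def rows : PS ≃+* PowerSeries (PowerSeries ℂ) where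
  toFun F := PowerSeries.mk fun i => PowerSeries.mk fun j => MvPowerSeries.coeff (expo i j) F
  invFun := unrows
  left_inv F := by
    apply PS.ext; intro i j
    rw [coeff_unrows, PowerSeries.coeff_mk, PowerSeries.coeff_mk, expo_zero, expo_one]
  right_inv G := by
    ext i j
    rw [PowerSeries.coeff_mk, PowerSeries.coeff_mk, coeff_unrows, expo_zero, expo_one]
  map_add' F G := by ext i j; simp
  map_mul' F G := by
    classical
    ext i j
    simp only [PowerSeries.coeff_mk, PowerSeries.coeff_mul, MvPowerSeries.coeff_mul, map_sum]
    exact sum_antidiagonal_expo i j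
      fun a b => MvPowerSeries.coeff a F * MvPowerSeries.coeff b G

theorem coeff_rows (F : PS) (i j : ℕ) : PowerSeries.coeff j (PowerSeries.coeff i (rows F)) =
    MvPowerSeries.coeff (expo i j) F := by
  change PowerSeries.coeff j (PowerSeries.coeff i (PowerSeries.mk fun i => PowerSeries.mk fun j =>
    MvPowerSeries.coeff (expo i j) F)) = _
  rw [PowerSeries.coeff_mk, PowerSeries.coeff_mk]

theorem coeff_rows_symm (G : PowerSeries (PowerSeries ℂ)) (i j : ℕ) :
    MvPowerSeries.coeff (expo i j) (rows.symm G) =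
      PowerSeries.coeff j (PowerSeries.coeff i G) := by
  rw [← coeff_rows, rows.apply_symm_apply]

/-- A polynomial in `x` as a power series in `x` and `y`. -/
def ofPoly : (PowerSeries ℂ)[X] →+* PS :=
  (RingEquiv.toRingHom rows.symm).comp Polynomial.coeToPowerSeries.ringHom

theorem coeff_ofPoly (p : (PowerSeries ℂ)[X]) (i j : ℕ) :
    MvPowerSeries.coeff (expo i j) (ofPoly p) = PowerSeries.coeff j (p.coeff i) := by
  change MvPowerSeries.coeff (expo i j) (rows.symm (p : PowerSeries (PowerSeries ℂ))) = _
  rw [coeff_rows_symm, Polynomial.coeff_coe]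

theorem rows_ofPoly (p : (PowerSeries ℂ)[X]) : rows (ofPoly p) = (p : PowerSeries _) :=
  rows.apply_symm_apply _

theorem ofPoly_X : ofPoly X = MvPowerSeries.X 0 := by
  classical
  apply PS.ext; intro i j
  rw [coeff_ofPoly, Polynomial.coeff_X, MvPowerSeries.coeff_X,
    show (Finsupp.single 0 1 : Fin 2 →₀ ℕ) = expo 1 0 by simp [expo]]
  simp only [expo_inj]
  by_cases h : i = 1
  · subst h
    by_cases hj : j = 0
    · simp [hj]
    · simp [hj, PowerSeries.coeff_one]
  · rw [if_neg (fun h' => h h'.symm), if_neg (fun h' => h h'.1), map_zero]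

theorem evalArc_ofPoly_C (a : PowerSeries ℂ) {ξ : Ser} (h : PosArc ξ) :
    evalArc (ofPoly (C a)) ξ = psi 1 a := by
  ext e
  rw [evalArc_coeff _ h.2]
  have hy : ∀ j : ℕ, yS ^ j = psi 1 (PowerSeries.X ^ j) := by
    intro j
    have := psi_X_pow 1
    rw [pow_one] at this
    rw [map_pow, this]
  have hz : ∀ n : ℕ × ℕ, n.1 ≠ 0 → MvPowerSeries.coeff (expo n.1 n.2) (ofPoly (C a)) = 0 := by
    intro n hn
    rw [coeff_ofPoly, Polynomial.coeff_C, if_neg hn, map_zero]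
  by_cases he : ∃ n : ℕ, e = (n : ℚ) / (1 : ℕ)
  · obtain ⟨n, rfl⟩ := he
    rw [psi_coeff, finsum_eq_single _ ((0, n) : ℕ × ℕ)]
    · rw [pow_zero, one_mul, hy, psi_coeff, coeff_ofPoly]
      simp
    · rintro ⟨i, j⟩ hij
      by_cases hi : i = 0
      · subst hi
        rw [pow_zero, one_mul, hy, psi_coeff, PowerSeries.coeff_X_pow, if_neg, mul_zero]
        rintro rfl; exact hij rfl
      · rw [hz _ hi, zero_mul]
  · push Not at he
    rw [psi_coeff_of_ne 1 a e he, ← finsum_zero (α := ℕ × ℕ)]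
    refine finsum_congr fun n => ?_
    by_cases hi : n.1 = 0
    · rw [hi, pow_zero, one_mul, hy, psi_coeff_of_ne 1 _ e he, mul_zero]
    · rw [hz _ hi, zero_mul]

theorem evalArc_ofPoly (p : (PowerSeries ℂ)[X]) {ξ : Ser} (h : PosArc ξ) :
    evalArc (ofPoly p) ξ = (p.map (psi 1)).eval ξ := by
  have : (evHom ξ h).comp ofPoly = eval₂RingHom (psi 1) ξ := by
    apply Polynomial.ringHom_ext
    · intro a
      simpa using show evHom ξ h (ofPoly (C a)) = psi 1 a from evalArc_ofPoly_C a h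
    · rw [RingHom.comp_apply, ofPoly_X]
      simpa using show evHom ξ h (MvPowerSeries.X 0) = ξ from evalArc_X0 h.2
  have h2 := RingHom.congr_fun this p
  rw [eval_map]
  exact h2

theorem dx_ofPoly (p : (PowerSeries ℂ)[X]) : dx (ofPoly p) = ofPoly (derivative p) := by
  apply PS.ext; intro i j
  rw [coeff_dx, coeff_ofPoly, coeff_ofPoly, coeff_derivative]
  have : ((i : PowerSeries ℂ) + 1) = PowerSeries.C ((i : ℂ) + 1) := by simp
  rw [this, PowerSeries.coeff_mul_C]

theorem dx_iterate_ofPoly (n : ℕ) (p : (PowerSeries ℂ)[X]) :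
    dx^[n] (ofPoly p) = ofPoly (derivative^[n] p) := by
  induction n generalizing p with
  | zero => rfl
  | succ n ih => rw [Function.iterate_succ_apply, dx_ofPoly, ih, Function.iterate_succ_apply]

theorem dx_iterate_add (n : ℕ) (F G : PS) : dx^[n] (F + G) = dx^[n] F + dx^[n] G := by
  induction n generalizing F G with
  | zero => rfl
  | succ n ih => rw [Function.iterate_succ_apply, dx_add, ih]; rfl

/-! ### Factorization -/

theorem yOrder_spec {F : PS} (hF : F ≠ 0) :
    (∃ i, MvPowerSeries.coeff (expo i (yOrder F)) F ≠ 0) ∧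
      ∀ i j, j < yOrder F → MvPowerSeries.coeff (expo i j) F = 0 := by
  have hne : {j | ∃ i, MvPowerSeries.coeff (expo i j) F ≠ 0}.Nonempty := by
    by_contra h
    rw [Set.not_nonempty_iff_eq_empty] at h
    apply hF
    apply PS.ext; intro i j
    by_contra hc
    have : j ∈ {j | ∃ i, MvPowerSeries.coeff (expo i j) F ≠ 0} := ⟨i, by simpa using hc⟩
    rw [h] at this; exact this
  refine ⟨Nat.sInf_mem hne, fun i j hj => ?_⟩
  by_contra hc
  exact absurd (Nat.sInf_le (s := {j | ∃ i, MvPowerSeries.coeff (expo i j) F ≠ 0}) ⟨i, hc⟩)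
    (not_le.2 hj)

theorem coeff_y_pow_mul (E : ℕ) (F : PS) (i j : ℕ) :
    MvPowerSeries.coeff (expo i j) (MvPowerSeries.X 1 ^ E * F) =
      if E ≤ j then MvPowerSeries.coeff (expo i (j - E)) F else 0 := by
  classical
  rw [MvPowerSeries.X_pow_eq, MvPowerSeries.coeff_monomial_mul]
  have h : (Finsupp.single 1 E : Fin 2 →₀ ℕ) ≤ expo i j ↔ E ≤ j := by
    rw [Finsupp.single_le_iff, expo_one]
  by_cases hE : E ≤ j
  · rw [if_pos (h.2 hE), if_pos hE, one_mul]
    congr 2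
    ext k; fin_cases k <;> simp [expo]
  · rw [if_neg (fun h' => hE (h.1 h')), if_neg hE]

/-- Every nonzero power series is a power of `y`, times a distinguished polynomial in `x` that
splits over the fractional power series, times a unit. -/
theorem exists_factorization {F : PS} (hF : F ≠ 0) :
    ∃ (U : PS) (p : (PowerSeries ℂ)[X]) (s : Multiset Ser),
      MvPowerSeries.constantCoeff U ≠ 0 ∧ (∀ γ ∈ s, PosArc γ) ∧ p.Monic ∧
      p.map redC = X ^ p.natDegree ∧
      p.map (psi 1) = (s.map fun γ => X - C γ).prod ∧
      F = MvPowerSeries.X 1 ^ yOrder F * U * ofPoly p := by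
  obtain ⟨⟨i0, hi0⟩, hlow⟩ := yOrder_spec hF
  set E := yOrder F with hE
  set F1 : PS := rows.symm (PowerSeries.mk fun i => PowerSeries.mk fun j =>
    MvPowerSeries.coeff (expo i (j + E)) F) with hF1
  have hF1c : ∀ i j, MvPowerSeries.coeff (expo i j) F1 = MvPowerSeries.coeff (expo i (j + E)) F := by
    intro i j; rw [hF1, coeff_rows_symm, PowerSeries.coeff_mk, PowerSeries.coeff_mk]
  have hFE : F = MvPowerSeries.X 1 ^ E * F1 := by
    apply PS.ext; intro i j
    rw [coeff_y_pow_mul]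
    split_ifs with h
    · rw [hF1c, Nat.sub_add_cancel h]
    · exact hlow i j (not_le.1 h)
  -- `F1` is `F` divided by the largest possible power of `y`, so it does not vanish identically on
  -- `y = 0` and Weierstrass preparation in `x` applies.
  have hres : (rows F1).map (IsLocalRing.residue (PowerSeries ℂ)) ≠ 0 := by
    intro h
    have := congrArg (PowerSeries.coeff i0) h
    rw [PowerSeries.coeff_map, map_zero, IsLocalRing.residue_eq_zero_iff, cc_eq_zero_iff_mem,
      ← PowerSeries.coeff_zero_eq_constantCoeff_apply, coeff_rows, hF1c, zero_add] at this
    exact hi0 this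
  obtain ⟨P, U, hPU⟩ := PowerSeries.exists_isWeierstrassFactorization hres
  have hP := hPU.isDistinguishedAt
  have hPX : P.map redC = X ^ P.natDegree := by
    ext i
    rw [coeff_map, coeff_X_pow]
    split_ifs with h
    · rw [h, coeff_natDegree, hP.monic.leadingCoeff, map_one]
    · rcases lt_or_gt_of_ne h with h | h
      · exact (cc_eq_zero_iff_mem _).1 (hP.mem h)
      · rw [coeff_eq_zero_of_natDegree_lt h, map_zero]
  obtain ⟨k, _, s, hs, hsp⟩ := exists_split_distinguished _ P hP.monic hPX
  have hcomp : (psi k).comp (ex k) = psi 1 := by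
    ext1 a
    rw [RingHom.comp_apply, ex_apply, ← psi_expand 1 k a]
    exact psi_cast (one_mul k).symm _
  refine ⟨rows.symm U, P, s.map (psi k), ?_, ?_, hP.monic, hPX, ?_, ?_⟩
  · have := hPU.isUnit
    rw [PowerSeries.isUnit_iff_constantCoeff, PowerSeries.isUnit_iff_constantCoeff] at this
    have h0 := coeff_rows_symm U 0 0
    have : PowerSeries.coeff 0 (PowerSeries.coeff 0 U) ≠ 0 := by simpa using this.ne_zero
    rw [← coeff_rows_symm] at this
    simpa [expo] using this
  · intro γ hγ
    obtain ⟨ζ, hζ, rfl⟩ := Multiset.mem_map.1 hγ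
    exact (posArc_iff _).2 ⟨k, inferInstance, ζ, hs ζ hζ, rfl⟩
  · rw [← hcomp, ← Polynomial.map_map, hsp, Polynomial.map_multiset_prod, Multiset.map_map,
      Multiset.map_map]
    congr 1
    apply Multiset.map_congr rfl
    intro ζ _
    simp
  · have h1 : F1 = rows.symm U * ofPoly P := by
      apply rows.injective
      have h2 := hPU.eq_mul
      rw [h2, map_mul, rows_ofPoly, mul_comm]
      congr 1
      exact (rows.apply_symm_apply U).symm
    rw [mul_assoc, ← h1]; exact hFE

theorem evalArc_unit {U : PS} {ξ : Ser} (h : PosArc ξ) :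
    0 ≤ (evalArc U ξ).orderTop ∧ (evalArc U ξ).coeff 0 = MvPowerSeries.constantCoeff U := by
  obtain ⟨s, hs0, hs1, hs⟩ := exists_small h.2
  constructor
  · have := le_orderTop_evalArc h.2 hs1 hs0.le hs (N := 0) (F := U) (by intro i j hij; omega)
    simpa using this
  · have h1 : HighDeg 1 (U - MvPowerSeries.C (MvPowerSeries.constantCoeff U)) := by
      intro i j hij
      obtain rfl : i = 0 := by omega
      obtain rfl : j = 0 := by omega
      simp [expo]
    have h2 := le_orderTop_evalArc h.2 hs1 hs0.le hs h1
    rw [evalArc_sub h, evalArc_C h.2] at h2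
    have h3 : (evalArc U ξ - HahnSeries.C (MvPowerSeries.constantCoeff U)).coeff 0 = 0 :=
      HahnSeries.coeff_eq_zero_of_lt_orderTop (lt_of_lt_of_le (by exact_mod_cast (by simpa using hs0)) h2)
    rw [HahnSeries.coeff_sub, sub_eq_zero] at h3
    rw [h3]; simp

theorem evalArc_unit_ne {U : PS} (hU : MvPowerSeries.constantCoeff U ≠ 0) {ξ : Ser}
    (h : PosArc ξ) : evalArc U ξ ≠ 0 := by
  intro h0
  apply hU
  rw [← (evalArc_unit h).2, h0, HahnSeries.coeff_zero]

theorem yS_ne : yS ≠ 0 := HahnSeries.single_ne_zero one_ne_zero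

theorem eval_prod_ne {s : Multiset Ser} {ξ : Ser} :
    ((s.map fun γ => X - C γ).prod).eval ξ = 0 ↔ ξ ∈ s := by
  rw [eval_multiset_prod, Multiset.prod_eq_zero_iff, Multiset.map_map]
  simp only [Function.comp, Multiset.mem_map, eval_sub, eval_X, eval_C, sub_eq_zero]
  constructor
  · rintro ⟨a, ha, rfl⟩; exact ha
  · intro h; exact ⟨ξ, h, rfl⟩

theorem eval_derivative_prod (s : Multiset Ser) {ξ : Ser} (h : ξ ∉ s) :
    (derivative (s.map fun γ => X - C γ).prod).eval ξ =
      ((s.map fun γ => X - C γ).prod).eval ξ * (s.map fun γ => (ξ - γ)⁻¹).sum := by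
  induction s using Multiset.induction_on with
  | empty => simp
  | cons a s ih =>
    rw [Multiset.mem_cons, not_or] at h
    rw [Multiset.map_cons, Multiset.prod_cons, derivative_mul, eval_add, eval_mul, eval_mul,
      ih h.2, Multiset.map_cons, Multiset.sum_cons, eval_mul]
    have : ξ - a ≠ 0 := sub_ne_zero.2 h.1
    simp
    field_simp

/-- If `F` vanishes at `ξ` together with its first `m - 1` derivatives in `x`, then so does every
multiple, and the derivatives of order `m` are proportional. -/
theorem evalArc_iterate_mul {ξ : Ser} (h : PosArc ξ) (m : ℕ) : ∀ (H V : PS),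
    (∀ n < m, evalArc (dx^[n] H) ξ = 0) →
    evalArc (dx^[m] (H * V)) ξ = evalArc (dx^[m] H) ξ * evalArc V ξ := by
  induction m with
  | zero => intro H V _; exact evalArc_mul h H V
  | succ m ih =>
    intro H V hH
    rw [Function.iterate_succ_apply, dx_mul, dx_iterate_add, evalArc_add h,
      ih (dx H) V (fun n hn => by
        rw [← Function.iterate_succ_apply]; exact hH (n + 1) (by omega)),
      ih H (dx V) (fun n hn => hH n (by omega)), hH m (by omega), zero_mul, add_zero,
      Function.iterate_succ_apply]

instance charZeroSer : CharZero Ser :=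
  charZero_of_injective_ringHom (f := (HahnSeries.C : ℂ →+* Ser)) HahnSeries.C_injective

/-- Since `V` does not vanish along the arc, the first nonvanishing `x`-derivative has the same
order for `H` as for the polynomial factor, where in characteristic zero this order is the
multiplicity of the root. -/
theorem rootMult_eq_count {H V : PS} {p : (PowerSeries ℂ)[X]} {s : Multiset Ser}
    (hp : p.Monic) (hH : H = V * ofPoly p) (hs : p.map (psi 1) = (s.map fun γ => X - C γ).prod)
    {ξ : Ser} (h : PosArc ξ) (hV : evalArc V ξ ≠ 0) [DecidableEq Ser] :
    rootMult H ξ = s.count ξ := by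
  have hev : ∀ n, evalArc (dx^[n] (ofPoly p)) ξ = (derivative^[n] (p.map (psi 1))).eval ξ := by
    intro n
    rw [dx_iterate_ofPoly, evalArc_ofPoly _ h, iterate_derivative_map]
  have hne : p.map (psi 1) ≠ 0 := (hp.map _).ne_zero
  have hcount : s.count ξ = (p.map (psi 1)).rootMultiplicity ξ := by
    rw [← count_roots, hs, roots_multiset_prod_X_sub_C]
  have h0 : ∀ n < s.count ξ, evalArc (dx^[n] (ofPoly p)) ξ = 0 := by
    intro n hn
    rw [hcount] at hn
    rw [hev]
    exact (lt_rootMultiplicity_iff_isRoot_iterate_derivative hne).1 hn n le_rfl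
  have h1 : evalArc (dx^[s.count ξ] (ofPoly p)) ξ ≠ 0 := by
    intro hc
    have : s.count ξ < (p.map (psi 1)).rootMultiplicity ξ := by
      rw [lt_rootMultiplicity_iff_isRoot_iterate_derivative hne]
      intro m hm
      rcases hm.lt_or_eq with hm | rfl
      · have := h0 m hm; rw [hev] at this; exact this
      · rw [hev] at hc; exact hc
    omega
  rw [hH, mul_comm]
  apply le_antisymm
  · apply Nat.sInf_le
    change evalArc (dx^[s.count ξ] (ofPoly p * V)) ξ ≠ 0
    rw [evalArc_iterate_mul h _ _ _ h0]
    exact mul_ne_zero h1 hV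
  · apply le_csInf
    · exact ⟨s.count ξ, by
        change evalArc (dx^[s.count ξ] (ofPoly p * V)) ξ ≠ 0
        rw [evalArc_iterate_mul h _ _ _ h0]
        exact mul_ne_zero h1 hV⟩
    · intro n hn
      by_contra hc
      apply hn
      rw [evalArc_iterate_mul h n _ _ (fun m hm => h0 m (by omega)), h0 n (by omega), zero_mul]

/-- The factorization of `F` at an arc, in terms of the roots of `F`. -/
theorem exists_root_multiset {F : PS} (hF : F ≠ 0) :
    ∃ (U : PS) (s : Multiset Ser), MvPowerSeries.constantCoeff U ≠ 0 ∧
      (∀ γ, γ ∈ s ↔ γ ∈ roots F) ∧ (∀ [DecidableEq Ser], ∀ γ ∈ s, s.count γ = rootMult F γ) ∧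
      (∀ ξ, PosArc ξ → evalArc F ξ = yS ^ yOrder F * evalArc U ξ * (s.map fun γ => ξ - γ).prod) ∧
      (∀ ξ, PosArc ξ → evalArc F ξ ≠ 0 → evalArc (dx F) ξ = evalArc F ξ *
        (evalArc (dx U) ξ / evalArc U ξ + (s.map fun γ => (ξ - γ)⁻¹).sum)) := by
  obtain ⟨U, p, s, hU, hs, hp, -, hps, hFe⟩ := exists_factorization hF
  have hev : ∀ ξ, PosArc ξ → evalArc F ξ =
      yS ^ yOrder F * evalArc U ξ * (s.map fun γ => ξ - γ).prod := by
    intro ξ h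
    conv_lhs => rw [hFe]
    rw [evalArc_mul h, evalArc_mul h, evalArc_pow h, evalArc_X1 h.2, evalArc_ofPoly _ h, hps,
      eval_multiset_prod, Multiset.map_map]
    simp
  have hVne : ∀ ξ, PosArc ξ → yS ^ yOrder F * evalArc U ξ ≠ 0 := fun ξ h =>
    mul_ne_zero (pow_ne_zero _ yS_ne) (evalArc_unit_ne hU h)
  have hmem : ∀ γ, γ ∈ s ↔ γ ∈ roots F := by
    intro γ
    constructor
    · intro hγ
      refine ⟨(hs γ hγ).1, (hs γ hγ).2, ?_⟩
      rw [hev γ (hs γ hγ), Multiset.prod_eq_zero, mul_zero]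
      exact Multiset.mem_map.2 ⟨γ, hγ, sub_self γ⟩
    · rintro ⟨h1, h2, h3⟩
      rw [hev γ ⟨h1, h2⟩, mul_eq_zero, or_iff_right (hVne γ ⟨h1, h2⟩),
        Multiset.prod_eq_zero_iff, Multiset.mem_map] at h3
      obtain ⟨a, ha, h4⟩ := h3
      rwa [sub_eq_zero.1 h4]
  refine ⟨U, s, hU, hmem, ?_, hev, ?_⟩
  · intro _ γ hγ
    refine (rootMult_eq_count hp hFe hps (hs γ hγ) ?_).symm
    rw [evalArc_mul (hs γ hγ), evalArc_pow (hs γ hγ), evalArc_X1 (hs γ hγ).2]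
    exact hVne γ (hs γ hγ)
  · intro ξ h hne
    have hns : ξ ∉ s := fun hc => hne ((hmem ξ).1 hc).2.2
    have hE : dx (MvPowerSeries.X 1 ^ yOrder F) = 0 := by
      rw [dx, MvPowerSeries.pderiv_pow, MvPowerSeries.pderiv_X_of_ne (by decide), mul_zero]
    conv_lhs => rw [hFe]
    rw [dx_mul, dx_mul, hE, dx_ofPoly, evalArc_add h, evalArc_mul h, evalArc_mul h, evalArc_add h,
      evalArc_mul h, evalArc_mul h, evalArc_mul h, evalArc_zero h, evalArc_pow h,
      evalArc_X1 h.2, evalArc_ofPoly _ h, evalArc_ofPoly _ h, ← derivative_map, hps,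
      eval_derivative_prod s hns, hev ξ h, eval_multiset_prod, Multiset.map_map]
    have := evalArc_unit_ne hU h
    simp only [Function.comp_def, eval_sub, eval_X, eval_C]
    field_simp
    ring

theorem roots_finite {F : PS} (hF : F ≠ 0) : (roots F).Finite := by
  classical
  obtain ⟨U, s, -, hmem, -⟩ := exists_root_multiset hF
  refine s.toFinset.finite_toSet.subset fun γ hγ => ?_
  simpa using (hmem γ).2 hγ

theorem roots_posArc {F : PS} {ξ : Ser} (h : ξ ∈ roots F) : PosArc ξ := ⟨h.1, h.2.1⟩

end PolarTree
end

noncomputable section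

namespace PolarTree

open HahnSeries
open scoped Classical

/-! ### Leading terms -/

/-- `s = c y ^ v + ⋯`, where `c` may vanish. -/
def Lead (s : Ser) (v : ℚ) (c : ℂ) : Prop := (v : WithTop ℚ) ≤ s.orderTop ∧ s.coeff v = c

theorem lead_iff (s : Ser) (v : ℚ) (c : ℂ) :
    Lead s v c ↔ (v : WithTop ℚ) < (s - single v c).orderTop := by
  constructor
  · rintro ⟨h1, h2⟩
    refine lt_of_le_of_ne ?_ fun h => ?_
    · exact le_trans (le_min h1 orderTop_single_le) min_orderTop_le_orderTop_sub
    · exact coeff_orderTop_ne h.symm (by simp [h2])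
  · intro h
    constructor
    · have : s = (s - single v c) + single v c := by ring
      rw [this]
      exact le_trans (le_min h.le orderTop_single_le) min_orderTop_le_orderTop_add
    · have := coeff_eq_zero_of_lt_orderTop h
      rw [coeff_sub, coeff_single_same, sub_eq_zero] at this
      exact this

theorem lead_of_lt {s : Ser} {v : ℚ} (h : (v : WithTop ℚ) < s.orderTop) : Lead s v 0 :=
  ⟨h.le, coeff_eq_zero_of_lt_orderTop h⟩

theorem Lead.add {s t : Ser} {v : ℚ} {c d : ℂ} (hs : Lead s v c) (ht : Lead t v d) :
    Lead (s + t) v (c + d) :=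
  ⟨le_trans (le_min hs.1 ht.1) min_orderTop_le_orderTop_add, by rw [coeff_add, hs.2, ht.2]⟩

theorem Lead.neg {s : Ser} {v : ℚ} {c : ℂ} (hs : Lead s v c) : Lead (-s) v (-c) :=
  ⟨by rw [orderTop_neg]; exact hs.1, by rw [coeff_neg, hs.2]⟩

theorem Lead.sub {s t : Ser} {v : ℚ} {c d : ℂ} (hs : Lead s v c) (ht : Lead t v d) :
    Lead (s - t) v (c - d) := by
  rw [sub_eq_add_neg, sub_eq_add_neg]; exact hs.add ht.neg

theorem Lead.mul {s t : Ser} {v w : ℚ} {c d : ℂ} (hs : Lead s v c) (ht : Lead t w d) :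
    Lead (s * t) (v + w) (c * d) := by
  rw [lead_iff]
  have h1 := (lead_iff _ _ _).1 hs
  have h2 := (lead_iff _ _ _).1 ht
  have : s * t - single (v + w) (c * d) =
      (s - single v c) * t + single v c * (t - single w d) := by
    rw [← single_mul_single]; ring
  rw [this]
  refine lt_of_lt_of_le (lt_min ?_ ?_) min_orderTop_le_orderTop_add
  · refine lt_of_lt_of_le ?_ orderTop_add_le_mul
    rw [WithTop.coe_add]
    exact WithTop.add_lt_add_of_lt_of_le WithTop.coe_ne_top h1 ht.1
  · refine lt_of_lt_of_le ?_ orderTop_add_le_mul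
    rw [WithTop.coe_add]
    exact WithTop.add_lt_add_of_le_of_lt WithTop.coe_ne_top orderTop_single_le h2

theorem Lead.orderTop {s : Ser} {v : ℚ} {c : ℂ} (hs : Lead s v c) (hc : c ≠ 0) :
    s.orderTop = v :=
  le_antisymm (orderTop_le_of_coeff_ne_zero (by rw [hs.2]; exact hc)) hs.1

theorem Lead.ne_zero {s : Ser} {v : ℚ} {c : ℂ} (hs : Lead s v c) (hc : c ≠ 0) : s ≠ 0 := by
  rintro rfl; exact hc (by rw [← hs.2, coeff_zero])

theorem Lead.unique {s : Ser} {v w : ℚ} {c d : ℂ} (hs : Lead s v c) (hs' : Lead s w d)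
    (hc : c ≠ 0) (hd : d ≠ 0) : v = w ∧ c = d := by
  have h := hs.orderTop hc
  rw [hs'.orderTop hd, WithTop.coe_inj] at h
  subst h
  exact ⟨rfl, hs.2.symm.trans hs'.2⟩

theorem Lead.inv {s : Ser} {v : ℚ} {c : ℂ} (hs : Lead s v c) (hc : c ≠ 0) :
    Lead s⁻¹ (-v) c⁻¹ := by
  have hs0 := hs.ne_zero hc
  have h1 : (s⁻¹).orderTop + s.orderTop = 0 := by
    rw [← orderTop_mul, inv_mul_cancel₀ hs0, orderTop_one]
  have h2 : (s⁻¹).orderTop = ((-v : ℚ) : WithTop ℚ) := by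
    rw [hs.orderTop hc] at h1
    obtain ⟨q, hq⟩ := WithTop.ne_top_iff_exists.1 (orderTop_ne_top.2 (inv_ne_zero hs0))
    rw [← hq] at h1 ⊢
    rw [← WithTop.coe_add] at h1
    have h3 : q + v = 0 := by exact_mod_cast h1
    congr 1; linarith
  have h3 : Lead s⁻¹ (-v) ((s⁻¹).coeff (-v)) := ⟨h2.ge, rfl⟩
  have h4 := h3.mul hs
  rw [inv_mul_cancel₀ hs0, neg_add_cancel] at h4
  have h5 : (s⁻¹).coeff (-v) * c = 1 := by rw [← h4.2]; simp
  rw [← eq_inv_of_mul_eq_one_left h5]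
  exact h3

theorem Lead.eul {s : Ser} {v : ℚ} {c : ℂ} (hs : Lead s v c) : Lead (eul s) v (v * c) :=
  ⟨hs.1.trans (orderTop_eul_ge s), by rw [eul_coeff, hs.2]⟩

theorem lead_one : Lead (1 : Ser) 0 1 := ⟨by simp, by simp⟩

theorem Lead.pow {s : Ser} {v : ℚ} {c : ℂ} (hs : Lead s v c) (n : ℕ) :
    Lead (s ^ n) (n * v) (c ^ n) := by
  induction n with
  | zero => simpa using lead_one
  | succ n ih =>
    rw [pow_succ, pow_succ, Nat.cast_succ, add_mul, one_mul]
    exact ih.mul hs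

theorem lead_yS : Lead yS 1 1 := ⟨orderTop_single_le, coeff_single_same _ _⟩

theorem lead_prod (s : Multiset Ser) (φ : Ser → Ser) (v : Ser → ℚ) (c : Ser → ℂ)
    (h : ∀ γ ∈ s, Lead (φ γ) (v γ) (c γ)) :
    Lead (s.map φ).prod (s.map v).sum (s.map c).prod := by
  induction s using Multiset.induction_on with
  | empty => simpa using lead_one
  | cons a s ih =>
    simp only [Multiset.map_cons, Multiset.prod_cons, Multiset.sum_cons]
    exact (h a (Multiset.mem_cons_self a s)).mul
      (ih fun γ hγ => h γ (Multiset.mem_cons_of_mem hγ))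

theorem lead_sum (s : Multiset Ser) (φ : Ser → Ser) (v : ℚ) (c : Ser → ℂ)
    (h : ∀ γ ∈ s, Lead (φ γ) v (c γ)) : Lead (s.map φ).sum v (s.map c).sum := by
  induction s using Multiset.induction_on with
  | empty => exact ⟨by simp, by simp⟩
  | cons a s ih =>
    simp only [Multiset.map_cons, Multiset.sum_cons]
    exact (h a (Multiset.mem_cons_self a s)).add
      (ih fun γ hγ => h γ (Multiset.mem_cons_of_mem hγ))

/-! ### Bars and series climbing over them -/

/-- The properties of the bars of positive height that are used in the computations of orders. -/
structure ProperBar (B : Bar) : Prop where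
  height_pos : 0 < B.height
  posArc : PosArc B.stem
  stem_coeff : ∀ e, B.height ≤ e → B.stem.coeff e = 0

/-- The order of `ξ - γ` for a generic `ξ` climbing over `B`. -/
def ordAt (B : Bar) (γ : Ser) : ℚ := if Climbs γ B then B.height else (B.stem - γ).order

/-- The leading coefficient of `ξ - γ` for `ξ` climbing over `B` at `z`. -/
def leadAt (B : Bar) (z : ℂ) (γ : Ser) : ℂ :=
  if Climbs γ B then z - γ.coeff B.height else (B.stem - γ).leadingCoeff

theorem climbs_iff {γ : Ser} {B : Bar} :
    Climbs γ B ↔ ∀ e < B.height, γ.coeff e = B.stem.coeff e :=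
  ⟨fun ⟨_, h⟩ => h.1, fun h => ⟨_, h, rfl⟩⟩

theorem climbsAt_iff {γ : Ser} {B : Bar} {c : ℂ} :
    ClimbsAt γ B c ↔ Climbs γ B ∧ γ.coeff B.height = c :=
  ⟨fun h => ⟨⟨c, h⟩, h.2⟩, fun h => ⟨climbs_iff.1 h.1, h.2⟩⟩

theorem ClimbsAt.climbs {γ : Ser} {B : Bar} {c : ℂ} (h : ClimbsAt γ B c) : Climbs γ B := ⟨c, h⟩

theorem not_climbs_order {γ : Ser} {B : Bar} (h : ¬ Climbs γ B) :
    B.stem - γ ≠ 0 ∧ (B.stem - γ).order < B.height := by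
  rw [climbs_iff] at h
  push Not at h
  obtain ⟨e, he, hne⟩ := h
  have hc : (B.stem - γ).coeff e ≠ 0 := by
    rw [coeff_sub, sub_ne_zero]; exact hne.symm
  exact ⟨ne_zero_of_coeff_ne_zero hc, (order_le_of_coeff_ne_zero hc).trans_lt he⟩

/-- Below the height of `B` the arc `ξ` agrees with the stem: if `γ` climbs too, everything below
`h(B)` cancels; otherwise the difference is already decided by the stem and does not depend on `z`.
-/
theorem lead_sub {B : Bar} {ξ γ : Ser} {z : ℂ} (hξ : ClimbsAt ξ B z) :
    Lead (ξ - γ) (ordAt B γ) (leadAt B z γ) := by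
  by_cases h : Climbs γ B
  · rw [ordAt, leadAt, if_pos h, if_pos h]
    refine ⟨?_, by rw [coeff_sub, hξ.2]⟩
    rw [le_orderTop_iff_forall]
    intro e he
    have he : e < B.height := by exact_mod_cast he
    rw [coeff_sub, hξ.1 e he, climbs_iff.1 h e he, sub_self]
  · obtain ⟨hne, hlt⟩ := not_climbs_order h
    have hcoe : ∀ e < B.height, (ξ - γ).coeff e = (B.stem - γ).coeff e := by
      intro e he
      rw [coeff_sub, coeff_sub, hξ.1 e he]
    rw [ordAt, leadAt, if_neg h, if_neg h]
    refine ⟨?_, ?_⟩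
    · rw [le_orderTop_iff_forall]
      intro e he
      have he : e < (B.stem - γ).order := by exact_mod_cast he
      rw [hcoe e (he.trans hlt)]
      exact coeff_eq_zero_of_lt_order he
    · rw [hcoe _ hlt, leadingCoeff_eq]

theorem leadAt_ne {B : Bar} {γ : Ser} {z : ℂ} (h : ¬ ClimbsAt γ B z) : leadAt B z γ ≠ 0 := by
  rw [leadAt]
  split_ifs with hc
  · rw [sub_ne_zero]
    intro h'; exact h (climbsAt_iff.2 ⟨hc, h'.symm⟩)
  · rw [leadingCoeff_ne_zero]; exact (not_climbs_order hc).1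

/-! ### The roots of a power series with multiplicities -/

/-- The roots of `F` with their multiplicities. -/
def rootMS (F : PS) : Multiset Ser :=
  if h : F ≠ 0 then (exists_root_multiset h).choose_spec.choose else 0

/-- The unit factor of `F`. -/
def rootUnit (F : PS) : PS := if h : F ≠ 0 then (exists_root_multiset h).choose else 0


theorem rootUnit_cc {F : PS} (hF : F ≠ 0) : MvPowerSeries.constantCoeff (rootUnit F) ≠ 0 := by
  rw [rootUnit, dif_pos hF]
  exact (exists_root_multiset hF).choose_spec.choose_spec.1

theorem mem_rootMS {F : PS} (hF : F ≠ 0) {γ : Ser} : γ ∈ rootMS F ↔ γ ∈ roots F := by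
  rw [rootMS, dif_pos hF]
  exact (exists_root_multiset hF).choose_spec.choose_spec.2.1 γ

theorem count_rootMS {F : PS} (hF : F ≠ 0) {γ : Ser} (hγ : γ ∈ roots F) : (rootMS F).count γ = rootMult F γ := by
  have h := (mem_rootMS hF).2 hγ
  rw [rootMS, dif_pos hF] at h ⊢
  exact (exists_root_multiset hF).choose_spec.choose_spec.2.2.1 γ h

theorem evalArc_eq_prod {F : PS} (hF : F ≠ 0) {ξ : Ser} (h : PosArc ξ) : evalArc F ξ =
    yS ^ yOrder F * evalArc (rootUnit F) ξ * ((rootMS F).map fun γ => ξ - γ).prod := by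
  rw [rootMS, dif_pos hF, rootUnit, dif_pos hF]
  exact (exists_root_multiset hF).choose_spec.choose_spec.2.2.2.1 ξ h

theorem evalArc_dx_eq {F : PS} (hF : F ≠ 0) {ξ : Ser} (h : PosArc ξ) (hne : evalArc F ξ ≠ 0) : evalArc (dx F) ξ =
    evalArc F ξ * (evalArc (dx (rootUnit F)) ξ / evalArc (rootUnit F) ξ +
      ((rootMS F).map fun γ => (ξ - γ)⁻¹).sum) := by
  rw [rootMS, dif_pos hF, rootUnit, dif_pos hF]
  exact (exists_root_multiset hF).choose_spec.choose_spec.2.2.2.2 ξ h hne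

/-- The roots of `F` that climb over `B`. -/
def climbMS (F : PS) (B : Bar) : Multiset Ser := (rootMS F).filter (Climbs · B)

/-- The number of roots of `F` that climb over `B` at `c`, with multiplicities. -/
def cnt (F : PS) (B : Bar) (c : ℂ) : ℕ := (rootMS F).countP (ClimbsAt · B c)

/-- The polynomial whose roots are the points over which the roots of `F` climb. -/
def initPoly (F : PS) (B : Bar) : Polynomial ℂ :=
  ((climbMS F B).map fun γ => Polynomial.X - Polynomial.C (γ.coeff B.height)).prod

theorem initPoly_eval {F : PS} (B : Bar) (z : ℂ) :
    (initPoly F B).eval z = ((climbMS F B).map fun γ => z - γ.coeff B.height).prod := by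
  rw [initPoly, Polynomial.eval_multiset_prod, Multiset.map_map]
  simp

theorem initPoly_ne {F : PS} (B : Bar) : initPoly F B ≠ 0 := by
  rw [initPoly]
  apply Multiset.prod_ne_zero
  intro h
  obtain ⟨γ, -, h⟩ := Multiset.mem_map.1 h
  exact Polynomial.X_sub_C_ne_zero _ h

theorem rootMultiplicity_initPoly {F : PS} (B : Bar) (c : ℂ) :
    (initPoly F B).rootMultiplicity c = cnt F B c := by
  have h1 : initPoly F B = (((climbMS F B).map fun γ => γ.coeff B.height).map
      fun a => Polynomial.X - Polynomial.C a).prod := by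
    rw [initPoly, Multiset.map_map]; rfl
  rw [← Polynomial.count_roots, h1, Polynomial.roots_multiset_prod_X_sub_C, Multiset.count_map,
    climbMS, Multiset.filter_filter, cnt, Multiset.countP_eq_card_filter]
  congr 1
  refine Multiset.filter_congr fun γ _ => ?_
  rw [climbsAt_iff, and_comm, eq_comm]

/-- The order of `F` along a generic arc climbing over `B`. -/
def nuS (F : PS) (B : Bar) : ℚ := yOrder F + ((rootMS F).map (ordAt B)).sum

/-- The unit and the roots that do not climb over `B` contribute a constant, the others one factor
`z - c` each. That one `C` serves all `z` is what later turns leading coefficients into polynomials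
in `z`. -/
theorem exists_lead {F : PS} (hF : F ≠ 0) (B : Bar) : ∃ C : ℂ, C ≠ 0 ∧ ∀ ξ z, PosArc ξ → ClimbsAt ξ B z →
    Lead (evalArc F ξ) (nuS F B) (C * (initPoly F B).eval z) := by
  refine ⟨MvPowerSeries.constantCoeff (rootUnit F) *
    (((rootMS F).filter (¬ Climbs · B)).map fun γ => (B.stem - γ).leadingCoeff).prod, ?_, ?_⟩
  · refine mul_ne_zero (rootUnit_cc hF) (Multiset.prod_ne_zero fun h => ?_)
    obtain ⟨γ, hγ, h⟩ := Multiset.mem_map.1 h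
    exact leadingCoeff_ne_zero.2 (not_climbs_order (Multiset.mem_filter.1 hγ).2).1 h
  · intro ξ z hξ hz
    rw [evalArc_eq_prod hF hξ]
    have h1 : Lead (yS ^ yOrder F) (yOrder F) 1 := by simpa using lead_yS.pow (yOrder F)
    have h2 : Lead (evalArc (rootUnit F) ξ) 0 (MvPowerSeries.constantCoeff (rootUnit F)) :=
      evalArc_unit hξ
    have h3 := lead_prod (rootMS F) (fun γ => ξ - γ) (ordAt B) (leadAt B z)
      fun γ _ => lead_sub hz
    have h4 := (h1.mul h2).mul h3
    rw [add_zero, one_mul] at h4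
    have h5 : ((rootMS F).map (leadAt B z)).prod =
        (((rootMS F).filter (¬ Climbs · B)).map fun γ => (B.stem - γ).leadingCoeff).prod *
          (initPoly F B).eval z := by
      rw [initPoly_eval, climbMS]
      conv_lhs => rw [← Multiset.filter_add_not (Climbs · B) (rootMS F)]
      rw [Multiset.map_add, Multiset.prod_add, mul_comm]
      congr 2
      · refine Multiset.map_congr rfl fun γ hγ => ?_
        rw [leadAt, if_neg (Multiset.mem_filter.1 hγ).2]
      · refine Multiset.map_congr rfl fun γ hγ => ?_
        rw [leadAt, if_pos (Multiset.mem_filter.1 hγ).2]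
    rw [h5, ← mul_assoc] at h4
    exact h4

theorem lead_ne {F : PS} (hF : F ≠ 0) {B : Bar} {z : ℂ} (hz : ∀ γ ∈ roots F, ¬ ClimbsAt γ B z) :
    (initPoly F B).eval z ≠ 0 := by
  rw [initPoly_eval]
  refine Multiset.prod_ne_zero fun h => ?_
  obtain ⟨γ, hγ, h⟩ := Multiset.mem_map.1 h
  rw [climbMS, Multiset.mem_filter, mem_rootMS hF] at hγ
  exact hz γ hγ.1 (climbsAt_iff.2 ⟨hγ.2, (sub_eq_zero.1 h).symm⟩)

/-- The logarithmic derivative of `F` in `x` along an arc climbing over `B`. -/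
theorem lead_dx {F : PS} (hF : F ≠ 0) {B : Bar} (hB : ProperBar B) {ξ : Ser} {z : ℂ} (hξ : PosArc ξ)
    (hz : ClimbsAt ξ B z) (hne : ∀ γ ∈ roots F, ¬ ClimbsAt γ B z) {C : ℂ}
    (hC : Lead (evalArc F ξ) (nuS F B) C) (hC0 : C ≠ 0) :
    Lead (evalArc (dx F) ξ) (nuS F B + -B.height)
      (C * ((climbMS F B).map fun γ => (z - γ.coeff B.height)⁻¹).sum) := by
  rw [evalArc_dx_eq hF hξ (hC.ne_zero hC0)]
  refine hC.mul ?_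
  have hU : Lead (evalArc (rootUnit F) ξ) 0 (MvPowerSeries.constantCoeff (rootUnit F)) :=
    evalArc_unit hξ
  have hneg : ((-B.height : ℚ) : WithTop ℚ) < ((0 : ℚ) : WithTop ℚ) := by
    have := hB.height_pos
    rw [WithTop.coe_lt_coe]; linarith
  -- The unit has a logarithmic derivative of nonnegative order, which is negligible at order `-h(B)
  -- < 0`.
  have h1 : Lead (evalArc (dx (rootUnit F)) ξ / evalArc (rootUnit F) ξ) (-B.height) 0 := by
    apply lead_of_lt
    have h2 : Lead (evalArc (dx (rootUnit F)) ξ) 0 _ := evalArc_unit hξ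
    have h3 := (h2.mul (hU.inv (rootUnit_cc hF))).1
    rw [neg_zero, add_zero] at h3
    rw [div_eq_mul_inv]
    exact lt_of_lt_of_le hneg h3
  have h2 := lead_sum (rootMS F) (fun γ => (ξ - γ)⁻¹) (-B.height)
    (fun γ => if Climbs γ B then (z - γ.coeff B.height)⁻¹ else 0) (by
      intro γ hγ
      have h := (lead_sub (γ := γ) hz).inv (leadAt_ne (hne γ ((mem_rootMS hF).1 hγ)))
      by_cases hc : Climbs γ B
      · rw [ordAt, leadAt, if_pos hc, if_pos hc] at h
        rwa [if_pos hc]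
      -- A root that does not climb has contact less than `h(B)` with `ξ`, so its term has order
      -- greater than `-h(B)`.
      · rw [ordAt, if_neg hc] at h
        rw [if_neg hc]
        apply lead_of_lt
        refine lt_of_lt_of_le ?_ h.1
        have := (not_climbs_order hc).2
        rw [WithTop.coe_lt_coe]; linarith)
  have h3 := h1.add h2
  rw [zero_add] at h3
  convert h3 using 1
  rw [climbMS]
  induction rootMS F using Multiset.induction_on with
  | empty => simp
  | cons a s ih =>
    by_cases hc : Climbs a B
    · rw [Multiset.filter_cons_of_pos (p := (Climbs · B)) _ hc]; simp [hc, ih]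
    · rw [Multiset.filter_cons_of_neg (p := (Climbs · B)) _ hc]; simp [hc, ih]


theorem posArc_single {h : ℚ} (hh : 0 < h) (z : ℂ) : PosArc (single h z) := by
  refine ⟨⟨h.den, h.den_pos, fun e he => ⟨h.num.toNat, ?_⟩⟩, ?_⟩
  · rw [eq_of_mem_support_single he]
    have h0 : 0 ≤ h.num := Rat.num_nonneg.2 hh.le
    have h1 : ((h.num.toNat : ℕ) : ℚ) = (h.num : ℚ) := by
      exact_mod_cast congrArg (Int.cast : ℤ → ℚ) (Int.toNat_of_nonneg h0)
    rw [h1, Rat.num_div_den]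
  · exact lt_of_lt_of_le (by exact_mod_cast hh) orderTop_single_le

/-- The arc `λ_B + z y ^ h(B)`. -/
def testArc (B : Bar) (z : ℂ) : Ser := B.stem + single B.height z

theorem testArc_posArc {B : Bar} (hB : ProperBar B) (z : ℂ) : PosArc (testArc B z) :=
  hB.posArc.add (posArc_single hB.height_pos z)

theorem testArc_climbsAt {B : Bar} (hB : ProperBar B) (z : ℂ) : ClimbsAt (testArc B z) B z := by
  refine ⟨fun e he => ?_, ?_⟩
  · rw [testArc, coeff_add, coeff_single_of_ne he.ne, add_zero]
  · rw [testArc, coeff_add, coeff_single_same, hB.stem_coeff _ le_rfl, zero_add]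

theorem cofinite_not_climbs {F : PS} (hF : F ≠ 0) (B : Bar) :
    ∀ᶠ z : ℂ in Filter.cofinite, ∀ γ ∈ roots F, ¬ ClimbsAt γ B z := by
  rw [Filter.eventually_cofinite]
  refine ((roots_finite hF).image fun γ => γ.coeff B.height).subset fun z hz => ?_
  simp only [Set.mem_ofPred_eq, not_forall, not_not] at hz
  obtain ⟨γ, hγ, h⟩ := hz
  exact ⟨γ, hγ, h.2⟩

/-- The generic order exists by `exists_lead`, so the value chosen by `Classical.epsilon` is a
generic order as well, and two generic orders agree at a common `z`. -/
theorem nu_eq_nuS {F : PS} (hF : F ≠ 0) {B : Bar} (hB : ProperBar B) : nu F B = nuS F B := by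
  obtain ⟨C, hC, hlead⟩ := exists_lead hF B
  have key : ∀ᶠ z : ℂ in Filter.cofinite,
      (evalArc F (testArc B z)).orderTop = (nuS F B : WithTop ℚ) := by
    filter_upwards [cofinite_not_climbs hF B] with z hz
    exact (hlead _ z (testArc_posArc hB z) (testArc_climbsAt hB z)).orderTop
      (mul_ne_zero hC (lead_ne hF hz))
  rw [nu, if_neg hB.height_pos.ne']
  have h1 := Classical.epsilon_spec (p := fun v : ℚ => ∀ᶠ z : ℂ in Filter.cofinite,
    (evalArc F (B.stem + single B.height z)).orderTop = (v : WithTop ℚ)) ⟨_, key⟩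
  obtain ⟨z, hz⟩ := (h1.and key).exists
  exact WithTop.coe_injective (hz.1.symm.trans hz.2)

end PolarTree
end

noncomputable section

namespace PolarTree

open HahnSeries
open scoped Classical

/-! ### Pairs with simple roots -/

/-- The condition of `GoodPair` for formal power series. -/
def GoodPS (f g : PS) : Prop :=
  MvPowerSeries.constantCoeff f = 0 ∧ MvPowerSeries.constantCoeff g = 0 ∧
    ∀ ξ ∈ roots (f * g), evalArc (dx (f * g)) ξ ≠ 0

theorem posArc_zero : PosArc 0 := by
  refine (posArc_iff 0).2 ⟨1, inferInstance, 0, by simp, by simp⟩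

section

variable {f g : PS}

theorem GoodPS.mul_ne (h : GoodPS f g) : f * g ≠ 0 := by
  intro h0
  have := h.2.2
  rw [h0] at this
  refine this 0 ⟨posArc_zero.1, posArc_zero.2, evalArc_zero posArc_zero⟩ ?_
  rw [show dx (0 : PS) = 0 by simp [dx]]
  exact evalArc_zero posArc_zero

theorem GoodPS.ne_left (h : GoodPS f g) : f ≠ 0 := left_ne_zero_of_mul h.mul_ne
theorem GoodPS.ne_right (h : GoodPS f g) : g ≠ 0 := right_ne_zero_of_mul h.mul_ne

theorem GoodPS.symm (h : GoodPS f g) : GoodPS g f :=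
  ⟨h.2.1, h.1, by rw [mul_comm]; exact h.2.2⟩

theorem roots_mul (f g : PS) : roots (f * g) = allRoots f g := by
  ext ξ
  constructor
  · rintro ⟨h1, h2, h3⟩
    rw [evalArc_mul ⟨h1, h2⟩, mul_eq_zero] at h3
    exact h3.imp (fun h => ⟨h1, h2, h⟩) fun h => ⟨h1, h2, h⟩
  · rintro (⟨h1, h2, h3⟩ | ⟨h1, h2, h3⟩)
    · exact ⟨h1, h2, by rw [evalArc_mul ⟨h1, h2⟩, h3, zero_mul]⟩
    · exact ⟨h1, h2, by rw [evalArc_mul ⟨h1, h2⟩, h3, mul_zero]⟩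

theorem allRoots_posArc {ξ : Ser} (h : ξ ∈ allRoots f g) : PosArc ξ :=
  h.elim roots_posArc roots_posArc

theorem allRoots_finite (h : GoodPS f g) : (allRoots f g).Finite := by
  rw [← roots_mul]; exact roots_finite h.mul_ne

theorem GoodPS.simple (h : GoodPS f g) {ξ : Ser} (hξ : ξ ∈ roots f) :
    evalArc (dx f) ξ ≠ 0 ∧ evalArc g ξ ≠ 0 := by
  have h1 := h.2.2 ξ (by rw [roots_mul]; exact Or.inl hξ)
  have hp := roots_posArc hξ
  rw [dx_mul, evalArc_add hp, evalArc_mul hp, evalArc_mul hp, hξ.2.2, zero_mul, add_zero] at h1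
  exact mul_ne_zero_iff.1 h1

theorem GoodPS.rootMult_eq_one (h : GoodPS f g) {ξ : Ser} (hξ : ξ ∈ roots f) :
    rootMult f ξ = 1 := by
  apply le_antisymm
  · exact Nat.sInf_le (h.simple hξ).1
  · refine le_csInf ⟨1, (h.simple hξ).1⟩ fun n hn => ?_
    by_contra hc
    obtain rfl : n = 0 := by omega
    exact hn hξ.2.2

theorem GoodPS.nodup (h : GoodPS f g) : (rootMS f).Nodup := by
  rw [Multiset.nodup_iff_count_eq_one]
  intro ξ hξ
  have hξ' := (mem_rootMS h.ne_left).1 hξ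
  rw [count_rootMS h.ne_left hξ', h.rootMult_eq_one hξ']

theorem GoodPS.cnt_eq (h : GoodPS f g) (B : Bar) (c : ℂ) : cnt f B c = mult f B c := by
  rw [cnt, mult, Multiset.countP_eq_card_filter]
  have : {ξ | ξ ∈ roots f ∧ ClimbsAt ξ B c} =
      (((rootMS f).filter (ClimbsAt · B c)).toFinset : Set Ser) := by
    ext ξ
    simp [mem_rootMS h.ne_left]
  rw [this, Set.ncard_coe_finset, Multiset.toFinset_card_of_nodup (h.nodup.filter _)]

/-- A root of the Jacobian is not a root of `f`. -/
theorem GoodPS.not_root_jac_left (h : GoodPS f g) {ξ : Ser} (hξ : ξ ∈ roots f) :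
    evalArc (jac f g) ξ ≠ 0 := by
  intro hJ
  have hp := roots_posArc hξ
  have h1 := evalArc_jac f g hp
  -- Along a root of `f` the identity for `y J` reduces to `-f_x` times `y d/dy g(ξ)`. As the root
  -- is simple, vanishing of `J` would make `g(ξ)` constant, hence zero since `g` vanishes at the
  -- origin, so `ξ` would be a common root of `f` and `g`.
  rw [hJ, hξ.2.2, map_zero, mul_zero, zero_mul, zero_sub, eq_comm, neg_eq_zero, mul_eq_zero,
    or_iff_right (h.simple hξ).1] at h1
  apply (h.simple hξ).2
  ext e
  have h2 := congrArg (fun s => s.coeff e) h1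
  simp only [eul_coeff, coeff_zero, mul_eq_zero] at h2
  rcases h2 with h2 | h2
  · have he : e = 0 := by exact_mod_cast h2
    rw [he, (evalArc_unit hp).2, h.2.1]; simp
  · rw [h2]; simp

theorem jac_symm (f g : PS) : jac g f = -jac f g := by
  rw [jac, jac]; ring

theorem GoodPS.not_root_jac_right (h : GoodPS f g) {ξ : Ser} (hξ : ξ ∈ roots g) :
    evalArc (jac f g) ξ ≠ 0 := by
  have h1 := h.symm.not_root_jac_left hξ
  rw [jac_symm] at h1
  intro h2
  apply h1
  rw [← zero_sub, evalArc_sub (roots_posArc hξ), evalArc_zero (roots_posArc hξ), h2, sub_zero]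

/-- The condition `f g ≠ 0` along a polar root is automatic, so all counts can run over the full
multiset of roots of `J`. -/
theorem GoodPS.polarRoots_eq (h : GoodPS f g) : polarRoots f g = roots (jac f g) := by
  ext ξ
  refine ⟨fun hξ => hξ.1, fun hξ => ⟨hξ, ?_⟩⟩
  rintro (h' | h')
  · exact h.not_root_jac_left h' hξ.2.2
  · exact h.not_root_jac_right h' hξ.2.2

/-! ### Bars of the tree -/

theorem contact_comm (ξ η : Ser) : contact ξ η = contact η ξ := by
  rw [contact, contact, ← orderTop_neg, neg_sub]

theorem contact_pos {ξ η : Ser} (hξ : PosArc ξ) (hη : PosArc η) : 0 < contact ξ η :=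
  lt_of_lt_of_le (lt_min hξ.2 hη.2) min_orderTop_le_orderTop_sub

theorem isArc_truncLT {ξ : Ser} (h : IsArc ξ) (q : ℚ) : IsArc (truncLT q ξ) := by
  obtain ⟨D, hD, h⟩ := h
  exact ⟨D, hD, fun e he => h e (support_truncLT_subset q ξ he)⟩

theorem posArc_truncLT {ξ : Ser} (h : PosArc ξ) (q : ℚ) : PosArc (truncLT q ξ) := by
  refine ⟨isArc_truncLT h.1 q, lt_of_lt_of_le h.2 ?_⟩
  rw [le_orderTop_iff_forall]
  intro e he
  by_cases hq : e < q
  · rw [coeff_truncLT_of_lt hq, coeff_eq_zero_of_lt_orderTop he]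
  · rw [coeff_truncLT_of_le (not_lt.1 hq)]

theorem IsBar.ground_or_pos {B : Bar} (hB : IsBar f g B) : B = ground ∨
    (0 < B.height ∧ ∃ ξ ∈ allRoots f g, ∃ η ∈ allRoots f g,
      contact ξ η = (B.height : WithTop ℚ) ∧ B.stem = truncLT B.height ξ) := by
  rcases hB with h | ⟨ξ, hξ, η, hη, h1, h2⟩
  · exact Or.inl h
  · refine Or.inr ⟨?_, ξ, hξ, η, hη, h1, h2⟩
    have := contact_pos (allRoots_posArc hξ) (allRoots_posArc hη)
    rw [h1] at this
    exact_mod_cast this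

theorem IsBar.nonneg {B : Bar} (hB : IsBar f g B) : 0 ≤ B.height := by
  rcases hB.ground_or_pos with rfl | h
  · exact le_rfl
  · exact h.1.le

theorem IsBar.proper {B : Bar} (hB : IsBar f g B) (h : 0 < B.height) : ProperBar B := by
  rcases hB.ground_or_pos with rfl | ⟨_, ξ, hξ, η, hη, h1, h2⟩
  · exact absurd h (lt_irrefl _)
  · refine ⟨h, ?_, fun e he => ?_⟩
    · rw [h2]; exact posArc_truncLT (allRoots_posArc hξ) _
    · rw [h2, coeff_truncLT_of_le he]

theorem finite_delta_support (h : GoodPS f g) (B : Bar) :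
    {c | delta f g B c ≠ 0}.Finite ∧ ∀ c, delta f g B c ≠ 0 → TrunkAt f g B c := by
  have h1 : ∀ c, delta f g B c ≠ 0 → TrunkAt f g B c := by
    intro c hc
    by_contra hT
    apply hc
    have hf : mult f B c = 0 := by
      rw [mult, show {ξ | ξ ∈ roots f ∧ ClimbsAt ξ B c} = ∅ from ?_, Set.ncard_empty]
      ext ξ
      simp only [Set.mem_ofPred_eq, Set.mem_empty_iff_false, iff_false, not_and]
      exact fun hξ hc => hT ⟨ξ, Or.inl hξ, hc⟩
    have hg : mult g B c = 0 := by
      rw [mult, show {ξ | ξ ∈ roots g ∧ ClimbsAt ξ B c} = ∅ from ?_, Set.ncard_empty]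
      ext ξ
      simp only [Set.mem_ofPred_eq, Set.mem_empty_iff_false, iff_false, not_and]
      exact fun hξ hc => hT ⟨ξ, Or.inr hξ, hc⟩
    rw [delta, hf, hg]; simp
  refine ⟨((allRoots_finite h).image fun ξ => ξ.coeff B.height).subset ?_, h1⟩
  intro c hc
  obtain ⟨ξ, hξ, hcl⟩ := h1 c hc
  exact ⟨ξ, hξ, hcl.2⟩

/-- The finite set of points with nonzero `delta`. -/
def ncPts (f g : PS) (B : Bar) : Finset ℂ :=
  if h : {c | delta f g B c ≠ 0}.Finite then h.toFinset else ∅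

theorem mem_ncPts (h : GoodPS f g) {B : Bar} {c : ℂ} :
    c ∈ ncPts f g B ↔ delta f g B c ≠ 0 := by
  rw [ncPts, dif_pos (finite_delta_support h B).1]; simp

end

/-! ### The rational function of a bar -/

section

open Polynomial

/-- The numerator of `∑ d c / (X - c)`. -/
def sumNum (T : Finset ℂ) (d : ℂ → ℂ) : ℂ[X] :=
  ∑ c ∈ T, Polynomial.C (d c) * ∏ a ∈ T.erase c, (X - Polynomial.C a)

/-- The common denominator `∏ (X - c)`. -/
def sumDen (T : Finset ℂ) : ℂ[X] := ∏ c ∈ T, (X - Polynomial.C c)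

theorem sumNum_eval_of_notMem (T : Finset ℂ) (d : ℂ → ℂ) {z : ℂ} (hz : z ∉ T) :
    (sumNum T d).eval z = (sumDen T).eval z * ∑ c ∈ T, d c * (z - c)⁻¹ := by
  rw [sumNum, sumDen, eval_finsetSum, Finset.mul_sum]
  refine Finset.sum_congr rfl fun c hc => ?_
  rw [← Finset.mul_prod_erase T _ hc]
  have : z - c ≠ 0 := sub_ne_zero.2 fun h => hz (h ▸ hc)
  simp only [eval_mul, eval_C, eval_sub, eval_X]
  field_simp

theorem sumNum_eval_of_mem (T : Finset ℂ) (d : ℂ → ℂ) {c : ℂ} (hc : c ∈ T) :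
    (sumNum T d).eval c = d c * ∏ a ∈ T.erase c, (c - a) := by
  rw [sumNum, eval_finsetSum, Finset.sum_eq_single c]
  · simp [eval_prod]
  · intro b hb hbc
    rw [eval_mul, eval_prod, Finset.prod_eq_zero (i := c), mul_zero]
    · exact Finset.mem_erase.2 ⟨hbc.symm, hc⟩
    · simp
  · intro h; exact absurd hc h

theorem sumNum_eval_ne (T : Finset ℂ) (d : ℂ → ℂ) (hd : ∀ c ∈ T, d c ≠ 0) {c : ℂ} (hc : c ∈ T) :
    (sumNum T d).eval c ≠ 0 := by
  rw [sumNum_eval_of_mem T d hc]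
  refine mul_ne_zero (hd c hc) (Finset.prod_ne_zero_iff.2 fun a ha => ?_)
  rw [sub_ne_zero]; exact (Finset.mem_erase.1 ha).1.symm

theorem sumDen_ne (T : Finset ℂ) : sumDen T ≠ 0 :=
  Finset.prod_ne_zero_iff.2 fun c _ => X_sub_C_ne_zero c

/-- The residues are nonzero, so no factor cancels: the numerator over the common denominator is
coprime to it and agrees with `num` up to a unit. -/
theorem rootMultiplicity_num (T : Finset ℂ) (d : ℂ → ℂ) (hd : ∀ c ∈ T, d c ≠ 0) (z : ℂ) :
    (∑ c ∈ T, RatFunc.C (d c) / (RatFunc.X - RatFunc.C c)).num.rootMultiplicity z =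
      (sumNum T d).rootMultiplicity z := by
  set M := ∑ c ∈ T, RatFunc.C (d c) / (RatFunc.X - RatFunc.C c) with hM
  have hX : ∀ c : ℂ, (RatFunc.X - RatFunc.C c) = algebraMap ℂ[X] (RatFunc ℂ) (X - Polynomial.C c) := by
    intro c; rw [map_sub, RatFunc.algebraMap_X, RatFunc.algebraMap_C]
  have hne : ∀ p : ℂ[X], p ≠ 0 → algebraMap ℂ[X] (RatFunc ℂ) p ≠ 0 := fun p hp =>
    RatFunc.algebraMap_ne_zero hp
  have hMe : M = algebraMap ℂ[X] (RatFunc ℂ) (sumNum T d) /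
      algebraMap ℂ[X] (RatFunc ℂ) (sumDen T) := by
    rw [eq_div_iff (hne _ (sumDen_ne T)), hM, Finset.sum_mul, sumNum, map_sum]
    refine Finset.sum_congr rfl fun c hc => ?_
    rw [sumDen, ← Finset.mul_prod_erase T _ hc, map_mul, map_mul, hX, RatFunc.algebraMap_C]
    have := hne _ (X_sub_C_ne_zero c)
    field_simp
  have h1 : M.num * sumDen T = sumNum T d * M.denom := by
    rw [RatFunc.num_mul_eq_mul_denom_iff (sumDen_ne T)]; exact hMe
  have hco : IsCoprime (sumNum T d) (sumDen T) := by
    refine IsCoprime.prod_right fun c hc => IsCoprime.symm ?_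
    rw [(irreducible_X_sub_C c).coprime_iff_not_dvd, dvd_iff_isRoot]
    exact sumNum_eval_ne T d hd hc
  have h2 : sumNum T d ∣ M.num := hco.dvd_of_dvd_mul_right ⟨M.denom, h1⟩
  have h3 : M.num ∣ sumNum T d :=
    (RatFunc.isCoprime_num_denom M).dvd_of_dvd_mul_right ⟨sumDen T, h1.symm⟩
  by_cases h0 : sumNum T d = 0
  · rw [h0] at h2 ⊢; rw [zero_dvd_iff.1 h2]
  · have h0' : M.num ≠ 0 := fun h => h0 (by rw [h] at h3; exact zero_dvd_iff.1 h3)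
    exact le_antisymm (rootMultiplicity_le_rootMultiplicity_of_dvd h0 h3 z)
      (rootMultiplicity_le_rootMultiplicity_of_dvd h0' h2 z)

theorem rootMultiplicity_sumDen (T : Finset ℂ) (c : ℂ) :
    (sumDen T).rootMultiplicity c = if c ∈ T then 1 else 0 := by
  have : sumDen T = (T.val.map fun a => X - Polynomial.C a).prod := rfl
  rw [← count_roots, this, roots_multiset_prod_X_sub_C]
  split_ifs with h
  · exact Multiset.count_eq_one_of_mem T.nodup h
  · exact Multiset.count_eq_zero.2 h

variable {f g : PS}

/-- The numerator of the rational function of a bar. -/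
def barNum (f g : PS) (B : Bar) : ℂ[X] :=
  sumNum (ncPts f g B) fun c => ((delta f g B c : ℚ) : ℂ)

theorem meroMult_eq (h : GoodPS f g) (B : Bar) (z : ℂ) :
    meroMult f g B z = (barNum f g B).rootMultiplicity z := by
  rw [meroMult, mero, barNum, ← rootMultiplicity_num]
  · congr 2
    apply finsum_eq_sum_of_support_subset
    intro c hc
    rw [Finset.mem_coe, mem_ncPts h]
    intro h0
    apply hc
    simp [h0]
  · intro c hc
    exact_mod_cast (mem_ncPts h).1 hc

theorem barNum_ne (h : GoodPS f g) {B : Bar} (hB : NonColl f g B) : barNum f g B ≠ 0 := by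
  obtain ⟨c, -, hc⟩ := hB
  intro h0
  have := sumNum_eval_ne (ncPts f g B) (fun c => ((delta f g B c : ℚ) : ℂ))
    (fun c hc => by exact_mod_cast (mem_ncPts h).1 hc) ((mem_ncPts h).2 hc)
  rw [barNum] at h0
  rw [h0] at this
  simp at this

/-- The zeros of the rational function are not points with nonzero `delta`. -/
theorem meroMult_of_delta_ne (h : GoodPS f g) {B : Bar} {c : ℂ} (hc : delta f g B c ≠ 0) :
    meroMult f g B c = 0 := by
  rw [meroMult_eq h, rootMultiplicity_eq_zero_iff]
  intro h0
  exact absurd h0 (sumNum_eval_ne (ncPts f g B) (fun c => ((delta f g B c : ℚ) : ℂ))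
    (fun c hc => by exact_mod_cast (mem_ncPts h).1 hc) ((mem_ncPts h).2 hc))

theorem sum_inv_eq (h : GoodPS f g) (B : Bar) (T : Finset ℂ)
    (hT : ∀ ξ ∈ roots f, Climbs ξ B → ξ.coeff B.height ∈ T) (z : ℂ) :
    ((climbMS f B).map fun γ => (z - γ.coeff B.height)⁻¹).sum =
      ∑ c ∈ T, (mult f B c : ℂ) * (z - c)⁻¹ := by
  have h1 : ((climbMS f B).map fun γ => (z - γ.coeff B.height)⁻¹) =
      ((climbMS f B).map fun γ => γ.coeff B.height).map fun c => (z - c)⁻¹ := by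
    rw [Multiset.map_map]; rfl
  rw [h1, Finset.sum_multiset_map_count]
  rw [Finset.sum_subset (s₂ := T)]
  · refine Finset.sum_congr rfl fun c _ => ?_
    rw [nsmul_eq_mul, ← h.cnt_eq, ← rootMultiplicity_initPoly, ← count_roots, initPoly]
    congr 3
    rw [← roots_multiset_prod_X_sub_C (Multiset.map _ _), Multiset.map_map]
    rfl
  · intro c hc
    rw [Multiset.mem_toFinset, Multiset.mem_map] at hc
    obtain ⟨γ, hγ, rfl⟩ := hc
    rw [climbMS, Multiset.mem_filter, mem_rootMS h.ne_left] at hγ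
    exact hT γ hγ.1 hγ.2
  · intro c _ hc
    rw [Multiset.mem_toFinset] at hc
    rw [Multiset.count_eq_zero.2 hc, zero_smul]

/-- The expansion of the Jacobian along the arcs that climb over a bar. -/
theorem exists_lead_jac (h : GoodPS f g) {B : Bar} (hB : ProperBar B) :
    ∃ C : ℂ, C ≠ 0 ∧ ∀ᶠ z : ℂ in Filter.cofinite,
      Lead (yS * evalArc (jac f g) (testArc B z)) (nuS f B + nuS g B - B.height)
        (C * ((initPoly f B).eval z * (initPoly g B).eval z * (barNum f g B).eval z *
          ((sumDen (ncPts f g B)).eval z)⁻¹)) := by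
  obtain ⟨Cf, hCf, hf⟩ := exists_lead h.ne_left B
  obtain ⟨Cg, hCg, hg⟩ := exists_lead h.ne_right B
  refine ⟨Cf * Cg, mul_ne_zero hCf hCg, ?_⟩
  have hfin : ∀ᶠ z : ℂ in Filter.cofinite, z ∉ ncPts f g B := by
    rw [Filter.eventually_cofinite]
    simp
  filter_upwards [cofinite_not_climbs h.ne_left B, cofinite_not_climbs h.ne_right B, hfin]
    with z hzf hzg hzn
  have hp := testArc_posArc hB z
  have hc := testArc_climbsAt hB z
  have lf := hf _ z hp hc
  have lg := hg _ z hp hc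
  have hf0 := mul_ne_zero hCf (lead_ne h.ne_left hzf)
  have hg0 := mul_ne_zero hCg (lead_ne h.ne_right hzg)
  have dlf := lead_dx h.ne_left hB hp hc hzf lf hf0
  have dlg := lead_dx h.ne_right hB hp hc hzg lg hg0
  rw [evalArc_jac f g hp]
  have h1 := lf.eul.mul dlg
  have h2 := dlf.mul lg.eul
  rw [show nuS f B + (nuS g B + -B.height) = nuS f B + nuS g B - B.height by ring] at h1
  rw [show nuS f B + -B.height + nuS g B = nuS f B + nuS g B - B.height by ring] at h2
  -- Both products have the same order; in the difference of their leading coefficients `y d/dy`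
  -- contributes the factors `ν_f` and `ν_g`, and the logarithmic derivatives contribute the sums
  -- over points.
  convert h1.sub h2 using 1
  -- A common index set for the sums of `f`, of `g` and of `delta`; it may contain points at which
  -- no trunk grows, where all the terms vanish.
  set T : Finset ℂ := (allRoots_finite h).toFinset.image fun ξ => ξ.coeff B.height with hT
  have hTm : ∀ ξ ∈ allRoots f g, ξ.coeff B.height ∈ T := by
    intro ξ hξ
    exact Finset.mem_image.2 ⟨ξ, by simpa using hξ, rfl⟩
  rw [sum_inv_eq h B T (fun ξ hξ _ => hTm ξ (Or.inl hξ)) z,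
    sum_inv_eq h.symm B T (fun ξ hξ _ => hTm ξ (Or.inr hξ)) z]
  have hnT : ncPts f g B ⊆ T := by
    intro c hc
    obtain ⟨ξ, hξ, hcl⟩ := (finite_delta_support h B).2 c ((mem_ncPts h).1 hc)
    rw [← hcl.2]; exact hTm ξ hξ
  have hsum : (barNum f g B).eval z * ((sumDen (ncPts f g B)).eval z)⁻¹ =
      ∑ c ∈ T, ((delta f g B c : ℚ) : ℂ) * (z - c)⁻¹ := by
    rw [barNum, sumNum_eval_of_notMem _ _ hzn, ← Finset.sum_subset hnT]
    · have : (sumDen (ncPts f g B)).eval z ≠ 0 := by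
        rw [sumDen, eval_prod, Finset.prod_ne_zero_iff]
        intro c hc
        rw [eval_sub, eval_X, eval_C, sub_ne_zero]
        rintro rfl; exact hzn hc
      field_simp
    · intro c _ hc
      rw [mem_ncPts h, not_not] at hc
      rw [hc]; simp
  have hd : ∑ c ∈ T, ((delta f g B c : ℚ) : ℂ) * (z - c)⁻¹ =
      (nuS f B : ℂ) * ∑ c ∈ T, (mult g B c : ℂ) * (z - c)⁻¹ -
        (nuS g B : ℂ) * ∑ c ∈ T, (mult f B c : ℂ) * (z - c)⁻¹ := by
    rw [Finset.mul_sum, Finset.mul_sum, ← Finset.sum_sub_distrib]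
    refine Finset.sum_congr rfl fun c _ => ?_
    rw [delta, nu_eq_nuS h.ne_left hB, nu_eq_nuS h.ne_right hB]
    push_cast; ring
  rw [mul_assoc ((initPoly f B).eval z * (initPoly g B).eval z), hsum, hd]
  ring

theorem eval_ne_cofinite {p : ℂ[X]} (hp : p ≠ 0) :
    ∀ᶠ z : ℂ in Filter.cofinite, p.eval z ≠ 0 := by
  rw [Filter.eventually_cofinite]
  refine p.roots.toFinset.finite_toSet.subset fun z hz => ?_
  simp only [Set.mem_ofPred_eq, not_not] at hz
  simpa [hp] using hz

/-- The number of roots of the Jacobian over the points of a non-collinear bar. -/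
theorem count_jac (h : GoodPS f g) {B : Bar} (hB : ProperBar B) (hnc : NonColl f g B) :
    jac f g ≠ 0 ∧ ∀ c, cnt (jac f g) B c + (if delta f g B c ≠ 0 then 1 else 0) =
      mult f B c + mult g B c + meroMult f g B c := by
  obtain ⟨C, hC, hlead⟩ := exists_lead_jac h hB
  have hgen : ∀ᶠ z : ℂ in Filter.cofinite, C * ((initPoly f B).eval z * (initPoly g B).eval z *
      (barNum f g B).eval z * ((sumDen (ncPts f g B)).eval z)⁻¹) ≠ 0 := by
    filter_upwards [eval_ne_cofinite (initPoly_ne (F := f) B),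
      eval_ne_cofinite (initPoly_ne (F := g) B), eval_ne_cofinite (barNum_ne h hnc),
      eval_ne_cofinite (sumDen_ne (ncPts f g B))] with z h1 h2 h3 h4
    exact mul_ne_zero hC (mul_ne_zero (mul_ne_zero (mul_ne_zero h1 h2) h3) (inv_ne_zero h4))
  have hJ : jac f g ≠ 0 := by
    obtain ⟨z, hz1, hz2⟩ := (hlead.and hgen).exists
    intro h0
    apply hz1.ne_zero hz2
    rw [h0, evalArc_zero (testArc_posArc hB z), mul_zero]
  refine ⟨hJ, fun c => ?_⟩
  obtain ⟨CJ, hCJ, hleadJ⟩ := exists_lead hJ B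
  have hev : ∀ᶠ z : ℂ in Filter.cofinite, CJ * (initPoly (jac f g) B).eval z =
      C * ((initPoly f B).eval z * (initPoly g B).eval z *
      (barNum f g B).eval z * ((sumDen (ncPts f g B)).eval z)⁻¹) := by
    filter_upwards [hlead, hgen, eval_ne_cofinite (initPoly_ne (F := jac f g) B)] with z h1 h2 h3
    have h4 := lead_yS.mul (hleadJ _ z (testArc_posArc hB z) (testArc_climbsAt hB z))
    rw [one_mul] at h4
    exact (h4.unique h1 (mul_ne_zero hCJ h3) h2).2
  -- The two descriptions of the leading coefficient agree for almost all `z`, hence as polynomials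
  -- once the denominator is cleared; the count at `c` is the comparison of the multiplicities of
  -- `c` on both sides.
  have hpoly : Polynomial.C CJ * initPoly (jac f g) B * sumDen (ncPts f g B) =
      Polynomial.C C * (initPoly f B * initPoly g B * barNum f g B) := by
    apply Polynomial.eq_of_infinite_eval_eq
    have : ∀ᶠ z : ℂ in Filter.cofinite,
        (Polynomial.C CJ * initPoly (jac f g) B * sumDen (ncPts f g B)).eval z =
        (Polynomial.C C * (initPoly f B * initPoly g B * barNum f g B)).eval z := by
      filter_upwards [hev, eval_ne_cofinite (sumDen_ne (ncPts f g B))] with z h1 h2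
      simp only [eval_mul, eval_C]
      rw [h1]
      field_simp
    exact Set.infinite_of_finite_compl (Filter.eventually_cofinite.1 this)
  have e1 : (Polynomial.C CJ * initPoly (jac f g) B * sumDen (ncPts f g B)).rootMultiplicity c =
      cnt (jac f g) B c + (if delta f g B c ≠ 0 then 1 else 0) := by
    have h0 : Polynomial.C CJ ≠ 0 := C_ne_zero.2 hCJ
    rw [rootMultiplicity_mul (mul_ne_zero (mul_ne_zero h0 (initPoly_ne B)) (sumDen_ne _)),
      rootMultiplicity_mul (mul_ne_zero h0 (initPoly_ne B)), rootMultiplicity_C, zero_add,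
      rootMultiplicity_initPoly, rootMultiplicity_sumDen]
    simp only [mem_ncPts h]
  have e2 : (Polynomial.C C * (initPoly f B * initPoly g B * barNum f g B)).rootMultiplicity c =
      mult f B c + mult g B c + meroMult f g B c := by
    have h0 : Polynomial.C C ≠ 0 := C_ne_zero.2 hC
    have h1 := mul_ne_zero (initPoly_ne (F := f) B) (initPoly_ne (F := g) B)
    have h2 := barNum_ne h hnc
    rw [rootMultiplicity_mul (mul_ne_zero h0 (mul_ne_zero h1 h2)), rootMultiplicity_C, zero_add,
      rootMultiplicity_mul (mul_ne_zero h1 h2), rootMultiplicity_mul h1,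
      rootMultiplicity_initPoly, rootMultiplicity_initPoly, h.cnt_eq, h.symm.cnt_eq,
      meroMult_eq h]
  rw [← e1, hpoly, e2]

end

end PolarTree
end

noncomputable section

namespace PolarTree

open scoped ENNReal

/-! ### Weighted `ℓ¹` norms of power series -/

section

variable {σ τ : Type*}

/-- The value of the monomial with exponent `m` at `ρ`. -/
def wt (ρ : σ → ℝ≥0∞) (m : σ →₀ ℕ) : ℝ≥0∞ := m.prod fun i e => ρ i ^ e

theorem wt_zero (ρ : σ → ℝ≥0∞) : wt ρ 0 = 1 := Finsupp.prod_zero_index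

theorem wt_add (ρ : σ → ℝ≥0∞) (m n : σ →₀ ℕ) : wt ρ (m + n) = wt ρ m * wt ρ n := by
  classical
  exact Finsupp.prod_add_index' (fun _ => pow_zero _) fun _ _ _ => pow_add _ _ _

theorem wt_single (ρ : σ → ℝ≥0∞) (i : σ) (n : ℕ) : wt ρ (Finsupp.single i n) = ρ i ^ n :=
  Finsupp.prod_single_index (pow_zero _)

theorem wt_mono {ρ ρ' : σ → ℝ≥0∞} (h : ρ ≤ ρ') (m : σ →₀ ℕ) : wt ρ m ≤ wt ρ' m :=
  Finset.prod_le_prod' fun i _ => pow_le_pow_left' (h i) _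

theorem wt_smul_le {ρ : σ → ℝ≥0∞} {u : ℝ≥0∞} (hu : u ≤ 1) {m : σ →₀ ℕ} (hm : m ≠ 0) :
    wt (fun i => u * ρ i) m ≤ u * wt ρ m := by
  classical
  obtain ⟨i, hi⟩ := Finsupp.ne_iff.1 hm
  have hi' : m i ≠ 0 := hi
  have h : m = Finsupp.single i 1 + (m - Finsupp.single i 1) := by
    ext j
    by_cases hj : j = i
    · subst hj; simp; omega
    · simp [Ne.symm hj]
  rw [h, wt_add, wt_add, wt_single, wt_single, pow_one, pow_one, mul_assoc u]
  gcongr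
  apply wt_mono
  intro j
  exact mul_le_of_le_one_left (zero_le) hu

/-- The weighted `ℓ¹` norm of a power series. -/
def wnorm (ρ : σ → ℝ≥0∞) (F : MvPowerSeries σ ℂ) : ℝ≥0∞ :=
  ∑' m, ‖MvPowerSeries.coeff m F‖ₑ * wt ρ m

theorem wnorm_mono {ρ ρ' : σ → ℝ≥0∞} (h : ρ ≤ ρ') (F : MvPowerSeries σ ℂ) :
    wnorm ρ F ≤ wnorm ρ' F :=
  ENNReal.tsum_le_tsum fun m => mul_le_mul_right (wt_mono h m) _

/-- Each monomial other than the constant one contains at least one variable, hence at least one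
factor `u`. Thus shrinking the polydisc makes a series without constant term as small as desired. -/
theorem wnorm_smul_le {ρ : σ → ℝ≥0∞} {u : ℝ≥0∞} (hu : u ≤ 1) {F : MvPowerSeries σ ℂ}
    (hF : MvPowerSeries.constantCoeff F = 0) : wnorm (fun i => u * ρ i) F ≤ u * wnorm ρ F := by
  rw [wnorm, wnorm, ← ENNReal.tsum_mul_left]
  refine ENNReal.tsum_le_tsum fun m => ?_
  by_cases hm : m = 0
  · subst hm
    rw [MvPowerSeries.coeff_zero_eq_constantCoeff_apply, hF]; simp
  · calc _ ≤ ‖MvPowerSeries.coeff m F‖ₑ * (u * wt ρ m) := mul_le_mul_right (wt_smul_le hu hm) _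
      _ = _ := by ring

theorem wnorm_add_le (ρ : σ → ℝ≥0∞) (F G : MvPowerSeries σ ℂ) :
    wnorm ρ (F + G) ≤ wnorm ρ F + wnorm ρ G := by
  rw [wnorm, wnorm, wnorm, ← ENNReal.tsum_add]
  refine ENNReal.tsum_le_tsum fun m => ?_
  rw [← add_mul, map_add]
  exact mul_le_mul_left (enorm_add_le _ _) _

theorem wnorm_neg (ρ : σ → ℝ≥0∞) (F : MvPowerSeries σ ℂ) : wnorm ρ (-F) = wnorm ρ F := by
  simp only [wnorm, map_neg, enorm_neg]

theorem wnorm_monomial (ρ : σ → ℝ≥0∞) (d : σ →₀ ℕ) (c : ℂ) :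
    wnorm ρ (MvPowerSeries.monomial d c) = ‖c‖ₑ * wt ρ d := by
  classical
  rw [wnorm, tsum_eq_single d]
  · rw [MvPowerSeries.coeff_monomial_same]
  · intro m hm
    rw [MvPowerSeries.coeff_monomial_ne hm]; simp

theorem wnorm_one (ρ : σ → ℝ≥0∞) : wnorm ρ 1 = 1 := by
  have := wnorm_monomial ρ 0 1
  rw [wt_zero] at this
  simpa using this

theorem wnorm_mul_le (ρ : σ → ℝ≥0∞) (F G : MvPowerSeries σ ℂ) :
    wnorm ρ (F * G) ≤ wnorm ρ F * wnorm ρ G := by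
  classical
  have h1 : wnorm ρ F * wnorm ρ G = ∑' m, ∑ p ∈ Finset.HasAntidiagonal.antidiagonal m,
      (‖MvPowerSeries.coeff p.1 F‖ₑ * wt ρ p.1) * (‖MvPowerSeries.coeff p.2 G‖ₑ * wt ρ p.2) := by
    rw [wnorm, wnorm, ← ENNReal.tsum_mul_right]
    simp_rw [← ENNReal.tsum_mul_left]
    rw [← ENNReal.tsum_prod (f := fun a b => (‖MvPowerSeries.coeff a F‖ₑ * wt ρ a) *
      (‖MvPowerSeries.coeff b G‖ₑ * wt ρ b)), ← Finset.HasAntidiagonal.sigmaAntidiagonalEquivProd.tsum_eq,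
      ENNReal.tsum_sigma']
    refine tsum_congr fun m => ?_
    rw [tsum_fintype, Finset.univ_eq_attach]
    exact Finset.sum_attach _ fun p : (σ →₀ ℕ) × (σ →₀ ℕ) =>
      (‖MvPowerSeries.coeff p.1 F‖ₑ * wt ρ p.1) * (‖MvPowerSeries.coeff p.2 G‖ₑ * wt ρ p.2)
  rw [h1, wnorm]
  refine ENNReal.tsum_le_tsum fun m => ?_
  rw [MvPowerSeries.coeff_mul]
  calc _ ≤ (∑ p ∈ Finset.HasAntidiagonal.antidiagonal m,
        ‖MvPowerSeries.coeff p.1 F * MvPowerSeries.coeff p.2 G‖ₑ) * wt ρ m :=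
        mul_le_mul_left (enorm_sum_le _ _) _
    _ = _ := by
      rw [Finset.sum_mul]
      refine Finset.sum_congr rfl fun p hp => ?_
      rw [← Finset.HasAntidiagonal.mem_antidiagonal.1 hp, wt_add, enorm_mul]
      ring

theorem wnorm_pow_le (ρ : σ → ℝ≥0∞) (F : MvPowerSeries σ ℂ) (n : ℕ) :
    wnorm ρ (F ^ n) ≤ wnorm ρ F ^ n := by
  induction n with
  | zero => rw [pow_zero, pow_zero, wnorm_one]
  | succ n ih =>
    rw [pow_succ, pow_succ]
    exact (wnorm_mul_le _ _ _).trans (mul_le_mul_left ih _)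

theorem wnorm_prod_le {ι : Type*} (s : Finset ι) (ρ : σ → ℝ≥0∞) (F : ι → MvPowerSeries σ ℂ) :
    wnorm ρ (∏ i ∈ s, F i) ≤ ∏ i ∈ s, wnorm ρ (F i) := by
  classical
  induction s using Finset.induction_on with
  | empty => rw [Finset.prod_empty, Finset.prod_empty, wnorm_one]
  | insert i s hi ih =>
    rw [Finset.prod_insert hi, Finset.prod_insert hi]
    exact (wnorm_mul_le _ _ _).trans (mul_le_mul_right ih _)

/-- With values in `[0, ∞]` the sums may be interchanged freely; the rest is submultiplicativity of
the norm. -/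
theorem wnorm_subst_le (ρ : τ → ℝ≥0∞) {a : σ → MvPowerSeries τ ℂ} (ha : MvPowerSeries.HasSubst a)
    (F : MvPowerSeries σ ℂ) :
    wnorm ρ (MvPowerSeries.subst a F) ≤ wnorm (fun i => wnorm ρ (a i)) F := by
  have h1 : ∀ e : τ →₀ ℕ, ‖MvPowerSeries.coeff e (MvPowerSeries.subst a F)‖ₑ ≤
      ∑' d, ‖MvPowerSeries.coeff d F‖ₑ *
        ‖MvPowerSeries.coeff e (d.prod fun s n => a s ^ n)‖ₑ := by
    intro e
    rw [MvPowerSeries.coeff_subst ha,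
      finsum_eq_sum _ (MvPowerSeries.coeff_subst_finite ha F e)]
    refine (enorm_sum_le _ _).trans ?_
    simp only [smul_eq_mul, enorm_mul]
    exact ENNReal.sum_le_tsum _
  calc _ ≤ ∑' e, (∑' d, ‖MvPowerSeries.coeff d F‖ₑ *
        ‖MvPowerSeries.coeff e (d.prod fun s n => a s ^ n)‖ₑ) * wt ρ e :=
        ENNReal.tsum_le_tsum fun e => mul_le_mul_left (h1 e) _
    _ = ∑' d, ‖MvPowerSeries.coeff d F‖ₑ * wnorm ρ (d.prod fun s n => a s ^ n) := by
      simp_rw [← ENNReal.tsum_mul_right, wnorm, ← ENNReal.tsum_mul_left]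
      rw [ENNReal.tsum_comm]
      simp_rw [mul_assoc]
    _ ≤ _ := by
      refine ENNReal.tsum_le_tsum fun d => mul_le_mul_right ?_ _
      refine (wnorm_prod_le _ _ _).trans (Finset.prod_le_prod' fun i _ => wnorm_pow_le _ _ _)

/-! ### Closure properties of convergent series -/

/-- Convergence on some polydisc. -/
def Cvg (F : MvPowerSeries σ ℂ) : Prop := ∃ r : ℝ≥0∞, 0 < r ∧ wnorm (fun _ => r) F ≠ ⊤

theorem Cvg.of_le {F : MvPowerSeries σ ℂ} {r s : ℝ≥0∞} (h : wnorm (fun _ => r) F ≠ ⊤)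
    (hs : s ≤ r) : wnorm (fun _ => s) F ≠ ⊤ :=
  ne_top_of_le_ne_top h (wnorm_mono (fun _ => hs) F)

theorem Cvg.common {τ : Type*} {F : MvPowerSeries σ ℂ} {G : MvPowerSeries τ ℂ} (hF : Cvg F)
    (hG : Cvg G) : ∃ r : ℝ≥0∞, 0 < r ∧ wnorm (fun _ => r) F ≠ ⊤ ∧ wnorm (fun _ => r) G ≠ ⊤ := by
  obtain ⟨r, hr, h1⟩ := hF
  obtain ⟨s, hs, h2⟩ := hG
  exact ⟨min r s, lt_min hr hs, Cvg.of_le h1 (min_le_left _ _), Cvg.of_le h2 (min_le_right _ _)⟩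

theorem Cvg.add {F G : MvPowerSeries σ ℂ} (hF : Cvg F) (hG : Cvg G) : Cvg (F + G) := by
  obtain ⟨r, hr, h1, h2⟩ := hF.common hG
  exact ⟨r, hr, ne_top_of_le_ne_top (ENNReal.add_ne_top.2 ⟨h1, h2⟩) (wnorm_add_le _ _ _)⟩

theorem Cvg.mul {F G : MvPowerSeries σ ℂ} (hF : Cvg F) (hG : Cvg G) : Cvg (F * G) := by
  obtain ⟨r, hr, h1, h2⟩ := hF.common hG
  exact ⟨r, hr, ne_top_of_le_ne_top (ENNReal.mul_ne_top h1 h2) (wnorm_mul_le _ _ _)⟩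

theorem Cvg.neg {F : MvPowerSeries σ ℂ} (hF : Cvg F) : Cvg (-F) := by
  obtain ⟨r, hr, h1⟩ := hF
  exact ⟨r, hr, by rwa [wnorm_neg]⟩

theorem Cvg.sub {F G : MvPowerSeries σ ℂ} (hF : Cvg F) (hG : Cvg G) : Cvg (F - G) := by
  rw [sub_eq_add_neg]; exact hF.add hG.neg

theorem Cvg.monomial (d : σ →₀ ℕ) (c : ℂ) : Cvg (MvPowerSeries.monomial d c) := by
  refine ⟨1, one_pos, ?_⟩
  rw [wnorm_monomial]
  simp [wt, Finsupp.prod]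

theorem Cvg.C (c : ℂ) : Cvg (MvPowerSeries.C c : MvPowerSeries σ ℂ) := Cvg.monomial 0 c
theorem Cvg.X (i : σ) : Cvg (MvPowerSeries.X i : MvPowerSeries σ ℂ) := Cvg.monomial _ 1

theorem Cvg.pow {F : MvPowerSeries σ ℂ} (hF : Cvg F) (n : ℕ) : Cvg (F ^ n) := by
  induction n with
  | zero => rw [pow_zero]; exact Cvg.C 1
  | succ n ih => rw [pow_succ]; exact ih.mul hF

theorem exists_small_mul {A r : ℝ≥0∞} (hA : A ≠ ⊤) (hr : 0 < r) :
    ∃ u : ℝ≥0∞, 0 < u ∧ u ≤ 1 ∧ u * A ≤ r := by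
  refine ⟨min 1 (r / (A + 1)), lt_min one_pos ?_, min_le_left _ _, ?_⟩
  · exact ENNReal.div_pos hr.ne' (by simp [hA])
  · calc _ ≤ r / (A + 1) * (A + 1) := by
          gcongr
          · exact min_le_right _ _
          · exact le_self_add
      _ ≤ r := by rw [mul_comm]; exact ENNReal.mul_div_le

/-- Substitution preserves convergence. -/
theorem Cvg.subst_pair {a b : MvPowerSeries τ ℂ} {F : PS} (hF : Cvg F) (ha : Cvg a) (hb : Cvg b)
    (ha0 : MvPowerSeries.constantCoeff a = 0) (hb0 : MvPowerSeries.constantCoeff b = 0) :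
    Cvg (MvPowerSeries.subst ![a, b] F) := by
  obtain ⟨r, hr, h1⟩ := hF
  obtain ⟨s, hs, h2, h3⟩ := ha.common hb
  obtain ⟨u, hu0, hu1, hu⟩ := exists_small_mul (ENNReal.add_ne_top.2 ⟨h2, h3⟩) hr
  refine ⟨u * s, ENNReal.mul_pos hu0.ne' hs.ne', ne_top_of_le_ne_top h1 ?_⟩
  refine (wnorm_subst_le _ (hasSubst_of_zero ha0 hb0) F).trans (wnorm_mono ?_ F)
  intro i
  fin_cases i
  · exact (wnorm_smul_le (ρ := fun _ => s) hu1 ha0).trans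
      ((mul_le_mul_right le_self_add _).trans hu)
  · exact (wnorm_smul_le (ρ := fun _ => s) hu1 hb0).trans
      ((mul_le_mul_right le_add_self _).trans hu)

theorem isConv_iff (F : PS) : IsConv F ↔ Cvg F := by
  have key : ∀ r : NNReal, (Summable fun m : Fin 2 →₀ ℕ =>
      ‖MvPowerSeries.coeff m F‖ * (r : ℝ) ^ (m 0 + m 1)) ↔
      wnorm (fun _ => (r : ℝ≥0∞)) F ≠ ⊤ := by
    intro r
    have h1 : wnorm (fun _ => (r : ℝ≥0∞)) F = ∑' m : Fin 2 →₀ ℕ,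
        ((‖MvPowerSeries.coeff m F‖₊ * r ^ (m 0 + m 1) : NNReal) : ℝ≥0∞) := by
      refine tsum_congr fun m => ?_
      rw [wt, Finsupp.prod_fintype _ _ (by simp), Fin.prod_univ_two, ← pow_add]
      push_cast; rfl
    rw [h1, ENNReal.tsum_coe_ne_top_iff_summable, ← NNReal.summable_coe]
    simp
  constructor
  · rintro ⟨r, hr, h⟩
    lift r to NNReal using hr.le
    exact ⟨r, by exact_mod_cast hr, (key r).1 h⟩
  · rintro ⟨r, hr, h⟩
    -- `r` may be infinite; a finite radius is needed for the comparison with the real definition.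
    have hs : min r 1 ≠ ⊤ := ne_top_of_le_ne_top ENNReal.one_ne_top (min_le_right _ _)
    have h' := Cvg.of_le h (min_le_left r 1)
    have h0 : 0 < min r 1 := lt_min hr one_pos
    lift min r 1 to NNReal using hs with s hs
    exact ⟨s, by exact_mod_cast h0, (key s).2 h'⟩

/-- Divisibility by a variable. -/
theorem Cvg.of_X_mul {i : σ} {F : MvPowerSeries σ ℂ} (h : Cvg (MvPowerSeries.X i * F)) :
    Cvg F := by
  classical
  obtain ⟨r, hr, h⟩ := h
  have h' := Cvg.of_le h (min_le_left r 1)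
  have h0 : min r 1 ≠ 0 := (lt_min hr one_pos).ne'
  refine ⟨min r 1, lt_min hr one_pos, fun hc => h' ?_⟩
  rw [eq_top_iff, ← ENNReal.mul_top h0, ← hc, wnorm, wnorm, ← ENNReal.tsum_mul_left]
  have hinj : Function.Injective fun m : σ →₀ ℕ => Finsupp.single i 1 + m :=
    fun a b hab => add_left_cancel hab
  refine le_trans (le_of_eq ?_) (ENNReal.tsum_comp_le_tsum_of_injective hinj _)
  refine tsum_congr fun m => ?_
  rw [wt_add, wt_single, pow_one, MvPowerSeries.X, MvPowerSeries.coeff_add_monomial_mul, one_mul]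
  ring

theorem Cvg.of_X_pow_mul {i : σ} {F : MvPowerSeries σ ℂ} {n : ℕ}
    (h : Cvg (MvPowerSeries.X i ^ n * F)) : Cvg F := by
  induction n with
  | zero => simpa using h
  | succ n ih => rw [pow_succ', mul_assoc] at h; exact ih h.of_X_mul

end

end PolarTree
end

noncomputable section

namespace PolarTree

open scoped ENNReal

/-! ### Substitution of pairs of series -/

section

variable {τ : Type*}

/-- Substitution of `a` for `x` and of `b` for `y`. -/
def sb (a b : MvPowerSeries τ ℂ) (ha : MvPowerSeries.constantCoeff a = 0)
    (hb : MvPowerSeries.constantCoeff b = 0) : PS →ₐ[ℂ] MvPowerSeries τ ℂ :=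
  MvPowerSeries.substAlgHom (hasSubst_of_zero ha hb)

variable {a b : MvPowerSeries τ ℂ} (ha : MvPowerSeries.constantCoeff a = 0)
  (hb : MvPowerSeries.constantCoeff b = 0)

theorem sb_apply (F : PS) : sb a b ha hb F = MvPowerSeries.subst ![a, b] F :=
  MvPowerSeries.substAlgHom_apply _ F

theorem sb_X0 : sb a b ha hb (MvPowerSeries.X 0) = a := MvPowerSeries.substAlgHom_X _ 0
theorem sb_X1 : sb a b ha hb (MvPowerSeries.X 1) = b := MvPowerSeries.substAlgHom_X _ 1

theorem cc_sb (F : PS) : MvPowerSeries.constantCoeff (sb a b ha hb F) =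
    MvPowerSeries.constantCoeff F := by
  have h1 : F = MvPowerSeries.C (MvPowerSeries.constantCoeff F) +
      (F - MvPowerSeries.C (MvPowerSeries.constantCoeff F)) := by ring
  rw [h1, map_add, map_add, map_add, sb_apply ha hb (F - _)]
  rw [MvPowerSeries.constantCoeff_subst_eq_zero (hasSubst_of_zero ha hb)]
  · have : sb a b ha hb (MvPowerSeries.C (MvPowerSeries.constantCoeff F)) =
        MvPowerSeries.C (MvPowerSeries.constantCoeff F) := (sb a b ha hb).commutes _
    rw [this]
    simp
  · intro i; fin_cases i
    · exact ha
    · exact hb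
  · simp

theorem Cvg.sb {F : PS} (hF : Cvg F) (hca : Cvg a) (hcb : Cvg b) : Cvg (sb a b ha hb F) := by
  rw [sb_apply]; exact hF.subst_pair hca hcb ha hb

theorem sb_sb {a' b' : PS} (ha' : MvPowerSeries.constantCoeff a' = 0)
    (hb' : MvPowerSeries.constantCoeff b' = 0) (F : PS) :
    sb a b ha hb (sb a' b' ha' hb' F) = sb (sb a b ha hb a') (sb a b ha hb b')
      (by rw [cc_sb, ha']) (by rw [cc_sb, hb']) F := by
  simp only [sb_apply]
  rw [MvPowerSeries.subst_comp_subst_apply (hasSubst_of_zero ha' hb') (hasSubst_of_zero ha hb)]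
  congr 1
  funext i; fin_cases i <;> rfl

theorem sb_self (F : PS) (h0) (h1) :
    sb (MvPowerSeries.X 0 : PS) (MvPowerSeries.X 1) h0 h1 F = F := by
  rw [sb_apply]
  have : ![(MvPowerSeries.X 0 : PS), MvPowerSeries.X 1] = MvPowerSeries.X := by
    funext i; fin_cases i <;> rfl
  rw [this, MvPowerSeries.subst_self, id]

theorem sb_congr {a' b' : MvPowerSeries τ ℂ} (h1 : a = a') (h2 : b = b') (F : PS) :
    sb a b ha hb F = sb a' b' (h1 ▸ ha) (h2 ▸ hb) F := by subst h1 h2; rfl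

end

theorem cc_X (i : Fin 2) : MvPowerSeries.constantCoeff (MvPowerSeries.X i : PS) = 0 :=
  MvPowerSeries.constantCoeff_X i

theorem hasSubst_Y : MvPowerSeries.HasSubst fun _ : Unit => (MvPowerSeries.X 1 : PS) :=
  MvPowerSeries.hasSubst_of_constantCoeff_zero fun _ => cc_X 1

/-- A power series in `y` as a power series in `x` and `y`. -/
def liftY : PowerSeries ℂ →ₐ[ℂ] PS := MvPowerSeries.substAlgHom hasSubst_Y

theorem liftY_apply (a : PowerSeries ℂ) :
    liftY a = MvPowerSeries.subst (fun _ : Unit => (MvPowerSeries.X 1 : PS)) a :=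
  MvPowerSeries.substAlgHom_apply _ _

theorem coeff_liftY (a : PowerSeries ℂ) (i j : ℕ) :
    MvPowerSeries.coeff (expo i j) (liftY a) = if i = 0 then PowerSeries.coeff j a else 0 := by
  classical
  rw [liftY_apply, MvPowerSeries.coeff_subst hasSubst_Y, finsum_eq_single _ (Finsupp.single () j)]
  · rw [Finsupp.prod_single_index (h := fun (_ : Unit) e => (MvPowerSeries.X 1 : PS) ^ e)
      (pow_zero _), MvPowerSeries.coeff_X_pow, smul_eq_mul,
      show (Finsupp.single 1 j : Fin 2 →₀ ℕ) = expo 0 j by simp [expo]]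
    simp only [expo_inj]
    split_ifs with h1 h2 h2
    · rw [mul_one]; rfl
    · exact absurd h1.1 h2
    · exact absurd ⟨h2, trivial⟩ h1
    · rw [mul_zero]
  · intro d hd
    obtain ⟨n, rfl⟩ : ∃ n, d = Finsupp.single () n := ⟨d (), by ext; simp⟩
    rw [Finsupp.prod_single_index (h := fun (_ : Unit) e => (MvPowerSeries.X 1 : PS) ^ e)
      (pow_zero _), MvPowerSeries.coeff_X_pow, smul_eq_mul,
      show (Finsupp.single 1 n : Fin 2 →₀ ℕ) = expo 0 n by simp [expo], if_neg, mul_zero]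
    rw [expo_inj]
    rintro ⟨-, rfl⟩
    exact hd rfl

theorem cc_liftY (a : PowerSeries ℂ) : MvPowerSeries.constantCoeff (liftY a) =
    PowerSeries.constantCoeff a := by
  have := coeff_liftY a 0 0
  simpa [expo] using this

theorem liftY_X : liftY PowerSeries.X = MvPowerSeries.X 1 :=
  MvPowerSeries.substAlgHom_X hasSubst_Y ()

theorem Cvg.liftY {a : PowerSeries ℂ} (ha : Cvg a) : Cvg (liftY a) := by
  obtain ⟨r, hr, h⟩ := ha
  refine ⟨r, hr, ne_top_of_le_ne_top h ?_⟩
  rw [liftY_apply]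
  refine (wnorm_subst_le _ hasSubst_Y a).trans (wnorm_mono (fun _ => ?_) a)
  rw [MvPowerSeries.X, wnorm_monomial, wt_single]
  simp

theorem dx_liftY (a : PowerSeries ℂ) : dx (liftY a) = 0 := by
  apply PS.ext
  intro i j
  rw [coeff_dx, coeff_liftY, if_neg (by omega), zero_mul, map_zero]

theorem sb_liftY {a : PowerSeries ℂ} (ha : MvPowerSeries.constantCoeff a = 0) (hX)
    (c : PowerSeries ℂ) : sb a (PowerSeries.X : PowerSeries ℂ) ha hX (liftY c) = c := by
  rw [sb_apply, liftY_apply,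
    MvPowerSeries.subst_comp_subst_apply hasSubst_Y (hasSubst_of_zero ha hX)]
  have : (fun _ : Unit => MvPowerSeries.subst ![a, (PowerSeries.X : PowerSeries ℂ)]
      (MvPowerSeries.X 1 : PS)) = MvPowerSeries.X := by
    funext s
    rw [MvPowerSeries.subst_X (hasSubst_of_zero ha hX)]; rfl
  rw [this, MvPowerSeries.subst_self, id]

theorem sb_liftY' {a : PS} (ha : MvPowerSeries.constantCoeff a = 0)
    (c : PowerSeries ℂ) : sb a (MvPowerSeries.X 1) ha (cc_X 1) (liftY c) = liftY c := by
  rw [sb_apply, liftY_apply,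
    MvPowerSeries.subst_comp_subst_apply hasSubst_Y (hasSubst_of_zero ha (cc_X 1))]
  congr 1
  funext s
  rw [MvPowerSeries.subst_X (hasSubst_of_zero ha (cc_X 1))]; rfl

theorem cc_T : MvPowerSeries.constantCoeff (PowerSeries.X : PowerSeries ℂ) = 0 :=
  PowerSeries.constantCoeff_X

theorem Cvg.T : Cvg (PowerSeries.X : PowerSeries ℂ) := Cvg.X ()

/-- `F(a(t), t)`. -/
def evT (a : PowerSeries ℂ) (ha : PowerSeries.constantCoeff a = 0) : PS →ₐ[ℂ] PowerSeries ℂ :=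
  sb a PowerSeries.X ha cc_T

theorem evT_apply {a : PowerSeries ℂ} (ha : PowerSeries.constantCoeff a = 0) (F : PS) :
    evT a ha F = MvPowerSeries.subst ![a, PowerSeries.X] F := sb_apply _ _ F

theorem evT_X0 {a : PowerSeries ℂ} (ha : PowerSeries.constantCoeff a = 0) :
    evT a ha (MvPowerSeries.X 0) = a := sb_X0 _ _
theorem evT_liftY {a : PowerSeries ℂ} (ha : PowerSeries.constantCoeff a = 0) (c : PowerSeries ℂ) :
    evT a ha (liftY c) = c := sb_liftY _ _ _

theorem Cvg.evT {F : PS} (hF : Cvg F) {a : PowerSeries ℂ} (ha : PowerSeries.constantCoeff a = 0)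
    (hc : Cvg a) : Cvg (evT a ha F) := hF.sb _ _ hc Cvg.T

/-- Splitting off the part of degree `0` in `x`. -/
theorem exists_split_X0 (F : PS) : ∃ b G, F = liftY b + MvPowerSeries.X 0 * G := by
  classical
  refine ⟨PowerSeries.mk fun j => MvPowerSeries.coeff (expo 0 j) F,
    rows.symm (PowerSeries.mk fun i => PowerSeries.coeff (i + 1) (rows F)), ?_⟩
  apply PS.ext
  intro i j
  rw [map_add, coeff_liftY, MvPowerSeries.X]
  rcases i with _ | i
  · rw [if_pos rfl, MvPowerSeries.coeff_monomial_mul, if_neg]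
    · simp
    · intro h
      have := h 0
      simp [expo] at this
  · rw [if_neg (by omega), show expo (i + 1) j = Finsupp.single 0 1 + expo i j from ?_,
      MvPowerSeries.coeff_add_monomial_mul, coeff_rows_symm, PowerSeries.coeff_mk, coeff_rows,
      one_mul, zero_add]
    · congr 1
      rw [expo, expo, Finsupp.single_add]; abel_nf
    · rw [expo, expo, Finsupp.single_add]; abel

theorem Cvg.split_X0 {F G : PS} {b : PowerSeries ℂ} (h : F = PolarTree.liftY b + MvPowerSeries.X 0 * G)
    (hF : Cvg F) : Cvg b ∧ Cvg G := by
  have hb : PolarTree.evT 0 (map_zero _) F = b := by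
    rw [h, map_add, map_mul, evT_X0, evT_liftY, zero_mul, add_zero]
  have hcb : Cvg b := by
    rw [← hb]
    refine hF.evT _ ?_
    exact Cvg.monomial (σ := Unit) 0 0 |> fun h => by simpa using h
  refine ⟨hcb, Cvg.of_X_mul (i := 0) ?_⟩
  rw [show MvPowerSeries.X 0 * G = F - PolarTree.liftY b by rw [h]; ring]
  exact hF.sub hcb.liftY

/-- Division by `x - γ(y)`. -/
theorem exists_division (F : PS) {γ : PowerSeries ℂ} (hγ : PowerSeries.constantCoeff γ = 0) :
    ∃ G, F = (MvPowerSeries.X 0 - liftY γ) * G + liftY (evT γ hγ F) ∧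
      (Cvg F → Cvg γ → Cvg G) := by
  have h1 : MvPowerSeries.constantCoeff (MvPowerSeries.X 0 + liftY γ) = 0 := by
    rw [map_add, cc_X, cc_liftY, hγ, add_zero]
  have h2 : MvPowerSeries.constantCoeff (MvPowerSeries.X 0 - liftY γ) = 0 := by
    rw [map_sub, cc_X, cc_liftY, hγ, sub_zero]
  -- The translation `x ↦ x + γ(y)` turns the divisor into `x`; the quotient is translated back.
  obtain ⟨b, G1, hG1⟩ := exists_split_X0 (sb _ _ h1 (cc_X 1) F)
  have hF : F = (MvPowerSeries.X 0 - liftY γ) * sb _ _ h2 (cc_X 1) G1 + liftY b := by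
    have h3 : sb _ _ h2 (cc_X 1) (sb _ _ h1 (cc_X 1) F) = F := by
      rw [sb_sb, sb_congr (a' := MvPowerSeries.X 0) (b' := MvPowerSeries.X 1), sb_self]
      · rw [map_add, sb_X0, sb_liftY']; ring
      · rw [sb_X1]
    rw [hG1, map_add, map_mul, sb_X0, sb_liftY'] at h3
    rw [← h3]; ring
  have hb : evT γ hγ F = b := by
    rw [hF, map_add, map_mul, map_sub, evT_X0, evT_liftY, evT_liftY]; ring
  refine ⟨_, by rw [hb]; exact hF, fun hcF hcγ => ?_⟩
  have hc1 : Cvg (sb _ _ h1 (cc_X 1) F) := hcF.sb _ _ ((Cvg.X 0).add hcγ.liftY) (Cvg.X 1)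
  exact (hc1.split_X0 hG1).2.sb _ _ ((Cvg.X 0).sub hcγ.liftY) (Cvg.X 1)

/-! ### The implicit function theorem -/

theorem wnorm_le_of_trunc {ρ : Unit → ℝ≥0∞} {w : PowerSeries ℂ} {s : ℝ≥0∞}
    (h : ∀ n, wnorm ρ ((w.trunc n : Polynomial ℂ) : PowerSeries ℂ) ≤ s) : wnorm ρ w ≤ s := by
  rw [wnorm, ENNReal.tsum_eq_iSup_sum]
  refine iSup_le fun S => ?_
  obtain ⟨n, hn⟩ : ∃ n, ∀ m ∈ S, m () < n :=
    ⟨S.sup (fun m => m ()) + 1, fun m hm => Nat.lt_succ_of_le (Finset.le_sup (f := fun m => m ()) hm)⟩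
  refine le_trans (le_of_eq ?_) ((ENNReal.sum_le_tsum S).trans (h n))
  refine Finset.sum_congr rfl fun m hm => ?_
  have hm' : m = Finsupp.single () (m ()) := by ext; simp
  have e1 : MvPowerSeries.coeff m ((w.trunc n : Polynomial ℂ) : PowerSeries ℂ) =
      MvPowerSeries.coeff m w := by
    have := PowerSeries.coeff_trunc (m ()) n w
    rw [if_pos (hn m hm), ← Polynomial.coeff_coe, PowerSeries.coeff_def (s := m) rfl] at this
    exact this
  rw [e1]

theorem wnorm_trunc_le {ρ : Unit → ℝ≥0∞} {v w : PowerSeries ℂ} {n : ℕ}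
    (h : ∀ m < n, PowerSeries.coeff m w = PowerSeries.coeff m v) :
    wnorm ρ ((w.trunc n : Polynomial ℂ) : PowerSeries ℂ) ≤ wnorm ρ v := by
  refine ENNReal.tsum_le_tsum fun m => ?_
  have hm' : m = Finsupp.single () (m ()) := by ext; simp
  have e1 : MvPowerSeries.coeff m ((w.trunc n : Polynomial ℂ) : PowerSeries ℂ) =
      if m () < n then MvPowerSeries.coeff m v else 0 := by
    have := PowerSeries.coeff_trunc (m ()) n w
    rw [← Polynomial.coeff_coe] at this
    have h2 : (if m () < n then PowerSeries.coeff (m ()) w else 0) =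
        if m () < n then PowerSeries.coeff (m ()) v else 0 := by
      split_ifs with hh
      · exact h _ hh
      · rfl
    rw [h2, PowerSeries.coeff_def (s := m) rfl] at this
    exact this
  rw [e1]
  split_ifs
  · exact le_rfl
  · simp

theorem X_pow_dvd_pow_sub {w v : PowerSeries ℂ} (hw : PowerSeries.X ∣ w) (hv : PowerSeries.X ∣ v)
    {n : ℕ} (h : PowerSeries.X ^ n ∣ w - v) (i : ℕ) :
    PowerSeries.X ^ (n + i) ∣ w ^ (i + 1) - v ^ (i + 1) := by
  induction i with
  | zero => simpa using h
  | succ i ih =>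
    have : w ^ (i + 1 + 1) - v ^ (i + 1 + 1) =
        (w - v) * w ^ (i + 1) + (w ^ (i + 1) - v ^ (i + 1)) * v := by ring
    rw [this]
    refine dvd_add ?_ ?_
    · rw [pow_add]; exact mul_dvd_mul h (pow_dvd_pow_of_dvd hw _)
    · rw [← add_assoc, pow_succ]; exact mul_dvd_mul ih hv

/-- Without the monomial `x`, every monomial that involves `x` has a further factor `x` or `y`, so
`w ↦ K(w(t), t)` gains one order of agreement. This is the contraction property behind the implicit
function theorem. -/
theorem coeff_evT_congr {K : PS}
    (h10 : MvPowerSeries.coeff (expo 1 0) K = 0) {w v : PowerSeries ℂ}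
    (hw : PowerSeries.constantCoeff w = 0) (hv : PowerSeries.constantCoeff v = 0) {n : ℕ}
    (h : PowerSeries.X ^ n ∣ w - v) {m : ℕ} (hm : m < n + 1) :
    PowerSeries.coeff m (evT w hw K) = PowerSeries.coeff m (evT v hv K) := by
  rw [evT_apply, evT_apply, PowerSeries.coeff_def (s := Finsupp.single () m) (by simp),
    coeff_subst_pair (hasSubst_of_zero hw cc_T),
    coeff_subst_pair (hasSubst_of_zero hv cc_T)]
  refine finsum_congr fun ⟨i, j⟩ => ?_
  dsimp only
  by_cases hk : MvPowerSeries.coeff (expo i j) K = 0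
  · rw [hk, zero_mul, zero_mul]
  congr 1
  rw [← sub_eq_zero]
  have hd : (PowerSeries.X : PowerSeries ℂ) ^ (n + 1) ∣
      w ^ i * PowerSeries.X ^ j - v ^ i * PowerSeries.X ^ j := by
    rw [← sub_mul]
    rcases i with _ | i
    · simp
    · have h1 := X_pow_dvd_pow_sub (PowerSeries.X_dvd_iff.2 hw) (PowerSeries.X_dvd_iff.2 hv) h i
      have h2 := mul_dvd_mul h1 (dvd_refl (PowerSeries.X ^ j : PowerSeries ℂ))
      rw [← pow_add] at h2
      refine (pow_dvd_pow _ ?_).trans h2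
      rcases i with _ | i
      · rcases j with _ | j
        · exact absurd h10 hk
        · omega
      · omega
  have := PowerSeries.X_pow_dvd_iff.1 hd m hm
  rw [map_sub] at this
  exact this

/-- The implicit function theorem for convergent series. -/
theorem Cvg.implicit {H : PS} (hH : Cvg H) (h00 : MvPowerSeries.coeff (expo 0 0) H = 0)
    (h10 : MvPowerSeries.coeff (expo 1 0) H ≠ 0) {w : PowerSeries ℂ}
    (hw : PowerSeries.constantCoeff w = 0) (h : PolarTree.evT w hw H = 0) : Cvg w := by
  classical
  set c := MvPowerSeries.coeff (expo 1 0) H with hc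
  -- The equation `H(w, t) = 0` becomes the fixed point equation `w = K(w, t)`, where `K` has
  -- neither a constant term nor the monomial `x`.
  set K : PS := MvPowerSeries.X 0 - MvPowerSeries.C c⁻¹ * H with hKdef
  have hX0 : ∀ i j, MvPowerSeries.coeff (expo i j) (MvPowerSeries.X 0 : PS) =
      if i = 1 ∧ j = 0 then 1 else 0 := by
    intro i j
    rw [MvPowerSeries.coeff_X,
      show (Finsupp.single 0 1 : Fin 2 →₀ ℕ) = expo 1 0 by simp [expo]]
    simp only [expo_inj]
  have hK00 : MvPowerSeries.coeff (expo 0 0) K = 0 := by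
    rw [hKdef, map_sub, hX0, MvPowerSeries.coeff_C_mul, h00]; simp
  have hK10 : MvPowerSeries.coeff (expo 1 0) K = 0 := by
    rw [hKdef, map_sub, hX0, MvPowerSeries.coeff_C_mul, ← hc, inv_mul_cancel₀ h10]; simp
  have hKw : PolarTree.evT w hw K = w := by
    rw [hKdef, map_sub, map_mul, evT_X0, h]; simp
  have hKc : Cvg K := (Cvg.X 0).sub ((Cvg.C _).mul hH)
  obtain ⟨r', hr', hM'⟩ := hKc
  obtain ⟨r, hr0, hr1, hM⟩ : ∃ r : ℝ≥0∞, 0 < r ∧ r ≤ 1 ∧ wnorm (fun _ => r) K ≠ ⊤ :=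
    ⟨min r' 1, lt_min hr' one_pos, min_le_right _ _, Cvg.of_le hM' (min_le_left _ _)⟩
  have hrt : r ≠ ⊤ := ne_top_of_le_ne_top ENNReal.one_ne_top hr1
  set M := wnorm (fun _ => r) K
  -- The radii `u r` for `x` and `v r` for `y` are chosen so that `K` has norm at most `u r`: the
  -- part of degree at least two in `x` and the part divisible by `y` each account for half of it.
  obtain ⟨u, hu0, hu1, hu⟩ := exists_small_mul hM (ENNReal.half_pos hr0.ne')
  obtain ⟨v, hv0, hv1, hv⟩ := exists_small_mul hM (ENNReal.half_pos (ENNReal.mul_pos hr0.ne' hu0.ne').ne')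
  have hbound : wnorm ![u * r, v * r] K ≤ u * r := by
    have h1 : wnorm ![u * r, v * r] K ≤ (u * u + v) * M := by
      rw [show M = wnorm (fun _ => r) K from rfl, wnorm, wnorm, ← ENNReal.tsum_mul_left]
      refine ENNReal.tsum_le_tsum fun m => ?_
      rw [eq_expo m]
      set i := m 0
      set j := m 1
      by_cases hk : MvPowerSeries.coeff (expo i j) K = 0
      · rw [hk]; simp
      have hwt : ∀ ρ : Fin 2 → ℝ≥0∞, wt ρ (expo i j) = ρ 0 ^ i * ρ 1 ^ j := by
        intro ρ; rw [expo, wt_add, wt_single, wt_single]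
      rw [hwt, hwt]
      simp only [Matrix.cons_val_zero, Matrix.cons_val_one]
      have h2 : u ^ i * v ^ j ≤ u * u + v := by
        by_cases hi : 2 ≤ i
        · calc u ^ i * v ^ j ≤ u ^ 2 * 1 :=
                mul_le_mul' (pow_le_pow_right_of_le_one' hu1 hi) (pow_le_one' hv1 _)
            _ ≤ _ := by rw [mul_one, sq]; exact le_self_add
        · have hj : 1 ≤ j := by
            by_contra hj
            have hj0 : j = 0 := by omega
            rw [hj0] at hk
            interval_cases i
            · exact hk hK00
            · exact hk hK10
          calc u ^ i * v ^ j ≤ 1 * v ^ 1 :=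
                mul_le_mul' (pow_le_one' hu1 _) (pow_le_pow_right_of_le_one' hv1 hj)
            _ ≤ _ := by rw [one_mul, pow_one]; exact le_add_self
      calc _ = (u ^ i * v ^ j) * (‖MvPowerSeries.coeff (expo i j) K‖ₑ * (r ^ i * r ^ j)) := by
            rw [mul_pow, mul_pow]; ring
        _ ≤ _ := mul_le_mul_left h2 _
    refine h1.trans ?_
    have h3 : u * u * M ≤ u * (r / 2) := by rw [mul_assoc]; exact mul_le_mul_right hu _
    calc (u * u + v) * M = u * u * M + v * M := add_mul _ _ _
      _ ≤ u * (r / 2) + r * u / 2 := add_le_add h3 hv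
      _ = u * r / 2 + u * r / 2 := by
        rw [mul_comm r u, mul_div_assoc]
      _ = u * r := ENNReal.add_halves _
  have hcct : ∀ n, PowerSeries.constantCoeff ((w.trunc n : Polynomial ℂ) : PowerSeries ℂ) = 0 := by
    intro n
    rw [← PowerSeries.coeff_zero_eq_constantCoeff_apply, Polynomial.coeff_coe,
      PowerSeries.coeff_trunc]
    split_ifs
    · simpa using hw
    · rfl
  -- The truncation of `w = K(w, t)` to `n + 1` terms depends only on its truncation to `n` terms,
  -- so the bound propagates from one truncation to the next.
  have hind : ∀ n, wnorm (fun _ => v * r) ((w.trunc n : Polynomial ℂ) : PowerSeries ℂ) ≤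
      u * r := by
    intro n
    induction n with
    | zero =>
      have : wnorm (fun _ : Unit => v * r) ((w.trunc 0 : Polynomial ℂ) : PowerSeries ℂ) = 0 := by
        simp [wnorm]
      rw [this]; exact zero_le
    | succ n ih =>
      have hdvd : (PowerSeries.X : PowerSeries ℂ) ^ n ∣
          w - ((w.trunc n : Polynomial ℂ) : PowerSeries ℂ) := by
        rw [PowerSeries.X_pow_dvd_iff]
        intro m hm
        rw [map_sub, Polynomial.coeff_coe, PowerSeries.coeff_trunc, if_pos hm, sub_self]
      refine (wnorm_trunc_le (v := PolarTree.evT _ (hcct n) K) fun m hm => ?_).trans ?_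
      · conv_lhs => rw [← hKw]
        exact coeff_evT_congr hK10 hw (hcct n) hdvd hm
      · rw [evT_apply]
        refine (wnorm_subst_le _ (hasSubst_of_zero (hcct n) cc_T) K).trans
          ((wnorm_mono ?_ K).trans hbound)
        intro i
        fin_cases i
        · exact ih
        · change wnorm _ (PowerSeries.X : PowerSeries ℂ) ≤ v * r
          rw [PowerSeries.X, MvPowerSeries.X, wnorm_monomial, wt_single]
          simp
  refine ⟨v * r, ENNReal.mul_pos hv0.ne' hr0.ne', ne_top_of_le_ne_top ?_ (wnorm_le_of_trunc hind)⟩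
  exact ENNReal.mul_ne_top (ne_top_of_le_ne_top ENNReal.one_ne_top hu1) hrt

/-- The inverse of a convergent unit in one variable. -/
theorem Cvg.of_mul_eq_one {u v : PowerSeries ℂ} (hu : Cvg u) (h : u * v = 1) : Cvg v := by
  set c := PowerSeries.constantCoeff u with hc
  have hcv : c * PowerSeries.constantCoeff v = 1 := by rw [hc, ← map_mul, h, map_one]
  have hc0 : c ≠ 0 := left_ne_zero_of_mul_eq_one hcv
  have hw : PowerSeries.constantCoeff (v - PowerSeries.C c⁻¹) = 0 := by
    rw [map_sub, PowerSeries.constantCoeff_C, eq_inv_of_mul_eq_one_right hcv, sub_self]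
  have hlC : ∀ a : ℂ, PolarTree.liftY (PowerSeries.C a) = MvPowerSeries.C a :=
    fun a => PolarTree.liftY.commutes a
  -- The inverse without its constant term is the root of `H`, and `H_x` at the origin is `u(0) = c
  -- ≠ 0`.
  set H : PS := (MvPowerSeries.X 0 + MvPowerSeries.C c⁻¹) * PolarTree.liftY u - 1 with hH
  have hHc : Cvg H := (((Cvg.X 0).add (Cvg.C _)).mul hu.liftY).sub (by simpa using Cvg.C 1)
  have h00 : MvPowerSeries.coeff (expo 0 0) H = 0 := by
    rw [show expo 0 0 = 0 by simp [expo], MvPowerSeries.coeff_zero_eq_constantCoeff_apply, hH,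
      map_sub, map_mul, map_add, cc_X, cc_liftY, ← hc]
    simp [hc0]
  have h10 : MvPowerSeries.coeff (expo 1 0) H ≠ 0 := by
    have h1 := coeff_dx H 0 0
    have h2 : dx H = PolarTree.liftY u := by
      have hd1 : dx (MvPowerSeries.X 0 : PS) = 1 := by
        rw [dx, MvPowerSeries.pderiv_X_self]
      have hd2 : ∀ a : ℂ, dx (MvPowerSeries.C a : PS) = 0 := by
        intro a; rw [← hlC, dx_liftY]
      have hd3 : dx (1 : PS) = 0 := by simpa using hd2 1
      rw [hH, dx, map_sub, ← dx, ← dx, dx_mul, dx_add, hd1, hd2, hd3, dx_liftY]; ring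
    rw [h2, coeff_liftY, if_pos rfl, PowerSeries.coeff_zero_eq_constantCoeff_apply, ← hc] at h1
    intro h0
    rw [zero_add, h0, zero_mul] at h1
    exact hc0 h1
  have hev : PolarTree.evT _ hw H = 0 := by
    rw [hH, map_sub, map_mul, map_add, evT_X0, evT_liftY, map_one, ← hlC, evT_liftY,
      sub_add_cancel, mul_comm, h, sub_self]
  have := (hHc.implicit h00 h10 hw hev).add (Cvg.C (σ := Unit) c⁻¹)
  have e : (v - PowerSeries.C c⁻¹) + MvPowerSeries.C (σ := Unit) c⁻¹ = v := sub_add_cancel _ _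
  rwa [e] at this

end PolarTree
end

noncomputable section

namespace PolarTree

open scoped ENNReal

/-! ### Convergence of Newton-Puiseux roots -/

/-- The factor `i` produced by the derivative is at most `2 ^ (i + j)`, which is absorbed by halving
the radius. Multiplying by `x` first keeps the exponents aligned. -/
theorem Cvg.dx {F : PS} (hF : Cvg F) : Cvg (dx F) := by
  classical
  obtain ⟨r, hr, h⟩ := hF
  apply Cvg.of_X_mul (i := 0)
  refine ⟨r / 2, ENNReal.half_pos hr.ne', ne_top_of_le_ne_top h (ENNReal.tsum_le_tsum fun m => ?_)⟩
  rw [eq_expo m]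
  set i := m 0
  set j := m 1
  have hwt : ∀ s : ℝ≥0∞, wt (fun _ : Fin 2 => s) (expo i j) = s ^ (i + j) := by
    intro s; rw [expo, wt_add, wt_single, wt_single, pow_add]
  have hc : ‖MvPowerSeries.coeff (expo i j) (MvPowerSeries.X 0 * PolarTree.dx F)‖ₑ ≤
      ‖MvPowerSeries.coeff (expo i j) F‖ₑ * 2 ^ (i + j) := by
    rcases i with _ | i
    · rw [MvPowerSeries.X, MvPowerSeries.coeff_monomial_mul, if_neg]
      · simp
      · intro h
        have := h 0
        simp [expo] at this
    · rw [show expo (i + 1) j = Finsupp.single 0 1 + expo i j by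
          rw [expo, expo, Finsupp.single_add]; abel, MvPowerSeries.X,
        MvPowerSeries.coeff_add_monomial_mul, one_mul, coeff_dx, enorm_mul,
        show expo (i + 1) j = Finsupp.single 0 1 + expo i j by
          rw [expo, expo, Finsupp.single_add]; abel]
      gcongr
      have h1 : ‖((i : ℂ) + 1)‖ₑ = ((i + 1 : ℕ) : ℝ≥0∞) := by
        rw [← Nat.cast_succ, ← ofReal_norm, Complex.norm_natCast, ENNReal.ofReal_natCast]
      rw [h1]
      calc ((i + 1 : ℕ) : ℝ≥0∞) ≤ ((2 ^ (i + 1 + j) : ℕ) : ℝ≥0∞) := by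
            refine Nat.cast_le.2 (Nat.lt_two_pow_self.le.trans ?_)
            exact Nat.pow_le_pow_right (by norm_num) (by omega)
        _ = _ := by push_cast; rfl
  rw [hwt, hwt]
  calc _ ≤ ‖MvPowerSeries.coeff (expo i j) F‖ₑ * 2 ^ (i + j) * (r / 2) ^ (i + j) :=
        mul_le_mul_left hc _
    _ = ‖MvPowerSeries.coeff (expo i j) F‖ₑ * (2 * (r / 2)) ^ (i + j) := by
        rw [mul_pow]; ring
    _ = _ := by rw [ENNReal.mul_div_cancel (by simp) (by simp)]

theorem Cvg.dx_iterate {F : PS} (hF : Cvg F) (n : ℕ) : Cvg (PolarTree.dx^[n] F) := by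
  induction n generalizing F with
  | zero => exact hF
  | succ n ih => rw [Function.iterate_succ_apply]; exact ih hF.dx

theorem Cvg.dy {F : PS} (hF : Cvg F) : Cvg (dy F) := by
  classical
  obtain ⟨r, hr, h⟩ := hF
  apply Cvg.of_X_mul (i := 1)
  refine ⟨r / 2, ENNReal.half_pos hr.ne', ne_top_of_le_ne_top h (ENNReal.tsum_le_tsum fun m => ?_)⟩
  rw [eq_expo m]
  set i := m 0
  set j := m 1
  have hwt : ∀ s : ℝ≥0∞, wt (fun _ : Fin 2 => s) (expo i j) = s ^ (i + j) := by
    intro s; rw [expo, wt_add, wt_single, wt_single, pow_add]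
  have hc : ‖MvPowerSeries.coeff (expo i j) (MvPowerSeries.X 1 * PolarTree.dy F)‖ₑ ≤
      ‖MvPowerSeries.coeff (expo i j) F‖ₑ * 2 ^ (i + j) := by
    rcases j with _ | j
    · rw [MvPowerSeries.X, MvPowerSeries.coeff_monomial_mul, if_neg]
      · simp
      · intro h
        have := h 1
        simp [expo] at this
    · rw [show expo i (j + 1) = Finsupp.single 1 1 + expo i j by
          rw [expo, expo, Finsupp.single_add]; abel, MvPowerSeries.X,
        MvPowerSeries.coeff_add_monomial_mul, one_mul, coeff_dy, enorm_mul,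
        show expo i (j + 1) = Finsupp.single 1 1 + expo i j by
          rw [expo, expo, Finsupp.single_add]; abel]
      gcongr
      have h1 : ‖((j : ℂ) + 1)‖ₑ = ((j + 1 : ℕ) : ℝ≥0∞) := by
        rw [← Nat.cast_succ, ← ofReal_norm, Complex.norm_natCast, ENNReal.ofReal_natCast]
      rw [h1]
      calc ((j + 1 : ℕ) : ℝ≥0∞) ≤ ((2 ^ (i + (j + 1)) : ℕ) : ℝ≥0∞) := by
            refine Nat.cast_le.2 (Nat.lt_two_pow_self.le.trans ?_)
            exact Nat.pow_le_pow_right (by norm_num) (by omega)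
        _ = _ := by push_cast; rfl
  rw [hwt, hwt]
  calc _ ≤ ‖MvPowerSeries.coeff (expo i j) F‖ₑ * 2 ^ (i + j) * (r / 2) ^ (i + j) :=
        mul_le_mul_left hc _
    _ = ‖MvPowerSeries.coeff (expo i j) F‖ₑ * (2 * (r / 2)) ^ (i + j) := by
        rw [mul_pow]; ring
    _ = _ := by rw [ENNReal.mul_div_cancel (by simp) (by simp)]

theorem Cvg.jac {f g : PS} (hf : Cvg f) (hg : Cvg g) : Cvg (jac f g) :=
  (hf.dy.mul hg.dx).sub (hf.dx.mul hg.dy)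

theorem Cvg.polynomial (p : Polynomial ℂ) : Cvg (p : PowerSeries ℂ) := by
  induction p using Polynomial.induction_on' with
  | add p q hp hq => rw [Polynomial.coe_add]; exact hp.add hq
  | monomial n a => rw [Polynomial.coe_monomial]; exact Cvg.monomial (σ := Unit) _ a

/-- A simple root of a convergent series is convergent. -/
theorem Cvg.of_simple_root {F : PS} (hF : Cvg F) {γ : PowerSeries ℂ}
    (hγ : PowerSeries.constantCoeff γ = 0) (h0 : PolarTree.evT γ hγ F = 0)
    (h1 : PolarTree.evT γ hγ (PolarTree.dx F) ≠ 0) : Cvg γ := by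
  obtain ⟨G, hG, -⟩ := exists_division F hγ
  rw [h0, map_zero, add_zero] at hG
  have hdX : ∀ a : PowerSeries ℂ, PolarTree.dx (MvPowerSeries.X 0 - PolarTree.liftY a) = 1 := by
    intro a
    have := dx_liftY a
    rw [PolarTree.dx] at this ⊢
    rw [map_sub, MvPowerSeries.pderiv_X_self, this, sub_zero]
  have hGγ : PolarTree.evT γ hγ (PolarTree.dx F) = PolarTree.evT γ hγ G := by
    rw [hG, dx_mul, hdX, map_add, map_mul, map_mul, map_sub, evT_X0, evT_liftY]; simp
  rw [hGγ] at h1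
  obtain ⟨S, hS, -⟩ := exists_division G hγ
  -- `e` is the order of `F_x` along the root. The root need not be simple at `t = 0`, so it is
  -- separated by blowing up around a polynomial approximation.
  obtain ⟨e, u, hu, hu0⟩ := exists_eq_X_pow_mul h1
  rw [hu] at hS
  -- Two terms beyond `e` are kept so that the rest is `t ^ (e + 1) w` with `w(0) = 0`.
  set γ0 : PowerSeries ℂ := ((γ.trunc (e + 2) : Polynomial ℂ) : PowerSeries ℂ) with hγ0
  have hcc0 : PowerSeries.constantCoeff γ0 = 0 := by
    rw [hγ0, ← PowerSeries.coeff_zero_eq_constantCoeff_apply, Polynomial.coeff_coe,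
      PowerSeries.coeff_trunc, if_pos (by omega)]
    simpa using hγ
  obtain ⟨w', hw'⟩ : PowerSeries.X ^ (e + 2) ∣ γ - γ0 := by
    rw [PowerSeries.X_pow_dvd_iff]
    intro m hm
    rw [map_sub, hγ0, Polynomial.coeff_coe, PowerSeries.coeff_trunc, if_pos hm, sub_self]
  set w : PowerSeries ℂ := PowerSeries.X * w' with hw
  have hwc : PowerSeries.constantCoeff w = 0 := by rw [hw, map_mul]; simp
  have hγw : γ = γ0 + PowerSeries.X ^ (e + 1) * w := by
    rw [hw, ← mul_assoc, ← pow_succ, ← hw']; ring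
  clear_value w
  have hA : MvPowerSeries.constantCoeff
      (PolarTree.liftY γ0 + MvPowerSeries.X 1 ^ (e + 1) * MvPowerSeries.X 0) = 0 := by
    rw [map_add, map_mul, cc_liftY, hcc0, cc_X, mul_zero, add_zero]
  set φ := PolarTree.sb _ _ hA (cc_X 1) with hφ
  have hφX : φ (MvPowerSeries.X 0 - PolarTree.liftY γ) =
      MvPowerSeries.X 1 ^ (e + 1) * (MvPowerSeries.X 0 - PolarTree.liftY w) := by
    rw [hφ, map_sub, sb_X0, sb_liftY', hγw, map_add, map_mul, map_pow, liftY_X]; ring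
  -- Under `x ↦ γ0 + y ^ (e + 1) x` the series `F` becomes `y ^ (2 e + 1) H`: one factor `y ^ (e +
  -- 1)` comes from `x - γ`, and `y ^ e` from the cofactor. Now `w` is a root of `H` with `H_x =
  -- u(0) ≠ 0` at the origin.
  set H : PS := (MvPowerSeries.X 0 - PolarTree.liftY w) *
    (MvPowerSeries.X 1 * (MvPowerSeries.X 0 - PolarTree.liftY w) * φ S + PolarTree.liftY u) with hH
  have hFH : φ F = MvPowerSeries.X 1 ^ (2 * e + 1) * H := by
    have h3 : φ (PolarTree.liftY (PowerSeries.X ^ e * u)) =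
        MvPowerSeries.X 1 ^ e * PolarTree.liftY u := by
      rw [hφ, sb_liftY', map_mul, map_pow, liftY_X]
    rw [hG, hS, map_mul, map_add, map_mul, hφX, h3, hH]
    ring
  have hcγ0 : Cvg γ0 := Cvg.polynomial _
  have hHc : Cvg H := by
    apply Cvg.of_X_pow_mul (i := 1) (n := 2 * e + 1)
    rw [← hFH]
    exact hF.sb _ _ (hcγ0.liftY.add (((Cvg.X 1).pow _).mul (Cvg.X 0))) (Cvg.X 1)
  have hw0 : MvPowerSeries.constantCoeff (MvPowerSeries.X 0 - PolarTree.liftY w) = 0 := by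
    rw [map_sub, cc_X, cc_liftY, hwc, sub_zero]
  have h00 : MvPowerSeries.coeff (expo 0 0) H = 0 := by
    rw [show expo 0 0 = 0 by simp [expo], MvPowerSeries.coeff_zero_eq_constantCoeff_apply, hH,
      map_mul, hw0, zero_mul]
  have h10 : MvPowerSeries.coeff (expo 1 0) H ≠ 0 := by
    have h4 := coeff_dx H 0 0
    rw [show expo 0 0 = 0 by simp [expo], MvPowerSeries.coeff_zero_eq_constantCoeff_apply, hH,
      dx_mul, hdX, map_add, map_mul, map_mul, hw0, map_add, map_mul, map_mul, cc_X, cc_liftY] at h4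
    intro h5
    rw [← hH, zero_add, h5] at h4
    apply hu0
    simpa using h4
  have hev : PolarTree.evT w hwc H = 0 := by
    rw [hH, map_mul, map_sub, evT_X0, evT_liftY, sub_self, zero_mul]
  have hcw := hHc.implicit h00 h10 hwc hev
  rw [hγw]
  exact hcγ0.add ((Cvg.T.pow _).mul hcw)

/-! ### Ramification -/

theorem cc_X_pow (D : ℕ) [NeZero D] :
    MvPowerSeries.constantCoeff ((MvPowerSeries.X 1 : PS) ^ D) = 0 := by
  rw [map_pow, cc_X, zero_pow (NeZero.ne D)]

/-- The substitution `F(x, y) ↦ F(x, t ^ D)`. -/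
def ram (D : ℕ) [NeZero D] : PS →ₐ[ℂ] PS :=
  sb (MvPowerSeries.X 0) (MvPowerSeries.X 1 ^ D) (cc_X 0) (cc_X_pow D)

theorem coeff_ram (D : ℕ) [NeZero D] (F : PS) (i j : ℕ) :
    MvPowerSeries.coeff (expo i j) (ram D F) =
      if D ∣ j then MvPowerSeries.coeff (expo i (j / D)) F else 0 := by
  classical
  have hm : ∀ a b : ℕ, (MvPowerSeries.X 0 : PS) ^ a * (MvPowerSeries.X 1 ^ D) ^ b =
      MvPowerSeries.monomial (expo a (D * b)) 1 := by
    intro a b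
    rw [← pow_mul, MvPowerSeries.X_pow_eq, MvPowerSeries.X_pow_eq,
      MvPowerSeries.monomial_mul_monomial, one_mul]; rfl
  rw [ram, sb_apply, coeff_subst_pair (hasSubst_of_zero (cc_X 0) (cc_X_pow D))]
  simp_rw [hm, MvPowerSeries.coeff_monomial, expo_inj]
  split_ifs with h
  · obtain ⟨k, rfl⟩ := h
    have hD : 0 < D := Nat.pos_of_ne_zero (NeZero.ne D)
    rw [Nat.mul_div_cancel_left _ hD, finsum_eq_single _ (i, k)]
    · simp
    · rintro ⟨a, b⟩ hab
      rw [if_neg, mul_zero]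
      rintro ⟨h1, h2⟩
      apply hab
      rw [Prod.mk.injEq]
      exact ⟨h1.symm, (Nat.eq_of_mul_eq_mul_left hD h2).symm⟩
  · rw [finsum_eq_zero_of_forall_eq_zero]
    rintro ⟨a, b⟩
    rw [if_neg, mul_zero]
    rintro ⟨-, rfl⟩
    exact h (Dvd.intro _ rfl)

theorem Cvg.ram {F : PS} (hF : Cvg F) (D : ℕ) [NeZero D] : Cvg (ram D F) :=
  hF.sb _ _ (Cvg.X 0) ((Cvg.X 1).pow D)

theorem wt_expo (r : ℝ≥0∞) (i j : ℕ) : wt (fun _ : Fin 2 => r) (expo i j) = r ^ (i + j) := by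
  rw [expo, wt_add, wt_single, wt_single, pow_add]

/-- The part of a series consisting of the terms whose exponent of `y` is `k` modulo `D`. -/
def ramPart (D k : ℕ) (G : PS) : PS :=
  rows.symm (PowerSeries.mk fun i => PowerSeries.mk fun j =>
    MvPowerSeries.coeff (expo i (D * j + k)) G)

theorem coeff_ramPart (D k : ℕ) (G : PS) (i j : ℕ) :
    MvPowerSeries.coeff (expo i j) (ramPart D k G) =
      MvPowerSeries.coeff (expo i (D * j + k)) G := by
  rw [ramPart, coeff_rows_symm, PowerSeries.coeff_mk, PowerSeries.coeff_mk]

theorem Cvg.ramPart {G : PS} (hG : Cvg G) (D k : ℕ) [NeZero D] : Cvg (ramPart D k G) := by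
  obtain ⟨r', hr', h'⟩ := hG
  obtain ⟨r, hr0, hr1, h⟩ : ∃ r : ℝ≥0∞, 0 < r ∧ r ≤ 1 ∧ wnorm (fun _ => r) G ≠ ⊤ :=
    ⟨min r' 1, lt_min hr' one_pos, min_le_right _ _, Cvg.of_le h' (min_le_left _ _)⟩
  have hrt : r ≠ ⊤ := ne_top_of_le_ne_top ENNReal.one_ne_top hr1
  have hpos : ∀ n, r ^ n ≠ 0 := fun n => pow_ne_zero n hr0.ne'
  have hD : 0 < D := Nat.pos_of_ne_zero (NeZero.ne D)
  have key : r ^ k * wnorm (fun _ => r ^ D) (PolarTree.ramPart D k G) ≤ wnorm (fun _ => r) G := by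
    have hinj : Function.Injective fun m : Fin 2 →₀ ℕ => expo (m 0) (D * m 1 + k) := by
      intro a b hab
      rw [expo_inj] at hab
      rw [eq_expo a, eq_expo b, hab.1,
        Nat.eq_of_mul_eq_mul_left hD (Nat.add_right_cancel hab.2)]
    rw [wnorm, wnorm, ← ENNReal.tsum_mul_left]
    refine le_trans (ENNReal.tsum_le_tsum fun m => ?_) (ENNReal.tsum_comp_le_tsum_of_injective hinj _)
    rw [eq_expo m, coeff_ramPart]
    simp only [wt_expo, expo_zero, expo_one]
    set i := m 0
    set j := m 1
    calc _ = ‖MvPowerSeries.coeff (expo i (D * j + k)) G‖ₑ * r ^ (k + D * (i + j)) := by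
          rw [← pow_mul, pow_add]; ring
      _ ≤ _ := by
        refine mul_le_mul_right (pow_le_pow_right_of_le_one' hr1 ?_) _
        have : i ≤ D * i := Nat.le_mul_of_pos_left i hD
        rw [mul_add]; omega
  refine ⟨r ^ D, pos_iff_ne_zero.2 (hpos D), fun hc => ?_⟩
  rw [hc, ENNReal.mul_top (hpos k), top_le_iff] at key
  exact h key

theorem ramPart_ram (D : ℕ) [NeZero D] (F : PS) : ramPart D 0 (ram D F) = F := by
  apply PS.ext; intro i j
  rw [coeff_ramPart, coeff_ram, if_pos (by simp), add_zero,
    Nat.mul_div_cancel_left _ (Nat.pos_of_ne_zero (NeZero.ne D))]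

/-- Evaluation at an arc factors through the ramification. -/
theorem evalArc_eq_evT (F : PS) (D : ℕ) [NeZero D] {a : PowerSeries ℂ}
    (ha : PowerSeries.constantCoeff a = 0) : evalArc F (psi D a) = psi D (evT a ha (ram D F)) := by
  rw [evalArc_psi F D ha]
  refine congrArg (psi D) (Eq.trans ?_
    (sb_sb (a := a) (b := PowerSeries.X) ha cc_T (cc_X 0) (cc_X_pow D) F).symm)
  refine Eq.trans ?_ (sb_apply _ _ F).symm
  have e1 := sb_X0 (a := a) (b := PowerSeries.X) ha cc_T
  have e2 := sb_X1 (a := a) (b := PowerSeries.X) ha cc_T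
  rw [map_pow, e1, e2]
  rfl

theorem dx_ram (D : ℕ) [NeZero D] (F : PS) : dx (ram D F) = ram D (dx F) := by
  apply PS.ext; intro i j
  rw [coeff_dx, coeff_ram, coeff_ram]
  split_ifs
  · rw [coeff_dx]
  · rw [zero_mul]

/-- Newton-Puiseux roots of convergent series are convergent. -/
theorem cvg_of_root {F : PS} (hF : F ≠ 0) (hc : Cvg F) {D : ℕ} [NeZero D] {a : PowerSeries ℂ}
    (h : psi D a ∈ roots F) : Cvg a := by
  classical
  have hp := roots_posArc h
  have ha : PowerSeries.constantCoeff a = 0 := (orderTop_psi_pos D a).1 hp.2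
  have hne : {n | evalArc (dx^[n] F) (psi D a) ≠ 0}.Nonempty := by
    by_contra hemp
    have hall : ∀ n, evalArc (dx^[n] F) (psi D a) = 0 := by
      intro n
      by_contra hn
      exact hemp ⟨n, hn⟩
    have h0 : rootMult F (psi D a) = 0 := by
      rw [rootMult, show {n | evalArc (dx^[n] F) (psi D a) ≠ 0} = ∅ from
        Set.not_nonempty_iff_eq_empty.1 hemp, Nat.sInf_empty]
    have h1 := count_rootMS hF h
    rw [h0] at h1
    exact absurd ((mem_rootMS hF).2 h) (Multiset.count_eq_zero.1 h1)
  set m := rootMult F (psi D a)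
  have hm : evalArc (dx^[m] F) (psi D a) ≠ 0 := Nat.sInf_mem hne
  -- A root of multiplicity `m` is a simple root of the derivative of order `m - 1` in `x`, to which
  -- the simple case applies.
  obtain ⟨k, hk⟩ : ∃ k, m = k + 1 := by
    refine Nat.exists_eq_succ_of_ne_zero fun h0 => hm ?_
    rw [h0]; exact h.2.2
  have hk0 : evalArc (dx^[k] F) (psi D a) = 0 := by
    by_contra hk0
    have := Nat.sInf_le (s := {n | evalArc (dx^[n] F) (psi D a) ≠ 0}) hk0
    have : m ≤ k := this
    omega
  rw [hk, Function.iterate_succ_apply'] at hm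
  rw [evalArc_eq_evT _ D ha] at hk0 hm
  refine ((hc.dx_iterate k).ram D).of_simple_root ha ?_ ?_
  · exact (map_eq_zero_iff _ (psi_injective D)).1 hk0
  · rw [dx_ram]
    intro h0
    rw [h0, map_zero] at hm
    exact hm rfl

end PolarTree
end

noncomputable section

namespace PolarTree

open Polynomial
open scoped Classical

/-! ### Splitting a series according to the exponents of `y` modulo `D` -/

theorem ramPart_add (D k : ℕ) (F G : PS) :
    ramPart D k (F + G) = ramPart D k F + ramPart D k G := by
  apply PS.ext; intro i j
  rw [map_add, coeff_ramPart, coeff_ramPart, coeff_ramPart, map_add]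

theorem ramPart_smul (D k : ℕ) (c : ℂ) (F : PS) : ramPart D k (c • F) = c • ramPart D k F := by
  apply PS.ext; intro i j
  simp [coeff_ramPart]

/-- `ramPart D k` as a linear map. -/
def ramPartL (D k : ℕ) : PS →ₗ[ℂ] PS where
  toFun := ramPart D k
  map_add' := ramPart_add D k
  map_smul' := ramPart_smul D k

theorem ramPart_y_pow_mul (D : ℕ) [NeZero D] {k l : ℕ} (hk : k < D) (hl : l < D) (F : PS) :
    ramPart D k (MvPowerSeries.X 1 ^ l * ram D F) = if k = l then F else 0 := by
  have hD : 0 < D := Nat.pos_of_ne_zero (NeZero.ne D)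
  apply PS.ext; intro i j
  rw [coeff_ramPart, coeff_y_pow_mul, coeff_ram]
  split_ifs with h1 h2 h3 h3
  · subst h3
    rw [Nat.add_sub_cancel, Nat.mul_div_cancel_left _ hD]
  · exfalso
    apply h3
    obtain ⟨m, hm⟩ := h2
    have h4 : D * j + k = D * m + l := by omega
    have h5 := congrArg (· % D) h4
    simpa [Nat.mul_add_mod, Nat.mod_eq_of_lt hk, Nat.mod_eq_of_lt hl] using h5
  · exfalso
    apply h2
    subst h3
    rw [Nat.add_sub_cancel]; exact Dvd.intro _ rfl
  · rfl
  · omega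
  · rfl

theorem sum_ramPart (D : ℕ) [NeZero D] (G : PS) :
    ∑ k ∈ Finset.range D, MvPowerSeries.X 1 ^ k * ram D (ramPart D k G) = G := by
  have hD : 0 < D := Nat.pos_of_ne_zero (NeZero.ne D)
  apply PS.ext; intro i j
  rw [map_sum, Finset.sum_eq_single (j % D)]
  · rw [coeff_y_pow_mul, if_pos (Nat.mod_le _ _), coeff_ram, if_pos (Nat.dvd_sub_mod j),
      coeff_ramPart]
    rw [Nat.mul_div_cancel' (Nat.dvd_sub_mod j), Nat.sub_add_cancel (Nat.mod_le _ _)]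
  · intro k hk hne
    rw [coeff_y_pow_mul]
    split_ifs with h
    · rw [coeff_ram, if_neg]
      rintro ⟨m, hm⟩
      apply hne
      have h4 : j = D * m + k := by omega
      rw [h4, Nat.mul_add_mod, Nat.mod_eq_of_lt (Finset.mem_range.1 hk)]
    · rfl
  · intro h
    exact absurd (Finset.mem_range.2 (Nat.mod_lt j hD)) h

/-- The series in `x, t` form a free module over those in `x, t ^ D` with basis `1, t, …, t ^ (D -
1)`; `ramPart D k` is a coordinate and hence linear over the smaller ring. -/
theorem ramPart_ram_mul (D : ℕ) [NeZero D] {k : ℕ} (hk : k < D) (P Q : PS) :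
    ramPart D k (ram D P * Q) = P * ramPart D k Q := by
  have h1 : ram D P * Q =
      ∑ l ∈ Finset.range D, MvPowerSeries.X 1 ^ l * ram D (P * ramPart D l Q) := by
    conv_lhs => rw [← sum_ramPart D Q]
    rw [Finset.mul_sum]
    refine Finset.sum_congr rfl fun l _ => ?_
    rw [map_mul]; ring
  change ramPartL D k _ = _
  rw [h1, map_sum, Finset.sum_eq_single k]
  · exact (ramPart_y_pow_mul D hk hk _).trans (if_pos rfl)
  · intro l hl hne
    exact (ramPart_y_pow_mul D hk (Finset.mem_range.1 hl) _).trans (if_neg hne.symm)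
  · intro h
    exact absurd (Finset.mem_range.2 hk) h

/-! ### Products of linear factors -/

theorem ofPoly_C (a : PowerSeries ℂ) : ofPoly (C a) = liftY a := by
  apply PS.ext; intro i j
  rw [coeff_ofPoly, coeff_liftY, coeff_C]
  split_ifs <;> simp

/-- `∏ (x - a(y))` as a power series. -/
def linProd (t : Multiset (PowerSeries ℂ)) : PS :=
  (t.map fun a => MvPowerSeries.X 0 - liftY a).prod

/-- `∏ (x - γ)`. -/
def monicProd (s : Multiset Ser) : Ser[X] := (s.map fun γ => X - C γ).prod

theorem linProd_zero : linProd 0 = 1 := by simp [linProd]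

theorem linProd_cons (a : PowerSeries ℂ) (t : Multiset (PowerSeries ℂ)) :
    linProd (a ::ₘ t) = (MvPowerSeries.X 0 - liftY a) * linProd t := by
  simp [linProd]

theorem linProd_eq (t : Multiset (PowerSeries ℂ)) :
    linProd t = ofPoly (t.map fun a => X - C a).prod := by
  rw [linProd, map_multiset_prod, Multiset.map_map]
  congr 1
  refine Multiset.map_congr rfl fun a _ => ?_
  rw [Function.comp_apply, map_sub, ofPoly_X, ofPoly_C]

theorem map_prod_psi (D : ℕ) [NeZero D] (t : Multiset (PowerSeries ℂ)) :
    ((t.map fun a => X - C a).prod).map (psi D) = monicProd (t.map (psi D)) := by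
  rw [Polynomial.map_multiset_prod, Multiset.map_map, monicProd, Multiset.map_map]
  congr 1
  refine Multiset.map_congr rfl fun a _ => ?_
  simp

theorem coeff_monicProd (D : ℕ) [NeZero D] (t : Multiset (PowerSeries ℂ)) (i : ℕ) :
    (monicProd (t.map (psi D))).coeff i =
      psi D (PowerSeries.mk fun j => MvPowerSeries.coeff (expo i j) (linProd t)) := by
  rw [← map_prod_psi, coeff_map]
  congr 1
  ext j
  rw [PowerSeries.coeff_mk, linProd_eq, coeff_ofPoly]

theorem Cvg.linProd {t : Multiset (PowerSeries ℂ)} (h : ∀ a ∈ t, Cvg a) : Cvg (linProd t) := by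
  induction t using Multiset.induction_on with
  | empty => rw [linProd_zero]; simpa using Cvg.C (σ := Fin 2) 1
  | cons a t ih =>
    rw [linProd_cons]
    exact ((Cvg.X 0).sub (h a (Multiset.mem_cons_self _ _)).liftY).mul
      (ih fun b hb => h b (Multiset.mem_cons_of_mem hb))


/-- The row of degree `i` in `x`, as a series in `y`. -/
def row (i : ℕ) (F : PS) : PowerSeries ℂ :=
  PowerSeries.mk fun j => MvPowerSeries.coeff (expo i j) F

theorem coeff_row (i j : ℕ) (F : PS) :
    PowerSeries.coeff j (row i F) = MvPowerSeries.coeff (expo i j) F := PowerSeries.coeff_mk _ _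

theorem row_ram (D : ℕ) [NeZero D] (F : PS) (i : ℕ) : row i (ram D F) = ex D (row i F) := by
  ext j
  rw [coeff_row, coeff_ram, ex_apply, PowerSeries.coeff_expand]
  split_ifs
  · rw [coeff_row]
  · rfl

theorem psi_row_ram (D : ℕ) [NeZero D] (F : PS) (i : ℕ) :
    psi D (row i (ram D F)) = psi 1 (row i F) := by
  rw [row_ram, ex_apply, ← psi_expand 1 D]
  exact psi_cast (one_mul D).symm _

theorem represents_iff (F : ConvPS) (p : Ser[X]) :
    Represents F p ↔ ∀ i, psi 1 (row i (F : PS)) = p.coeff i := by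
  refine forall_congr' fun i => ?_
  rw [ofPowerSeries_eq_psi]; rfl

/-- After `y = t ^ D` the roots become power series in `t`, and being represented becomes an
identity of power series in two variables. -/
theorem represents_iff_ram (F : ConvPS) (D : ℕ) [NeZero D] (t : Multiset (PowerSeries ℂ)) :
    Represents F (monicProd (t.map (psi D))) ↔ ram D (F : PS) = linProd t := by
  rw [represents_iff]
  constructor
  · intro h
    apply PS.ext; intro i j
    have h1 := h i
    rw [← psi_row_ram D, coeff_monicProd] at h1
    have h2 := congrArg (PowerSeries.coeff j) (psi_injective D h1)
    rw [coeff_row, PowerSeries.coeff_mk] at h2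
    exact h2
  · intro h i
    rw [← psi_row_ram D, coeff_monicProd, h]; rfl

/-! ### Galois-stable products over algebraic arcs -/

/-- The arcs that are roots of convergent series. -/
def AlgArc (γ : Ser) : Prop := ∃ J : PS, J ≠ 0 ∧ Cvg J ∧ γ ∈ roots J

theorem AlgArc.posArc {γ : Ser} (h : AlgArc γ) : PosArc γ :=
  let ⟨_, _, _, hJ⟩ := h; roots_posArc hJ

theorem AlgArc.cvg {D : ℕ} [NeZero D] {a : PowerSeries ℂ} (h : AlgArc (psi D a)) : Cvg a :=
  let ⟨_, h0, hc, hJ⟩ := h; cvg_of_root h0 hc hJ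

theorem PosArc.cc {D : ℕ} [NeZero D] {a : PowerSeries ℂ} (h : PosArc (psi D a)) :
    PowerSeries.constantCoeff a = 0 := (orderTop_psi_pos D a).1 h.2

theorem exists_common_multiset (s : Multiset Ser) (h : ∀ γ ∈ s, AlgArc γ) :
    ∃ D : ℕ, ∃ _ : NeZero D, ∃ t : Multiset (PowerSeries ℂ), s = t.map (psi D) ∧
      ∀ a ∈ t, Cvg a ∧ PowerSeries.constantCoeff a = 0 := by
  obtain ⟨D, hD, hc⟩ := exists_common_psi s.toFinset fun ξ hξ =>
    (h ξ (Multiset.mem_toFinset.1 hξ)).posArc.1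
  choose! a ha using hc
  refine ⟨D, hD, s.map a, ?_, ?_⟩
  · rw [Multiset.map_map]
    conv_lhs => rw [← Multiset.map_id s]
    exact Multiset.map_congr rfl fun γ hγ => ha γ (Multiset.mem_toFinset.2 hγ)
  · intro b hb
    obtain ⟨γ, hγ, rfl⟩ := Multiset.mem_map.1 hb
    have h1 := h γ hγ
    rw [ha γ (Multiset.mem_toFinset.2 hγ)] at h1
    exact ⟨h1.cvg, h1.posArc.cc⟩

theorem coeff_eq_zero_of_theta {ξ : Ser} (h : theta ξ = ξ) {e : ℚ} (he : ¬ ∃ n : ℤ, e = n) :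
    ξ.coeff e = 0 := by
  have h1 := congrArg (fun s => s.coeff e) h
  simp only [theta_coeff] at h1
  by_contra h0
  exact he ((chi_eq_one_iff e).1 (mul_right_cancel₀ h0 (by rw [h1, one_mul])))

/-- A multiset of algebraic arcs stable under the Galois action defines a convergent series. -/
theorem exists_represents (s : Multiset Ser) (h : ∀ γ ∈ s, AlgArc γ) (hθ : s.map theta = s) :
    ∃ F : ConvPS, Represents F (monicProd s) := by
  obtain ⟨D, hD, t, rfl, ht⟩ := exists_common_multiset s h
  have hc : Cvg (ramPart D 0 (linProd t)) := (Cvg.linProd fun a ha => (ht a ha).1).ramPart D 0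
  refine ⟨⟨_, (isConv_iff _).2 hc⟩, ?_⟩
  rw [represents_iff_ram]
  apply PS.ext; intro i j
  rw [coeff_ram]
  split_ifs with hj
  · rw [coeff_ramPart, add_zero, Nat.mul_div_cancel' hj]
  -- Stability makes every coefficient fixed by `theta`, so only integral exponents of `y` occur,
  -- that is, only exponents of `t` divisible by `D`.
  · have h1 : (monicProd (t.map (psi D))).map theta = monicProd (t.map (psi D)) := by
      conv_rhs => rw [← hθ]
      rw [monicProd, monicProd, Polynomial.map_multiset_prod, Multiset.map_map, Multiset.map_map,
        Multiset.map_map, Multiset.map_map]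
      congr 1
      refine Multiset.map_congr rfl fun a _ => ?_
      simp
    have h2 := congrArg (fun p => p.coeff i) h1
    simp only [coeff_map] at h2
    have hD0 : (D : ℚ) ≠ 0 := by exact_mod_cast NeZero.ne D
    have h3 := coeff_eq_zero_of_theta h2 (e := (j : ℚ) / D) (by
      rintro ⟨n, hn⟩
      apply hj
      rw [div_eq_iff hD0] at hn
      have : (j : ℤ) = n * D := by exact_mod_cast hn
      exact_mod_cast (Dvd.intro_left _ this.symm : (D : ℤ) ∣ j))
    rw [coeff_monicProd, psi_coeff, PowerSeries.coeff_mk] at h3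
    exact h3.symm

/-- The order in `x` of a represented polynomial is its degree. -/
theorem Represents.xOrder {F : ConvPS} {s : Multiset Ser} (hs : ∀ γ ∈ s, PosArc γ)
    (h : Represents F (monicProd s)) : xOrder F = s.card := by
  obtain ⟨D, hD, hc⟩ := exists_common_psi s.toFinset fun ξ hξ =>
    (hs ξ (Multiset.mem_toFinset.1 hξ)).1
  choose! a ha using hc
  have hst : s = (s.map a).map (psi D) := by
    rw [Multiset.map_map]
    conv_lhs => rw [← Multiset.map_id s]
    exact Multiset.map_congr rfl fun γ hγ => ha γ (Multiset.mem_toFinset.2 hγ)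
  have h0 : ∀ b ∈ s.map a, PowerSeries.constantCoeff b = 0 := by
    intro b hb
    obtain ⟨γ, hγ, rfl⟩ := Multiset.mem_map.1 hb
    have := hs γ hγ
    rw [ha γ (Multiset.mem_toFinset.2 hγ)] at this
    exact this.cc
  rw [hst, represents_iff_ram] at h
  have h1 : ∀ i, MvPowerSeries.coeff (expo i 0) (F : PS) =
      if i = (s.map a).card then 1 else 0 := by
    intro i
    have h2 := congrArg (MvPowerSeries.coeff (expo i 0)) h
    rw [coeff_ram, if_pos (dvd_zero D), Nat.zero_div, linProd_eq, coeff_ofPoly,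
      PowerSeries.coeff_zero_eq_constantCoeff_apply, ← coeff_map,
      Polynomial.map_multiset_prod, Multiset.map_map] at h2
    rw [h2, show (Multiset.map (Polynomial.map PowerSeries.constantCoeff ∘ fun b => X - C b)
      (s.map a)) = (s.map a).map fun _ => (X : ℂ[X]) from Multiset.map_congr rfl fun b hb => by
        simp [h0 b hb], Multiset.map_const', Multiset.prod_replicate, coeff_X_pow]
  rw [PolarTree.xOrder, PowerSeries.order_eq_nat.2]
  rw [Multiset.card_map] at h1
  refine ⟨?_, fun i hi => ?_⟩
  · rw [PowerSeries.coeff_mk, h1, if_pos rfl]; exact one_ne_zero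
  · rw [PowerSeries.coeff_mk, h1, if_neg hi.ne]

end PolarTree
end

noncomputable section

namespace PolarTree

open Polynomial
open scoped Classical

/-! ### Division by represented polynomials -/

theorem exists_division_of_root {G : PS} {a : PowerSeries ℂ} (ha : PowerSeries.constantCoeff a = 0)
    (h : evT a ha G = 0) :
    ∃ Q, G = (MvPowerSeries.X 0 - liftY a) * Q ∧ (Cvg G → Cvg a → Cvg Q) := by
  obtain ⟨Q, hQ, hc⟩ := exists_division G ha
  rw [h, map_zero, add_zero] at hQ
  exact ⟨Q, hQ, hc⟩

theorem evT_linear {a b : PowerSeries ℂ} (ha : PowerSeries.constantCoeff a = 0) :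
    evT a ha (MvPowerSeries.X 0 - liftY b) = a - b := by
  rw [map_sub, evT_X0, evT_liftY]

theorem exists_linProd_division {t : Multiset (PowerSeries ℂ)} (ht : t.Nodup)
    (h0 : ∀ a ∈ t, PowerSeries.constantCoeff a = 0) (hc : ∀ a ∈ t, Cvg a) {G : PS} (hG : Cvg G)
    (h : ∀ a ∈ t, ∀ ha : PowerSeries.constantCoeff a = 0, evT a ha G = 0) :
    ∃ Q, G = linProd t * Q ∧ Cvg Q := by
  induction t using Multiset.induction_on generalizing G with
  | empty => exact ⟨G, by rw [linProd_zero, one_mul], hG⟩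
  | cons a t ih =>
    rw [Multiset.nodup_cons] at ht
    have ha := Multiset.mem_cons_self a t
    obtain ⟨Q, hQ, hQc⟩ := exists_division_of_root (h0 a ha) (h a ha (h0 a ha))
    obtain ⟨S, hS, hSc⟩ := ih ht.2 (fun b hb => h0 b (Multiset.mem_cons_of_mem hb))
      (fun b hb => hc b (Multiset.mem_cons_of_mem hb)) (hQc hG (hc a ha)) (by
        intro b hb hb0
        have h1 := h b (Multiset.mem_cons_of_mem hb) hb0
        rw [hQ, map_mul, evT_linear, mul_eq_zero, sub_eq_zero] at h1
        refine h1.resolve_left ?_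
        rintro rfl; exact ht.1 hb)
    exact ⟨S, by rw [hQ, hS, linProd_cons]; ring, hSc⟩

/-- After ramification the distinct linear factors can be divided out one by one with convergent
quotients. Since divisor and dividend are series in `t ^ D`, the part of the quotient with exponents
divisible by `D` is a quotient before ramification. -/
theorem Represents.dvd {P G : ConvPS} {s : Multiset Ser} (hs : s.Nodup)
    (h : ∀ γ ∈ s, AlgArc γ) (hP : Represents P (monicProd s))
    (hG : ∀ γ ∈ s, evalArc (G : PS) γ = 0) : P ∣ G := by
  obtain ⟨D, hD, t, rfl, ht⟩ := exists_common_multiset s h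
  rw [represents_iff_ram] at hP
  obtain ⟨Q, hQ, hQc⟩ := exists_linProd_division (G := ram D (G : PS)) (Multiset.Nodup.of_map _ hs)
    (fun a ha => (ht a ha).2) (fun a ha => (ht a ha).1) (((isConv_iff _).1 G.2).ram D) (by
      intro a ha ha0
      have h1 := hG _ (Multiset.mem_map_of_mem _ ha)
      rw [evalArc_eq_evT _ D ha0] at h1
      exact (map_eq_zero_iff _ (psi_injective D)).1 h1)
  rw [← hP] at hQ
  refine ⟨⟨_, (isConv_iff _).2 (hQc.ramPart D 0)⟩, Subtype.ext ?_⟩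
  change (G : PS) = (P : PS) * ramPart D 0 Q
  rw [← ramPart_ram_mul D (Nat.pos_of_ne_zero (NeZero.ne D)), ← hQ, ramPart_ram]

/-! ### Intersection multiplicities -/

theorem interMult_eq_length (F G : ConvPS) :
    interMult F G = Module.length ℂ (ConvPS ⧸ Ideal.span ({F, G} : Set ConvPS)) :=
  (Module.length_eq_rank _ _).symm

theorem length_quotient_eq {R M : Type*} [CommRing R] [Algebra ℂ R] [AddCommGroup M] [Module ℂ M]
    (J : Ideal R) (φ : R →ₗ[ℂ] M) (hφ : Function.Surjective φ) (hker : ∀ G, φ G = 0 ↔ G ∈ J) :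
    Module.length ℂ (R ⧸ J) = Module.length ℂ M := by
  have h : J.restrictScalars ℂ = LinearMap.ker φ := by
    ext G; rw [Submodule.restrictScalars_mem, LinearMap.mem_ker, hker]
  exact ((Submodule.Quotient.restrictScalarsEquiv ℂ J).symm.trans
    ((Submodule.quotEquivOfEq _ _ h).trans (φ.quotKerEquivOfSurjective hφ))).length_eq

/-- `ram D` on convergent series. -/
def ramC (D : ℕ) [NeZero D] (F : ConvPS) : ConvPS :=
  ⟨ram D F, (isConv_iff _).2 (((isConv_iff _).1 F.2).ram D)⟩

/-- `ramPart D k` on convergent series. -/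
def ramPartC (D k : ℕ) [NeZero D] : ConvPS →ₗ[ℂ] ConvPS where
  toFun F := ⟨ramPart D k F, (isConv_iff _).2 (((isConv_iff _).1 F.2).ramPart D k)⟩
  map_add' F G := Subtype.ext (ramPart_add D k F G)
  map_smul' c F := Subtype.ext (ramPart_smul D k c F)

/-- The variable `y` in the ring of convergent series. -/
def yC : ConvPS := ⟨MvPowerSeries.X 1, (isConv_iff _).2 (Cvg.X 1)⟩

theorem ramPartC_ramC_mul (D : ℕ) [NeZero D] {k : ℕ} (hk : k < D) (P Q : ConvPS) :
    ramPartC D k (ramC D P * Q) = P * ramPartC D k Q :=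
  Subtype.ext (ramPart_ram_mul D hk P Q)

theorem sum_ramPartC (D : ℕ) [NeZero D] (G : ConvPS) :
    ∑ k ∈ Finset.range D, yC ^ k * ramC D (ramPartC D k G) = G := by
  apply Subtype.ext
  rw [AddSubmonoidClass.coe_finsetSum]
  exact sum_ramPart D G

/-- By freeness of rank `D` over the image of `y ↦ y ^ D`, the quotient after ramification consists
of `D` copies of the original one. -/
theorem interMult_ram (D : ℕ) [NeZero D] (F P : ConvPS) :
    interMult (ramC D F) (ramC D P) = D * interMult F P := by
  rw [interMult_eq_length, interMult_eq_length]
  set I := Ideal.span ({F, P} : Set ConvPS)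
  let φ : ConvPS →ₗ[ℂ] (Fin D → ConvPS ⧸ I) :=
    LinearMap.pi fun k => (Ideal.Quotient.mkₐ ℂ I).toLinearMap ∘ₗ ramPartC D k
  have hφ : ∀ G k, φ G k = Ideal.Quotient.mk I (ramPartC D k G) := fun G k => rfl
  rw [length_quotient_eq _ φ, Module.length_pi]
  · simp
  · intro v
    choose w hw using fun k => Ideal.Quotient.mk_surjective (v k)
    refine ⟨∑ l : Fin D, yC ^ (l : ℕ) * ramC D (w l), funext fun k => ?_⟩
    rw [hφ, map_sum, Finset.sum_eq_single k, ← hw]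
    · congr 1
      exact Subtype.ext ((ramPart_y_pow_mul D k.2 k.2 (w k)).trans (if_pos rfl))
    · intro l _ hl
      exact Subtype.ext ((ramPart_y_pow_mul D k.2 l.2 (w l)).trans
        (if_neg fun h => hl (Fin.ext h.symm)))
    · intro h; exact absurd (Finset.mem_univ k) h
  · intro G
    have h1 : φ G = 0 ↔ ∀ k : Fin D, ramPartC D k G ∈ I := by
      rw [funext_iff]
      exact forall_congr' fun k => by rw [hφ]; exact Ideal.Quotient.eq_zero_iff_mem
    rw [h1]
    constructor
    · intro h
      rw [← sum_ramPartC D G]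
      refine Ideal.sum_mem _ fun k hk => Ideal.mul_mem_left _ _ ?_
      have h2 := h ⟨k, Finset.mem_range.1 hk⟩
      obtain ⟨a, b, hab⟩ := Ideal.mem_span_pair.1 h2
      have h3 : ramC D (ramPartC D k G) = ramC D a * ramC D F + ramC D b * ramC D P := by
        have h4 := congrArg (fun x : ConvPS => ram D (x : PS)) hab
        apply Subtype.ext
        exact h4.symm.trans ((map_add _ _ _).trans (congrArg₂ _ (map_mul _ _ _) (map_mul _ _ _)))
      rw [h3]
      exact Ideal.mem_span_pair.2 ⟨_, _, rfl⟩
    · intro h k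
      obtain ⟨a, b, rfl⟩ := Ideal.mem_span_pair.1 h
      rw [mul_comm a, mul_comm b, map_add, ramPartC_ramC_mul D k.2, ramPartC_ramC_mul D k.2]
      exact Ideal.mem_span_pair.2 ⟨ramPartC D k a, ramPartC D k b, by ring⟩

/-! ### Intersection with smooth branches and additivity -/

/-- `x - a(y)` as a convergent series. -/
def linC (a : PowerSeries ℂ) (ha : Cvg a) : ConvPS :=
  ⟨MvPowerSeries.X 0 - liftY a, (isConv_iff _).2 ((Cvg.X 0).sub ha.liftY)⟩

theorem linC_dvd {a : PowerSeries ℂ} (ha : Cvg a) (h0 : PowerSeries.constantCoeff a = 0)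
    (G : ConvPS) : linC a ha ∣ G ↔ evT a h0 (G : PS) = 0 := by
  constructor
  · rintro ⟨Q, rfl⟩
    change evT a h0 ((MvPowerSeries.X 0 - liftY a) * (Q : PS)) = 0
    rw [map_mul, evT_linear, sub_self, zero_mul]
  · intro h
    obtain ⟨Q, hQ, hc⟩ := exists_division_of_root h0 h
    exact ⟨⟨Q, (isConv_iff _).2 (hc ((isConv_iff _).1 G.2) ha)⟩, Subtype.ext hQ⟩

/-- Modulo `x - a(y)` the ring becomes `ℂ{y}` and `F` becomes a unit times the `n`-th power of the
variable; a basis of the quotient is given by the first `n` powers. -/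
theorem interMult_linC {a : PowerSeries ℂ} (ha : Cvg a) (h0 : PowerSeries.constantCoeff a = 0)
    (F : ConvPS) {n : ℕ} {u : PowerSeries ℂ} (hu : PowerSeries.constantCoeff u ≠ 0)
    (hF : evT a h0 (F : PS) = PowerSeries.X ^ n * u) : interMult F (linC a ha) = n := by
  rw [interMult_eq_length]
  let φ : ConvPS →ₗ[ℂ] (Fin n → ℂ) := LinearMap.pi fun k =>
    (PowerSeries.coeff (k : ℕ) : PowerSeries ℂ →ₗ[ℂ] ℂ) ∘ₗ (evT a h0).toLinearMap ∘ₗ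
      ConvPS.val.toLinearMap
  have hφ : ∀ G k, φ G k = PowerSeries.coeff (k : ℕ) (evT a h0 (G : PS)) := fun _ _ => rfl
  rw [length_quotient_eq _ φ]
  · rw [Module.length_eq_finrank]; simp
  · intro v
    let q : ℂ[X] := ∑ k : Fin n, Polynomial.monomial k (v k)
    refine ⟨⟨liftY (q : PowerSeries ℂ), (isConv_iff _).2 (Cvg.polynomial q).liftY⟩,
      funext fun k => ?_⟩
    rw [hφ]
    change PowerSeries.coeff (k : ℕ) (evT a h0 (liftY (q : PowerSeries ℂ))) = v k
    rw [evT_liftY, Polynomial.coeff_coe, finsetSum_coeff, Finset.sum_eq_single k]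
    · rw [coeff_monomial, if_pos rfl]
    · intro l _ hl
      rw [coeff_monomial, if_neg fun h => hl (Fin.ext h)]
    · intro h; exact absurd (Finset.mem_univ k) h
  · intro G
    have h1 : φ G = 0 ↔ PowerSeries.X ^ n ∣ evT a h0 (G : PS) := by
      rw [funext_iff, PowerSeries.X_pow_dvd_iff]
      exact ⟨fun h m hm => h ⟨m, hm⟩, fun h k => h k k.2⟩
    rw [h1]
    constructor
    · rintro ⟨v, hv⟩
      obtain ⟨u', hu'⟩ := isUnit_iff_exists_inv.1 (isUnit_of_cc hu)
      -- Membership in the ideal has to be witnessed by convergent series, so `u`, its inverse and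
      -- `v` must be shown to converge.
      have hcF := (isConv_iff _).1 F.2
      have hcG := (isConv_iff _).1 G.2
      have hcu : Cvg u := by
        apply Cvg.of_X_pow_mul (i := ()) (n := n)
        have := hcF.evT h0 ha
        rw [hF] at this
        exact this
      have hcv : Cvg v := by
        apply Cvg.of_X_pow_mul (i := ()) (n := n)
        have := hcG.evT h0 ha
        rw [hv] at this
        exact this
      have hcw : Cvg (u' * v) := (hcu.of_mul_eq_one hu').mul hcv
      let W : ConvPS := ⟨liftY (u' * v), (isConv_iff _).2 hcw.liftY⟩
      have h2 : linC a ha ∣ G - W * F := by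
        rw [linC_dvd ha h0]
        change evT a h0 ((G : PS) - liftY (u' * v) * (F : PS)) = 0
        rw [map_sub, map_mul, evT_liftY, hF, hv]
        linear_combination (-(PowerSeries.X ^ n * v)) * hu'
      obtain ⟨Q, hQ⟩ := h2
      refine Ideal.mem_span_pair.2 ⟨W, Q, ?_⟩
      rw [mul_comm Q, ← hQ]; ring
    · intro h
      obtain ⟨A, B, rfl⟩ := Ideal.mem_span_pair.1 h
      change PowerSeries.X ^ n ∣ evT a h0 ((A : PS) * (F : PS) + (B : PS) * (MvPowerSeries.X 0 - liftY a))
      rw [map_add, map_mul, map_mul, hF, evT_linear, sub_self, mul_zero, add_zero]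
      exact ⟨evT a h0 (A : PS) * u, by ring⟩

/-- The sequence `0 → R/(F, P) → R/(F, p P) → R/(F, p) → 0`, with multiplication by `p` as the first
map, is exact; `h` says that `F` is not a zero divisor modulo `p` and gives injectivity. -/
theorem length_quotient_mul {R : Type*} [CommRing R] [IsDomain R] [Algebra ℂ R] (F p P : R)
    (hp : p ≠ 0) (h : ∀ x, p ∣ x * F → p ∣ x) :
    Module.length ℂ (R ⧸ Ideal.span ({F, p * P} : Set R)) =
      Module.length ℂ (R ⧸ Ideal.span ({F, P} : Set R)) +
        Module.length ℂ (R ⧸ Ideal.span ({F, p} : Set R)) := by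
  have h1 : Ideal.span ({F, P} : Set R) ≤
      Submodule.comap (LinearMap.mulLeft R p) (Ideal.span ({F, p * P} : Set R)) := by
    rw [Ideal.span_le]
    rintro x (rfl | rfl)
    · exact Ideal.mem_span_pair.2 ⟨p, 0, by simp⟩
    · exact Ideal.mem_span_pair.2 ⟨0, 1, by simp⟩
  have h2 : Ideal.span ({F, p * P} : Set R) ≤
      Submodule.comap (LinearMap.id : R →ₗ[R] R) (Ideal.span ({F, p} : Set R)) := by
    rw [Ideal.span_le]
    rintro x (rfl | rfl)
    · exact Ideal.mem_span_pair.2 ⟨1, 0, by simp⟩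
    · exact Ideal.mem_span_pair.2 ⟨0, P, by simp [mul_comm]⟩
  refine Module.length_eq_add_of_exact ((Submodule.mapQ _ _ _ h1).restrictScalars ℂ)
    ((Submodule.mapQ _ _ _ h2).restrictScalars ℂ) ?_ ?_ ?_
  · rw [← LinearMap.ker_eq_bot, LinearMap.ker_eq_bot']
    intro x hx
    obtain ⟨x, rfl⟩ := Ideal.Quotient.mk_surjective x
    have hx' : p * x ∈ Ideal.span ({F, p * P} : Set R) := (Submodule.Quotient.mk_eq_zero _).1 hx
    obtain ⟨A, B, hAB⟩ := Ideal.mem_span_pair.1 hx'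
    obtain ⟨A', rfl⟩ := h A ⟨x - B * P, by linear_combination hAB⟩
    refine Ideal.Quotient.eq_zero_iff_mem.2 (Ideal.mem_span_pair.2 ⟨A', B, ?_⟩)
    apply mul_left_cancel₀ hp
    linear_combination hAB
  · intro x
    obtain ⟨x, rfl⟩ := Ideal.Quotient.mk_surjective x
    exact ⟨Ideal.Quotient.mk _ x, rfl⟩
  · intro x
    obtain ⟨x, rfl⟩ := Ideal.Quotient.mk_surjective x
    constructor
    · intro hx
      have hx' : x ∈ Ideal.span ({F, p} : Set R) := (Submodule.Quotient.mk_eq_zero _).1 hx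
      obtain ⟨A, B, rfl⟩ := Ideal.mem_span_pair.1 hx'
      refine ⟨Ideal.Quotient.mk _ B, ?_⟩
      change Ideal.Quotient.mk _ (p * B) = _
      rw [Ideal.Quotient.eq]
      exact Ideal.mem_span_pair.2 ⟨-A, 0, by ring⟩
    · rintro ⟨z, hz⟩
      obtain ⟨z, rfl⟩ := Ideal.Quotient.mk_surjective z
      rw [← hz]
      change Ideal.Quotient.mk _ (p * z) = 0
      rw [Ideal.Quotient.eq_zero_iff_mem]
      exact Ideal.mem_span_pair.2 ⟨0, z, by ring⟩

instance isDomainPS : IsDomain PS := NoZeroDivisors.to_isDomain PS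

instance isDomainConvPS : IsDomain ConvPS := Subalgebra.isDomain ConvPS

theorem interMult_mul_linC {a : PowerSeries ℂ} (ha : Cvg a) (h0 : PowerSeries.constantCoeff a = 0)
    (F P : ConvPS) (hF : evT a h0 (F : PS) ≠ 0) :
    interMult F (linC a ha * P) = interMult F P + interMult F (linC a ha) := by
  simp only [interMult_eq_length]
  apply length_quotient_mul
  · intro h
    have h1 := congrArg (fun x : ConvPS => MvPowerSeries.coeff (expo 1 0) (x : PS)) h
    change MvPowerSeries.coeff (expo 1 0) (MvPowerSeries.X 0 - liftY a) =
      MvPowerSeries.coeff (expo 1 0) (0 : PS) at h1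
    rw [map_sub, coeff_liftY, if_neg one_ne_zero, ← ofPoly_X, coeff_ofPoly] at h1
    simp at h1
  · intro x hx
    rw [linC_dvd ha h0] at hx ⊢
    change evT a h0 ((x : PS) * F) = 0 at hx
    rw [map_mul] at hx
    exact (mul_eq_zero.1 hx).resolve_right hF

theorem interMult_linProd {t : Multiset (PowerSeries ℂ)} {F : ConvPS}
    (ht : ∀ a ∈ t, Cvg a ∧ PowerSeries.constantCoeff a = 0) (n : PowerSeries ℂ → ℕ)
    (hn : ∀ a ∈ t, ∀ ha : PowerSeries.constantCoeff a = 0, ∃ u,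
      PowerSeries.constantCoeff u ≠ 0 ∧ evT a ha (F : PS) = PowerSeries.X ^ n a * u)
    {P : ConvPS} (hP : (P : PS) = linProd t) : interMult F P = ((t.map n).sum : ℕ) := by
  induction t using Multiset.induction_on generalizing P with
  | empty =>
    have : P = 1 := Subtype.ext (hP.trans linProd_zero)
    rw [this, interMult_eq_length, Multiset.map_zero, Multiset.sum_zero, Nat.cast_zero,
      Module.length_eq_zero_iff, Ideal.Quotient.subsingleton_iff, Ideal.eq_top_iff_one]
    exact Ideal.subset_span (by simp)
  | cons a t ih =>
    obtain ⟨hac, ha0⟩ := ht a (Multiset.mem_cons_self _ _)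
    obtain ⟨u, hu, hau⟩ := hn a (Multiset.mem_cons_self _ _) ha0
    have ht' : ∀ b ∈ t, Cvg b ∧ PowerSeries.constantCoeff b = 0 :=
      fun b hb => ht b (Multiset.mem_cons_of_mem hb)
    let P' : ConvPS := ⟨linProd t, (isConv_iff _).2 (Cvg.linProd fun b hb => (ht' b hb).1)⟩
    have hPP : P = linC a hac * P' := Subtype.ext (hP.trans (linProd_cons a t))
    have hne : evT a ha0 (F : PS) ≠ 0 := by
      rw [hau]
      refine mul_ne_zero (pow_ne_zero _ PowerSeries.X_ne_zero) ?_
      rintro rfl; exact hu (map_zero _)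
    rw [hPP, interMult_mul_linC hac ha0 F P' hne, interMult_linC hac ha0 F hu hau,
      ih ht' (fun b hb => hn b (Multiset.mem_cons_of_mem hb)) (P := P') rfl,
      Multiset.map_cons, Multiset.sum_cons, add_comm]
    push_cast; rfl

theorem lead_psi (D : ℕ) [NeZero D] (n : ℕ) (u : PowerSeries ℂ) :
    Lead (psi D (PowerSeries.X ^ n * u)) ((n : ℚ) / D) (PowerSeries.constantCoeff u) := by
  constructor
  · rw [HahnSeries.le_orderTop_iff_forall]
    intro e he
    by_cases hn : ∃ m : ℕ, e = (m : ℚ) / D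
    · obtain ⟨m, rfl⟩ := hn
      have hD : (0 : ℚ) < D := by exact_mod_cast Nat.pos_of_ne_zero (NeZero.ne D)
      have hlt : (m : ℚ) / D < (n : ℚ) / D := by exact_mod_cast he
      rw [div_lt_div_iff_of_pos_right hD] at hlt
      rw [psi_coeff, PowerSeries.coeff_X_pow_mul', if_neg]
      exact not_le.2 (by exact_mod_cast hlt)
    · push Not at hn
      exact psi_coeff_of_ne D _ e hn
  · rw [psi_coeff, PowerSeries.coeff_X_pow_mul', if_pos le_rfl, Nat.sub_self]; simp

/-- The intersection multiplicity with a product of linear factors is the sum of the orders. -/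
theorem interMult_represents {F P : ConvPS} {s : Multiset Ser} (hs : ∀ γ ∈ s, AlgArc γ)
    (hP : Represents P (monicProd s)) (o : Ser → ℚ)
    (ho : ∀ γ ∈ s, (evalArc (F : PS) γ).orderTop = (o γ : WithTop ℚ)) :
    ∃ n : ℕ, interMult F P = n ∧ (n : ℚ) = (s.map o).sum := by
  obtain ⟨D, hD, t, rfl, ht⟩ := exists_common_multiset s hs
  rw [represents_iff_ram] at hP
  have hD0 : (D : ℚ) ≠ 0 := by exact_mod_cast NeZero.ne D
  have key : ∀ a ∈ t, ∃ n : ℕ, (∀ ha : PowerSeries.constantCoeff a = 0, ∃ u,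
      PowerSeries.constantCoeff u ≠ 0 ∧ evT a ha (ramC D F : PS) = PowerSeries.X ^ n * u) ∧
      (n : ℚ) = D * o (psi D a) := by
    intro a ha
    have h1 := ho _ (Multiset.mem_map_of_mem _ ha)
    have ha0 := (ht a ha).2
    rw [evalArc_eq_evT _ D ha0] at h1
    have hne : evT a ha0 (ram D (F : PS)) ≠ 0 := by
      intro h0
      rw [h0, map_zero, HahnSeries.orderTop_zero] at h1
      exact WithTop.top_ne_coe h1
    obtain ⟨n, u, hu, hu0⟩ := exists_eq_X_pow_mul hne
    refine ⟨n, fun _ => ⟨u, hu0, hu⟩, ?_⟩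
    rw [hu, (lead_psi D n u).orderTop hu0] at h1
    have h2 : (n : ℚ) / D = o (psi D a) := by exact_mod_cast h1
    rw [← h2]; field_simp
  choose! n hn1 hn2 using key
  have h1 := interMult_linProd (F := ramC D F) (P := ramC D P) ht n hn1 hP
  rw [interMult_ram] at h1
  -- Ramification multiplies both the intersection multiplicity and the orders by `D`; once
  -- finiteness is known, `D` can be cancelled.
  have hne : interMult F P ≠ ⊤ := by
    intro h
    rw [h, ENat.mul_top (by exact_mod_cast NeZero.ne D)] at h1
    exact ENat.top_ne_natCast _ h1
  obtain ⟨m, hm⟩ := ENat.ne_top_iff_exists.1 hne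
  refine ⟨m, hm.symm, ?_⟩
  rw [← hm] at h1
  have h2 : D * m = (t.map n).sum := by exact_mod_cast h1
  have h3 : (D : ℚ) * m = D * ((t.map (psi D)).map o).sum := by
    rw [← Nat.cast_mul, h2, Multiset.map_map, ← Multiset.sum_map_mul_left]
    rw [← Nat.coe_castRingHom, map_multiset_sum, Multiset.map_map]
    congr 1
    exact Multiset.map_congr rfl fun a ha => hn2 a ha
  exact mul_left_cancel₀ hD0 h3

end PolarTree
end

noncomputable section

namespace PolarTree

open HahnSeries
open scoped Classical

/-! ### Bars and contact orders -/

section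

variable {f g : PS}

/-- Climbing is expressed by contact orders, the only data that a correspondence of roots is known
to preserve. -/
theorem climbs_iff_contact {B : Bar} {ξ ζ : Ser} (hξ : Climbs ξ B) :
    Climbs ζ B ↔ (B.height : WithTop ℚ) ≤ contact ζ ξ := by
  rw [climbs_iff] at hξ
  rw [climbs_iff, contact, le_orderTop_iff_forall]
  constructor
  · intro h e he
    have he : e < B.height := by exact_mod_cast he
    rw [coeff_sub, h e he, hξ e he, sub_self]
  · intro h e he
    have := h e (by exact_mod_cast he)
    rw [coeff_sub, sub_eq_zero] at this
    rw [this, hξ e he]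

theorem climbsAt_iff_contact {B : Bar} {ξ ζ : Ser} {c : ℂ} (hξ : ClimbsAt ξ B c) :
    ClimbsAt ζ B c ↔ (B.height : WithTop ℚ) < contact ζ ξ := by
  rw [climbsAt_iff, climbs_iff_contact hξ.climbs]
  constructor
  · rintro ⟨h1, h2⟩
    refine lt_of_le_of_ne h1 fun h3 => ?_
    apply coeff_orderTop_ne (x := ζ - ξ) h3.symm
    rw [coeff_sub, h2, hξ.2, sub_self]
  · intro h
    refine ⟨h.le, ?_⟩
    have := coeff_eq_zero_of_lt_orderTop h
    rw [coeff_sub, sub_eq_zero] at this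
    rw [this, hξ.2]

theorem IsBar.stem_coeff {B : Bar} (hB : IsBar f g B) {e : ℚ} (he : B.height ≤ e) :
    B.stem.coeff e = 0 := by
  rcases hB with rfl | ⟨ξ, _, η, _, _, h2⟩
  · rfl
  · rw [h2, coeff_truncLT_of_le he]

theorem IsBar.posArc {B : Bar} (hB : IsBar f g B) : PosArc B.stem := by
  rcases hB with rfl | ⟨ξ, hξ, η, _, _, h2⟩
  · exact posArc_zero
  · rw [h2]; exact posArc_truncLT (allRoots_posArc hξ) _

theorem IsBar.stem_climbs {B : Bar} : Climbs B.stem B := climbs_iff.2 fun _ _ => rfl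

theorem IsBar.ext {f' g' : PS} {B B' : Bar} (hB : IsBar f g B) (hB' : IsBar f' g' B')
    (h : B.height = B'.height) {ξ : Ser} (h1 : Climbs ξ B) (h2 : Climbs ξ B') : B = B' := by
  have : B.stem = B'.stem := by
    ext e
    by_cases he : e < B.height
    · rw [← climbs_iff.1 h1 e he, climbs_iff.1 h2 e (h ▸ he)]
    · rw [hB.stem_coeff (not_lt.1 he), hB'.stem_coeff (h ▸ not_lt.1 he)]
  cases B; cases B'; simp_all

theorem IsBar.exists_root {B : Bar} (hB : IsBar f g B) (h : 0 < B.height) :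
    ∃ ξ ∈ allRoots f g, Climbs ξ B ∧ B.stem = truncLT B.height ξ ∧
      ∃ η ∈ allRoots f g, contact ξ η = (B.height : WithTop ℚ) := by
  rcases hB.ground_or_pos with rfl | ⟨_, ξ, hξ, η, hη, h1, h2⟩
  · exact absurd h (lt_irrefl _)
  · refine ⟨ξ, hξ, climbs_iff.2 fun e he => ?_, h2, η, hη, h1⟩
    rw [h2, coeff_truncLT_of_lt he]

theorem posArc_climbs_ground {ξ : Ser} (h : PosArc ξ) : ClimbsAt ξ ground 0 :=
  ⟨fun e he => coeff_eq_zero_of_lt_orderTop (lt_trans (by exact_mod_cast he) h.2),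
    coeff_eq_zero_of_lt_orderTop h.2⟩

theorem isBar_ground : IsBar f g ground := Or.inl rfl

theorem IsBar.eq_ground {B : Bar} (hB : IsBar f g B) (h : B.height = 0) : B = ground := by
  rcases hB.ground_or_pos with h' | ⟨h', _⟩
  · exact h'
  · exact absurd h h'.ne'

theorem IsBar.pos_of_ne {B : Bar} (hB : IsBar f g B) (h : B ≠ ground) : 0 < B.height :=
  lt_of_le_of_ne hB.nonneg fun h0 => h (hB.eq_ground h0.symm)

end

/-! ### Isomorphisms of trees -/

/-- The correspondences of roots that preserve the contact orders. -/
structure TreeIso (f g f' g' : PS) (σ : Ser → Ser) : Prop where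
  bijF : Set.BijOn σ (roots f) (roots f')
  bijG : Set.BijOn σ (roots g) (roots g')
  contact_eq : ∀ ξ ∈ allRoots f g, ∀ η ∈ allRoots f g, contact (σ ξ) (σ η) = contact ξ η
  yOrderF : yOrder f = yOrder f'
  yOrderG : yOrder g = yOrder g'

theorem TreeEquiv.iso {f g f' g' : PS} {σ : Ser → Ser} (h : TreeEquiv f g f' g' σ) :
    TreeIso f g f' g' σ := ⟨h.bijF, h.bijG, h.contact_eq, h.yOrderF, h.yOrderG⟩

namespace TreeIso

variable {f g f' g' : PS} {σ : Ser → Ser}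

theorem swap (h : TreeIso f g f' g' σ) : TreeIso g f g' f' σ :=
  ⟨h.bijG, h.bijF, fun ξ hξ η hη => h.contact_eq ξ hξ.symm η hη.symm, h.yOrderG, h.yOrderF⟩

theorem bij (h : TreeIso f g f' g' σ) : Set.BijOn σ (allRoots f g) (allRoots f' g') := by
  refine ⟨?_, ?_, ?_⟩
  · rintro ξ (hξ | hξ)
    · exact Or.inl (h.bijF.mapsTo hξ)
    · exact Or.inr (h.bijG.mapsTo hξ)
  · intro ξ hξ η hη he
    have h1 := h.contact_eq ξ hξ η hη
    rw [he, contact, sub_self, orderTop_zero] at h1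
    exact sub_eq_zero.1 (orderTop_eq_top.1 h1.symm)
  · rintro ξ (hξ | hξ)
    · obtain ⟨η, hη, rfl⟩ := h.bijF.surjOn hξ; exact ⟨η, Or.inl hη, rfl⟩
    · obtain ⟨η, hη, rfl⟩ := h.bijG.surjOn hξ; exact ⟨η, Or.inr hη, rfl⟩

theorem exists_inv (h : TreeIso f g f' g' σ) : ∃ ρ, TreeIso f' g' f g ρ ∧
    (∀ ξ ∈ allRoots f g, ρ (σ ξ) = ξ) ∧ ∀ ξ ∈ allRoots f' g', σ (ρ ξ) = ξ := by
  have hl : ∀ ξ ∈ allRoots f g, Function.invFunOn σ (allRoots f g) (σ ξ) = ξ :=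
    fun ξ hξ => h.bij.injOn.leftInvOn_invFunOn hξ
  have hr : ∀ ξ ∈ allRoots f' g', σ (Function.invFunOn σ (allRoots f g) ξ) = ξ :=
    fun ξ hξ => h.bij.surjOn.rightInvOn_invFunOn hξ
  refine ⟨_, ⟨?_, ?_, ?_, h.yOrderF.symm, h.yOrderG.symm⟩, hl, hr⟩
  · refine Set.InvOn.bijOn ⟨fun ξ hξ => hr ξ (Or.inl hξ), fun ξ hξ => hl ξ (Or.inl hξ)⟩ ?_
      h.bijF.mapsTo
    intro ξ hξ
    obtain ⟨η, hη, rfl⟩ := h.bijF.surjOn hξ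
    rw [hl η (Or.inl hη)]; exact hη
  · refine Set.InvOn.bijOn ⟨fun ξ hξ => hr ξ (Or.inr hξ), fun ξ hξ => hl ξ (Or.inr hξ)⟩ ?_
      h.bijG.mapsTo
    intro ξ hξ
    obtain ⟨η, hη, rfl⟩ := h.bijG.surjOn hξ
    rw [hl η (Or.inr hη)]; exact hη
  · intro ξ hξ η hη
    obtain ⟨ξ, hξ', rfl⟩ := h.bij.surjOn hξ
    obtain ⟨η, hη', rfl⟩ := h.bij.surjOn hη
    rw [hl ξ hξ', hl η hη', h.contact_eq ξ hξ' η hη']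

theorem barCorr_of_climbs (h : TreeIso f g f' g' σ) {B B' : Bar} (hh : B.height = B'.height)
    {ξ : Ser} (hξ : ξ ∈ allRoots f g) (h1 : Climbs ξ B) (h2 : Climbs (σ ξ) B') :
    BarCorr f g σ B B' := by
  refine ⟨hh, fun ζ hζ => ?_⟩
  rw [climbs_iff_contact h1, climbs_iff_contact h2, h.contact_eq ζ hζ ξ hξ, hh]

theorem barCorr_ground (h : TreeIso f g f' g' σ) : BarCorr f g σ ground ground :=
  ⟨rfl, fun _ hξ => iff_of_true (posArc_climbs_ground (allRoots_posArc hξ)).climbs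
    (posArc_climbs_ground (allRoots_posArc (h.bij.mapsTo hξ))).climbs⟩

theorem exists_corr (h : TreeIso f g f' g' σ) {B : Bar} (hB : IsBar f g B) :
    ∃ B', IsBar f' g' B' ∧ BarCorr f g σ B B' := by
  by_cases hg : B = ground
  · subst hg
    exact ⟨ground, isBar_ground, h.barCorr_ground⟩
  · obtain ⟨ξ, hξ, hc, hs, η, hη, hco⟩ := hB.exists_root (hB.pos_of_ne hg)
    refine ⟨⟨B.height, truncLT B.height (σ ξ)⟩, Or.inr ⟨σ ξ, h.bij.mapsTo hξ, σ η,
      h.bij.mapsTo hη, ?_, rfl⟩, h.barCorr_of_climbs rfl hξ hc ?_⟩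
    · rw [h.contact_eq ξ hξ η hη, hco]
    · exact climbs_iff.2 fun e he => (coeff_truncLT_of_lt he _).symm

theorem corr_unique (_h : TreeIso f g f' g' σ) {B B' B'' : Bar} (hB : IsBar f g B)
    (hB' : IsBar f' g' B') (hB'' : IsBar f' g' B'') (h1 : BarCorr f g σ B B')
    (h2 : BarCorr f g σ B B'') : B' = B'' := by
  -- The ground bar is identified by its height alone, since the pair may have no roots of positive
  -- order.
  by_cases hg : B = ground
  · subst hg
    rw [hB'.eq_ground h1.1.symm, hB''.eq_ground h2.1.symm]
  · obtain ⟨ξ, hξ, hc, -⟩ := hB.exists_root (hB.pos_of_ne hg)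
    exact hB'.ext hB'' (h1.1.symm.trans h2.1) ((h1.2 ξ hξ).1 hc) ((h2.2 ξ hξ).1 hc)

theorem corr_symm {ρ : Ser → Ser} (_h : TreeIso f g f' g' σ) (hr : ∀ ξ ∈ allRoots f' g', σ (ρ ξ) = ξ)
    (hρ : TreeIso f' g' f g ρ) {B B' : Bar} (hc : BarCorr f g σ B B') : BarCorr f' g' ρ B' B := by
  refine ⟨hc.1.symm, fun ξ hξ => ?_⟩
  rw [hc.2 _ (hρ.bij.mapsTo hξ), hr ξ hξ]

theorem corr_injective (h : TreeIso f g f' g' σ) {B₁ B₂ B' : Bar} (h1 : IsBar f g B₁)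
    (h2 : IsBar f g B₂) (hB' : IsBar f' g' B') (hc1 : BarCorr f g σ B₁ B')
    (hc2 : BarCorr f g σ B₂ B') : B₁ = B₂ := by
  obtain ⟨ρ, hρ, -, hr⟩ := h.exists_inv
  exact hρ.corr_unique hB' h1 h2 (h.corr_symm hr hρ hc1) (h.corr_symm hr hρ hc2)

/-- The induced bijection of bars. -/
theorem exists_barMap (h : TreeIso f g f' g' σ) : ∃ β : Bar → Bar,
    Set.BijOn β {B | IsBar f g B} {B | IsBar f' g' B} ∧
      ∀ B, IsBar f g B → ∀ B', IsBar f' g' B' → (BarCorr f g σ B B' ↔ B' = β B) := by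
  choose! β h1 h2 using fun B (hB : IsBar f g B) => h.exists_corr hB
  refine ⟨β, ⟨fun B hB => h1 B hB, ?_, ?_⟩, fun B hB B' hB' => ⟨fun hc => ?_, ?_⟩⟩
  · intro B hB B' hB' he
    exact h.corr_injective hB hB' (h1 B hB) (h2 B hB) (he ▸ h2 B' hB')
  · intro B' hB'
    obtain ⟨ρ, hρ, hl, hr⟩ := h.exists_inv
    obtain ⟨B, hB, hc⟩ := hρ.exists_corr hB'
    have hc' := hρ.corr_symm hl h hc
    exact ⟨B, hB, h.corr_unique hB (h1 B hB) hB' (h2 B hB) hc'⟩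
  · exact h.corr_unique hB hB' (h1 B hB) hc (h2 B hB)
  · rintro rfl; exact h2 B hB

theorem ptCorr_of_climbs (h : TreeIso f g f' g' σ) {B B' : Bar} (hh : B.height = B'.height)
    {ξ : Ser} (hξ : ξ ∈ allRoots f g) {c c' : ℂ} (h1 : ClimbsAt ξ B c)
    (h2 : ClimbsAt (σ ξ) B' c') : PtCorr f g σ B c B' c' := by
  intro ζ hζ
  rw [climbsAt_iff_contact h1, climbsAt_iff_contact h2, h.contact_eq ζ hζ ξ hξ, hh]

theorem exists_ptMap (h : TreeIso f g f' g' σ) {B B' : Bar} (hc : BarCorr f g σ B B') :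
    ∃ π : ℂ → ℂ, Set.BijOn π {c | TrunkAt f g B c} {c | TrunkAt f' g' B' c} ∧
      ∀ c, TrunkAt f g B c → PtCorr f g σ B c B' (π c) := by
  have key : ∀ c, TrunkAt f g B c → ∃ c', TrunkAt f' g' B' c' ∧ PtCorr f g σ B c B' c' := by
    rintro c ⟨ξ, hξ, hcl⟩
    have h1 : ClimbsAt (σ ξ) B' ((σ ξ).coeff B'.height) :=
      climbsAt_iff.2 ⟨(hc.2 ξ hξ).1 hcl.climbs, rfl⟩
    exact ⟨_, ⟨σ ξ, h.bij.mapsTo hξ, h1⟩, h.ptCorr_of_climbs hc.1 hξ hcl h1⟩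
  choose! π h1 h2 using key
  refine ⟨π, ⟨fun c hc => h1 c hc, ?_, ?_⟩, h2⟩
  · rintro c ⟨ξ, hξ, hcl⟩ c₁ hc₁ he
    have h3 := (h2 c ⟨ξ, hξ, hcl⟩ ξ hξ).1 hcl
    rw [he] at h3
    have h4 := (h2 c₁ hc₁ ξ hξ).2 h3
    rw [← hcl.2, h4.2]
  · rintro c' ⟨ξ', hξ', hcl'⟩
    obtain ⟨ξ, hξ, rfl⟩ := h.bij.surjOn hξ'
    have h3 : ClimbsAt ξ B (ξ.coeff B.height) := climbsAt_iff.2 ⟨(hc.2 ξ hξ).2 hcl'.climbs, rfl⟩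
    refine ⟨_, ⟨ξ, hξ, h3⟩, ?_⟩
    have h4 := (h2 _ ⟨ξ, hξ, h3⟩ ξ hξ).1 h3
    rw [← hcl'.2, h4.2]

theorem mult_eq (h : TreeIso f g f' g' σ) {B B' : Bar} {c c' : ℂ}
    (hc : PtCorr f g σ B c B' c') : mult f B c = mult f' B' c' := by
  rw [mult, mult]
  have : {ξ | ξ ∈ roots f' ∧ ClimbsAt ξ B' c'} = σ '' {ξ | ξ ∈ roots f ∧ ClimbsAt ξ B c} := by
    ext ξ'
    constructor
    · rintro ⟨h1, h2⟩
      obtain ⟨ξ, hξ, rfl⟩ := h.bijF.surjOn h1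
      exact ⟨ξ, ⟨hξ, (hc ξ (Or.inl hξ)).2 h2⟩, rfl⟩
    · rintro ⟨ξ, ⟨h1, h2⟩, rfl⟩
      exact ⟨h.bijF.mapsTo h1, (hc ξ (Or.inl h1)).1 h2⟩
  rw [this, (h.bijF.injOn.mono fun ξ hξ => hξ.1).ncard_image]

/-- A root climbing over `B` can replace a generic arc: for `ζ` not climbing over `B`, the generic
order is the contact order of `ζ` with that root. -/
theorem ordAt_eq (h : TreeIso f g f' g' σ) {B B' : Bar} (hB : IsBar f g B)
    (h0 : 0 < B.height) (hc : BarCorr f g σ B B') {ζ : Ser} (hζ : ζ ∈ allRoots f g) :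
    ordAt B ζ = ordAt B' (σ ζ) := by
  obtain ⟨ξ, hξ, hcl, -⟩ := hB.exists_root h0
  by_cases hz : Climbs ζ B
  · rw [ordAt, ordAt, if_pos hz, if_pos ((hc.2 ζ hζ).1 hz), hc.1]
  · have hz' : ¬ Climbs (σ ζ) B' := fun h' => hz ((hc.2 ζ hζ).2 h')
    have h1 := (lead_sub (γ := ζ) (climbsAt_iff.2 ⟨hcl, rfl⟩)).orderTop
      (leadAt_ne fun h' => hz h'.climbs)
    have h2 := (lead_sub (γ := σ ζ) (climbsAt_iff.2 ⟨(hc.2 ξ hξ).1 hcl, rfl⟩)).orderTop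
      (leadAt_ne fun h' => hz' h'.climbs)
    have h3 := h.contact_eq ξ hξ ζ hζ
    rw [contact, contact, h1, h2] at h3
    exact (WithTop.coe_injective h3).symm

theorem rootMS_eq (h : TreeIso f g f' g' σ) (hg : GoodPS f g) (hg' : GoodPS f' g') :
    rootMS f' = (rootMS f).map σ := by
  have hinj : ∀ ξ ∈ rootMS f, ∀ η ∈ rootMS f, σ ξ = σ η → ξ = η := fun ξ hξ η hη he =>
    h.bijF.injOn ((mem_rootMS hg.ne_left).1 hξ) ((mem_rootMS hg.ne_left).1 hη) he
  rw [Multiset.Nodup.ext hg'.nodup (Multiset.Nodup.map_on hinj hg.nodup)]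
  intro ξ'
  rw [mem_rootMS hg'.ne_left, Multiset.mem_map]
  constructor
  · intro h1
    obtain ⟨ξ, hξ, rfl⟩ := h.bijF.surjOn h1
    exact ⟨ξ, (mem_rootMS hg.ne_left).2 hξ, rfl⟩
  · rintro ⟨ξ, hξ, rfl⟩
    exact h.bijF.mapsTo ((mem_rootMS hg.ne_left).1 hξ)

theorem nu_eq (h : TreeIso f g f' g' σ) (hg : GoodPS f g) (hg' : GoodPS f' g') {B B' : Bar}
    (hB : IsBar f g B) (hB' : IsBar f' g' B') (hc : BarCorr f g σ B B') :
    nu f B = nu f' B' := by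
  by_cases h0 : B.height = 0
  · rw [nu, nu, if_pos h0, if_pos (hc.1 ▸ h0), h.yOrderF]
  · have hp : 0 < B.height := lt_of_le_of_ne hB.nonneg (Ne.symm h0)
    rw [nu_eq_nuS hg.ne_left (hB.proper hp), nu_eq_nuS hg'.ne_left (hB'.proper (hc.1 ▸ hp)),
      nuS, nuS, h.yOrderF, h.rootMS_eq hg hg', Multiset.map_map]
    congr 2
    refine Multiset.map_congr rfl fun ξ hξ => ?_
    exact h.ordAt_eq hB hp hc (Or.inl ((mem_rootMS hg.ne_left).1 hξ))

theorem delta_eq (h : TreeIso f g f' g' σ) (hg : GoodPS f g) (hg' : GoodPS f' g') {B B' : Bar}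
    (hB : IsBar f g B) (hB' : IsBar f' g' B') (hc : BarCorr f g σ B B') {c c' : ℂ}
    (hp : PtCorr f g σ B c B' c') : delta f g B c = delta f' g' B' c' := by
  have hc' : BarCorr g f σ B B' := ⟨hc.1, fun ξ hξ => hc.2 ξ hξ.symm⟩
  have hp' : PtCorr g f σ B c B' c' := fun ξ hξ => hp ξ hξ.symm
  have hsB : ∀ {f g : PS} {B : Bar}, IsBar f g B → IsBar g f B := fun hB =>
    hB.imp id fun ⟨ξ, hξ, η, hη, h⟩ => ⟨ξ, hξ.symm, η, hη.symm, h⟩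
  rw [delta, delta, h.nu_eq hg hg' hB hB' hc, h.swap.nu_eq hg.symm hg'.symm (hsB hB) (hsB hB') hc',
    h.mult_eq hp, h.swap.mult_eq hp']

theorem nonColl_iff (h : TreeIso f g f' g' σ) (hg : GoodPS f g) (hg' : GoodPS f' g') {B B' : Bar}
    (hB : IsBar f g B) (hB' : IsBar f' g' B') (hc : BarCorr f g σ B B') :
    NonColl f g B ↔ NonColl f' g' B' := by
  obtain ⟨π, hπ, hpt⟩ := h.exists_ptMap hc
  constructor
  · rintro ⟨c, h1, h2⟩
    exact ⟨π c, hπ.mapsTo h1, by rwa [← h.delta_eq hg hg' hB hB' hc (hpt c h1)]⟩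
  · rintro ⟨c', h1, h2⟩
    obtain ⟨c, hc1, rfl⟩ := hπ.surjOn h1
    exact ⟨c, hc1, by rwa [h.delta_eq hg hg' hB hB' hc (hpt c hc1)]⟩

theorem collPts_bij (h : TreeIso f g f' g' σ) (hg : GoodPS f g) (hg' : GoodPS f' g') {B B' : Bar}
    (hB : IsBar f g B) (hB' : IsBar f' g' B') (hc : BarCorr f g σ B B') :
    ∃ π : ℂ → ℂ, Set.BijOn π {c | TrunkAt f g B c} {c | TrunkAt f' g' B' c} ∧
      (∀ c, TrunkAt f g B c → PtCorr f g σ B c B' (π c)) ∧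
      (∀ c, TrunkAt f g B c → delta f g B c = delta f' g' B' (π c)) ∧
      Set.BijOn π (collPts f g B) (collPts f' g' B') := by
  obtain ⟨π, hπ, hpt⟩ := h.exists_ptMap hc
  have hd : ∀ c, TrunkAt f g B c → delta f g B c = delta f' g' B' (π c) :=
    fun c hc1 => h.delta_eq hg hg' hB hB' hc (hpt c hc1)
  refine ⟨π, hπ, hpt, hd, ?_, ?_, ?_⟩
  · rintro c ⟨h1, h2⟩
    exact ⟨hπ.mapsTo h1, by rw [← hd c h1, h2]⟩
  · exact hπ.injOn.mono fun c hc => hc.1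
  · rintro c' ⟨h1, h2⟩
    obtain ⟨c, hc1, rfl⟩ := hπ.surjOn h1
    exact ⟨c, ⟨hc1, by rw [hd c hc1, h2]⟩, rfl⟩

/-- Up to the height of the lower bar, the stem of the upper one coincides with any root climbing
over it, so the relation can be tested on such a root. -/
theorem liesOver_iff (_h : TreeIso f g f' g' σ) {B B' B₁ B₁' : Bar} (hB : IsBar f g B)
    (hB₁ : IsBar f g B₁) (hc₁ : BarCorr f g σ B₁ B₁')
    (hc : BarCorr f g σ B B') {c c' : ℂ} (hp : PtCorr f g σ B c B' c') :
    LiesOver B c B₁ ↔ LiesOver B' c' B₁' := by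
  rw [LiesOver, LiesOver, ← hc.1, ← hc₁.1]
  refine and_congr_right fun hlt => ?_
  obtain ⟨ξ, hξ, hcl, -⟩ := hB₁.exists_root (hB.nonneg.trans_lt hlt)
  have hcl' := (hc₁.2 ξ hξ).1 hcl
  have key : ∀ {A A₁ : Bar} {a : ℂ} {η : Ser}, Climbs η A₁ → A.height < A₁.height →
      (ClimbsAt A₁.stem A a ↔ ClimbsAt η A a) := by
    intro A A₁ a η hη hA
    rw [climbs_iff] at hη
    refine and_congr (forall₂_congr fun e he => ?_) ?_
    · rw [hη e (he.trans hA)]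
    · rw [hη _ hA]
  rw [key hcl hlt, key hcl' (by rwa [← hc.1, ← hc₁.1]), hp ξ hξ]

theorem liesAbove_iff (_h : TreeIso f g f' g' σ) {B B' B₁ B₁' : Bar} (hB : IsBar f g B)
    (hB₁ : IsBar f g B₁) (hc₁ : BarCorr f g σ B₁ B₁')
    (hc : BarCorr f g σ B B') : LiesAbove B B₁ ↔ LiesAbove B' B₁' := by
  by_cases hlt : B.height < B₁.height
  · obtain ⟨ξ, hξ, hcl, -⟩ := hB₁.exists_root (hB.nonneg.trans_lt hlt)
    have hcl' := (hc₁.2 ξ hξ).1 hcl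
    have hlt' : B'.height < B₁'.height := by rwa [← hc.1, ← hc₁.1]
    have key : ∀ {A A₁ : Bar} {η : Ser}, Climbs η A₁ → A.height < A₁.height →
        (LiesAbove A A₁ ↔ Climbs η A) := by
      intro A A₁ η hη hA
      rw [climbs_iff] at hη
      constructor
      · rintro ⟨a, -, h1⟩
        exact climbs_iff.2 fun e he => by rw [hη e (he.trans hA), h1.1 e he]
      · intro h1
        exact ⟨_, hA, fun e he => by rw [← hη e (he.trans hA), climbs_iff.1 h1 e he], rfl⟩
    rw [key hcl hlt, key hcl' hlt', hc.2 ξ hξ]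
  · refine iff_of_false (fun ⟨_, h1, _⟩ => hlt h1) fun ⟨_, h1, _⟩ => hlt ?_
    rwa [← hc.1, ← hc₁.1] at h1

theorem cover_bij (h : TreeIso f g f' g' σ) (hg : GoodPS f g) (hg' : GoodPS f' g') {B B' : Bar}
    (hB : IsBar f g B) (hc : BarCorr f g σ B B') {c c' : ℂ}
    (hp : PtCorr f g σ B c B' c') {β : Bar → Bar}
    (hβ : Set.BijOn β {B | IsBar f g B} {B | IsBar f' g' B})
    (hβc : ∀ B, IsBar f g B → BarCorr f g σ B (β B)) :
    Set.BijOn β (cover f g B c) (cover f' g' B' c') := by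
  have key : ∀ B₁, IsBar f g B₁ → (B₁ ∈ cover f g B c ↔ β B₁ ∈ cover f' g' B' c') := by
    intro B₁ hB₁
    rw [cover, cover, Set.mem_ofPred_eq, Set.mem_ofPred_eq,
      h.nonColl_iff hg hg' hB₁ (hβ.mapsTo hB₁) (hβc _ hB₁), h.liesOver_iff hB hB₁ (hβc _ hB₁) hc hp]
    refine and_congr (iff_of_true hB₁ (hβ.mapsTo hB₁)) (and_congr_right fun _ =>
      and_congr_right fun _ => ⟨fun h1 B₂' hB₂' => ?_, fun h1 B₂ hB₂ => ?_⟩)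
    · obtain ⟨B₂, hB₂, rfl⟩ := hβ.surjOn hB₂'
      have := h1 B₂ hB₂
      rwa [h.liesAbove_iff hB hB₂ (hβc _ hB₂) hc, h.liesAbove_iff hB₂ hB₁ (hβc _ hB₁) (hβc _ hB₂),
        h.nonColl_iff hg hg' hB₂ (hβ.mapsTo hB₂) (hβc _ hB₂)] at this
    · have := h1 _ (hβ.mapsTo hB₂)
      rwa [← h.liesAbove_iff hB hB₂ (hβc _ hB₂) hc,
        ← h.liesAbove_iff hB₂ hB₁ (hβc _ hB₁) (hβc _ hB₂),
        ← h.nonColl_iff hg hg' hB₂ (hβ.mapsTo hB₂) (hβc _ hB₂)] at this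
  refine ⟨fun B₁ h1 => (key B₁ h1.1).1 h1, hβ.injOn.mono fun B₁ h1 => h1.1, fun B₁' h1 => ?_⟩
  obtain ⟨B₁, hB₁, rfl⟩ := hβ.surjOn h1.1
  exact ⟨B₁, (key B₁ hB₁).2 h1, rfl⟩

end TreeIso

end PolarTree
end

noncomputable section

namespace PolarTree

open HahnSeries
open scoped Classical

/-! ### Counting roots of the Jacobian -/

theorem countP_exists {α β : Type*} (s : Multiset α) (p : α → β → Prop)
    [∀ b, DecidablePred (p · b)] [DecidablePred fun a => ∃ b, p a b] (T : Finset β)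
    (huniq : ∀ a b b', p a b → p a b' → b = b') (hT : ∀ a ∈ s, ∀ b, p a b → b ∈ T) :
    s.countP (fun a => ∃ b, p a b) = ∑ b ∈ T, s.countP (p · b) := by
  induction s using Multiset.induction_on with
  | empty => simp
  | cons a s ih =>
    have ih' := ih fun a' ha' => hT a' (Multiset.mem_cons_of_mem ha')
    simp only [Multiset.countP_cons]
    rw [Finset.sum_add_distrib, ih']
    congr 1
    by_cases h : ∃ b, p a b
    · obtain ⟨b, hb⟩ := h
      rw [if_pos ⟨b, hb⟩, Finset.sum_eq_single b]
      · rw [if_pos hb]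
      · intro b' _ hne
        rw [if_neg fun hb' => hne (huniq a b' b hb' hb)]
      · intro hb'
        exact absurd (hT a (Multiset.mem_cons_self _ _) b hb) hb'
    · rw [if_neg h, Finset.sum_eq_zero]
      intro b _
      rw [if_neg fun hb => h ⟨b, hb⟩]

section

variable {f g : PS}

/-- The number of roots of `F` that climb over `B`, with multiplicities. -/
def climbTot (F : PS) (B : Bar) : ℕ := (rootMS F).countP (Climbs · B)

/-- A finite set containing the points of `B` that are relevant for the counts. -/
def ptFinset (f g : PS) (B : Bar) : Finset ℂ :=
  ((rootMS (jac f g) + rootMS f + rootMS g).map fun γ => γ.coeff B.height).toFinset ∪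
    ((barNum f g B).roots.toFinset ∪ ncPts f g B)

theorem mem_ptFinset {B : Bar} {γ : Ser}
    (h : γ ∈ rootMS (jac f g) ∨ γ ∈ rootMS f ∨ γ ∈ rootMS g) :
    γ.coeff B.height ∈ ptFinset f g B := by
  rw [ptFinset, Finset.mem_union, Multiset.mem_toFinset, Multiset.mem_map]
  exact Or.inl ⟨γ, by simpa [or_assoc] using h, rfl⟩

theorem trunk_mem_ptFinset (h : GoodPS f g) {B : Bar} {c : ℂ} (hc : TrunkAt f g B c) :
    c ∈ ptFinset f g B := by
  obtain ⟨ξ, hξ, hcl⟩ := hc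
  rw [← hcl.2]
  refine mem_ptFinset (Or.inr (hξ.imp ?_ ?_))
  · exact (mem_rootMS h.ne_left).2
  · exact (mem_rootMS h.ne_right).2

theorem mero_mem_ptFinset (h : GoodPS f g) {B : Bar} (hB : NonColl f g B) {c : ℂ}
    (hc : meroMult f g B c ≠ 0) : c ∈ ptFinset f g B := by
  rw [ptFinset, Finset.mem_union, Finset.mem_union]
  refine Or.inr (Or.inl ?_)
  rw [Multiset.mem_toFinset, Polynomial.mem_roots (barNum_ne h hB)]
  rw [meroMult_eq h] at hc
  exact (Polynomial.rootMultiplicity_pos (barNum_ne h hB)).1 (Nat.pos_of_ne_zero hc)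

theorem climbTot_eq_sum (F : PS) (B : Bar) (T : Finset ℂ)
    (hT : ∀ γ ∈ rootMS F, γ.coeff B.height ∈ T) :
    climbTot F B = ∑ c ∈ T, cnt F B c := by
  rw [climbTot]
  exact countP_exists _ (fun γ c => ClimbsAt γ B c) T (fun γ b b' h h' => h.2.symm.trans h'.2)
    fun γ hγ b hb => hb.2 ▸ hT γ hγ

theorem meroTotal_eq_sum (h : GoodPS f g) {B : Bar} (hB : NonColl f g B) :
    meroTotal f g B = ∑ c ∈ ptFinset f g B, meroMult f g B c :=
  finsum_eq_sum_of_support_subset _ fun _ hc => mero_mem_ptFinset h hB hc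

/-- The sum of `count_jac` over all points of the bar; everything on the right and the number of
non-collinear points are invariants of the tree. -/
theorem climbTot_jac (h : GoodPS f g) {B : Bar} (hB : ProperBar B) (hnc : NonColl f g B) :
    climbTot (jac f g) B + (ncPts f g B).card =
      climbTot f B + climbTot g B + meroTotal f g B := by
  have h1 := (count_jac h hB hnc).2
  rw [meroTotal_eq_sum h hnc, climbTot_eq_sum (jac f g) B (ptFinset f g B),
    climbTot_eq_sum f B (ptFinset f g B), climbTot_eq_sum g B (ptFinset f g B)]
  · have h2 : (ncPts f g B).card = ∑ c ∈ ptFinset f g B, if delta f g B c ≠ 0 then 1 else 0 := by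
      rw [Finset.sum_ite, Finset.sum_const_zero, add_zero, Finset.sum_const, smul_eq_mul, mul_one]
      congr 1
      ext c
      rw [Finset.mem_filter, mem_ncPts h]
      refine ⟨fun hc => ⟨trunk_mem_ptFinset h ((finite_delta_support h B).2 c hc), hc⟩, And.right⟩
    rw [h2, ← Finset.sum_add_distrib, ← Finset.sum_add_distrib, ← Finset.sum_add_distrib]
    exact Finset.sum_congr rfl fun c _ => by rw [h1 c, h.cnt_eq, h.symm.cnt_eq]
  · exact fun γ hγ => mem_ptFinset (Or.inr (Or.inr hγ))
  · exact fun γ hγ => mem_ptFinset (Or.inr (Or.inl hγ))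
  · exact fun γ hγ => mem_ptFinset (Or.inl hγ)

theorem mult_eq_zero (h : GoodPS f g) {B : Bar} {c : ℂ} (hc : ¬ TrunkAt f g B c) :
    mult f B c = 0 := by
  rw [← h.cnt_eq, cnt, Multiset.countP_eq_zero]
  exact fun γ hγ hcl => hc ⟨γ, Or.inl ((mem_rootMS h.ne_left).1 hγ), hcl⟩

theorem trunkAt_symm {B : Bar} {c : ℂ} : TrunkAt f g B c ↔ TrunkAt g f B c := by
  simp only [TrunkAt, allRoots, Set.union_comm]

theorem delta_eq_zero (h : GoodPS f g) {B : Bar} {c : ℂ} (hc : ¬ TrunkAt f g B c) :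
    delta f g B c = 0 := by
  by_contra h0; exact hc ((finite_delta_support h B).2 c h0)

theorem cnt_jac_of_delta (h : GoodPS f g) {B : Bar} (hB : ProperBar B) (hnc : NonColl f g B)
    {c : ℂ} (hc : delta f g B c = 0) :
    cnt (jac f g) B c = mult f B c + mult g B c + meroMult f g B c := by
  have := (count_jac h hB hnc).2 c
  rwa [if_neg (not_not.2 hc), add_zero] at this

/-- There is a pole where `Δ_B(c) ≠ 0`, so a mero-zero at which a trunk grows is a collinear point.
Hence the pure mero-zeros are the ones off the trunks. -/
theorem pureZeros_indicator (h : GoodPS f g) {B : Bar} (c : ℂ) :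
    (pureZeros f g B).indicator (meroMult f g B) c =
      if TrunkAt f g B c then 0 else meroMult f g B c := by
  rw [Set.indicator_apply]
  by_cases hm : meroMult f g B c = 0
  · simp [hm]
  · have hd : delta f g B c = 0 := by
      by_contra hd; exact hm (meroMult_of_delta_ne h hd)
    by_cases ht : TrunkAt f g B c
    · rw [if_neg fun hp => hp.2 ⟨ht, hd⟩, if_pos ht]
    · rw [if_pos ⟨Nat.pos_of_ne_zero hm, fun hp => ht hp.1⟩, if_neg ht]

theorem mStar_eq_sum (h : GoodPS f g) {B : Bar} (hnc : NonColl f g B) : mStar f g B =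
    ∑ c ∈ ptFinset f g B, if TrunkAt f g B c then 0 else meroMult f g B c := by
  rw [mStar, finsum_mem_def]
  simp_rw [pureZeros_indicator h]
  refine finsum_eq_sum_of_support_subset _ fun c hc => mero_mem_ptFinset h hnc fun h0 => hc ?_
  change (if TrunkAt f g B c then 0 else meroMult f g B c) = 0
  rw [h0, ite_self]

/-- The number of polar roots that leave the tree on a bar. -/
theorem leaves_count (h : GoodPS f g) {B : Bar} (hB : ProperBar B) (hnc : NonColl f g B) :
    (rootMS (jac f g)).countP (Leaves f g · B) = mStar f g B := by
  rw [mStar_eq_sum h hnc]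
  refine (countP_exists _ (fun γ a => ClimbsAt γ B a ∧ ¬ TrunkAt f g B a)
    (ptFinset f g B) ?_ ?_).trans ?_
  rotate_left 2
  · refine Finset.sum_congr rfl fun c _ => ?_
    split_ifs with ht
    · rw [Multiset.countP_eq_zero]
      exact fun γ _ hγ => hγ.2 ht
    · have h1 := cnt_jac_of_delta h hB hnc (delta_eq_zero h ht)
      rw [mult_eq_zero h ht, mult_eq_zero h.symm (fun h' => ht (trunkAt_symm.2 h')), zero_add,
        zero_add] at h1
      rw [← h1, cnt]
      exact Multiset.countP_congr rfl fun γ _ => propext (and_iff_left ht)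
  · exact fun γ b b' h1 h2 => h1.1.2.symm.trans h2.1.2
  · intro γ hγ b hb
    rw [← hb.1.2]; exact mem_ptFinset (Or.inl hγ)

theorem collPts_finite (h : GoodPS f g) (B : Bar) : (collPts f g B).Finite :=
  (ptFinset f g B).finite_toSet.subset fun _ hc => trunk_mem_ptFinset h hc.1

/-- An equivalence preserves the total multiplicity and the multiplicities at collinear points; this
recovers the pure part from them. -/
theorem mStar_add (h : GoodPS f g) {B : Bar} (hnc : NonColl f g B) :
    mStar f g B + ∑ᶠ c ∈ collPts f g B, meroMult f g B c = meroTotal f g B := by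
  rw [mStar_eq_sum h hnc, meroTotal_eq_sum h hnc, finsum_mem_def,
    finsum_eq_sum_of_support_subset (s := ptFinset f g B), ← Finset.sum_add_distrib]
  · refine Finset.sum_congr rfl fun c _ => ?_
    rw [Set.indicator_apply]
    by_cases ht : TrunkAt f g B c
    · rw [if_pos ht, zero_add]
      split_ifs with hc
      · rfl
      · by_contra hm
        have hd : delta f g B c = 0 := by
          by_contra hd; exact hm (meroMult_of_delta_ne h hd).symm
        exact hc ⟨ht, hd⟩
    · rw [if_neg ht, if_neg fun hc => ht hc.1, add_zero]
  · intro c hc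
    rw [Function.mem_support, Set.indicator_apply, ne_eq, ite_eq_right_iff, not_forall] at hc
    exact trunk_mem_ptFinset h hc.1.1

/-! ### Polar roots over collinear points -/

theorem bars_finite (h : GoodPS f g) : {B | IsBar f g B}.Finite := by
  have hfin := (allRoots_finite h).prod (allRoots_finite h)
  refine ((hfin.image fun p : Ser × Ser => (⟨(contact p.1 p.2).untopD 0,
    truncLT ((contact p.1 p.2).untopD 0) p.1⟩ : Bar)).insert ground).subset ?_
  rintro B (hB | ⟨ξ, hξ, η, hη, h1, h2⟩)
  · exact Or.inl hB
  · refine Or.inr ⟨(ξ, η), ⟨hξ, hη⟩, ?_⟩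
    cases B
    dsimp only at h1 h2 ⊢
    rw [h1, WithTop.untopD_coe, h2]

theorem boundedBy_iff {γ : Ser} {B : Bar} : BoundedBy γ B ↔ ¬ Climbs γ B := by
  rw [BoundedBy, climbs_iff_contact IsBar.stem_climbs, not_le]

theorem LiesOver.of_climbs {B B' : Bar} {c : ℂ} {γ : Ser} (h : LiesOver B c B')
    (hγ : Climbs γ B') : ClimbsAt γ B c := by
  rw [climbs_iff] at hγ
  refine ⟨fun e he => ?_, ?_⟩
  · rw [hγ e (he.trans h.1), h.2.1 e he]
  · rw [hγ _ h.1, h.2.2]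

theorem liesAbove_of_climbs {B B' : Bar} {γ : Ser} (h : B.height < B'.height) (h1 : Climbs γ B)
    (h2 : Climbs γ B') : LiesAbove B B' := by
  rw [climbs_iff] at h1 h2
  exact ⟨_, h, fun e he => by rw [← h2 e (he.trans h), h1 e he], rfl⟩

/-- Two bars with a common climbing arc are nested or equal, and in a nested pair the lower one
would be a non-collinear bar strictly between `B` and the upper one. -/
theorem cover_unique {B B₁ B₂ : Bar} {c : ℂ} {γ : Ser} (h1 : B₁ ∈ cover f g B c)
    (h2 : B₂ ∈ cover f g B c) (hγ1 : Climbs γ B₁) (hγ2 : Climbs γ B₂) : B₁ = B₂ := by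
  rcases lt_trichotomy B₁.height B₂.height with hlt | heq | hlt
  · exact absurd h1.2.1 (h2.2.2.2 B₁ h1.1 ⟨c, h1.2.2.1⟩ (liesAbove_of_climbs hlt hγ1 hγ2))
  · exact h1.1.ext h2.1 heq hγ1 hγ2
  · exact absurd h2.2.1 (h1.2.2.2 B₂ h2.1 ⟨c, h2.2.2.1⟩ (liesAbove_of_climbs hlt hγ2 hγ1))

/-- The number of roots of the Jacobian over `c` that are bounded by the cover of `c`. -/
def coverCount (f g : PS) (B : Bar) (c : ℂ) : ℕ :=
  (rootMS (jac f g)).countP fun γ => ClimbsAt γ B c ∧ ∀ B' ∈ cover f g B c, BoundedBy γ B'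

/-- A root of `J` over `c` is either bounded by the whole cover or climbs over exactly one of its
bars, and an arc climbing over a bar of the cover passes through `c`. -/
theorem coverCount_add (h : GoodPS f g) (B : Bar) (c : ℂ) :
    coverCount f g B c + ∑ᶠ B' ∈ cover f g B c, climbTot (jac f g) B' =
      cnt (jac f g) B c := by
  have hfin : (cover f g B c).Finite := (bars_finite h).subset fun B' hB' => hB'.1
  rw [finsum_mem_eq_finite_toFinset_sum _ hfin, coverCount, cnt]
  have h1 := countP_exists (rootMS (jac f g)) (fun γ B' => B' ∈ cover f g B c ∧ Climbs γ B')
    hfin.toFinset (fun γ B₁ B₂ h1 h2 => cover_unique h1.1 h2.1 h1.2 h2.2)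
    (fun γ _ B' hB' => hfin.mem_toFinset.2 hB'.1)
  have h2 : ∑ B' ∈ hfin.toFinset, (rootMS (jac f g)).countP
      (fun γ => B' ∈ cover f g B c ∧ Climbs γ B') =
      ∑ B' ∈ hfin.toFinset, climbTot (jac f g) B' := by
    refine Finset.sum_congr rfl fun B' hB' => ?_
    exact Multiset.countP_congr rfl fun γ _ => propext (and_iff_right (hfin.mem_toFinset.1 hB'))
  rw [← h2, ← h1]
  induction rootMS (jac f g) using Multiset.induction_on with
  | empty => simp
  | cons a s ih =>
    simp only [Multiset.countP_cons]
    rw [← ih]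
    by_cases hc : ∃ B' ∈ cover f g B c, Climbs a B'
    · obtain ⟨B', hB', hcl⟩ := hc
      have ha := hB'.2.2.1.of_climbs hcl
      rw [if_neg (fun h' => boundedBy_iff.1 (h'.2 B' hB') hcl), if_pos ⟨B', hB', hcl⟩, if_pos ha]
      omega
    · have h3 : (ClimbsAt a B c ∧ ∀ B' ∈ cover f g B c, BoundedBy a B') ↔ ClimbsAt a B c :=
        and_iff_left fun B' hB' => boundedBy_iff.2 fun hcl => hc ⟨B', hB', hcl⟩
      rw [if_neg hc, if_congr h3 rfl rfl]
      omega

/-- The number of polar roots counted by `polyQ` on a bar. -/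
def collCount (f g : PS) (B : Bar) : ℕ :=
  (rootMS (jac f g)).countP fun γ => ∃ c ∈ collPts f g B,
    ClimbsAt γ B c ∧ ∀ B' ∈ cover f g B c, BoundedBy γ B'

theorem collCount_eq (h : GoodPS f g) (B : Bar) :
    collCount f g B = ∑ᶠ c ∈ collPts f g B, coverCount f g B c := by
  rw [finsum_mem_eq_finite_toFinset_sum _ (collPts_finite h B), collCount]
  refine (countP_exists _ _ (collPts_finite h B).toFinset ?_ ?_).trans ?_
  rotate_left 2
  · refine Finset.sum_congr rfl fun c hc => ?_
    exact Multiset.countP_congr rfl fun γ _ =>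
      propext (and_iff_right ((collPts_finite h B).mem_toFinset.1 hc))
  · exact fun γ c c' h1 h2 => h1.2.1.2.symm.trans h2.2.1.2
  · exact fun γ _ c hc => (collPts_finite h B).mem_toFinset.2 hc.1

end

/-! ### Invariance of the counts -/

section

variable {f g f' g' : PS} {σ : Ser → Ser}

theorem TreeEquiv.mStar_eq (h : TreeEquiv f g f' g' σ) (hg : GoodPS f g) (hg' : GoodPS f' g')
    {B B' : Bar} (hB : IsBar f g B) (hB' : IsBar f' g' B') (hc : BarCorr f g σ B B')
    (hnc : NonColl f g B) : mStar f g B = mStar f' g' B' := by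
  have hnc' := (h.iso.nonColl_iff hg hg' hB hB' hc).1 hnc
  obtain ⟨π, -, hpt, -, hπ⟩ := h.iso.collPts_bij hg hg' hB hB' hc
  have h1 := mStar_add hg hnc
  have h2 := mStar_add hg' hnc'
  have h3 : ∑ᶠ c ∈ collPts f g B, meroMult f g B c =
      ∑ᶠ c ∈ collPts f' g' B', meroMult f' g' B' c :=
    finsum_mem_eq_of_bijOn π hπ fun c hc1 =>
      h.meroMult_eq B B' hB hB' hc hnc c hc1 _ (hπ.mapsTo hc1) (hpt c hc1.1)
  have h4 := h.meroTotal_eq B B' hB hB' hc hnc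
  omega

theorem TreeIso.climbTot_eq (h : TreeIso f g f' g' σ) (hg : GoodPS f g) (hg' : GoodPS f' g')
    {B B' : Bar} (hc : BarCorr f g σ B B') : climbTot f B = climbTot f' B' := by
  rw [climbTot, climbTot, h.rootMS_eq hg hg', Multiset.countP_map, Multiset.countP_eq_card_filter]
  congr 1
  exact Multiset.filter_congr fun ξ hξ => hc.2 ξ (Or.inl ((mem_rootMS hg.ne_left).1 hξ))

theorem TreeIso.card_ncPts_eq (h : TreeIso f g f' g' σ) (hg : GoodPS f g) (hg' : GoodPS f' g')
    {B B' : Bar} (hB : IsBar f g B) (hB' : IsBar f' g' B') (hc : BarCorr f g σ B B') :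
    (ncPts f g B).card = (ncPts f' g' B').card := by
  obtain ⟨π, hπ, -, hd, -⟩ := h.collPts_bij hg hg' hB hB' hc
  have ht : ∀ c, delta f g B c ≠ 0 → TrunkAt f g B c := (finite_delta_support hg B).2
  have ht' : ∀ c, delta f' g' B' c ≠ 0 → TrunkAt f' g' B' c := (finite_delta_support hg' B').2
  refine Finset.card_bij (fun c _ => π c) ?_ ?_ ?_
  · intro c hc1
    rw [mem_ncPts hg] at hc1
    rw [mem_ncPts hg', ← hd c (ht c hc1)]; exact hc1
  · intro c hc1 c₂ hc2 he
    rw [mem_ncPts hg] at hc1 hc2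
    exact hπ.injOn (ht c hc1) (ht c₂ hc2) he
  · intro c' hc'
    rw [mem_ncPts hg'] at hc'
    obtain ⟨c, hc1, rfl⟩ := hπ.surjOn (ht' c' hc')
    exact ⟨c, by rw [mem_ncPts hg, hd c hc1]; exact hc', rfl⟩

theorem TreeEquiv.climbTot_jac_eq (h : TreeEquiv f g f' g' σ) (hg : GoodPS f g)
    (hg' : GoodPS f' g') {B B' : Bar} (hB : IsBar f g B) (hB' : IsBar f' g' B')
    (hpos : 0 < B.height) (hc : BarCorr f g σ B B') (hnc : NonColl f g B) :
    climbTot (jac f g) B = climbTot (jac f' g') B' := by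
  have hnc' := (h.iso.nonColl_iff hg hg' hB hB' hc).1 hnc
  have h1 := climbTot_jac hg (hB.proper hpos) hnc
  have h2 := climbTot_jac hg' (hB'.proper (hc.1 ▸ hpos)) hnc'
  rw [← h.meroTotal_eq B B' hB hB' hc hnc, ← h.iso.climbTot_eq hg hg' hc,
    ← h.iso.swap.climbTot_eq hg.symm hg'.symm ⟨hc.1, fun ξ hξ => hc.2 ξ hξ.symm⟩,
    ← h.iso.card_ncPts_eq hg hg' hB hB' hc] at h2
  omega

/-- The number of roots of `J` over `c` and the numbers climbing over the bars of the cover are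
invariant by the counting formulas, hence so is their difference. -/
theorem TreeEquiv.coverCount_eq (h : TreeEquiv f g f' g' σ) (hg : GoodPS f g)
    (hg' : GoodPS f' g') {B B' : Bar} (hB : IsBar f g B) (hB' : IsBar f' g' B')
    (hpos : 0 < B.height) (hc : BarCorr f g σ B B') (hnc : NonColl f g B) {c c' : ℂ}
    (hcc : c ∈ collPts f g B) (hcc' : c' ∈ collPts f' g' B') (hp : PtCorr f g σ B c B' c') :
    coverCount f g B c = coverCount f' g' B' c' := by
  have hnc' := (h.iso.nonColl_iff hg hg' hB hB' hc).1 hnc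
  obtain ⟨β, hβ, hβc⟩ := h.iso.exists_barMap
  have hβc' : ∀ B, IsBar f g B → BarCorr f g σ B (β B) :=
    fun B hB => (hβc B hB _ (hβ.mapsTo hB)).2 rfl
  have hcov := h.iso.cover_bij hg hg' hB hc hp hβ hβc'
  have h1 := coverCount_add hg B c
  have h2 := coverCount_add hg' B' c'
  have h3 : ∑ᶠ B₁ ∈ cover f g B c, climbTot (jac f g) B₁ =
      ∑ᶠ B₁ ∈ cover f' g' B' c', climbTot (jac f' g') B₁ :=
    finsum_mem_eq_of_bijOn β hcov fun B₁ hB₁ =>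
      h.climbTot_jac_eq hg hg' hB₁.1 (hβ.mapsTo hB₁.1) (hpos.trans hB₁.2.2.1.1) (hβc' _ hB₁.1)
        hB₁.2.1
  rw [cnt_jac_of_delta hg (hB.proper hpos) hnc hcc.2] at h1
  rw [cnt_jac_of_delta hg' (hB'.proper (hc.1 ▸ hpos)) hnc' hcc'.2, ← h.iso.mult_eq hp,
    ← h.iso.swap.mult_eq (fun ξ hξ => hp ξ hξ.symm),
    ← h.meroMult_eq B B' hB hB' hc hnc c hcc c' hcc' hp] at h2
  omega

theorem TreeEquiv.collCount_eq (h : TreeEquiv f g f' g' σ) (hg : GoodPS f g)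
    (hg' : GoodPS f' g') {B B' : Bar} (hB : IsBar f g B) (hB' : IsBar f' g' B')
    (hpos : 0 < B.height) (hc : BarCorr f g σ B B') (hnc : NonColl f g B) :
    collCount f g B = collCount f' g' B' := by
  obtain ⟨π, -, hpt, -, hπ⟩ := h.iso.collPts_bij hg hg' hB hB' hc
  rw [PolarTree.collCount_eq hg, PolarTree.collCount_eq hg']
  exact finsum_mem_eq_of_bijOn π hπ fun c hc1 =>
    h.coverCount_eq hg hg' hB hB' hpos hc hnc hc1 (hπ.mapsTo hc1) (hpt c hc1.1)

end

end PolarTree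
end

noncomputable section

namespace PolarTree

open HahnSeries
open scoped Classical

/-! ### The Galois action on roots and bars -/

theorem theta_iterate_orderTop (k : ℕ) (ξ : Ser) : (theta^[k] ξ).orderTop = ξ.orderTop := by
  induction k with
  | zero => rfl
  | succ k ih => rw [Function.iterate_succ_apply', theta_orderTop, ih]

theorem theta_injective : Function.Injective theta := by
  intro a b h
  have h1 : (theta (a - b)).orderTop = ⊤ := by rw [map_sub, h, sub_self, orderTop_zero]
  rw [theta_orderTop, orderTop_eq_top, sub_eq_zero] at h1
  exact h1

theorem contact_theta (ξ η : Ser) : contact (theta ξ) (theta η) = contact ξ η := by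
  rw [contact, ← map_sub, theta_orderTop, contact]

theorem PosArc.theta {ξ : Ser} (h : PosArc ξ) : PosArc (theta ξ) :=
  ⟨theta_isArc h.1, by rw [theta_orderTop]; exact h.2⟩

theorem exists_period {ξ : Ser} (h : IsArc ξ) : ∃ n, 0 < n ∧ theta^[n] ξ = ξ := by
  obtain ⟨D, hD, h⟩ := h
  refine ⟨D, hD, ?_⟩
  ext e
  rw [theta_iterate_coeff]
  by_cases he : ξ.coeff e = 0
  · rw [he, mul_zero]
  · obtain ⟨n, rfl⟩ := h e he
    have hD0 : (D : ℚ) ≠ 0 := by exact_mod_cast hD.ne'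
    rw [chi_pow, mul_div_cancel₀ _ hD0, (chi_eq_one_iff _).2 ⟨n, by push_cast; rfl⟩, one_mul]

theorem theta_mem_roots {F : PS} {ξ : Ser} (h : ξ ∈ roots F) : theta ξ ∈ roots F :=
  ⟨(roots_posArc h).theta.1, (roots_posArc h).theta.2, by
    rw [evalArc_theta F (roots_posArc h).2, h.2.2, map_zero]⟩

theorem theta_iterate_mem_roots {F : PS} {ξ : Ser} (h : ξ ∈ roots F) (k : ℕ) :
    theta^[k] ξ ∈ roots F := by
  induction k with
  | zero => exact h
  | succ k ih => rw [Function.iterate_succ_apply']; exact theta_mem_roots ih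

theorem theta_bijOn_roots (F : PS) : Set.BijOn theta (roots F) (roots F) := by
  refine ⟨fun ξ hξ => theta_mem_roots hξ, theta_injective.injOn, fun ξ hξ => ?_⟩
  obtain ⟨n, hn, h⟩ := exists_period hξ.1
  obtain ⟨m, rfl⟩ := Nat.exists_eq_succ_of_ne_zero hn.ne'
  exact ⟨theta^[m] ξ, theta_iterate_mem_roots hξ m, by
    rw [← Function.iterate_succ_apply' (f := theta)]; exact h⟩

theorem treeIso_theta (f g : PS) : TreeIso f g f g theta :=
  ⟨theta_bijOn_roots f, theta_bijOn_roots g, fun ξ _ η _ => contact_theta ξ η, rfl, rfl⟩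

theorem rootMult_theta (F : PS) {ξ : Ser} (h : PosArc ξ) :
    rootMult F (theta ξ) = rootMult F ξ := by
  rw [rootMult, rootMult]
  congr 1
  ext n
  rw [Set.mem_ofPred_eq, Set.mem_ofPred_eq, evalArc_theta _ h.2, map_ne_zero_iff _ theta_injective]

theorem rootMS_theta (F : PS) : (rootMS F).map theta = rootMS F := by
  by_cases hF : F = 0
  · rw [rootMS, dif_neg (not_not.2 hF), Multiset.map_zero]
  ext ξ
  by_cases hξ : ξ ∈ roots F
  · obtain ⟨η, hη, rfl⟩ := (theta_bijOn_roots F).surjOn hξ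
    rw [Multiset.count_map_eq_count' _ _ theta_injective, count_rootMS hF hη, count_rootMS hF hξ,
      rootMult_theta F (roots_posArc hη)]
  · rw [Multiset.count_eq_zero.2, Multiset.count_eq_zero.2]
    · rwa [mem_rootMS hF]
    · rw [Multiset.mem_map]
      rintro ⟨η, hη, rfl⟩
      exact hξ (theta_mem_roots ((mem_rootMS hF).1 hη))

/-- The conjugate of a bar. -/
def thetaBar (B : Bar) : Bar := ⟨B.height, theta B.stem⟩

theorem thetaBar_iterate (k : ℕ) (B : Bar) :
    thetaBar^[k] B = ⟨B.height, theta^[k] B.stem⟩ := by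
  induction k with
  | zero => rfl
  | succ k ih => rw [Function.iterate_succ_apply', ih, Function.iterate_succ_apply']; rfl

theorem Climbs.theta {ξ : Ser} {B : Bar} (h : Climbs ξ B) : Climbs (theta ξ) (thetaBar B) :=
  climbs_iff.2 fun e he => by
    change _ = (PolarTree.theta B.stem).coeff e
    rw [theta_coeff, theta_coeff, climbs_iff.1 h e he]

theorem climbs_theta_iff {ξ : Ser} {B : Bar} : Climbs (theta ξ) (thetaBar B) ↔ Climbs ξ B := by
  refine ⟨fun h => climbs_iff.2 fun e he => ?_, Climbs.theta⟩
  have h1 : (theta ξ).coeff e = (theta B.stem).coeff e := climbs_iff.1 h e he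
  rw [theta_coeff, theta_coeff] at h1
  exact mul_left_cancel₀ (chi_ne_zero e) h1

theorem climbsAt_theta_iff {ξ : Ser} {B : Bar} {c : ℂ} :
    ClimbsAt (theta ξ) (thetaBar B) (chi B.height * c) ↔ ClimbsAt ξ B c := by
  rw [climbsAt_iff, climbsAt_iff, climbs_theta_iff]
  refine and_congr_right fun _ => ?_
  change (theta ξ).coeff B.height = _ ↔ _
  rw [theta_coeff, mul_right_inj' (chi_ne_zero _)]

theorem Climbs.theta_iterate {ξ : Ser} {B : Bar} (h : Climbs ξ B) (k : ℕ) :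
    Climbs (PolarTree.theta^[k] ξ) (thetaBar^[k] B) := by
  induction k with
  | zero => exact h
  | succ k ih => rw [Function.iterate_succ_apply', Function.iterate_succ_apply']; exact ih.theta

section

variable {f g : PS}

theorem barCorr_theta (B : Bar) : BarCorr f g theta B (thetaBar B) :=
  ⟨rfl, fun _ _ => climbs_theta_iff.symm⟩

theorem ptCorr_theta (B : Bar) (c : ℂ) :
    PtCorr f g theta B c (thetaBar B) (chi B.height * c) :=
  fun _ _ => climbsAt_theta_iff.symm

theorem IsBar.thetaBar {B : Bar} (hB : IsBar f g B) : IsBar f g (thetaBar B) := by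
  obtain ⟨B', hB', hc⟩ := (treeIso_theta f g).exists_corr hB
  have : B' = PolarTree.thetaBar B := by
    have h1 : Climbs (theta B.stem) B' := by
      by_cases h0 : 0 < B.height
      · obtain ⟨ξ, hξ, hcl, -⟩ := hB.exists_root h0
        have h2 := climbs_iff.1 ((hc.2 ξ hξ).1 hcl)
        refine climbs_iff.2 fun e he => ?_
        rw [← h2 e he, theta_coeff, theta_coeff, climbs_iff.1 hcl e (hc.1 ▸ he)]
      · have h3 : B' = ground := hB'.eq_ground
          (hc.1.symm.trans (le_antisymm (not_lt.1 h0) hB.nonneg))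
        rw [h3]
        exact (posArc_climbs_ground hB.posArc.theta).climbs
    have hst : B'.stem = theta B.stem := by
      ext e
      by_cases he : e < B'.height
      · exact (climbs_iff.1 h1 e he).symm
      · rw [hB'.stem_coeff (not_lt.1 he), theta_coeff, hB.stem_coeff (hc.1 ▸ not_lt.1 he), mul_zero]
    rw [PolarTree.thetaBar, ← hst, hc.1]
  exact this ▸ hB'

theorem IsBar.thetaBar_iterate {B : Bar} (hB : IsBar f g B) (k : ℕ) :
    IsBar f g (PolarTree.thetaBar^[k] B) := by
  induction k with
  | zero => exact hB
  | succ k ih => rw [Function.iterate_succ_apply']; exact ih.thetaBar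

theorem thetaBar_bijOn :
    Set.BijOn thetaBar {B | IsBar f g B} {B | IsBar f g B} := by
  obtain ⟨β, hβ, hβc⟩ := (treeIso_theta f g).exists_barMap
  exact hβ.congr fun B hB => ((hβc B hB _ hB.thetaBar).1 (barCorr_theta B)).symm

end

/-! ### Minimal polynomials of arcs and conjugate bars -/

theorem evalArc_represents {F : ConvPS} {p : Polynomial Ser} (h : Represents F p) {ξ : Ser}
    (hξ : PosArc ξ) : evalArc (F : PS) ξ = p.eval ξ := by
  rw [represents_iff] at h
  let P : Polynomial (PowerSeries ℂ) :=
    ∑ i ∈ Finset.range (p.natDegree + 1), Polynomial.monomial i (row i (F : PS))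
  have hP : ∀ i, P.coeff i = row i (F : PS) := by
    intro i
    simp only [P, Polynomial.finsetSum_coeff, Polynomial.coeff_monomial]
    rw [Finset.sum_ite_eq']
    split_ifs with hi
    · rfl
    · rw [Finset.mem_range, not_lt] at hi
      apply psi_injective 1
      rw [h, Polynomial.coeff_eq_zero_of_natDegree_lt (by omega), map_zero]
  have h1 : (F : PS) = ofPoly P := by
    apply PS.ext; intro i j
    rw [coeff_ofPoly, hP, coeff_row]
  rw [h1, evalArc_ofPoly _ hξ]
  congr 1
  ext1 i
  rw [Polynomial.coeff_map, hP, h]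

theorem eval_monicProd_eq_zero {s : Multiset Ser} {ξ : Ser} :
    (monicProd s).eval ξ = 0 ↔ ξ ∈ s := eval_prod_ne

theorem evalArc_unit_conv {u : ConvPS} (hu : IsUnit u) {ξ : Ser} (h : PosArc ξ) :
    evalArc (u : PS) ξ ≠ 0 := by
  obtain ⟨v, hv⟩ := isUnit_iff_exists_inv.1 hu
  intro h0
  have h1 : evalArc ((u : PS) * (v : PS)) ξ = 1 := by
    have h2 : ((u : PS) * (v : PS)) = 1 := congrArg Subtype.val hv
    rw [h2]; exact map_one (evHom ξ h)
  rw [evalArc_mul h, h0, zero_mul] at h1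
  exact zero_ne_one h1

/-- The orbit of an arc under the Galois action. -/
def orbit (ξ : Ser) (n : ℕ) : Finset Ser := (Finset.range n).image fun k => theta^[k] ξ

theorem mem_orbit {ξ : Ser} {n : ℕ} (hn : 0 < n) (h : theta^[n] ξ = ξ) {η : Ser} :
    η ∈ orbit ξ n ↔ ∃ k, η = theta^[k] ξ := by
  rw [orbit, Finset.mem_image]
  constructor
  · rintro ⟨k, -, rfl⟩; exact ⟨k, rfl⟩
  · rintro ⟨k, rfl⟩
    refine ⟨k % n, Finset.mem_range.2 (Nat.mod_lt _ hn), ?_⟩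
    have hp : Function.IsPeriodicPt theta n ξ := h
    exact hp.iterate_mod_apply k

/-- `q` is the product of `x - γ` over the Galois orbit of `ξ`. It divides every convergent series
vanishing along `ξ`, since such a series vanishes along the orbit; a factor of `q` vanishing along
`ξ` is thus divisible by `q`, which gives irreducibility. -/
theorem exists_minimal {ξ : Ser} (h : AlgArc ξ) : ∃ q : ConvPS, Irreducible q ∧
    (∀ η, PosArc η → (evalArc (q : PS) η = 0 ↔ ∃ k, η = theta^[k] ξ)) ∧
    ∀ F : ConvPS, evalArc (F : PS) ξ = 0 → q ∣ F := by
  obtain ⟨n, hn, hper⟩ := exists_period h.posArc.1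
  obtain ⟨J, hJ, hJc, hξ⟩ := h
  set s := (orbit ξ n).val with hs
  have hmem : ∀ η, η ∈ s ↔ ∃ k, η = theta^[k] ξ := fun η => mem_orbit hn hper
  have halg : ∀ γ ∈ s, AlgArc γ := by
    intro γ hγ
    obtain ⟨k, rfl⟩ := (hmem γ).1 hγ
    exact ⟨J, hJ, hJc, theta_iterate_mem_roots hξ k⟩
  have hθ : s.map theta = s := by
    refine Multiset.eq_of_le_of_card_le ?_ (by rw [Multiset.card_map])
    rw [Multiset.le_iff_subset ((orbit ξ n).nodup.map theta_injective)]
    intro η hη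
    obtain ⟨γ, hγ, rfl⟩ := Multiset.mem_map.1 hη
    obtain ⟨k, rfl⟩ := (hmem γ).1 hγ
    exact (hmem _).2 ⟨k + 1, by rw [Function.iterate_succ_apply']⟩
  obtain ⟨q, hq⟩ := exists_represents s halg hθ
  have hroot : ∀ η, PosArc η → (evalArc (q : PS) η = 0 ↔ ∃ k, η = theta^[k] ξ) := by
    intro η hη
    rw [evalArc_represents hq hη, eval_monicProd_eq_zero, hmem]
  have hdvd : ∀ F : ConvPS, evalArc (F : PS) ξ = 0 → q ∣ F := by
    intro F hF
    refine hq.dvd (orbit ξ n).nodup halg fun γ hγ => ?_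
    obtain ⟨k, rfl⟩ := (hmem γ).1 hγ
    exact (theta_iterate_mem_roots (F := (F : PS)) ⟨hξ.1, hξ.2.1, hF⟩ k).2.2
  have hp := roots_posArc hξ
  have hq0 : evalArc (q : PS) ξ = 0 := (hroot ξ hp).2 ⟨0, rfl⟩
  have hqne : q ≠ 0 := by
    rintro rfl
    -- If `q` were zero, `ξ + y` would be a conjugate of `ξ`; but conjugation fixes the coefficient
    -- of `y`.
    have h1 := (hroot (theta^[0] ξ + yS) ((show PosArc ξ from hp).add yS_posArc)).1
      (evalArc_zero ((show PosArc ξ from hp).add yS_posArc))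
    obtain ⟨k, hk⟩ := h1
    have h2 := congrArg (fun s => s.coeff 1) hk
    have h3 : yS.coeff 1 = 1 := coeff_single_same _ _
    have hc1 : chi 1 = 1 := (chi_eq_one_iff 1).2 ⟨1, by norm_num⟩
    simp only [theta_iterate_coeff, coeff_add, hc1, h3, one_pow, one_mul, pow_zero] at h2
    exact one_ne_zero (add_eq_left.1 h2)
  refine ⟨q, ⟨fun hu => evalArc_unit_conv hu hp hq0, ?_⟩, hroot, hdvd⟩
  intro a b hab
  have h1 : evalArc (a : PS) ξ * evalArc (b : PS) ξ = 0 := by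
    rw [← evalArc_mul hp, ← hq0, hab]; rfl
  rcases mul_eq_zero.1 h1 with h2 | h2
  · obtain ⟨a', rfl⟩ := hdvd a h2
    right
    refine IsUnit.of_mul_eq_one a' ?_
    apply mul_left_cancel₀ hqne
    rw [mul_one]; conv_rhs => rw [hab]
    ring
  · obtain ⟨b', rfl⟩ := hdvd b h2
    left
    refine IsUnit.of_mul_eq_one b' ?_
    apply mul_left_cancel₀ hqne
    rw [mul_one]; conv_rhs => rw [hab]
    ring

theorem algArc_zero : AlgArc 0 := by
  refine ⟨MvPowerSeries.X 0, ?_, Cvg.X 0, posArc_zero.1, posArc_zero.2, evalArc_X0 posArc_zero.2⟩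
  intro h
  have := congrArg (MvPowerSeries.coeff (Finsupp.single 0 1)) h
  simp at this

theorem algArc_of_root {F : ConvPS} (hF : (F : PS) ≠ 0) {ξ : Ser} (h : ξ ∈ roots (F : PS)) :
    AlgArc ξ := ⟨F, hF, (isConv_iff _).1 F.2, h⟩

theorem GoodPair.goodPS {f g : ConvPS} (h : GoodPair f g) : GoodPS (f : PS) g := h

/-- The roots of an irreducible series form a single orbit of `theta`, because it is associated to
the minimal series of any of its roots. -/
theorem conj_iff {f g : ConvPS} (h : GoodPair f g) {B B' : Bar} (hB : IsBar (f : PS) g B)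
    (hB' : IsBar (f : PS) g B') : Conj B B' ↔ ∃ k, B' = thetaBar^[k] B := by
  constructor
  · rintro ⟨hh, p, hp, ⟨ξ, hξ, hcl⟩, η, hη, hcl'⟩
    have hpne : (p : PS) ≠ 0 := fun h0 => hp.ne_zero (Subtype.ext h0)
    obtain ⟨q, hq, hroot, hdvd⟩ := exists_minimal (algArc_of_root hpne hξ)
    have hqp : q ∣ p := hdvd p hξ.2.2
    obtain ⟨u, hu⟩ := hqp
    have hun : IsUnit u := (hp.isUnit_or_isUnit hu).resolve_left hq.not_isUnit
    have h1 : evalArc (q : PS) η * evalArc (u : PS) η = 0 := by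
      rw [← evalArc_mul (roots_posArc hη), ← hη.2.2, hu]; rfl
    obtain ⟨k, rfl⟩ := (hroot η (roots_posArc hη)).1
      ((mul_eq_zero.1 h1).resolve_right (evalArc_unit_conv hun (roots_posArc hη)))
    refine ⟨k, hB'.ext (hB.thetaBar_iterate k) ?_ hcl' (hcl.theta_iterate k)⟩
    rw [thetaBar_iterate, hh]
  · rintro ⟨k, rfl⟩
    refine ⟨by rw [thetaBar_iterate], ?_⟩
    obtain ⟨ξ, hξ, hcl⟩ : ∃ ξ, AlgArc ξ ∧ Climbs ξ B := by
      by_cases h0 : 0 < B.height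
      · obtain ⟨ξ, hξ, hcl, -⟩ := hB.exists_root h0
        refine ⟨ξ, ?_, hcl⟩
        rcases hξ with hξ | hξ
        · exact algArc_of_root h.goodPS.ne_left hξ
        · exact algArc_of_root h.goodPS.ne_right hξ
      -- There may be no root of `f g` climbing over the ground bar, so the arc `0` is used instead.
      · refine ⟨0, algArc_zero, ?_⟩
        rw [hB.eq_ground (le_antisymm (not_lt.1 h0) hB.nonneg)]
        exact (posArc_climbs_ground posArc_zero).climbs
    obtain ⟨q, hq, hroot, -⟩ := exists_minimal hξ
    have hmem : ξ ∈ roots (q : PS) :=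
      ⟨hξ.posArc.1, hξ.posArc.2, (hroot ξ hξ.posArc).2 ⟨0, rfl⟩⟩
    exact ⟨q, hq, ⟨ξ, hmem, hcl⟩, theta^[k] ξ, theta_iterate_mem_roots hmem k, hcl.theta_iterate k⟩

end PolarTree
end

noncomputable section

namespace PolarTree

open HahnSeries
open scoped Classical

/-! ### Conjugacy classes of bars -/

section

variable {f g : PS}

theorem trunkAt_theta_iff {B : Bar} {c : ℂ} :
    TrunkAt f g (thetaBar B) (chi B.height * c) ↔ TrunkAt f g B c := by
  constructor
  · rintro ⟨ξ, hξ, hcl⟩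
    obtain ⟨η, hη, rfl⟩ := (treeIso_theta f g).bij.surjOn hξ
    exact ⟨η, hη, climbsAt_theta_iff.1 hcl⟩
  · rintro ⟨ξ, hξ, hcl⟩
    exact ⟨theta ξ, (treeIso_theta f g).bij.mapsTo hξ, climbsAt_theta_iff.2 hcl⟩

theorem exists_chi_mul (e : ℚ) (a : ℂ) : ∃ b, a = chi e * b :=
  ⟨(chi e)⁻¹ * a, by rw [mul_inv_cancel_left₀ (chi_ne_zero e)]⟩

theorem leaves_theta_iff {γ : Ser} {B : Bar} :
    Leaves f g (theta γ) (thetaBar B) ↔ Leaves f g γ B := by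
  constructor
  · rintro ⟨a, h1, h2⟩
    obtain ⟨b, rfl⟩ := exists_chi_mul B.height a
    exact ⟨b, climbsAt_theta_iff.1 h1, fun h => h2 (trunkAt_theta_iff.2 h)⟩
  · rintro ⟨b, h1, h2⟩
    exact ⟨_, climbsAt_theta_iff.2 h1, fun h => h2 (trunkAt_theta_iff.1 h)⟩

/-- The arc `γ` climbs over `B` at a collinear point and is bounded by the cover of this point. -/
def CollAt (f g : PS) (γ : Ser) (B : Bar) : Prop :=
  ∃ c ∈ collPts f g B, ClimbsAt γ B c ∧ ∀ B' ∈ cover f g B c, BoundedBy γ B'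

theorem CollAt.climbs {γ : Ser} {B : Bar} (h : CollAt f g γ B) : Climbs γ B :=
  let ⟨c, _, h, _⟩ := h; ⟨c, h⟩

theorem Leaves.climbs {γ : Ser} {B : Bar} (h : Leaves f g γ B) : Climbs γ B :=
  let ⟨c, h, _⟩ := h; ⟨c, h⟩

theorem collAt_theta_iff (h : GoodPS f g) {γ : Ser} {B : Bar} (hB : IsBar f g B) :
    CollAt f g (theta γ) (thetaBar B) ↔ CollAt f g γ B := by
  have hcoll : ∀ c, chi B.height * c ∈ collPts f g (thetaBar B) ↔ c ∈ collPts f g B := fun c =>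
    and_congr trunkAt_theta_iff (by
      rw [← (treeIso_theta f g).delta_eq h h hB hB.thetaBar (barCorr_theta B) (ptCorr_theta B c)])
  have hcov : ∀ c, (∀ B' ∈ cover f g (thetaBar B) (chi B.height * c), BoundedBy (theta γ) B') ↔
      ∀ B' ∈ cover f g B c, BoundedBy γ B' := by
    intro c
    have hb := (treeIso_theta f g).cover_bij h h hB (barCorr_theta B) (ptCorr_theta B c)
      thetaBar_bijOn fun B _ => barCorr_theta B
    rw [← hb.image_eq, Set.forall_mem_image]
    refine forall₂_congr fun B' _ => ?_
    rw [boundedBy_iff, boundedBy_iff, climbs_theta_iff]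
  constructor
  · rintro ⟨a, h1, h2, h3⟩
    obtain ⟨b, rfl⟩ := exists_chi_mul B.height a
    exact ⟨b, (hcoll b).1 h1, climbsAt_theta_iff.1 h2, (hcov b).1 h3⟩
  · rintro ⟨b, h1, h2, h3⟩
    exact ⟨_, (hcoll b).2 h1, climbsAt_theta_iff.2 h2, (hcov b).2 h3⟩

theorem exists_bar_period {B : Bar} (hB : IsBar f g B) : ∃ n, 0 < n ∧ thetaBar^[n] B = B := by
  obtain ⟨n, hn, h⟩ := exists_period hB.posArc.1
  exact ⟨n, hn, by rw [thetaBar_iterate, h]⟩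

/-- The Galois orbits of bars. -/
structure IsClass (f g : PS) (K : Set Bar) : Prop where
  exists_eq : ∃ B, IsBar f g B ∧ K = {B' | ∃ k, B' = thetaBar^[k] B}

namespace IsClass

variable {K : Set Bar}

theorem isBar (hK : IsClass f g K) {B : Bar} (h : B ∈ K) : IsBar f g B := by
  obtain ⟨B₀, hB₀, rfl⟩ := hK.exists_eq
  obtain ⟨k, rfl⟩ := h
  exact hB₀.thetaBar_iterate k

theorem thetaBar_mem (hK : IsClass f g K) {B : Bar} (h : B ∈ K) : thetaBar B ∈ K := by
  obtain ⟨B₀, hB₀, rfl⟩ := hK.exists_eq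
  obtain ⟨k, rfl⟩ := h
  exact ⟨k + 1, (Function.iterate_succ_apply' ..).symm⟩

theorem exists_thetaBar (hK : IsClass f g K) {B : Bar} (h : B ∈ K) :
    ∃ B' ∈ K, thetaBar B' = B := by
  obtain ⟨B₀, hB₀, rfl⟩ := hK.exists_eq
  obtain ⟨k, rfl⟩ := h
  obtain ⟨n, hn, hper⟩ := exists_bar_period hB₀
  refine ⟨thetaBar^[k + (n - 1)] B₀, ⟨_, rfl⟩, ?_⟩
  rw [← Function.iterate_succ_apply' (f := PolarTree.thetaBar),
    show (k + (n - 1)).succ = k + n by omega, Function.iterate_add_apply, hper]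

theorem height_eq (hK : IsClass f g K) {B B' : Bar} (h : B ∈ K) (h' : B' ∈ K) :
    B.height = B'.height := by
  obtain ⟨B₀, hB₀, rfl⟩ := hK.exists_eq
  obtain ⟨k, rfl⟩ := h
  obtain ⟨l, rfl⟩ := h'
  rw [thetaBar_iterate, thetaBar_iterate]

theorem induct (hK : IsClass f g K) (p : Bar → Prop)
    (hp : ∀ B, IsBar f g B → (p B ↔ p (thetaBar B))) {B B' : Bar} (h : B ∈ K) (h' : B' ∈ K)
    (hB : p B) : p B' := by
  obtain ⟨B₀, hB₀, rfl⟩ := hK.exists_eq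
  have key : ∀ k, p B₀ ↔ p (thetaBar^[k] B₀) := by
    intro k
    induction k with
    | zero => rfl
    | succ k ih => rw [ih, Function.iterate_succ_apply', hp _ (hB₀.thetaBar_iterate k)]
  obtain ⟨k, rfl⟩ := h
  obtain ⟨l, rfl⟩ := h'
  exact (key l).1 ((key k).2 hB)

theorem nonColl (hK : IsClass f g K) (hg : GoodPS f g) {B B' : Bar} (h : B ∈ K) (h' : B' ∈ K)
    (hB : NonColl f g B) : NonColl f g B' :=
  hK.induct _ (fun B hB => (treeIso_theta f g).nonColl_iff hg hg hB hB.thetaBar (barCorr_theta B))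
    h h' hB

theorem nu_left (hK : IsClass f g K) (hg : GoodPS f g) {B B' : Bar} (h : B ∈ K) (h' : B' ∈ K) :
    nu f B' = nu f B :=
  hK.induct (nu f · = nu f B) (fun B hB => by
    rw [(treeIso_theta f g).nu_eq hg hg hB hB.thetaBar (barCorr_theta B)]) h h' rfl

theorem swap (hK : IsClass f g K) : IsClass g f K := by
  obtain ⟨B, hB, h⟩ := hK.exists_eq
  exact ⟨B, hB.imp id fun ⟨ξ, hξ, η, hη, h⟩ => ⟨ξ, hξ.symm, η, hη.symm, h⟩, h⟩

theorem finite (hK : IsClass f g K) (hg : GoodPS f g) : K.Finite :=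
  (bars_finite hg).subset fun _ h => hK.isBar h

theorem unique (hK : IsClass f g K) {γ : Ser} {B B' : Bar} (h : B ∈ K) (h' : B' ∈ K)
    (hγ : Climbs γ B) (hγ' : Climbs γ B') : B = B' :=
  (hK.isBar h).ext (hK.isBar h') (hK.height_eq h h') hγ hγ'

end IsClass

end

theorem isClass_of_mem {f g : ConvPS} (h : GoodPair f g) {K : Set Bar}
    (hK : K ∈ barClasses (f : PS) g) : IsClass (f : PS) g K := by
  obtain ⟨B, hB, rfl⟩ := hK
  refine ⟨B, hB, ?_⟩
  ext B'
  constructor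
  · rintro ⟨h1, h2⟩; exact (conj_iff h hB h1).1 h2
  · rintro ⟨k, rfl⟩
    exact ⟨hB.thetaBar_iterate k, (conj_iff h hB (hB.thetaBar_iterate k)).2 ⟨k, rfl⟩⟩

section

variable {f g : PS}

/-! ### The ground bar -/

/-- Arcs of positive order climb over the ground bar at `0` only, and a trunk grows there when the
bar is non-collinear. -/
theorem not_leaves_ground (hnc : NonColl f g ground) {γ : Ser} (hγ : PosArc γ) :
    ¬ Leaves f g γ ground := by
  rintro ⟨a, ha, hna⟩
  obtain ⟨c, ⟨ξ, hξ, hcl⟩, -⟩ := hnc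
  apply hna
  have h1 := (posArc_climbs_ground hγ).2
  rw [ha.2] at h1
  exact ⟨ξ, hξ, h1 ▸ posArc_climbs_ground (allRoots_posArc hξ)⟩

theorem collPts_ground (hnc : NonColl f g ground) : collPts f g ground = ∅ := by
  obtain ⟨c, ⟨ξ, hξ, hcl⟩, hd⟩ := hnc
  have h0 := hcl.2.symm.trans (posArc_climbs_ground (allRoots_posArc hξ)).2
  refine Set.eq_empty_of_forall_notMem ?_
  rintro c' ⟨⟨ξ', hξ', hcl'⟩, hd'⟩
  have h0' := hcl'.2.symm.trans (posArc_climbs_ground (allRoots_posArc hξ')).2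
  rw [h0', ← h0] at hd'
  exact hd hd'

/-- The rational function is a constant over `z`, which has no zeros. The ground bar needs its own
argument because the counting formula assumes positive height. -/
theorem mStar_ground (h : GoodPS f g) (hnc : NonColl f g ground) : mStar f g ground = 0 := by
  have hc : ∀ c, delta f g ground c ≠ 0 → c = 0 := by
    intro c hc
    obtain ⟨ξ, hξ, hcl⟩ := (finite_delta_support h ground).2 c hc
    exact hcl.2.symm.trans (posArc_climbs_ground (allRoots_posArc hξ)).2
  have hT : ncPts f g ground = {0} := by
    ext c
    rw [mem_ncPts h, Finset.mem_singleton]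
    refine ⟨hc c, ?_⟩
    rintro rfl
    obtain ⟨c, -, hd⟩ := hnc
    exact (hc c hd) ▸ hd
  rw [mStar_eq_sum h hnc]
  refine Finset.sum_eq_zero fun c _ => ?_
  rw [meroMult_eq h, barNum, hT, sumNum]
  simp

theorem leaves_count_bar (h : GoodPS f g) {B : Bar} (hB : IsBar f g B) (hnc : NonColl f g B) :
    (rootMS (jac f g)).countP (Leaves f g · B) = mStar f g B := by
  by_cases h0 : B = ground
  · subst h0
    rw [mStar_ground h hnc, Multiset.countP_eq_zero]
    intro γ hγ
    by_cases hJ : jac f g = 0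
    · rw [rootMS, dif_neg (not_not.2 hJ)] at hγ
      exact absurd hγ (Multiset.notMem_zero _)
    · exact not_leaves_ground hnc (roots_posArc ((mem_rootMS hJ).1 hγ))
  · exact leaves_count h (hB.proper (hB.pos_of_ne h0)) hnc

/-! ### Products over roots of the Jacobian -/

theorem mem_roots_of_mem_rootMS {F : PS} {γ : Ser} (h : γ ∈ rootMS F) : F ≠ 0 ∧ γ ∈ roots F := by
  by_cases hF : F = 0
  · rw [rootMS, dif_neg (not_not.2 hF)] at h
    exact absurd h (Multiset.notMem_zero _)
  · exact ⟨hF, (mem_rootMS hF).1 h⟩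

theorem rootProd_eq {S : Set Ser} (hS : S ⊆ roots (jac f g)) :
    rootProd f g S = monicProd ((rootMS (jac f g)).filter (· ∈ S)) := by
  rw [rootProd, monicProd]
  by_cases hJ : jac f g = 0
  · rw [rootMS, dif_neg (not_not.2 hJ), Multiset.filter_zero, Multiset.map_zero,
      Multiset.prod_zero]
    refine (finprod_mem_congr rfl fun γ hγ => ?_).trans (finprod_mem_one S)
    -- If `J = 0`, the infimum of the empty set makes all multiplicities `0`, so the product over a
    -- possibly infinite set is still `1`.
    have : rootMult (jac f g) γ = 0 := by
      rw [rootMult]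
      have hz : ∀ n, dx^[n] (jac f g) = 0 := by
        intro n
        rw [hJ]
        induction n with
        | zero => rfl
        | succ n ih => rw [Function.iterate_succ_apply', ih, dx, map_zero]
      convert Nat.sInf_empty
      refine Set.eq_empty_of_forall_notMem fun n hn => hn ?_
      rw [hz]
      exact evalArc_zero (roots_posArc (hS hγ))
    rw [this, pow_zero]
  · have hfin : S.Finite := (roots_finite hJ).subset hS
    rw [finprod_mem_eq_finite_toFinset_prod _ hfin, Finset.prod_multiset_map_count]
    refine Finset.prod_congr ?_ fun γ hγ => ?_
    · ext γ
      rw [hfin.mem_toFinset, Multiset.mem_toFinset, Multiset.mem_filter, mem_rootMS hJ]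
      exact ⟨fun h => ⟨hS h, h⟩, fun h => h.2⟩
    · have hγ' := (Multiset.mem_filter.1 (Multiset.mem_toFinset.1 hγ)).2
      rw [Multiset.count_filter_of_pos hγ', count_rootMS hJ (hS hγ')]

/-- The roots of the Jacobian that leave the tree on a bar of `K`. -/
def leavesMS (f g : PS) (K : Set Bar) : Multiset Ser :=
  (rootMS (jac f g)).filter fun γ => ∃ B ∈ K, Leaves f g γ B

/-- The roots of the Jacobian over the collinear points of `K`, below the covers. -/
def collMS (f g : PS) (K : Set Bar) : Multiset Ser :=
  (rootMS (jac f g)).filter fun γ => ∃ B ∈ K, CollAt f g γ B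

theorem rootProd_polar (h : GoodPS f g) (p : Ser → Prop) :
    rootProd f g {γ ∈ polarRoots f g | p γ} = monicProd ((rootMS (jac f g)).filter p) := by
  rw [rootProd_eq (fun γ hγ => hγ.1.1)]
  have : (rootMS (jac f g)).filter (· ∈ {γ | γ ∈ polarRoots f g ∧ p γ}) =
      (rootMS (jac f g)).filter p :=
    Multiset.filter_congr fun γ hγ => by
      rw [Set.mem_ofPred_eq, h.polarRoots_eq]
      exact and_iff_right (mem_roots_of_mem_rootMS hγ).2
  rw [← this]
  congr!

theorem polyP_eq (h : GoodPS f g) (K : Set Bar) : polyP f g K = monicProd (leavesMS f g K) :=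
  rootProd_polar h _

theorem polyQ_eq (h : GoodPS f g) (K : Set Bar) : polyQ f g K = monicProd (collMS f g K) :=
  rootProd_polar h _

theorem filter_map_theta {F : PS} {p : Ser → Prop} (hp : ∀ γ, p (theta γ) ↔ p γ) :
    ((rootMS F).filter p).map theta = (rootMS F).filter p := by
  conv_rhs => rw [← rootMS_theta F, Multiset.filter_map]
  congr 1
  exact Multiset.filter_congr fun γ _ => (hp γ).symm

theorem IsClass.exists_theta_iff {K : Set Bar} (hK : IsClass f g K) {r : Ser → Bar → Prop}
    (hr : ∀ γ B, IsBar f g B → (r (theta γ) (thetaBar B) ↔ r γ B)) (γ : Ser) :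
    (∃ B ∈ K, r (theta γ) B) ↔ ∃ B ∈ K, r γ B := by
  constructor
  · rintro ⟨B, hB, h⟩
    obtain ⟨B', hB', rfl⟩ := hK.exists_thetaBar hB
    exact ⟨B', hB', (hr γ B' (hK.isBar hB')).1 h⟩
  · rintro ⟨B, hB, h⟩
    exact ⟨_, hK.thetaBar_mem hB, (hr γ B (hK.isBar hB)).2 h⟩

theorem leavesMS_theta {K : Set Bar} (hK : IsClass f g K) :
    (leavesMS f g K).map theta = leavesMS f g K :=
  filter_map_theta (hK.exists_theta_iff fun _ _ _ => leaves_theta_iff)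

theorem collMS_theta (h : GoodPS f g) {K : Set Bar} (hK : IsClass f g K) :
    (collMS f g K).map theta = collMS f g K :=
  filter_map_theta (hK.exists_theta_iff fun _ _ hB => collAt_theta_iff h hB)

theorem IsClass.countP_eq (h : GoodPS f g) {K : Set Bar} (hK : IsClass f g K) (s : Multiset Ser)
    (r : Ser → Bar → Prop) (hr : ∀ γ B, r γ B → Climbs γ B) :
    (s.filter fun γ => ∃ B ∈ K, r γ B).card = ∑ᶠ B ∈ K, s.countP (r · B) := by
  rw [finsum_mem_eq_finite_toFinset_sum _ (hK.finite h), ← Multiset.countP_eq_card_filter]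
  refine (countP_exists _ (fun γ B => B ∈ K ∧ r γ B) (hK.finite h).toFinset ?_ ?_).trans ?_
  · exact fun γ B B' h1 h2 => hK.unique h1.1 h2.1 (hr _ _ h1.2) (hr _ _ h2.2)
  · exact fun γ _ B hB => (hK.finite h).mem_toFinset.2 hB.1
  · refine Finset.sum_congr rfl fun B hB => ?_
    exact Multiset.countP_congr rfl fun γ _ =>
      propext (and_iff_right ((hK.finite h).mem_toFinset.1 hB))

theorem card_leavesMS (h : GoodPS f g) {K : Set Bar} (hK : IsClass f g K)
    (hnc : ∀ B ∈ K, NonColl f g B) : (leavesMS f g K).card = mStarClass f g K := by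
  rw [leavesMS, hK.countP_eq h _ _ fun _ _ h => h.climbs, mStarClass]
  exact finsum_mem_congr rfl fun B hB => leaves_count_bar h (hK.isBar hB) (hnc B hB)

theorem card_collMS (h : GoodPS f g) {K : Set Bar} (hK : IsClass f g K) :
    (collMS f g K).card = ∑ᶠ B ∈ K, collCount f g B := by
  rw [collMS, hK.countP_eq h _ _ fun _ _ h => h.climbs]
  exact finsum_mem_congr rfl fun B hB => rfl

theorem collCount_ground (hnc : NonColl f g ground) : collCount f g ground = 0 := by
  rw [collCount, collPts_ground hnc, Multiset.countP_eq_zero]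
  rintro γ - ⟨c, hc, -⟩
  exact hc

/-! ### Orders along polar roots -/

/-- No root of `f` climbs over `B` at the point of `γ`, so the leading coefficient does not vanish
and `γ` behaves like a generic arc. -/
theorem orderTop_of_leaves (h : GoodPS f g) {B : Bar} (hB : ProperBar B) {γ : Ser} (hγ : PosArc γ)
    (hl : Leaves f g γ B) : (evalArc f γ).orderTop = (nu f B : WithTop ℚ) := by
  obtain ⟨a, hcl, hna⟩ := hl
  obtain ⟨C, hC, hlead⟩ := exists_lead h.ne_left B
  rw [nu_eq_nuS h.ne_left hB]
  exact (hlead γ a hγ hcl).orderTop (mul_ne_zero hC (lead_ne h.ne_left fun ξ hξ hcl' =>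
    hna ⟨ξ, Or.inl hξ, hcl'⟩))

theorem orderTop_of_mem_leavesMS (h : GoodPS f g) {K : Set Bar} (hK : IsClass f g K)
    (hnc : ∀ B ∈ K, NonColl f g B) {B : Bar} (hB : B ∈ K) {γ : Ser} (hγ : γ ∈ leavesMS f g K) :
    (evalArc f γ).orderTop = (nu f B : WithTop ℚ) ∧
      (evalArc g γ).orderTop = (nu g B : WithTop ℚ) := by
  obtain ⟨hγ, B', hB', hl⟩ := Multiset.mem_filter.1 hγ
  have hp := roots_posArc (mem_roots_of_mem_rootMS hγ).2
  have hne : B' ≠ ground := by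
    rintro rfl
    exact not_leaves_ground (hnc _ hB') hp hl
  have hpr := (hK.isBar hB').proper ((hK.isBar hB').pos_of_ne hne)
  rw [← hK.nu_left h hB hB', ← hK.swap.nu_left h.symm hB hB']
  have hl' : Leaves g f γ B' :=
    let ⟨a, h1, h2⟩ := hl; ⟨a, h1, fun h' => h2 (trunkAt_symm.1 h')⟩
  exact ⟨orderTop_of_leaves h hpr hp hl, orderTop_of_leaves h.symm hpr hp hl'⟩

end

/-! ### The factors of the Jacobian -/

section

variable {f g : ConvPS}

theorem algArc_of_mem_rootMS_jac {γ : Ser} (h : γ ∈ rootMS (jac (f : PS) g)) : AlgArc γ :=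
  ⟨_, (mem_roots_of_mem_rootMS h).1, ((isConv_iff _).1 f.2).jac ((isConv_iff _).1 g.2),
    (mem_roots_of_mem_rootMS h).2⟩

theorem algArc_of_mem_leavesMS {K : Set Bar} {γ : Ser} (h : γ ∈ leavesMS (f : PS) g K) :
    AlgArc γ := algArc_of_mem_rootMS_jac (Multiset.mem_filter.1 h).1

theorem algArc_of_mem_collMS {K : Set Bar} {γ : Ser} (h : γ ∈ collMS (f : PS) g K) :
    AlgArc γ := algArc_of_mem_rootMS_jac (Multiset.mem_filter.1 h).1

theorem exists_polyP (h : GoodPair f g) {K : Set Bar} (hK : IsClass (f : PS) g K) :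
    ∃ P : ConvPS, Represents P (polyP f g K) := by
  rw [polyP_eq h.goodPS]
  exact exists_represents _ (fun γ => algArc_of_mem_leavesMS) (leavesMS_theta hK)

theorem exists_polyQ (h : GoodPair f g) {K : Set Bar} (hK : IsClass (f : PS) g K) :
    ∃ Q : ConvPS, Represents Q (polyQ f g K) := by
  rw [polyQ_eq h.goodPS]
  exact exists_represents _ (fun γ => algArc_of_mem_collMS) (collMS_theta h.goodPS hK)

theorem interMult_const {F P : ConvPS} {s : Multiset Ser} (hs : ∀ γ ∈ s, AlgArc γ)
    (hP : Represents P (monicProd s)) (v : ℚ)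
    (ho : ∀ γ ∈ s, (evalArc (F : PS) γ).orderTop = (v : WithTop ℚ)) :
    ∃ n : ℕ, interMult F P = n ∧ (n : ℚ) = v * (s.card : ℚ) := by
  obtain ⟨n, h1, h2⟩ := interMult_represents hs hP (fun _ => v) ho
  exact ⟨n, h1, by rw [h2, Multiset.map_const', Multiset.sum_replicate, nsmul_eq_mul, mul_comm]⟩

theorem interMult_polyP (h : GoodPair f g) {K : Set Bar} (hK : IsClass (f : PS) g K)
    (hnc : ∀ B ∈ K, NonColl (f : PS) g B) {P : ConvPS} (hP : Represents P (polyP f g K))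
    {B : Bar} (hB : B ∈ K) : ∃ a b c : ℕ,
      interMult f P = a ∧ interMult g P = b ∧ interMult (f * g) P = c ∧
      (a : ℚ) = nu f B * (mStarClass f g K : ℚ) ∧
      (b : ℚ) = nu g B * (mStarClass f g K : ℚ) ∧
      (c : ℚ) = (nu f B + nu g B) * (mStarClass f g K : ℚ) := by
  rw [polyP_eq h.goodPS] at hP
  have hs : ∀ γ ∈ leavesMS (f : PS) g K, AlgArc γ := fun γ => algArc_of_mem_leavesMS
  have ho := fun γ hγ => orderTop_of_mem_leavesMS h.goodPS hK hnc hB (γ := γ) hγ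
  obtain ⟨a, ha, ha'⟩ := interMult_const hs hP _ fun γ hγ => (ho γ hγ).1
  obtain ⟨b, hb, hb'⟩ := interMult_const hs hP _ fun γ hγ => (ho γ hγ).2
  obtain ⟨c, hc, hc'⟩ := interMult_const (F := f * g) hs hP (nu f B + nu g B) fun γ hγ => by
    have : evalArc ((f * g : ConvPS) : PS) γ = evalArc (f : PS) γ * evalArc (g : PS) γ :=
      evalArc_mul (hs γ hγ).posArc _ _
    rw [this, orderTop_mul, (ho γ hγ).1, (ho γ hγ).2, WithTop.coe_add]
  rw [card_leavesMS h.goodPS hK hnc] at ha' hb' hc'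
  exact ⟨a, b, c, ha, hb, hc, ha', hb', hc'⟩

theorem xOrder_polyP (h : GoodPair f g) {K : Set Bar} (hK : IsClass (f : PS) g K)
    (hnc : ∀ B ∈ K, NonColl (f : PS) g B) {P : ConvPS} (hP : Represents P (polyP f g K)) :
    xOrder P = mStarClass f g K := by
  rw [polyP_eq h.goodPS] at hP
  rw [hP.xOrder fun γ hγ => (algArc_of_mem_leavesMS hγ).posArc, card_leavesMS h.goodPS hK hnc]

theorem xOrder_polyQ (h : GoodPair f g) {K : Set Bar} (hK : IsClass (f : PS) g K) {Q : ConvPS}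
    (hQ : Represents Q (polyQ f g K)) : xOrder Q = (∑ᶠ B ∈ K, collCount (f : PS) g B : ℕ) := by
  rw [polyQ_eq h.goodPS] at hQ
  rw [hQ.xOrder fun γ hγ => (algArc_of_mem_collMS hγ).posArc, card_collMS h.goodPS hK]

end

/-! ### Corresponding classes -/

section

variable {f g f' g' : PS} {σ : Ser → Ser}

theorem TreeIso.exists_corrClass_bij (h : TreeIso f g f' g' σ) {K : Set Bar}
    (hK : ∀ B ∈ K, IsBar f g B) : ∃ β : Bar → Bar, Set.BijOn β K (corrClass f g f' g' σ K) ∧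
      ∀ B ∈ K, BarCorr f g σ B (β B) := by
  obtain ⟨β, hβ, hβc⟩ := h.exists_barMap
  refine ⟨β, ⟨?_, ?_, ?_⟩, fun B hB => (hβc B (hK B hB) _ (hβ.mapsTo (hK B hB))).2 rfl⟩
  · exact fun B hB => ⟨hβ.mapsTo (hK B hB), B, hB, (hβc B (hK B hB) _ (hβ.mapsTo (hK B hB))).2 rfl⟩
  · exact hβ.injOn.mono hK
  · rintro B' ⟨hB', B, hB, hc⟩
    exact ⟨B, hB, ((hβc B (hK B hB) B' hB').1 hc).symm⟩

theorem TreeEquiv.mStarClass_eq (h : TreeEquiv f g f' g' σ) (hg : GoodPS f g) (hg' : GoodPS f' g')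
    {K : Set Bar} (hK : ∀ B ∈ K, IsBar f g B) (hnc : ∀ B ∈ K, NonColl f g B) :
    mStarClass f g K = mStarClass f' g' (corrClass f g f' g' σ K) := by
  obtain ⟨β, hβ, hc⟩ := h.iso.exists_corrClass_bij hK
  exact finsum_mem_eq_of_bijOn β hβ fun B hB =>
    h.mStar_eq hg hg' (hK B hB) (hβ.mapsTo hB).1 (hc B hB) (hnc B hB)

theorem TreeEquiv.sum_collCount_eq (h : TreeEquiv f g f' g' σ) (hg : GoodPS f g)
    (hg' : GoodPS f' g') {K : Set Bar} (hK : ∀ B ∈ K, IsBar f g B)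
    (hnc : ∀ B ∈ K, NonColl f g B) :
    ∑ᶠ B ∈ K, collCount f g B = ∑ᶠ B ∈ corrClass f g f' g' σ K, collCount f' g' B := by
  obtain ⟨β, hβ, hc⟩ := h.iso.exists_corrClass_bij hK
  refine finsum_mem_eq_of_bijOn β hβ fun B hB => ?_
  have hB' := (hβ.mapsTo hB).1
  by_cases h0 : B.height = 0
  · have hnc' := (h.iso.nonColl_iff hg hg' (hK B hB) hB' (hc B hB)).1 (hnc B hB)
    have hncB := hnc B hB
    rw [hB'.eq_ground ((hc B hB).1.symm.trans h0)] at hnc' ⊢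
    rw [(hK B hB).eq_ground h0] at hncB ⊢
    rw [collCount_ground hncB, collCount_ground hnc']
  · exact h.collCount_eq hg hg' (hK B hB) hB' (lt_of_le_of_ne (hK B hB).nonneg (Ne.symm h0))
      (hc B hB) (hnc B hB)

theorem minimalBars_of_ground (hnc : NonColl f g ground) : ground ∈ minimalBars f g := by
  refine ⟨isBar_ground, hnc, ?_⟩
  rintro B hB ⟨c, hlt, -⟩
  exact absurd hlt (not_lt.2 hB.nonneg)

/-- A non-collinear ground bar is itself minimal, and no arc of positive order is bounded by it: the
product is empty. -/
theorem polyGround_eq (hnc : NonColl f g ground) : polyGround f g = 1 := by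
  rw [polyGround, rootProd]
  convert finprod_mem_empty
  refine Set.eq_empty_of_forall_notMem ?_
  rintro γ ⟨hγ, h⟩
  exact boundedBy_iff.1 (h ground (minimalBars_of_ground hnc))
    (posArc_climbs_ground (roots_posArc hγ.1)).climbs

end

theorem exists_represents_one : ∃ F : ConvPS, Represents F 1 := by
  have h1 : monicProd 0 = 1 := by simp [monicProd]
  exact h1 ▸ exists_represents 0 (fun γ hγ => absurd hγ (Multiset.notMem_zero γ))
    (Multiset.map_zero theta)

/-! ### The factors of the Jacobian and their invariance -/

section

variable {f g f' g' : ConvPS} {σ : Ser → Ser}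

theorem exists_factors (h : GoodPair f g) {K : Set Bar} (hK : K ∈ barClasses (f : PS) g)
    (hnc : ∃ B ∈ K, NonColl (f : PS) g B) : ∃ P Q : ConvPS,
      Represents P (polyP f g K) ∧ Represents Q (polyQ f g K) ∧
      ∀ B ∈ K, ∃ a b c : ℕ,
        interMult f P = a ∧ interMult g P = b ∧ interMult (f * g) P = c ∧
        (a : ℚ) = nu f B * (mStarClass f g K : ℚ) ∧
        (b : ℚ) = nu g B * (mStarClass f g K : ℚ) ∧
        (c : ℚ) = (nu f B + nu g B) * (mStarClass f g K : ℚ) := by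
  have hK' := isClass_of_mem h hK
  obtain ⟨B₀, hB₀, hnc⟩ := hnc
  obtain ⟨P, hP⟩ := exists_polyP h hK'
  obtain ⟨Q, hQ⟩ := exists_polyQ h hK'
  exact ⟨P, Q, hP, hQ, fun B hB =>
    interMult_polyP h hK' (fun B hB => hK'.nonColl h.goodPS hB₀ hB hnc) hP hB⟩

theorem factors_invariant (h : GoodPair f g) (h' : GoodPair f' g')
    (hσ : TreeEquiv (f : PS) g f' g' σ) {K : Set Bar} (hK : K ∈ barClasses (f : PS) g)
    (hK' : corrClass (f : PS) g f' g' σ K ∈ barClasses (f' : PS) g')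
    (hnc : ∃ B ∈ K, NonColl (f : PS) g B) :
    (∃ B' ∈ corrClass (f : PS) g f' g' σ K, NonColl (f' : PS) g' B') ∧
    ∀ P P' Q Q' : ConvPS, Represents P (polyP f g K) →
      Represents P' (polyP f' g' (corrClass (f : PS) g f' g' σ K)) →
      Represents Q (polyQ f g K) →
      Represents Q' (polyQ f' g' (corrClass (f : PS) g f' g' σ K)) →
      interMult f P = interMult f' P' ∧ interMult g P = interMult g' P' ∧
      interMult (f * g) P = interMult (f' * g') P' ∧
      xOrder P = xOrder P' ∧ xOrder Q = xOrder Q' := by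
  have hK₁ := isClass_of_mem h hK
  have hK₂ := isClass_of_mem h' hK'
  have hg := h.goodPS
  have hg' := h'.goodPS
  obtain ⟨B, hB, hncB⟩ := hnc
  have hnc₁ : ∀ B ∈ K, NonColl (f : PS) g B := fun B' hB' => hK₁.nonColl hg hB hB' hncB
  obtain ⟨B', hB', hc⟩ := hσ.iso.exists_corr (hK₁.isBar hB)
  have hmem : B' ∈ corrClass (f : PS) g f' g' σ K := ⟨hB', B, hB, hc⟩
  have hncB' := (hσ.iso.nonColl_iff hg hg' (hK₁.isBar hB) hB' hc).1 hncB
  have hnc₂ := fun B'' hB'' => hK₂.nonColl hg' hmem hB'' hncB' (B' := B'')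
  refine ⟨⟨B', hmem, hncB'⟩, fun P P' Q Q' hP hP' hQ hQ' => ?_⟩
  have hm := hσ.mStarClass_eq hg hg' (fun B hB => hK₁.isBar hB) hnc₁
  obtain ⟨a, b, c, ha, hb, hc1, ha', hb', hc'⟩ := interMult_polyP h hK₁ hnc₁ hP hB
  obtain ⟨a₂, b₂, c₂, ha₂, hb₂, hc₂, ha₂', hb₂', hc₂'⟩ := interMult_polyP h' hK₂ hnc₂ hP' hmem
  have hnf := hσ.iso.nu_eq hg hg' (hK₁.isBar hB) hB' hc
  have hng := hσ.iso.swap.nu_eq hg.symm hg'.symm (hK₁.swap.isBar hB) (hK₂.swap.isBar hmem)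
    ⟨hc.1, fun ξ hξ => hc.2 ξ hξ.symm⟩
  rw [← hm, ← hnf] at ha₂' hc₂'
  rw [← hm, ← hng] at hb₂'
  rw [← hng] at hc₂'
  refine ⟨?_, ?_, ?_, ?_, ?_⟩
  · rw [ha, ha₂, show a = a₂ by exact_mod_cast ha'.trans ha₂'.symm]
  · rw [hb, hb₂, show b = b₂ by exact_mod_cast hb'.trans hb₂'.symm]
  · rw [hc1, hc₂, show c = c₂ by exact_mod_cast hc'.trans hc₂'.symm]
  · rw [xOrder_polyP h hK₁ hnc₁ hP, xOrder_polyP h' hK₂ hnc₂ hP', hm]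
  · rw [xOrder_polyQ h hK₁ hQ, xOrder_polyQ h' hK₂ hQ',
      hσ.sum_collCount_eq hg hg' (fun B hB => hK₁.isBar hB) hnc₁]

theorem polyGround_invariant (h : GoodPair f g) (h' : GoodPair f' g')
    (hσ : TreeEquiv (f : PS) g f' g' σ) (hnc : NonColl (f : PS) g ground) :
    ∃ R R' : ConvPS, Represents R (polyGround f g) ∧ Represents R' (polyGround f' g') ∧
      xOrder R = xOrder R' := by
  have hnc' := (hσ.iso.nonColl_iff h.goodPS h'.goodPS isBar_ground isBar_ground
    hσ.iso.barCorr_ground).1 hnc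
  obtain ⟨R, hR⟩ := exists_represents_one
  rw [polyGround_eq hnc, polyGround_eq hnc']
  exact ⟨R, R, hR, hR, rfl⟩

end

end PolarTree
end

noncomputable section

namespace PolarTree

open HahnSeries
open scoped Classical

/-! ### Equivariant isometries -/

theorem contact_eq_top {ξ η : Ser} : contact ξ η = ⊤ ↔ ξ = η := by
  rw [contact, orderTop_eq_top, sub_eq_zero]

theorem coeff_eq_iff_lt_contact {ξ η : Ser} {h : ℚ} (hle : (h : WithTop ℚ) ≤ contact ξ η) :
    ξ.coeff h = η.coeff h ↔ (h : WithTop ℚ) < contact ξ η := by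
  constructor
  · intro he
    refine lt_of_le_of_ne hle fun h0 => ?_
    have h1 := coeff_orderTop_ne h0.symm
    rw [coeff_sub, he, sub_self] at h1
    exact h1 rfl
  · intro hlt
    have := coeff_eq_zero_of_lt_orderTop hlt
    rwa [coeff_sub, sub_eq_zero] at this

/-- Isometries that preserve colors. -/
structure ColIso {X : Type*} (κ κ' : Ser → X) (U V : Set Ser) (σ : Ser → Ser) : Prop where
  bij : Set.BijOn σ U V
  contact_eq : ∀ ξ ∈ U, ∀ η ∈ U, contact (σ ξ) (σ η) = contact ξ η
  color_eq : ∀ ξ ∈ U, κ' (σ ξ) = κ ξ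

namespace ColIso

variable {X : Type*} {κ κ' κ'' : Ser → X} {U V W : Set Ser} {σ ρ : Ser → Ser}

theorem refl (κ : Ser → X) (U : Set Ser) : ColIso κ κ U U id :=
  ⟨Set.bijOn_id U, fun _ _ _ _ => rfl, fun _ _ => rfl⟩

theorem trans (h : ColIso κ κ' U V σ) (h' : ColIso κ' κ'' V W ρ) :
    ColIso κ κ'' U W (ρ ∘ σ) :=
  ⟨h'.bij.comp h.bij, fun ξ hξ η hη => (h'.contact_eq _ (h.bij.mapsTo hξ) _
    (h.bij.mapsTo hη)).trans (h.contact_eq ξ hξ η hη),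
    fun ξ hξ => (h'.color_eq _ (h.bij.mapsTo hξ)).trans (h.color_eq ξ hξ)⟩

theorem exists_symm (h : ColIso κ κ' U V σ) : ∃ ρ, ColIso κ' κ V U ρ := by
  have hr : ∀ η ∈ V, σ (Function.invFunOn σ U η) = η := h.bij.invOn_invFunOn.2
  have hm := h.bij.surjOn.mapsTo_invFunOn
  refine ⟨Function.invFunOn σ U, (Set.bijOn_comm h.bij.invOn_invFunOn).2 h.bij, ?_, ?_⟩
  · intro ξ hξ η hη
    rw [← h.contact_eq _ (hm hξ) _ (hm hη), hr ξ hξ, hr η hη]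
  · intro ξ hξ
    rw [← h.color_eq _ (hm hξ), hr ξ hξ]

/-- The elements whose coefficient of exponent `h` lies in `A`. -/
def _root_.PolarTree.block (U : Set Ser) (h : ℚ) (A : Set ℂ) : Set Ser := {ξ ∈ U | ξ.coeff h ∈ A}

/-- Elements with different coefficients at the minimal height `h` have contact order exactly `h`,
in the source and in the target. So isometries of disjoint unions of blocks can be combined freely.
-/
theorem glue {h : ℚ} (hU : ∀ ξ ∈ U, ∀ η ∈ U, (h : WithTop ℚ) ≤ contact ξ η)
    (hV : ∀ ξ ∈ V, ∀ η ∈ V, (h : WithTop ℚ) ≤ contact ξ η) {T : Ser → Ser} {A B A' B' : Set ℂ}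
    (hAB : Disjoint A B) (hAB' : Disjoint A' B') {τ₁ τ₂ : Ser → Ser}
    (hT : ∀ ξ ∈ block U h A, T ξ ∈ block U h A) (hT' : ∀ ξ ∈ block U h B, T ξ ∈ block U h B)
    (h₁ : ColIso κ κ' (block U h A) (block V h A') τ₁)
    (h₂ : ColIso κ κ' (block U h B) (block V h B') τ₂)
    (e₁ : ∀ ξ ∈ block U h A, τ₁ (T ξ) = T (τ₁ ξ)) (e₂ : ∀ ξ ∈ block U h B, τ₂ (T ξ) = T (τ₂ ξ)) :
    ∃ τ, ColIso κ κ' (block U h (A ∪ B)) (block V h (A' ∪ B')) τ ∧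
      ∀ ξ ∈ block U h (A ∪ B), τ (T ξ) = T (τ ξ) := by
  let τ : Ser → Ser := fun ξ => if ξ.coeff h ∈ A then τ₁ ξ else τ₂ ξ
  have hτ₁ : ∀ ξ ∈ block U h A, τ ξ = τ₁ ξ := fun ξ hξ => if_pos hξ.2
  have hτ₂ : ∀ ξ ∈ block U h B, τ ξ = τ₂ ξ :=
    fun ξ hξ => if_neg fun hA => Set.disjoint_left.1 hAB hA hξ.2
  have hcases : ∀ ξ ∈ block U h (A ∪ B), ξ ∈ block U h A ∨ ξ ∈ block U h B :=
    fun ξ hξ => hξ.2.imp (fun h => ⟨hξ.1, h⟩) fun h => ⟨hξ.1, h⟩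
  have hsep : ∀ {W : Set Ser} {A B : Set ℂ}, Disjoint A B →
      (∀ ξ ∈ W, ∀ η ∈ W, (h : WithTop ℚ) ≤ contact ξ η) → ∀ ξ ∈ block W h A, ∀ η ∈ block W h B,
      contact ξ η = h := by
    intro W A B hd hW ξ hξ η hη
    refine le_antisymm (not_lt.1 fun hlt => ?_) (hW ξ hξ.1 η hη.1)
    have := (coeff_eq_iff_lt_contact hlt.le).2 hlt
    exact Set.disjoint_left.1 hd hξ.2 (this ▸ hη.2)
  have hcon : ∀ ξ ∈ block U h (A ∪ B), ∀ η ∈ block U h (A ∪ B),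
      contact (τ ξ) (τ η) = contact ξ η := by
    intro ξ hξ η hη
    rcases hcases ξ hξ with hξ | hξ <;> rcases hcases η hη with hη | hη
    · rw [hτ₁ ξ hξ, hτ₁ η hη, h₁.contact_eq ξ hξ η hη]
    · rw [hτ₁ ξ hξ, hτ₂ η hη, hsep hAB hU ξ hξ η hη,
        hsep hAB' hV _ (h₁.bij.mapsTo hξ) _ (h₂.bij.mapsTo hη)]
    · rw [hτ₂ ξ hξ, hτ₁ η hη, hsep hAB.symm hU ξ hξ η hη,
        hsep hAB'.symm hV _ (h₂.bij.mapsTo hξ) _ (h₁.bij.mapsTo hη)]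
    · rw [hτ₂ ξ hξ, hτ₂ η hη, h₂.contact_eq ξ hξ η hη]
  refine ⟨τ, ⟨⟨?_, ?_, ?_⟩, hcon, ?_⟩, ?_⟩
  · intro ξ hξ
    rcases hcases ξ hξ with hξ | hξ
    · rw [hτ₁ ξ hξ]; exact ⟨(h₁.bij.mapsTo hξ).1, Or.inl (h₁.bij.mapsTo hξ).2⟩
    · rw [hτ₂ ξ hξ]; exact ⟨(h₂.bij.mapsTo hξ).1, Or.inr (h₂.bij.mapsTo hξ).2⟩
  · intro ξ hξ η hη he
    rw [← contact_eq_top, ← hcon ξ hξ η hη, contact_eq_top, he]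
  · rintro ζ ⟨hζ, hζ' | hζ'⟩
    · obtain ⟨ξ, hξ, rfl⟩ := h₁.bij.surjOn ⟨hζ, hζ'⟩
      exact ⟨ξ, ⟨hξ.1, Or.inl hξ.2⟩, hτ₁ ξ hξ⟩
    · obtain ⟨ξ, hξ, rfl⟩ := h₂.bij.surjOn ⟨hζ, hζ'⟩
      exact ⟨ξ, ⟨hξ.1, Or.inr hξ.2⟩, hτ₂ ξ hξ⟩
  · intro ξ hξ
    rcases hcases ξ hξ with hξ | hξ
    · rw [hτ₁ ξ hξ, h₁.color_eq ξ hξ]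
    · rw [hτ₂ ξ hξ, h₂.color_eq ξ hξ]
  · intro ξ hξ
    rcases hcases ξ hξ with hξ | hξ
    · rw [hτ₁ ξ hξ, hτ₁ _ (hT ξ hξ), e₁ ξ hξ]
    · rw [hτ₂ ξ hξ, hτ₂ _ (hT' ξ hξ), e₂ ξ hξ]

end ColIso

/-! ### Rotations of blocks and extension over orbits -/

/-- An isometry of `U` that multiplies the coefficients of exponent `h` by `ω`. -/
structure Rotates (T : Ser → Ser) (ω : ℂ) (h : ℚ) (U : Set Ser) : Prop where
  bij : Set.BijOn T U U
  contact_eq : ∀ ξ η, contact (T ξ) (T η) = contact ξ η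
  coeff_eq : ∀ ξ, (T ξ).coeff h = ω * ξ.coeff h
  ne_zero : ω ≠ 0
  le_contact : ∀ ξ ∈ U, ∀ η ∈ U, (h : WithTop ℚ) ≤ contact ξ η

namespace Rotates

variable {T : Ser → Ser} {ω : ℂ} {h : ℚ} {U : Set Ser}

theorem iterate_coeff (hU : Rotates T ω h U) (k : ℕ) (ξ : Ser) :
    (T^[k] ξ).coeff h = ω ^ k * ξ.coeff h := by
  induction k with
  | zero => simp
  | succ k ih => rw [Function.iterate_succ_apply', hU.coeff_eq, ih]; ring

theorem iterate_contact (hU : Rotates T ω h U) (k : ℕ) (ξ η : Ser) :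
    contact (T^[k] ξ) (T^[k] η) = contact ξ η := by
  induction k with
  | zero => rfl
  | succ k ih => rw [Function.iterate_succ_apply', Function.iterate_succ_apply', hU.contact_eq, ih]

theorem iterate_mem (hU : Rotates T ω h U) (k : ℕ) {a : ℂ} {ξ : Ser} (hξ : ξ ∈ block U h {a}) :
    T^[k] ξ ∈ block U h {ω ^ k * a} :=
  ⟨(hU.bij.iterate k).mapsTo hξ.1, by
    rw [hU.iterate_coeff, show ξ.coeff h = a from hξ.2]; rfl⟩

theorem exists_iterate (hU : Rotates T ω h U) (k : ℕ) {a : ℂ} {ξ : Ser}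
    (hξ : ξ ∈ block U h {ω ^ k * a}) : ∃ η ∈ block U h {a}, T^[k] η = ξ := by
  obtain ⟨η, hη, rfl⟩ := (hU.bij.iterate k).surjOn hξ.1
  refine ⟨η, ⟨hη, ?_⟩, rfl⟩
  have := hξ.2
  rw [hU.iterate_coeff] at this
  exact mul_left_cancel₀ (pow_ne_zero k hU.ne_zero) this

theorem contact_of_ne (hU : Rotates T ω h U) {a b : ℂ} (hab : a ≠ b) {ξ η : Ser}
    (hξ : ξ ∈ block U h {a}) (hη : η ∈ block U h {b}) : contact ξ η = h := by
  refine le_antisymm (not_lt.1 fun hlt => ?_) (hU.le_contact ξ hξ.1 η hη.1)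
  have := (coeff_eq_iff_lt_contact hlt.le).2 hlt
  rw [show ξ.coeff h = a from hξ.2, show η.coeff h = b from hη.2] at this
  exact hab this

theorem pow_mul_eq_iff (hω : ω ≠ 0) {a a' : ℂ} (hst : ∀ k, ω ^ k * a = a ↔ ω ^ k * a' = a')
    {k l : ℕ} (hkl : k ≤ l) : ω ^ k * a = ω ^ l * a ↔ ω ^ (l - k) * a' = a' := by
  obtain ⟨m, rfl⟩ := Nat.exists_eq_add_of_le hkl
  rw [← hst, _root_.pow_add, mul_assoc, Nat.add_sub_cancel_left, mul_right_inj' (pow_ne_zero k hω),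
    eq_comm]

theorem pow_mul_eq_pow_mul_iff (hω : ω ≠ 0) {a a' : ℂ}
    (hst : ∀ k, ω ^ k * a = a ↔ ω ^ k * a' = a') (k l : ℕ) :
    ω ^ k * a = ω ^ l * a ↔ ω ^ k * a' = ω ^ l * a' := by
  rcases le_total k l with h | h
  · rw [pow_mul_eq_iff hω hst h, pow_mul_eq_iff hω (fun _ => Iff.rfl) h]
  · rw [eq_comm, pow_mul_eq_iff hω hst h, eq_comm (a := ω ^ k * a'),
      pow_mul_eq_iff hω (fun _ => Iff.rfl) h]

variable {X : Type*} {κ κ' : Ser → X} {V : Set Ser}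

/-- Extension of an isometry of blocks to the orbits of the blocks. -/
theorem exists_orbit_iso (hU : Rotates T ω h U) (hV : Rotates T ω h V)
    (hκ : ∀ ξ ∈ U, κ (T ξ) = κ ξ) (hκ' : ∀ ξ ∈ V, κ' (T ξ) = κ' ξ) {a a' : ℂ}
    (hst : ∀ k, ω ^ k * a = a ↔ ω ^ k * a' = a') {τ : Ser → Ser}
    (hτ : ColIso κ κ' (block U h {a}) (block V h {a'}) τ)
    (heq : ∀ k, ω ^ k * a = a → ∀ ξ ∈ block U h {a}, τ (T^[k] ξ) = T^[k] (τ ξ)) :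
    ∃ τ', ColIso κ κ' (block U h {c | ∃ k, c = ω ^ k * a}) (block V h {c | ∃ k, c = ω ^ k * a'}) τ' ∧
      ∀ ξ ∈ block U h {c | ∃ k, c = ω ^ k * a}, τ' (T ξ) = T (τ' ξ) := by
  -- After removing `T^[k]`, either `ω ^ m` fixes `a`, hence also `a'`, and the equivariance of `τ`
  -- under the stabilizer applies, or both pairs lie in different blocks and have contact order `h`.
  have key : ∀ k l, k ≤ l → ∀ x ∈ block U h {a}, ∀ y ∈ block U h {a},
      contact (T^[k] (τ x)) (T^[l] (τ y)) = contact (T^[k] x) (T^[l] y) := by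
    intro k l hkl x hx y hy
    obtain ⟨m, rfl⟩ := Nat.exists_eq_add_of_le hkl
    have hm : k + m - k = m := Nat.add_sub_cancel_left k m
    by_cases h1 : ω ^ m * a = a
    · have hy' := hU.iterate_mem m hy
      rw [h1] at hy'
      rw [Function.iterate_add_apply, Function.iterate_add_apply,
        hU.iterate_contact, hV.iterate_contact, ← heq _ h1 y hy,
        hτ.contact_eq x hx _ hy']
    · rw [hU.contact_of_ne (fun h2 => h1 (hm ▸ (pow_mul_eq_iff hU.ne_zero (fun _ => Iff.rfl) hkl).1 h2))
          (hU.iterate_mem k hx) (hU.iterate_mem _ hy),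
        hV.contact_of_ne (fun h2 => h1 (hm ▸ (pow_mul_eq_iff hU.ne_zero (fun k => (hst k).symm) hkl).1 h2))
          (hV.iterate_mem k (hτ.bij.mapsTo hx)) (hV.iterate_mem _ (hτ.bij.mapsTo hy))]
  have key' : ∀ k l, ∀ x ∈ block U h {a}, ∀ y ∈ block U h {a},
      contact (T^[k] (τ x)) (T^[l] (τ y)) = contact (T^[k] x) (T^[l] y) := by
    intro k l x hx y hy
    rcases le_total k l with hkl | hkl
    · exact key k l hkl x hx y hy
    · rw [contact_comm, key l k hkl y hy x hx, contact_comm]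
  have hex : ∀ ξ ∈ block U h {c | ∃ k, c = ω ^ k * a}, ∃ k, ∃ x ∈ block U h {a}, T^[k] x = ξ := by
    rintro ξ ⟨hξ, k, hk⟩
    exact ⟨k, hU.exists_iterate k ⟨hξ, hk⟩⟩
  choose! k x hx hkx using hex
  let τ' : Ser → Ser := fun ξ => T^[k ξ] (τ (x ξ))
  -- `τ'` uses chosen representatives; independence of the choice follows because contact order `⊤`
  -- means equality and contact orders are preserved by `key'`.
  have hτ' : ∀ l, ∀ y ∈ block U h {a}, τ' (T^[l] y) = T^[l] (τ y) := by
    intro l y hy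
    have hm : T^[l] y ∈ block U h {c | ∃ k, c = ω ^ k * a} :=
      ⟨(hU.iterate_mem l hy).1, l, (hU.iterate_mem l hy).2⟩
    rw [← contact_eq_top, key' _ _ _ (hx _ hm) _ hy, hkx _ hm, contact_eq_top]
  have hcol : ∀ {W : Set Ser} {κ : Ser → X}, Rotates T ω h W → (∀ ξ ∈ W, κ (T ξ) = κ ξ) →
      ∀ l, ∀ y ∈ W, κ (T^[l] y) = κ y := by
    intro W κ hW hκ l y hy
    induction l with
    | zero => rfl
    | succ l ih => rw [Function.iterate_succ_apply', hκ _ ((hW.bij.iterate l).mapsTo hy), ih]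
  refine ⟨τ', ⟨⟨?_, ?_, ?_⟩, ?_, ?_⟩, ?_⟩
  · intro ξ hξ
    have h1 := hV.iterate_mem (k ξ) (hτ.bij.mapsTo (hx ξ hξ))
    exact ⟨h1.1, k ξ, h1.2⟩
  · intro ξ hξ η hη he
    rw [← contact_eq_top, ← hkx ξ hξ, ← hkx η hη, ← key' _ _ _ (hx ξ hξ) _ (hx η hη),
      contact_eq_top]
    exact he
  · rintro ζ ⟨hζ, l, hl⟩
    obtain ⟨z, hz, rfl⟩ := hV.exists_iterate l ⟨hζ, hl⟩
    obtain ⟨y, hy, rfl⟩ := hτ.bij.surjOn hz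
    have hm := hU.iterate_mem l hy
    exact ⟨T^[l] y, ⟨hm.1, l, hm.2⟩, hτ' l y hy⟩
  · intro ξ hξ η hη
    have := key' (k ξ) (k η) _ (hx ξ hξ) _ (hx η hη)
    rwa [hkx ξ hξ, hkx η hη] at this
  · intro ξ hξ
    rw [hcol hV hκ' _ _ (hτ.bij.mapsTo (hx ξ hξ)).1, hτ.color_eq _ (hx ξ hξ)]
    conv_rhs => rw [← hkx ξ hξ]
    rw [hcol hU hκ _ _ (hx ξ hξ).1]
  · intro ξ hξ
    have h1 := hτ' (k ξ + 1) _ (hx ξ hξ)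
    rw [Function.iterate_succ_apply', Function.iterate_succ_apply', hkx ξ hξ] at h1
    exact h1

end Rotates

/-! ### Blocks of equal type and equal stabilizer -/

/-- In two finite sets of complex numbers that are stable under a rotation and carry the same
invariant types there are two points of the same type with the same stabilizer. -/
theorem exists_same_stabilizer {X : Type*} {ω : ℂ} {A A' : Finset ℂ}
    {t t' : ℂ → X} (hA : ∀ a ∈ A, ω * a ∈ A) (hA' : ∀ a ∈ A', ω * a ∈ A')
    (ht : ∀ a ∈ A, t (ω * a) = t a) (h : A.val.map t = A'.val.map t') (hne : A.Nonempty) :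
    ∃ a ∈ A, ∃ a' ∈ A', t a = t' a' ∧ ∀ k : ℕ, ω ^ k * a = a ↔ ω ^ k * a' = a' := by
  have hex : ∀ a ∈ A, ∃ a' ∈ A', t' a' = t a := by
    intro a ha
    have : t a ∈ A'.val.map t' := h ▸ Multiset.mem_map_of_mem t ha
    exact Multiset.mem_map.1 this
  by_cases h1 : ω = 1
  · obtain ⟨a, ha⟩ := hne
    obtain ⟨a', ha', he⟩ := hex a ha
    exact ⟨a, ha, a', ha', he.symm, fun k => by simp [h1]⟩
  by_cases h2 : ∃ a ∈ A, a ≠ 0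
  · obtain ⟨a, ha, ha0⟩ := h2
    -- A nonzero point is fixed by `ω ^ k` exactly if `ω ^ k = 1`, so any nonzero point of the right
    -- type will do. If only `0` had this type in `A'`, the type would occur at most once there, but
    -- in `A` it occurs at `a` and at `ω a`.
    suffices hs : ∃ a' ∈ A', t' a' = t a ∧ a' ≠ 0 by
      obtain ⟨a', ha', he, ha0'⟩ := hs
      exact ⟨a, ha, a', ha', he.symm, fun k => by rw [mul_eq_right₀ ha0, mul_eq_right₀ ha0']⟩
    by_contra! hc
    have h3 := congrArg (Multiset.count (t a)) h
    rw [Multiset.count_map, Multiset.count_map] at h3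
    have h4 : (A'.filter fun b => t a = t' b).card ≤ 1 := by
      refine Finset.card_le_one.2 fun b hb c hc' => ?_
      rw [Finset.mem_filter] at hb hc'
      rw [hc b hb.1 hb.2.symm, hc c hc'.1 hc'.2.symm]
    have h5 : 1 < (A.filter fun b => t a = t b).card := by
      refine Finset.one_lt_card.2 ⟨a, Finset.mem_filter.2 ⟨ha, rfl⟩, ω * a,
        Finset.mem_filter.2 ⟨hA a ha, (ht a ha).symm⟩, fun he => h1 ?_⟩
      exact (mul_eq_right₀ ha0).1 he.symm
    have h6 : (A.filter fun b => t a = t b).card = (A'.filter fun b => t a = t' b).card := h3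
    omega
  -- Now `A = {0}`, so `A'` is a single point, which stability forces to be fixed by `ω`.
  · push Not at h2
    obtain ⟨a, ha⟩ := hne
    obtain ⟨a', ha', he⟩ := hex a ha
    have hc : A'.card ≤ 1 := by
      have h3 := congrArg Multiset.card h
      rw [Multiset.card_map, Multiset.card_map] at h3
      rw [Finset.card_def, ← h3]
      exact Finset.card_le_one.2 fun b hb c hc => (h2 b hb).trans (h2 c hc).symm
    have h4 : ω * a' = a' := Finset.card_le_one.1 hc _ (hA' a' ha') _ ha'
    have h5 : ∀ k : ℕ, ω ^ k * a' = a' := by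
      intro k
      induction k with
      | zero => simp
      | succ k ih => rw [pow_succ, mul_assoc, h4, ih]
    exact ⟨a, ha, a', ha', he.symm, fun k => iff_of_true (by rw [h2 a ha, mul_zero]) (h5 k)⟩

theorem exists_min_contact {U : Set Ser} (hU : U.Finite) (h : ¬ U.Subsingleton) : ∃ e : ℚ,
    (∀ ξ ∈ U, ∀ η ∈ U, (e : WithTop ℚ) ≤ contact ξ η) ∧
      ∃ ξ ∈ U, ∃ η ∈ U, contact ξ η = e := by
  rw [Set.not_subsingleton_iff] at h
  obtain ⟨a, ha, b, hb, hab⟩ := h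
  obtain ⟨⟨ξ, η⟩, hp, hmin⟩ := Set.exists_min_image (U ×ˢ U) (fun p : Ser × Ser => contact p.1 p.2)
    (hU.prod hU) ⟨(a, b), ha, hb⟩
  have hlt : contact ξ η < ⊤ := (hmin (a, b) ⟨ha, hb⟩).trans_lt
    (lt_top_iff_ne_top.2 fun h0 => hab (contact_eq_top.1 h0))
  obtain ⟨e, he⟩ := WithTop.ne_top_iff_exists.1 hlt.ne
  exact ⟨e, fun ξ' h1 η' h2 => he ▸ hmin (ξ', η') ⟨h1, h2⟩, ξ, hp.1, η, hp.2, he.symm⟩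

theorem bijOn_of_finite {U : Set Ser} (hU : U.Finite) {T : Ser → Ser} (hT : Function.Injective T)
    (hm : ∀ ξ ∈ U, T ξ ∈ U) : Set.BijOn T U U :=
  ⟨hm, hT.injOn, (Set.eq_of_subset_of_ncard_le (Set.image_subset_iff.2 hm)
    (Set.ncard_image_of_injective U hT).ge hU).ge⟩

theorem rotates_theta_iterate (D : ℕ) {U : Set Ser} (hU : U.Finite)
    (hm : ∀ ξ ∈ U, theta^[D] ξ ∈ U) {h : ℚ}
    (hle : ∀ ξ ∈ U, ∀ η ∈ U, (h : WithTop ℚ) ≤ contact ξ η) :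
    Rotates theta^[D] (chi h ^ D) h U where
  bij := bijOn_of_finite hU (theta_injective.iterate D) hm
  contact_eq ξ η := by
    rw [contact, ← iterate_map_sub, theta_iterate_orderTop, contact]
  coeff_eq ξ := theta_iterate_coeff D ξ h
  ne_zero := pow_ne_zero D (chi_ne_zero h)
  le_contact := hle

/-! ### The equivariant isometry -/

section

variable {X : Type*} {κ κ' : Ser → X}

/-- The types of the blocks of `V`, relative to the blocks of `U`. -/
def blockType (κ κ' : Ser → X) (h : ℚ) (U V : Set Ser) (c : ℂ) : Set ℂ :=
  {b | ∃ σ, ColIso κ κ' (block U h {b}) (block V h {c}) σ}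

theorem ColIso.block_singleton {U V : Set Ser} {σ : Ser → Ser} (hσ : ColIso κ κ' U V σ) {h : ℚ}
    (hU : ∀ ξ ∈ U, ∀ η ∈ U, (h : WithTop ℚ) ≤ contact ξ η) {ξ : Ser} (hξ : ξ ∈ U) :
    ColIso κ κ' (block U h {ξ.coeff h}) (block V h {(σ ξ).coeff h}) σ := by
  have hiff : ∀ η ∈ U, η.coeff h = ξ.coeff h ↔ (σ η).coeff h = (σ ξ).coeff h := by
    intro η hη
    have h1 := hU η hη ξ hξ
    rw [coeff_eq_iff_lt_contact h1, coeff_eq_iff_lt_contact (by rwa [hσ.contact_eq η hη ξ hξ]),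
      hσ.contact_eq η hη ξ hξ]
  refine ⟨⟨fun η hη => ⟨hσ.bij.mapsTo hη.1, (hiff η hη.1).1 hη.2⟩,
    hσ.bij.injOn.mono fun η hη => hη.1, ?_⟩,
    fun η hη ζ hζ => hσ.contact_eq η hη.1 ζ hζ.1, fun η hη => hσ.color_eq η hη.1⟩
  rintro ζ ⟨hζ, hζ'⟩
  obtain ⟨η, hη, rfl⟩ := hσ.bij.surjOn hζ
  exact ⟨η, ⟨hη, (hiff η hη).2 hζ'⟩, rfl⟩

theorem Rotates.colIso {T : Ser → Ser} {ω : ℂ} {h : ℚ} {U : Set Ser} (hU : Rotates T ω h U)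
    (hκ : ∀ ξ ∈ U, κ (T ξ) = κ ξ) (a : ℂ) :
    ColIso κ κ (block U h {a}) (block U h {ω * a}) T := by
  refine ⟨⟨fun ξ hξ => ?_, (hU.bij.injOn).mono fun ξ hξ => hξ.1, fun ξ hξ => ?_⟩,
    fun ξ _ η _ => hU.contact_eq ξ η, fun ξ hξ => hκ ξ hξ.1⟩
  · simpa using hU.iterate_mem 1 hξ
  · obtain ⟨η, hη, he⟩ := hU.exists_iterate 1 (a := a) (by rwa [pow_one])
    exact ⟨η, hη, he⟩

theorem Rotates.blockType_eq {T : Ser → Ser} {ω : ℂ} {h : ℚ} {U V : Set Ser}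
    (hV : Rotates T ω h V) (hκ' : ∀ ξ ∈ V, κ' (T ξ) = κ' ξ) (a : ℂ) :
    blockType κ κ' h U V (ω * a) = blockType κ κ' h U V a := by
  ext b
  constructor
  · rintro ⟨σ, hσ⟩
    obtain ⟨ρ, hρ⟩ := (hV.colIso hκ' a).exists_symm
    exact ⟨_, hσ.trans hρ⟩
  · rintro ⟨σ, hσ⟩
    exact ⟨_, hσ.trans (hV.colIso hκ' a)⟩

/-- The isometry maps the blocks of `U` bijectively to those of `V`, and composition with it
identifies the types of corresponding blocks. -/
theorem ColIso.map_blockType {U V : Set Ser} (hUf : U.Finite) (hVf : V.Finite) {σ : Ser → Ser}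
    (hσ : ColIso κ κ' U V σ) {h : ℚ} (hU : ∀ ξ ∈ U, ∀ η ∈ U, (h : WithTop ℚ) ≤ contact ξ η) :
    (hUf.toFinset.image fun ξ => ξ.coeff h).val.map (blockType κ κ h U U) =
      (hVf.toFinset.image fun ξ => ξ.coeff h).val.map (blockType κ κ' h U V) := by
  have hex : ∀ a ∈ hUf.toFinset.image fun ξ => ξ.coeff h, ∃ ξ ∈ U, ξ.coeff h = a := by
    intro a ha
    obtain ⟨ξ, hξ, rfl⟩ := Finset.mem_image.1 ha
    exact ⟨ξ, hUf.mem_toFinset.1 hξ, rfl⟩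
  choose! x hx hxa using hex
  have hbl : ∀ a ∈ hUf.toFinset.image fun ξ => ξ.coeff h,
      ColIso κ κ' (block U h {a}) (block V h {(σ (x a)).coeff h}) σ := by
    intro a ha
    have := hσ.block_singleton hU (hx a ha)
    rwa [hxa a ha] at this
  refine Multiset.map_eq_map_of_bij_of_nodup _ _ (Finset.nodup _) (Finset.nodup _)
    (fun a _ => (σ (x a)).coeff h) ?_ ?_ ?_ ?_
  · intro a ha
    exact Finset.mem_image.2 ⟨_, hVf.mem_toFinset.2 (hσ.bij.mapsTo (hx a ha)), rfl⟩
  · intro a ha b hb he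
    have h1 : σ (x b) ∈ block V h {(σ (x a)).coeff h} := ⟨hσ.bij.mapsTo (hx b hb), he.symm⟩
    obtain ⟨ξ, hξ, hξ'⟩ := (hbl a ha).bij.surjOn h1
    have h2 := hσ.bij.injOn hξ.1 (hx b hb) hξ'
    exact (show ξ.coeff h = a from hξ.2).symm.trans ((congrArg (fun s => s.coeff h) h2).trans
      (hxa b hb))
  · intro a' ha'
    obtain ⟨ξ', hξ', rfl⟩ := Finset.mem_image.1 ha'
    obtain ⟨ξ, hξ, rfl⟩ := hσ.bij.surjOn (hVf.mem_toFinset.1 hξ')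
    have ha : ξ.coeff h ∈ hUf.toFinset.image fun ξ => ξ.coeff h :=
      Finset.mem_image_of_mem _ (hUf.mem_toFinset.2 hξ)
    exact ⟨_, ha, ((hbl _ ha).bij.mapsTo (⟨hξ, rfl⟩ : ξ ∈ block U h {ξ.coeff h})).2.symm⟩
  · intro a ha
    ext b
    constructor
    · rintro ⟨ρ, hρ⟩
      exact ⟨_, hρ.trans (hbl a ha)⟩
    · rintro ⟨ρ, hρ⟩
      obtain ⟨ρ', hρ'⟩ := (hbl a ha).exists_symm
      exact ⟨_, hρ.trans hρ'⟩

/-- Blocks that correspond under an isometry correspond under an equivariant one. -/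
theorem exists_equivariant_iso (n : ℕ) : ∀ (D : ℕ) (U V : Set Ser) (σ : Ser → Ser),
    U.Finite → U.ncard = n → (∀ ξ ∈ U, IsArc ξ) →
    (∀ ξ ∈ U, theta^[D] ξ ∈ U) → (∀ ξ ∈ V, theta^[D] ξ ∈ V) →
    (∀ ξ ∈ U, κ (theta^[D] ξ) = κ ξ) → (∀ ξ ∈ V, κ' (theta^[D] ξ) = κ' ξ) →
    ColIso κ κ' U V σ →
    ∃ τ, ColIso κ κ' U V τ ∧ ∀ ξ ∈ U, τ (theta^[D] ξ) = theta^[D] (τ ξ) := by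
  induction n using Nat.strong_induction_on with
  | _ n ih =>
  intro D U V σ hUf hn harc hTU hTV hκ hκ' hσ
  -- With at most one element in `U`, and hence in `V`, the action is trivial on both sides.
  by_cases hs : U.Subsingleton
  · refine ⟨σ, hσ, fun ξ hξ => ?_⟩
    rw [hs (hTU ξ hξ) hξ]
    have hm := hσ.bij.mapsTo hξ
    obtain ⟨η, hη, he⟩ := hσ.bij.surjOn (hTV _ hm)
    rw [← he, hs hη hξ]
  obtain ⟨h, hle, ξ₀, hξ₀, η₀, hη₀, h₀⟩ := exists_min_contact hUf hs
  have hVf : V.Finite := hσ.bij.image_eq ▸ hUf.image σ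
  have hle' : ∀ ξ ∈ V, ∀ η ∈ V, (h : WithTop ℚ) ≤ contact ξ η := by
    intro ξ hξ η hη
    obtain ⟨x, hx, rfl⟩ := hσ.bij.surjOn hξ
    obtain ⟨y, hy, rfl⟩ := hσ.bij.surjOn hη
    rw [hσ.contact_eq x hx y hy]
    exact hle x hx y hy
  have hRU := rotates_theta_iterate D hUf hTU hle
  have hRV := rotates_theta_iterate D hVf hTV hle'
  set ω := chi h ^ D with hω
  set T : Ser → Ser := theta^[D] with hT
  -- Two elements realize the minimal contact order `h` and so lie in different blocks; every block
  -- is a proper subset, and the induction applies to it.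
  have hlt : ∀ a, (block U h {a}).ncard < n := by
    intro a
    rw [← hn]
    refine Set.ncard_lt_ncard ⟨fun ξ hξ => hξ.1, fun hsub => ?_⟩ hUf
    have h1 : ξ₀.coeff h = η₀.coeff h := (hsub hξ₀).2.trans (hsub hη₀).2.symm
    rw [coeff_eq_iff_lt_contact (hle _ hξ₀ _ hη₀), h₀] at h1
    exact lt_irrefl _ h1
  have hblock : ∀ {W : Set Ser}, Rotates T ω h W → ∀ A : Finset ℂ, (∀ a ∈ A, ω * a ∈ A) →
      ∀ ξ ∈ block W h A, T ξ ∈ block W h A := fun hW A hA ξ hξ =>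
    ⟨hW.bij.mapsTo hξ.1, by rw [hW.coeff_eq]; exact hA _ hξ.2⟩
  have key : ∀ (m : ℕ) (A A' : Finset ℂ), A.card = m →
      A ⊆ (hUf.toFinset.image fun ξ => ξ.coeff h) →
      (∀ a ∈ A, ω * a ∈ A) → (∀ a ∈ A', ω * a ∈ A') →
      A.val.map (blockType κ κ h U U) = A'.val.map (blockType κ κ' h U V) →
      ∃ τ, ColIso κ κ' (block U h A) (block V h A') τ ∧ ∀ ξ ∈ block U h A, τ (T ξ) = T (τ ξ) := by
    intro m
    induction m using Nat.strong_induction_on with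
    | _ m ihm =>
    intro A A' hm hAU hA hA' hmap
    rcases A.eq_empty_or_nonempty with rfl | hne
    · have hA'0 : A' = ∅ := by
        rw [← Finset.val_eq_zero, ← Multiset.map_eq_zero (f := blockType κ κ' h U V), ← hmap]
        rfl
      subst hA'0
      have hemp : ∀ W : Set Ser, block W h (∅ : Finset ℂ) = ∅ :=
        fun W => Set.eq_empty_of_forall_notMem fun ξ hξ => Finset.notMem_empty _ hξ.2
      rw [hemp, hemp]
      exact ⟨id, ⟨Set.bijOn_empty _, fun _ h => h.elim, fun _ h => h.elim⟩, fun _ h => h.elim⟩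
    obtain ⟨a, ha, a', ha', htype, hst⟩ := exists_same_stabilizer hA hA'
      (fun a _ => hRU.blockType_eq hκ a) hmap hne
    obtain ⟨ρ, hρ⟩ : a ∈ blockType κ κ' h U V a' := htype ▸ ⟨id, ColIso.refl κ _⟩
    obtain ⟨ξ₁, hξ₁, hξ₁a⟩ := Finset.mem_image.1 (hAU ha)
    -- Arcs have finite period under `theta`, so the orbit of `a` is finite.
    obtain ⟨N, hN, hper⟩ : ∃ N, 0 < N ∧ ω ^ N * a = a := by
      obtain ⟨N, hN, h1⟩ := exists_period (harc ξ₁ (hUf.mem_toFinset.1 hξ₁))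
      refine ⟨N, hN, ?_⟩
      have h2 : T^[N] ξ₁ = ξ₁ := by
        rw [hT, ← Function.iterate_mul, mul_comm, Function.iterate_mul]
        exact Function.iterate_fixed h1 D
      have h3 := hRU.iterate_coeff N ξ₁
      rw [h2] at h3
      rw [← hξ₁a, ← h3]
    -- `p` generates the stabilizer of `a`, which is also that of `a'`. The outer induction is
    -- applied to the two blocks with `theta^[D * p]`, which is why `D` varies in the statement.
    obtain ⟨p, hp, hpmin⟩ : ∃ p, ω ^ p * a = a ∧ ∀ k, ω ^ k * a = a → p ∣ k := by
      have hit : ∀ k, (fun z => ω * z)^[k] a = ω ^ k * a := by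
        intro k
        induction k with
        | zero => simp
        | succ k ih => rw [Function.iterate_succ_apply', ih]; ring
      refine ⟨Function.minimalPeriod (fun z => ω * z) a, ?_, fun k hk => ?_⟩
      · rw [← hit]; exact Function.iterate_minimalPeriod
      · exact Function.IsPeriodicPt.minimalPeriod_dvd ((hit k).trans hk)
    have hTp : theta^[D * p] = T^[p] := Function.iterate_mul _ _ _
    have hcolT : ∀ {W : Set Ser} {κ : Ser → X}, Rotates T ω h W → (∀ ξ ∈ W, κ (T ξ) = κ ξ) →
        ∀ l, ∀ y ∈ W, κ (T^[l] y) = κ y := by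
      intro W κ hW hκ l y hy
      induction l with
      | zero => rfl
      | succ l ih => rw [Function.iterate_succ_apply', hκ _ ((hW.bij.iterate l).mapsTo hy), ih]
    obtain ⟨τ₀, hτ₀, heq₀⟩ := ih _ (hlt a) (D * p) (block U h {a}) (block V h {a'}) ρ
      (hUf.subset fun ξ hξ => hξ.1) rfl (fun ξ hξ => harc ξ hξ.1)
      (fun ξ hξ => by rw [hTp]; have := hRU.iterate_mem p hξ; rwa [hp] at this)
      (fun ξ hξ => by rw [hTp]; have := hRV.iterate_mem p hξ; rwa [(hst p).1 hp] at this)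
      (fun ξ hξ => by rw [hTp]; exact hcolT hRU hκ p ξ hξ.1)
      (fun ξ hξ => by rw [hTp]; exact hcolT hRV hκ' p ξ hξ.1) hρ
    have heq : ∀ k, ω ^ k * a = a → ∀ ξ ∈ block U h {a}, τ₀ (T^[k] ξ) = T^[k] (τ₀ ξ) := by
      intro k hk ξ hξ
      obtain ⟨q, rfl⟩ := hpmin k hk
      rw [Function.iterate_mul]
      clear hk
      induction q with
      | zero => rfl
      | succ q ihq =>
        rw [Function.iterate_succ_apply', Function.iterate_succ_apply', ← ihq, ← hTp, ← heq₀]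
        have h1 : ∀ q, (theta^[D * p])^[q] ξ ∈ block U h {a} := by
          intro q
          induction q with
          | zero => exact hξ
          | succ q ih' =>
            rw [Function.iterate_succ_apply', hTp]
            have := hRU.iterate_mem p (hTp ▸ ih')
            rwa [hp] at this
        exact h1 q
    obtain ⟨τ₁, hτ₁, he₁⟩ := hRU.exists_orbit_iso hRV hκ hκ' hst hτ₀ heq
    have horb : ∀ {A : Finset ℂ} {a : ℂ}, (∀ a ∈ A, ω * a ∈ A) → a ∈ A → ∀ k, ω ^ k * a ∈ A := by
      intro A a hA ha k
      induction k with
      | zero => simpa using ha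
      | succ k ih' => rw [pow_succ', mul_assoc]; exact hA _ ih'
    set O := A.filter fun c => ∃ k, c = ω ^ k * a with hO
    set O' := A'.filter fun c => ∃ k, c = ω ^ k * a' with hO'
    have hOs : (O : Set ℂ) = {c | ∃ k, c = ω ^ k * a} := by
      ext c
      simp only [hO, Finset.coe_filter, Set.mem_ofPred_eq]
      exact ⟨fun h => h.2, fun ⟨k, hk⟩ => ⟨hk ▸ horb hA ha k, k, hk⟩⟩
    have hOs' : (O' : Set ℂ) = {c | ∃ k, c = ω ^ k * a'} := by
      ext c
      simp only [hO', Finset.coe_filter, Set.mem_ofPred_eq]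
      exact ⟨fun h => h.2, fun ⟨k, hk⟩ => ⟨hk ▸ horb hA' ha' k, k, hk⟩⟩
    rw [← hOs, ← hOs'] at hτ₁
    rw [← hOs] at he₁
    have hmO : O.val.map (blockType κ κ h U U) = O'.val.map (blockType κ κ' h U V) := by
      have hO : ∀ c ∈ O.val, ∃ k, c = ω ^ k * a := fun c hc => (Finset.mem_filter.1 hc).2
      choose! k hk using hO
      have ht : ∀ (t : ℂ → Set ℂ), (∀ b, t (ω * b) = t b) → ∀ k b, t (ω ^ k * b) = t b := by
        intro t ht k b
        induction k with
        | zero => simp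
        | succ k ih' => rw [pow_succ', mul_assoc, ht, ih']
      refine Multiset.map_eq_map_of_bij_of_nodup _ _ O.nodup O'.nodup
        (fun c _ => ω ^ k c * a') ?_ ?_ ?_ ?_
      · exact fun c _ => Finset.mem_filter.2 ⟨horb hA' ha' _, _, rfl⟩
      · intro c hc d hd he
        rw [hk c hc, hk d hd]
        exact (Rotates.pow_mul_eq_pow_mul_iff hRU.ne_zero hst _ _).2 he
      · intro c' hc'
        obtain ⟨-, l, rfl⟩ := Finset.mem_filter.1 hc'
        have hc : ω ^ l * a ∈ O.val := Finset.mem_filter.2 ⟨horb hA ha _, l, rfl⟩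
        exact ⟨_, hc, ((Rotates.pow_mul_eq_pow_mul_iff hRU.ne_zero hst _ _).1 (hk _ hc)).symm⟩
      · intro c hc
        rw [ht _ (fun b => hRV.blockType_eq hκ' b), ← htype]
        conv_lhs => rw [hk c hc]
        exact ht _ (fun b => hRU.blockType_eq hκ b) _ _
    -- Stability of the complement of an orbit needs a step backwards in the orbit; multiplication
    -- by `ω ^ (P - 1)` provides it.
    have hrest : ∀ {A : Finset ℂ} {a : ℂ} (P : ℕ), 0 < P → ω ^ P * a = a → (∀ a ∈ A, ω * a ∈ A) →
        ∀ c ∈ A \ A.filter (fun c => ∃ k, c = ω ^ k * a),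
          ω * c ∈ A \ A.filter fun c => ∃ k, c = ω ^ k * a := by
      intro A a P hP hPa hA c hc
      rw [Finset.mem_sdiff, Finset.mem_filter] at hc ⊢
      refine ⟨hA c hc.1, fun h1 => hc.2 ⟨hc.1, ?_⟩⟩
      obtain ⟨k, hk⟩ := h1.2
      refine ⟨k + (P - 1), mul_left_cancel₀ hRU.ne_zero ?_⟩
      rw [hk]
      calc ω ^ k * a = ω ^ k * (ω ^ P * a) := by rw [hPa]
        _ = ω * (ω ^ (k + (P - 1)) * a) := by
          conv_lhs => rw [← Nat.sub_add_cancel hP]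
          ring
    have hmR : (A \ O).val.map (blockType κ κ h U U) =
        (A' \ O').val.map (blockType κ κ' h U V) := by
      have h1 : ∀ {A O : Finset ℂ} (t : ℂ → Set ℂ), O ⊆ A →
          A.val.map t = (A \ O).val.map t + O.val.map t := by
        intro A O t hOA
        rw [← Multiset.map_add, Finset.sdiff_val, tsub_add_cancel_of_le (Finset.val_le_iff.2 hOA)]
      rw [h1 _ (Finset.filter_subset _ A : O ⊆ A), h1 _ (Finset.filter_subset _ A' : O' ⊆ A'),
        hmO] at hmap
      exact add_right_cancel hmap
    obtain ⟨τ₂, hτ₂, he₂⟩ := ihm (A \ O).card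
      (hm ▸ Finset.card_lt_card (Finset.sdiff_ssubset (Finset.filter_subset _ _)
        ⟨a, Finset.mem_filter.2 ⟨ha, 0, by simp⟩⟩))
      (A \ O) (A' \ O') rfl (Finset.sdiff_subset.trans hAU) (hrest N hN hper hA)
      (hrest N hN ((hst N).1 hper) hA') hmR
    have hglue := ColIso.glue hle hle' (T := T)
      (Finset.disjoint_coe.2 (Finset.disjoint_sdiff (s := O) (t := A)))
      (Finset.disjoint_coe.2 (Finset.disjoint_sdiff (s := O') (t := A')))
      (hblock hRU O ?_) (hblock hRU (A \ O) (hrest N hN hper hA)) hτ₁ hτ₂ he₁ he₂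
    · rwa [← Finset.coe_union, ← Finset.coe_union, Finset.union_sdiff_of_subset,
        Finset.union_sdiff_of_subset] at hglue
      · exact Finset.filter_subset _ _
      · exact Finset.filter_subset _ _
    · intro c hc
      obtain ⟨hc, k, rfl⟩ := Finset.mem_filter.1 hc
      exact Finset.mem_filter.2 ⟨hA _ hc, k + 1, by ring⟩
  have hst : ∀ {W : Set Ser} (hWf : W.Finite), Rotates T ω h W →
      ∀ a ∈ hWf.toFinset.image fun ξ => ξ.coeff h, ω * a ∈ hWf.toFinset.image fun ξ => ξ.coeff h := by
    intro W hWf hW a ha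
    obtain ⟨ξ, hξ, rfl⟩ := Finset.mem_image.1 ha
    exact Finset.mem_image.2 ⟨T ξ, hWf.mem_toFinset.2 (hW.bij.mapsTo (hWf.mem_toFinset.1 hξ)),
      hW.coeff_eq ξ⟩
  have hall : ∀ {W : Set Ser} (hWf : W.Finite),
      block W h (hWf.toFinset.image fun ξ => ξ.coeff h : Finset ℂ) = W := by
    intro W hWf
    ext ξ
    exact ⟨fun hξ => hξ.1, fun hξ => ⟨hξ, Finset.mem_coe.2
      (Finset.mem_image.2 ⟨ξ, hWf.mem_toFinset.2 hξ, rfl⟩)⟩⟩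
  have hfin := key _ _ _ rfl subset_rfl (hst hUf hRU) (hst hVf hRV) (hσ.map_blockType hUf hVf hle)
  rwa [hall, hall] at hfin

end

end PolarTree
end

noncomputable section

namespace PolarTree

open HahnSeries
open scoped Classical

/-! ### Colors of roots -/

/-- The bar of height `e` that lies on the arc `ξ`. -/
def barAt (e : ℚ) (ξ : Ser) : Bar := ⟨e, truncLT e ξ⟩

theorem climbs_barAt (e : ℚ) (ξ : Ser) : Climbs ξ (barAt e ξ) :=
  climbs_iff.2 fun _ hd => (coeff_truncLT_of_lt hd _).symm

section

variable {f g f' g' : PS} {σ τ : Ser → Ser}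

theorem IsBar.barAt_eq {B : Bar} (hB : IsBar f g B) {ξ : Ser} (h : Climbs ξ B) :
    barAt B.height ξ = B := by
  have : truncLT B.height ξ = B.stem := by
    ext e
    rcases lt_or_ge e B.height with he | he
    · rw [coeff_truncLT_of_lt he, climbs_iff.1 h e he]
    · rw [coeff_truncLT_of_le he, hB.stem_coeff he]
  rw [barAt, this]

theorem TreeIso.isBar_barAt (h : TreeIso f g f' g' σ) {ξ : Ser} (hξ : ξ ∈ allRoots f g) {e : ℚ}
    (hB : IsBar f g (barAt e ξ)) : IsBar f' g' (barAt e (σ ξ)) ∧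
      BarCorr f g σ (barAt e ξ) (barAt e (σ ξ)) := by
  obtain ⟨B', hB', hc⟩ := h.exists_corr hB
  have h1 := hB'.barAt_eq ((hc.2 ξ hξ).1 (climbs_barAt e ξ))
  rw [← hc.1] at h1
  rw [show barAt e (σ ξ) = B' from h1]
  exact ⟨hB', hc⟩

theorem TreeIso.isBar_barAt_iff (h : TreeIso f g f' g' σ) {ξ : Ser} (hξ : ξ ∈ allRoots f g)
    {e : ℚ} : IsBar f g (barAt e ξ) ↔ IsBar f' g' (barAt e (σ ξ)) := by
  refine ⟨fun hB => (h.isBar_barAt hξ hB).1, fun hB => ?_⟩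
  obtain ⟨ρ, hρ, hl, hr⟩ := h.exists_inv
  have := (hρ.isBar_barAt (h.bij.mapsTo hξ) hB).1
  rwa [hl ξ hξ] at this

/-- The data that an equivalence has to preserve, along an arc. -/
def color (f g : PS) (ξ : Ser) : Prop × Prop × (ℚ → ℕ × ℕ) :=
  (ξ ∈ roots f, ξ ∈ roots g, fun e =>
    if IsBar f g (barAt e ξ) ∧ NonColl f g (barAt e ξ) then
      (meroTotal f g (barAt e ξ),
        if ξ.coeff e ∈ collPts f g (barAt e ξ) then meroMult f g (barAt e ξ) (ξ.coeff e) else 0)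
    else 0)

theorem TreeEquiv.color_eq (h : TreeEquiv f g f' g' σ) (hg : GoodPS f g) (hg' : GoodPS f' g')
    {ξ : Ser} (hξ : ξ ∈ allRoots f g) : color f' g' (σ ξ) = color f g ξ := by
  have hinj := h.iso.bij.injOn
  have hf : σ ξ ∈ roots f' ↔ ξ ∈ roots f := by
    refine ⟨fun h1 => ?_, fun h1 => h.bijF.mapsTo h1⟩
    obtain ⟨η, hη, he⟩ := h.bijF.surjOn h1
    exact hinj (Or.inl hη) hξ he ▸ hη
  have hgr : σ ξ ∈ roots g' ↔ ξ ∈ roots g := by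
    refine ⟨fun h1 => ?_, fun h1 => h.bijG.mapsTo h1⟩
    obtain ⟨η, hη, he⟩ := h.bijG.surjOn h1
    exact hinj (Or.inr hη) hξ he ▸ hη
  refine Prod.ext (propext hf) (Prod.ext (propext hgr) (funext fun e => ?_))
  change ite _ _ _ = ite _ _ _
  by_cases hB : IsBar f g (barAt e ξ)
  · obtain ⟨hB', hc⟩ := h.iso.isBar_barAt hξ hB
    have hnc := h.iso.nonColl_iff hg hg' hB hB' hc
    by_cases hn : NonColl f g (barAt e ξ)
    · have hand : IsBar f g (barAt e ξ) ∧ NonColl f g (barAt e ξ) := ⟨hB, hn⟩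
      have hand' : IsBar f' g' (barAt e (σ ξ)) ∧ NonColl f' g' (barAt e (σ ξ)) := ⟨hB', hnc.1 hn⟩
      rw [if_pos hand', if_pos hand, h.meroTotal_eq _ _ hB hB' hc hn]
      have h1 : ClimbsAt ξ (barAt e ξ) (ξ.coeff e) := climbsAt_iff.2 ⟨climbs_barAt e ξ, rfl⟩
      have h2 : ClimbsAt (σ ξ) (barAt e (σ ξ)) ((σ ξ).coeff e) :=
        climbsAt_iff.2 ⟨climbs_barAt e _, rfl⟩
      have hp := h.iso.ptCorr_of_climbs hc.1 hξ h1 h2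
      have hcoll : (σ ξ).coeff e ∈ collPts f' g' (barAt e (σ ξ)) ↔
          ξ.coeff e ∈ collPts f g (barAt e ξ) := by
        refine and_congr (iff_of_true ⟨_, h.iso.bij.mapsTo hξ, h2⟩ ⟨ξ, hξ, h1⟩) ?_
        rw [h.iso.delta_eq hg hg' hB hB' hc hp]
      by_cases hcp : ξ.coeff e ∈ collPts f g (barAt e ξ)
      · rw [if_pos (hcoll.2 hcp), if_pos hcp,
          h.meroMult_eq _ _ hB hB' hc hn _ hcp _ (hcoll.2 hcp) hp]
      · rw [if_neg (fun h' => hcp (hcoll.1 h')), if_neg hcp]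
    · rw [if_neg (fun h' => hn (hnc.2 h'.2)), if_neg fun h' => hn h'.2]
  · rw [if_neg (fun h' => hB ((h.iso.isBar_barAt_iff hξ).2 h'.1)), if_neg fun h' => hB h'.1]

theorem TreeEquiv.colIso (h : TreeEquiv f g f' g' σ) (hg : GoodPS f g) (hg' : GoodPS f' g') :
    ColIso (color f g) (color f' g') (allRoots f g) (allRoots f' g') σ :=
  ⟨h.iso.bij, h.contact_eq, fun _ hξ => h.color_eq hg hg' hξ⟩

/-- Every non-collinear bar, and every collinear point on it, has a root climbing over it, so its
data can be read from the color of that root. -/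
theorem ColIso.treeEquiv (h : ColIso (color f g) (color f' g') (allRoots f g) (allRoots f' g') τ)
    (hg : GoodPS f g) (hg' : GoodPS f' g') (hf0 : yOrder f = yOrder f')
    (hg0 : yOrder g = yOrder g') : TreeEquiv f g f' g' τ := by
  have hf : ∀ ξ ∈ allRoots f g, (τ ξ ∈ roots f' ↔ ξ ∈ roots f) := fun ξ hξ =>
    iff_of_eq (congrArg Prod.fst (h.color_eq ξ hξ))
  have hgr : ∀ ξ ∈ allRoots f g, (τ ξ ∈ roots g' ↔ ξ ∈ roots g) := fun ξ hξ =>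
    iff_of_eq (congrArg (fun c => c.2.1) (h.color_eq ξ hξ))
  have hiso : TreeIso f g f' g' τ := by
    refine ⟨⟨fun ξ hξ => (hf ξ (Or.inl hξ)).2 hξ, h.bij.injOn.mono fun _ => Or.inl, fun η hη => ?_⟩,
      ⟨fun ξ hξ => (hgr ξ (Or.inr hξ)).2 hξ, h.bij.injOn.mono fun _ => Or.inr, fun η hη => ?_⟩,
      h.contact_eq, hf0, hg0⟩
    · obtain ⟨ξ, hξ, rfl⟩ := h.bij.surjOn (Or.inl hη)
      exact ⟨ξ, (hf ξ hξ).1 hη, rfl⟩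
    · obtain ⟨ξ, hξ, rfl⟩ := h.bij.surjOn (Or.inr hη)
      exact ⟨ξ, (hgr ξ hξ).1 hη, rfl⟩
  have key : ∀ B B', IsBar f g B → IsBar f' g' B' → BarCorr f g τ B B' → NonColl f g B →
      ∀ ξ ∈ allRoots f g, Climbs ξ B → meroTotal f' g' B' = meroTotal f g B ∧
        (if (τ ξ).coeff B'.height ∈ collPts f' g' B' then
          meroMult f' g' B' ((τ ξ).coeff B'.height) else 0) =
        if ξ.coeff B.height ∈ collPts f g B then meroMult f g B (ξ.coeff B.height) else 0 := by
    intro B B' hB hB' hc hn ξ hξ hcl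
    have hn' := (hiso.nonColl_iff hg hg' hB hB' hc).1 hn
    have h1 := congrArg (fun c => c.2.2 B.height) (h.color_eq ξ hξ)
    have h2 := hB'.barAt_eq ((hc.2 ξ hξ).1 hcl)
    rw [← hc.1] at h2 ⊢
    simp only [color] at h1
    have hand : IsBar f g B ∧ NonColl f g B := ⟨hB, hn⟩
    have hand' : IsBar f' g' B' ∧ NonColl f' g' B' := ⟨hB', hn'⟩
    rw [hB.barAt_eq hcl, h2, if_pos hand', if_pos hand, Prod.mk.injEq] at h1
    exact h1
  refine ⟨hiso.bijF, hiso.bijG, hiso.contact_eq, hf0, hg0, ?_, ?_⟩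
  · intro B B' hB hB' hc hn
    obtain ⟨c, ⟨ξ, hξ, hcl⟩, -⟩ := id hn
    exact (key B B' hB hB' hc hn ξ hξ hcl.climbs).1.symm
  · intro B B' hB hB' hc hn c hcc c' hcc' hp
    obtain ⟨ξ, hξ, hcl⟩ := hcc.1
    have h1 := (key B B' hB hB' hc hn ξ hξ hcl.climbs).2
    rw [((hp ξ hξ).1 hcl).2, hcl.2, if_pos hcc, if_pos hcc'] at h1
    exact h1.symm

/-! ### The Galois action is an equivalence -/

theorem cnt_theta (F : PS) (B : Bar) (c : ℂ) :
    cnt F (thetaBar B) (chi B.height * c) = cnt F B c := by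
  rw [cnt, cnt, ← rootMS_theta F, Multiset.countP_map, Multiset.countP_eq_card_filter, rootMS_theta]
  congr 1
  exact Multiset.filter_congr fun γ _ => climbsAt_theta_iff

/-- Instead of transforming the rational function, the multiplicity is computed from `count_jac`,
all other terms of which are invariant under conjugation. The ground bar is its own conjugate. -/
theorem meroMult_theta (hg : GoodPS f g) {B : Bar} (hB : IsBar f g B) (hn : NonColl f g B) (c : ℂ) :
    meroMult f g (thetaBar B) (chi B.height * c) = meroMult f g B c := by
  by_cases h0 : B = ground
  · subst h0
    have h1 : chi ground.height = 1 := (chi_eq_one_iff _).2 ⟨0, by simp [ground]⟩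
    rw [h1, one_mul, show thetaBar ground = ground by simp [PolarTree.thetaBar, ground]]
  · have hpos := hB.pos_of_ne h0
    have hT := treeIso_theta f g
    have hn' := (hT.nonColl_iff hg hg hB hB.thetaBar (barCorr_theta B)).1 hn
    have h1 := (count_jac hg (hB.proper hpos) hn).2 c
    have h2 := (count_jac hg (hB.thetaBar.proper hpos) hn').2 (chi B.height * c)
    rw [cnt_theta, ← hT.delta_eq hg hg hB hB.thetaBar (barCorr_theta B) (ptCorr_theta B c),
      ← hT.mult_eq (ptCorr_theta B c), ← hT.swap.mult_eq (ptCorr_theta B c)] at h2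
    omega

/-- It follows that conjugate roots have the same color, as the construction of an equivariant
isometry requires. -/
theorem treeEquiv_theta (hg : GoodPS f g) : TreeEquiv f g f g theta := by
  have hT := treeIso_theta f g
  refine ⟨hT.bijF, hT.bijG, hT.contact_eq, rfl, rfl, ?_, ?_⟩
  · intro B B' hB hB' hc hn
    rw [hT.corr_unique hB hB' hB.thetaBar hc (barCorr_theta B), meroTotal, meroTotal]
    refine finsum_eq_of_bijective (fun z => chi B.height * z)
      (mulLeft_bijective₀ _ (chi_ne_zero _)) fun z => (meroMult_theta hg hB hn z).symm
  · intro B B' hB hB' hc hn c hcc c' hcc' hp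
    obtain ⟨ξ, hξ, hcl⟩ := hcc.1
    have h1 := (hp ξ hξ).1 hcl
    rw [hT.corr_unique hB hB' hB.thetaBar hc (barCorr_theta B)] at h1 ⊢
    rw [← h1.2.symm.trans (climbsAt_theta_iff.2 hcl).2 |>.symm, meroMult_theta hg hB hn]

theorem TreeEquiv.exists_equivariant (h : TreeEquiv f g f' g' σ) (hg : GoodPS f g)
    (hg' : GoodPS f' g') : ∃ τ, TreeEquiv f g f' g' τ ∧
      ∀ ξ ∈ allRoots f g, τ (theta ξ) = theta (τ ξ) := by
  obtain ⟨τ, hτ, heq⟩ := exists_equivariant_iso _ 1 (allRoots f g) (allRoots f' g') σ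
    (allRoots_finite hg) rfl (fun ξ hξ => (allRoots_posArc hξ).1)
    (fun ξ hξ => (treeIso_theta f g).bij.mapsTo hξ)
    (fun ξ hξ => (treeIso_theta f' g').bij.mapsTo hξ)
    (fun ξ hξ => (treeEquiv_theta hg).color_eq hg hg hξ)
    (fun ξ hξ => (treeEquiv_theta hg').color_eq hg' hg' hξ) (h.colIso hg hg')
  exact ⟨τ, hτ.treeEquiv hg hg' h.yOrderF h.yOrderG, heq⟩

theorem TreeIso.barCorr_thetaBar (_h : TreeIso f g f' g' τ)
    (he : ∀ ξ ∈ allRoots f g, τ (theta ξ) = theta (τ ξ)) {B B' : Bar} (hc : BarCorr f g τ B B') :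
    BarCorr f g τ (thetaBar B) (thetaBar B') := by
  refine ⟨hc.1, fun ξ hξ => ?_⟩
  obtain ⟨η, hη, rfl⟩ := (treeIso_theta f g).bij.surjOn hξ
  rw [he η hη, climbs_theta_iff, climbs_theta_iff, hc.2 η hη]

end

/-! ### Equivariant correspondences and conjugacy classes of bars -/

theorem mem_barClasses_iff {f g : ConvPS} (h : GoodPair f g) {K : Set Bar} :
    K ∈ barClasses (f : PS) g ↔ IsClass (f : PS) g K := by
  refine ⟨isClass_of_mem h, ?_⟩
  rintro ⟨B, hB, rfl⟩
  refine ⟨B, hB, ?_⟩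
  ext B'
  constructor
  · rintro ⟨k, rfl⟩
    exact ⟨hB.thetaBar_iterate k, (conj_iff h hB (hB.thetaBar_iterate k)).2 ⟨k, rfl⟩⟩
  · rintro ⟨h1, h2⟩; exact (conj_iff h hB h1).1 h2

/-- The induced bijection of bars commutes with `thetaBar`, hence carries orbits to orbits, and
these are the conjugacy classes. -/
theorem inducesClassBij_of_equivariant {f g f' g' : ConvPS} {τ : Ser → Ser} (h : GoodPair f g)
    (h' : GoodPair f' g') (hτ : TreeIso (f : PS) g f' g' τ)
    (he : ∀ ξ ∈ allRoots (f : PS) g, τ (theta ξ) = theta (τ ξ)) :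
    InducesClassBij (f : PS) g f' g' τ := by
  obtain ⟨β, hβ, hβc⟩ := hτ.exists_barMap
  have hc : ∀ B, IsBar (f : PS) g B → BarCorr (f : PS) g τ B (β B) :=
    fun B hB => (hβc B hB _ (hβ.mapsTo hB)).2 rfl
  have himg : ∀ K, IsClass (f : PS) g K → corrClass (f : PS) g f' g' τ K = β '' K := by
    intro K hK
    ext B'
    constructor
    · rintro ⟨hB', B, hB, hcB⟩
      exact ⟨B, hB, ((hβc B (hK.isBar hB) B' hB').1 hcB).symm⟩
    · rintro ⟨B, hB, rfl⟩
      exact ⟨hβ.mapsTo (hK.isBar hB), B, hB, hc B (hK.isBar hB)⟩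
  have hit : ∀ B, IsBar (f : PS) g B → ∀ k, β (thetaBar^[k] B) = thetaBar^[k] (β B) := by
    intro B hB k
    induction k with
    | zero => rfl
    | succ k ih =>
      rw [Function.iterate_succ_apply', Function.iterate_succ_apply', ← ih]
      have hBk := hB.thetaBar_iterate k
      exact ((hβc _ hBk.thetaBar _ (IsBar.thetaBar (hβ.mapsTo hBk))).1
        (hτ.barCorr_thetaBar he (hc _ hBk))).symm
  have horb : ∀ B, IsBar (f : PS) g B →
      β '' {B' | ∃ k, B' = thetaBar^[k] B} = {B' | ∃ k, B' = thetaBar^[k] (β B)} := by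
    intro B hB
    ext B'
    constructor
    · rintro ⟨_, ⟨k, rfl⟩, rfl⟩; exact ⟨k, hit B hB k⟩
    · rintro ⟨k, rfl⟩; exact ⟨_, ⟨k, rfl⟩, hit B hB k⟩
  refine ⟨fun K hK => ?_, fun K hK L hL heq => ?_, fun K' hK' => ?_⟩
  · have hK := (mem_barClasses_iff h).1 hK
    rw [himg K hK, mem_barClasses_iff h']
    obtain ⟨B, hB, rfl⟩ := hK.exists_eq
    exact ⟨β B, hβ.mapsTo hB, horb B hB⟩
  · have hK := (mem_barClasses_iff h).1 hK
    have hL := (mem_barClasses_iff h).1 hL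
    rw [himg K hK, himg L hL] at heq
    exact (hβ.injOn.image_eq_image_iff (fun B hB => hK.isBar hB) fun B hB => hL.isBar hB).1 heq
  · obtain ⟨B', hB', rfl⟩ := ((mem_barClasses_iff h').1 hK').exists_eq
    obtain ⟨B, hB, rfl⟩ := hβ.surjOn hB'
    have hcl : IsClass (f : PS) g {B' | ∃ k, B' = thetaBar^[k] B} := ⟨B, hB, rfl⟩
    exact ⟨_, (mem_barClasses_iff h).2 hcl, by rw [himg _ hcl, horb B hB]⟩

end PolarTree
end

/-! ### The theorem -/

theorem theoremI (f g : ConvPS) (hfg : GoodPair f g) :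
    (∀ K ∈ barClasses (f : PS) g, (∃ B ∈ K, NonColl f g B) →
      ∃ P Q : ConvPS,
        Represents P (polyP f g K) ∧
        Represents Q (polyQ f g K) ∧
        ∀ B ∈ K, ∃ a b c : ℕ,
          interMult f P = a ∧ interMult g P = b ∧
          interMult (f * g) P = c ∧
          (a : ℚ) = nu f B * (mStarClass f g K : ℚ) ∧
          (b : ℚ) = nu g B * (mStarClass f g K : ℚ) ∧
          (c : ℚ) = (nu f B + nu g B) *
            (mStarClass f g K : ℚ)) ∧
    (∀ f' g' : ConvPS, GoodPair f' g' →
      ∀ σ : Ser → Ser,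
        TreeEquiv (f : PS) g f' g' σ →
        (∃ τ : Ser → Ser,
          TreeEquiv (f : PS) g f' g' τ ∧
          InducesClassBij (f : PS) g f' g' τ) ∧
        (InducesClassBij (f : PS) g f' g' σ →
          ∀ K ∈ barClasses (f : PS) g,
            (∃ B ∈ K, NonColl f g B) →
            ∀ K', K' = corrClass (f : PS) g f' g' σ K →
            (∃ B' ∈ K', NonColl f' g' B') ∧
            ∀ P P' Q Q' : ConvPS,
              Represents P (polyP f g K) →
              Represents P' (polyP f' g' K') →
              Represents Q (polyQ f g K) →
              Represents Q' (polyQ f' g' K') →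
              interMult f P = interMult f' P' ∧
              interMult g P = interMult g' P' ∧
              interMult (f * g) P = interMult (f' * g') P' ∧
              xOrder P = xOrder P' ∧
              xOrder Q = xOrder Q') ∧
        (NonColl f g ground →
          ∃ R R' : ConvPS,
            Represents R (polyGround f g) ∧
            Represents R' (polyGround f' g') ∧
            xOrder R = xOrder R')) := by
  refine ⟨fun K hK hnc => exists_factors hfg hK hnc, fun f' g' hfg' σ hσ => ⟨?_, ?_, ?_⟩⟩
  · obtain ⟨τ, hτ, he⟩ := hσ.exists_equivariant hfg.goodPS hfg'.goodPS
    exact ⟨τ, hτ, inducesClassBij_of_equivariant hfg hfg' hτ.iso he⟩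
  · rintro hbij K hK hnc _ rfl
    exact factors_invariant hfg hfg' hσ hK (hbij.mapsTo hK) hnc
  · exact polyGround_invariant hfg hfg' hσ
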